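/- **Setting.** Let $d\in\{2,3\}$, let $\mathbb T^d=[0,\ell)^d$ be a flat torus ($\ell>0$, opposite sides identified), and let $\Omega^f$ be an open set with $C^\infty$ boundary and $\overline{\Omega^f}\subset(0,\ell)^d$; put $\Omega^s=\mathbb T^d\setminus\Omega^f$. Let $\mu>0$, $\lambda\ge0$, $\nu=\lambda+\frac{d-2}{d}\mu$, $p(\varrho)=a\varrho^\gamma$ with $a>0$, $\gamma>1$, let $\alpha>-1$ and $T>0$. The initial data $\varrho_0>0$, $\boldsymbol m_0$ on $\mathbb T^d$ are measurable with $\varrho_0\in L^\gamma(\mathbb T^d)$, $0<\underline\varrho\le\varrho_0\le\overline\varrho$ and $\boldsymbol m_0$ bounded on $\Omega^f$ (for some constants), $\boldsymbol m_0=0$ on $\Omega^s$; $E_0=\int_{\mathbb T^d}\big(\frac{|\boldsymbol m_0|^2}{2\varrho_0}+\frac{a}{\gamma-1}\varrho_0^\gamma\big)dx$. **Scheme.** Let $(\Delta t,h,\epsilon)\in(0,1)^3$ with $T/\Delta t$ and $\ell/h$ integers, and let $\mathcal T_h$ be the uniform mesh of cubes of side $h$, with faces $\mathcal E$. Let $Q_h$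 be the piecewise constant functions, $\Pi_{\mathcal T}$ the cell-average projection, $\Omega^s_h$ the union of the cells not contained in $\Omega^f$. On a face with normal $\boldsymbol n$ let $[\![v]\!]=v^{out}-v^{in}$, $\{v\}=\frac12(v^{in}+v^{out})$, and $F_h^\alpha(r,\boldsymbol u)=r^{up}\{\boldsymbol u\}\cdot\boldsymbol n-h^\alpha[\![r]\!]$, where $r^{up}=r^{in}$ if $\{\boldsymbol u\}\cdot\boldsymbol n\ge0$ and $r^{up}=r^{out}$ otherwise ($\mathbf F_h^\alpha$ is the componentwise version). Let $(\mathrm{div}_h\boldsymbol v)_K=\frac1h\sum_{\sigma\subset\partial K}\{\boldsymbol v\}\cdot\boldsymbol n$, and let $\nabla_{\mathcal E}r$ be the vector whose $i$-th component is $\frac1h[\![r]\!]$ (with $\boldsymbol n=\boldsymbol e_i$) on the dual cell of each face orthogonal to $\boldsymbol e_i$, i.e. the union of the two adjacent half cells. A solution is a sequence $(\varrho_h^k,\boldsymbol u_h^k)\in Q_h^{1+d}$, $0\le k\le T/\Delta t$, with $\varrho_h^0=\Pi_{\mathcal T}\varrho_0$, $\varrho_h^0\boldsymbol u_h^0=\Pi_{\mathcal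 T}\boldsymbol m_0$ and, for all $k\ge1$, $\phi_h\in Q_h$, $\boldsymbol\varphi_h\in Q_h^d$, $$\int_{\mathbb T^d}\tfrac{\varrho_h^k-\varrho_h^{k-1}}{\Delta t}\phi_h\,dx-\int_{\mathcal E}F_h^\alpha(\varrho_h^k,\boldsymbol u_h^k)[\![\phi_h]\!]\,dS=0,$$ $$\int_{\mathbb T^d}\tfrac{\varrho_h^k\boldsymbol u_h^k-\varrho_h^{k-1}\boldsymbol u_h^{k-1}}{\Delta t}\cdot\boldsymbol\varphi_h\,dx-\int_{\mathcal E}\mathbf F_h^\alpha(\varrho_h^k\boldsymbol u_h^k,\boldsymbol u_h^k)\cdot[\![\boldsymbol\varphi_h]\!]\,dS-\int_{\mathbb T^d}p(\varrho_h^k)\,\mathrm{div}_h\boldsymbol\varphi_h\,dx+\frac1\epsilon\int_{\Omega_h^s}\boldsymbol u_h^k\cdot\boldsymbol\varphi_h\,dx+\mu\int_{\mathbb T^d}\nabla_{\mathcal E}\boldsymbol u_h^k:\nabla_{\mathcal E}\boldsymbol\varphi_h\,dx+\nu\int_{\mathbb T^d}\mathrm{div}_h\boldsymbol u_h^k\,\mathrm{div}_h\boldsymbol\varphi_h\,dx=0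 .$$ Set $(\varrho_h,\boldsymbol u_h)(0)=(\varrho_h^0,\boldsymbol u_h^0)$, $(\varrho_h,\boldsymbol u_h)(t)=(\varrho_h^k,\boldsymbol u_h^k)$ for $t\in((k-1)\Delta t,k\Delta t]$, and $p_h=p(\varrho_h)$. **Consistency errors.** $$e_\varrho(\tau,\phi)=\Big[\int_{\mathbb T^d}\varrho_h\phi\,dx\Big]_{0}^{\tau}-\int_0^\tau\!\!\int_{\mathbb T^d}\big(\varrho_h\partial_t\phi+\varrho_h\boldsymbol u_h\cdot\nabla_x\phi\big)dx\,dt,$$ $$e_{\boldsymbol m}(\tau,\boldsymbol\varphi)=\Big[\int_{\mathbb T^d}\varrho_h\boldsymbol u_h\cdot\boldsymbol\varphi\,dx\Big]_0^\tau-\int_0^\tau\!\!\int_{\mathbb T^d}\big(\varrho_h\boldsymbol u_h\cdot\partial_t\boldsymbol\varphi+\varrho_h\boldsymbol u_h\otimes\boldsymbol u_h:\nabla_x\boldsymbol\varphi+p_h\,\mathrm{div}_x\boldsymbol\varphi\big)dx\,dt$$ $$\qquad+\int_0^\tau\!\!\int_{\mathbb T^d}\big(\mu\nabla_{\mathcal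 E}\boldsymbol u_h:\nabla_x\boldsymbol\varphi+\nu\,\mathrm{div}_h\boldsymbol u_h\,\mathrm{div}_x\boldsymbol\varphi\big)dx\,dt+\frac1\epsilon\int_0^\tau\!\!\int_{\Omega^s}\boldsymbol u_h\cdot\boldsymbol\varphi\,dx\,dt .$$ **Lemma 4.4 (Consistency formulation).** For every solution of the scheme and every $\tau\in[0,T]$, $$|e_\varrho(\tau,\phi)|\le C_\varrho\big(\Delta t+h^{(1+\alpha)/2}+h^{(1+\beta_R)/2}+h^{1+\beta_D}\big)$$ for all $\phi\in W^{1,\infty}((0,T)\times\mathbb T^d)$ with $\partial_t^2\phi\in L^\infty((0,T)\times\mathbb T^d)$; and for every $p\in\big[\frac{2\gamma}{\gamma-1},\infty\big)$ $$|e_{\boldsymbol m}(\tau,\boldsymbol\varphi)|\le C_{\boldsymbol m}\big(\sqrt{\Delta t}+h+h^{1+\alpha}+h^{1+\beta_M(p)}+(h/\epsilon)^{1/2}+(\Delta t/\epsilon)^{1/2}\big)$$ for all $\boldsymbol\varphi\in W^{1,\infty}((0,T)\times\mathbb T^d;\mathbb R^d)\cap L^\infty(0,T;W^{2,\infty}(\mathbb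 T^d;\mathbb R^d))$ with $\partial_t^2\boldsymbol\varphi\in L^\infty((0,T)\times\mathbb T^d;\mathbb R^d)$. Besides the fixed quantities $d,\ell,\Omega^f,a,\gamma,\mu,\lambda,\alpha$, the constant $C_\varrho$ depends only on upper bounds for $E_0$, $\|\phi\|_{W^{1,\infty}}$, $\|\partial_t^2\phi\|_{L^\infty}$ and on $T$; $C_{\boldsymbol m}$ depends only on upper bounds for $E_0$, $\|\boldsymbol\varphi\|_{W^{1,\infty}}$, $\|\boldsymbol\varphi\|_{L^\infty(0,T;W^{2,\infty})}$, $\|\partial_t^2\boldsymbol\varphi\|_{L^\infty}$ and on $T$ and $p$. In particular they do not depend on $\Delta t,h,\epsilon,\tau$. Here $$\beta_D=\begin{cases}\inf_{p\in[1,\infty)}\min\{\frac{p(\alpha+1)+4}{2p},1\}\cdot\frac{\gamma-2}{\gamma}&d=2,\ \gamma\in(1,2),\\ \min\{\frac{\alpha+2}{3},1\}\cdot\frac{3(\gamma-2)}{2\gamma}&d=3,\ \gamma\in(1,2),\\0&\gamma\ge2,\end{cases}\qquad \beta_R=\begin{cases}0&d=2,\\ \min\{\frac{1+\alpha}{2},1\}\cdot\frac{5\gamma-6}{2\gamma}&d=3,\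 \gamma\in(1,\frac65),\\0&d=3,\ \gamma\ge\frac65,\end{cases}$$ $$\beta_M(p)=\begin{cases}\max\{-\frac{p(\alpha+1)+4}{2p\gamma},\frac{p(\gamma-2)-2\gamma}{p\gamma}\}&d=2,\ \gamma\le2,\\0&d=2,\ \gamma>2,\\ \max\{-\frac{\alpha+2}{2\gamma},\frac{\gamma-3}{\gamma},-\frac{3}{2\gamma}\}&d=3,\ \gamma\le2,\\ \frac{\gamma-3}{\gamma}&d=3,\ \gamma\in(2,3),\\0&d=3,\ \gamma\ge3.\end{cases}$$ (In the infimum for $\beta_D$, the factor $\frac{\gamma-2}{\gamma}$ stands outside; $\beta_M(p)$ depends on $p$ only if $d=2$, $\gamma\le2$.) -/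

import Mathlib

open MeasureTheory Set
open scoped ContDiff Topology

noncomputable section

namespace FV

/-! ### Geometry

The flat torus `𝕋^d` of side `ℓ` is the cube `[0, ℓ)^d` with opposite sides identified; functions on
it are integrated over the cube, and test functions on it are `ℓ`-periodic functions on `ℝ^d`. -/

/-- Points of `ℝ^d`. -/
abbrev Space (d : ℕ) : Type := Fin d → ℝ

/-- The cube `[0, ℓ)^d`. -/
def cube (d : ℕ) (ℓ : ℝ) : Set (Space d) := Set.univ.pi fun _ => Ico 0 ℓ

/-- `Ω` is an open set, compactly contained in the open cube `(0, ℓ)^d`, whose boundary is smooth: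
near each boundary point `Ω` is the sublevel set of a smooth function with nonzero differential. -/
structure IsFluidDomain {d : ℕ} (ℓ : ℝ) (Ω : Set (Space d)) : Prop where
  isOpen : IsOpen Ω
  closure_subset : closure Ω ⊆ Set.univ.pi fun _ => Ioo 0 ℓ
  smooth_boundary : ∀ x ∈ frontier Ω, ∃ U ∈ 𝓝 x, ∃ g : Space d → ℝ,
    ContDiff ℝ ∞ g ∧ fderiv ℝ g x ≠ 0 ∧ ∀ y ∈ U, (y ∈ Ω ↔ g y < 0)

/-! ### The mesh and discrete operators

The mesh has `M` cells of width `h` in each direction (`M * h = ℓ`).  A cell is its multi-index in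
`(ℤ/M)^d`, so that `K + e_i` is the (periodic) neighbour of `K` in direction `e_i`.  A face is a pair
`(i, K)`: the face orthogonal to `e_i` that is common to `K` and `K + e_i`, with normal `e_i`. -/

/-- Cell indices. -/
abbrev Cell (d M : ℕ) : Type := Fin d → ZMod M

/-- The neighbour of `K` across its face with outer normal `e_i`. -/
def nxt {d M : ℕ} (i : Fin d) (K : Cell d M) : Cell d M := K + Pi.single i 1

/-- The neighbour of `K` across its face with outer normal `-e_i`. -/
def prv {d M : ℕ} (i : Fin d) (K : Cell d M) : Cell d M := K - Pi.single i 1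

/-- The closed cell `K`, as a subset of `[0, ℓ]^d`. -/
def cellSet {d M : ℕ} (h : ℝ) (K : Cell d M) : Set (Space d) :=
  {x | ∀ i, ((K i).val : ℝ) * h ≤ x i ∧ x i ≤ (((K i).val : ℝ) + 1) * h}

/-- The cell that contains the point `x`. -/
def cellAt {d M : ℕ} (h : ℝ) (x : Space d) : Cell d M := fun i => ((⌊x i / h⌋ : ℤ) : ZMod M)

/-- The piecewise constant function with the given cell values. -/
def pwc {d M : ℕ} (h : ℝ) (r : Cell d M → ℝ) (x : Space d) : ℝ := r (cellAt h x)

/-- The cell averages of `f` (values of the projection onto piecewise constant functions). -/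
def proj {d M : ℕ} (h : ℝ) (f : Space d → ℝ) (K : Cell d M) : ℝ :=
  (∫ x in cellSet h K, f x) / h ^ d

/-- Jump across the face `(i, K)`. -/
def jump {d M : ℕ} (i : Fin d) (r : Cell d M → ℝ) (K : Cell d M) : ℝ := r (nxt i K) - r K

/-- Average on the face `(i, K)`. -/
def avg {d M : ℕ} (i : Fin d) (r : Cell d M → ℝ) (K : Cell d M) : ℝ := (r K + r (nxt i K)) / 2

/-- `i`-th component of a discrete vector field. -/
def comp {d M : ℕ} (v : Cell d M → Fin d → ℝ) (i : Fin d) (K : Cell d M) : ℝ := v K i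

/-- The numerical flux `r^up {u}·n - h^α [r]` on the face `(i, K)`. -/
def flux {d M : ℕ} (h α : ℝ) (r : Cell d M → ℝ) (u : Cell d M → Fin d → ℝ) (i : Fin d)
    (K : Cell d M) : ℝ :=
  (if 0 ≤ avg i (comp u i) K then r K else r (nxt i K)) * avg i (comp u i) K
    - h ^ α * jump i r K

/-- Discrete divergence: `1/h` times the sum over the faces of `K` of `{v}·n`. -/
def divh {d M : ℕ} (h : ℝ) (v : Cell d M → Fin d → ℝ) (K : Cell d M) : ℝ :=
  (∑ i, (avg i (comp v i) K - avg i (comp v i) (prv i K))) / h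

/-- The `i`-th component of the discrete gradient, as a function of `x`: on the dual cell of the face
`(i, K)` (the cell `K` shifted by `h/2` in direction `e_i`) it is `[r]/h`. -/
def gradE {d M : ℕ} (h : ℝ) (r : Cell d M → ℝ) (i : Fin d) (x : Space d) : ℝ :=
  jump i r (cellAt h (x - Pi.single i (h / 2))) / h

/-- The pressure `a ϱ^γ`. -/
def pressure (a γ r : ℝ) : ℝ := a * r ^ γ

/-- The coefficient `ν = λ + (d-2)/d μ`. -/
def nu (d : ℕ) (μ lam : ℝ) : ℝ := lam + ((d : ℝ) - 2) / d * μ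

/-! ### Data and numerical solutions -/

/-- Admissible initial data on the torus for the penalized problem: `ϱ` is positive with `ϱ^γ`
integrable, bounded and bounded away from zero on the fluid domain; the momentum is bounded there
and vanishes in the solid part. -/
structure IsInitialData {d : ℕ} (ℓ γ : ℝ) (Ω : Set (Space d)) (ρ₀ : Space d → ℝ)
    (m₀ : Space d → Fin d → ℝ) : Prop where
  meas_density : AEStronglyMeasurable ρ₀ (volume.restrict (cube d ℓ))
  meas_momentum : AEStronglyMeasurable m₀ (volume.restrict (cube d ℓ))
  pos : ∀ᵐ x ∂volume.restrict (cube d ℓ), 0 < ρ₀ x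
  integrable : IntegrableOn (fun x => ρ₀ x ^ γ) (cube d ℓ)
  density_bounds : ∃ c C : ℝ, 0 < c ∧ ∀ᵐ x ∂volume.restrict Ω, c ≤ ρ₀ x ∧ ρ₀ x ≤ C
  momentum_bound : ∃ C : ℝ, ∀ᵐ x ∂volume.restrict Ω, ∀ i, |m₀ x i| ≤ C
  momentum_solid : ∀ᵐ x ∂volume.restrict (cube d ℓ \ Ω), m₀ x = 0

/-- The initial energy `∫ ½ ϱ₀ |u₀|² + a/(γ-1) ϱ₀^γ`, with `u₀ = m₀/ϱ₀`. -/
def initialEnergy {d : ℕ} (ℓ a γ : ℝ) (ρ₀ : Space d → ℝ) (m₀ : Space d → Fin d → ℝ) : ℝ :=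
  ∫ x in cube d ℓ, (1 / 2 * ρ₀ x * ∑ i, (m₀ x i / ρ₀ x) ^ 2 + a / (γ - 1) * ρ₀ x ^ γ)

open Classical in
/-- `(ρ k, u k)`, `0 ≤ k ≤ N`, is a solution of the finite volume scheme with `N` time steps of
length `Δt` on the mesh with `M^d` cells of width `h`.  Integrals of piecewise constant functions are
written as sums: cells and dual cells have measure `h^d`, faces `h^(d-1)`. The penalization acts on
the cells that are not contained in `Ω`. -/
structure IsFVSolution {d M : ℕ} [NeZero M] (Ω : Set (Space d)) (a γ μ lam α : ℝ)
    (ρ₀ : Space d → ℝ) (m₀ : Space d → Fin d → ℝ) (N : ℕ) (Δt h ε : ℝ)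
    (ρ : ℕ → Cell d M → ℝ) (u : ℕ → Cell d M → Fin d → ℝ) : Prop where
  init_density : ∀ K, ρ 0 K = proj h ρ₀ K
  init_momentum : ∀ K i, ρ 0 K * u 0 K i = proj h (fun x => m₀ x i) K
  continuity : ∀ k < N, ∀ φ : Cell d M → ℝ,
    ∑ K, h ^ d * ((ρ (k + 1) K - ρ k K) / Δt * φ K)
      - ∑ i, ∑ K, h ^ (d - 1) * (flux h α (ρ (k + 1)) (u (k + 1)) i K * jump i φ K) = 0
  momentum : ∀ k < N, ∀ φ : Cell d M → Fin d → ℝ,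
    ∑ K, h ^ d * ∑ j, (ρ (k + 1) K * u (k + 1) K j - ρ k K * u k K j) / Δt * φ K j
      - ∑ i, ∑ K, h ^ (d - 1) *
          ∑ j, flux h α (fun L => ρ (k + 1) L * u (k + 1) L j) (u (k + 1)) i K
            * jump i (comp φ j) K
      - ∑ K, h ^ d * (pressure a γ (ρ (k + 1) K) * divh h φ K)
      + 1 / ε * ∑ K, (if cellSet h K ⊆ Ω then 0 else h ^ d * ∑ j, u (k + 1) K j * φ K j)
      + μ * ∑ i, ∑ K, h ^ d *
          ∑ j, (jump i (comp (u (k + 1)) j) K / h) * (jump i (comp φ j) K / h)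
      + nu d μ lam * ∑ K, h ^ d * (divh h (u (k + 1)) K * divh h φ K) = 0

/-- Index of the discrete time level in force at time `t`: `0` at `t = 0` and `k` for
`t ∈ ((k-1)Δt, kΔt]`. -/
def level (Δt t : ℝ) : ℕ := ⌈t / Δt⌉₊

/-! ### Test functions -/

/-- On `(0,T) × ℝ^d`, `g` is the weak derivative of `f` in direction `v`, it is measurable, and
`|g| ≤ B` almost everywhere. -/
structure IsBddWeakDeriv {d : ℕ} (T B : ℝ) (v : ℝ × Space d) (f g : ℝ → Space d → ℝ) : Prop where
  meas : AEStronglyMeasurable (Function.uncurry g) (volume.restrict (Ioo 0 T ×ˢ univ))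
  bound : ∀ᵐ z ∂volume.restrict (Ioo 0 T ×ˢ (univ : Set (Space d))), |g z.1 z.2| ≤ B
  weak : ∀ ψ : ℝ × Space d → ℝ, ContDiff ℝ ∞ ψ → HasCompactSupport ψ →
    tsupport ψ ⊆ Ioo 0 T ×ˢ univ →
      ∫ z in Ioo 0 T ×ˢ univ, f z.1 z.2 * fderiv ℝ ψ z v
        = -∫ z in Ioo 0 T ×ˢ univ, g z.1 z.2 * ψ z

/-- `φ ∈ W^{1,∞}((0,T) × 𝕋^d)`, represented by its continuous representative on `[0,T] × 𝕋^d`, with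
weak derivatives `∂_t φ = φt`, `∂_i φ = φx i`, and `∂_t² φ ∈ L^∞`; the moduli of `φ`, of its first
weak derivatives and of `∂_t² φ` are bounded by `B`. -/
structure IsTestFun {d : ℕ} (ℓ T B : ℝ) (φ φt : ℝ → Space d → ℝ)
    (φx : Fin d → ℝ → Space d → ℝ) : Prop where
  cont : ContinuousOn (Function.uncurry φ) (Icc 0 T ×ˢ univ)
  periodic : ∀ t ∈ Icc 0 T, ∀ x i, φ t (x + Pi.single i ℓ) = φ t x
  bound : ∀ t ∈ Icc 0 T, ∀ x, |φ t x| ≤ B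
  dt : IsBddWeakDeriv T B (1, 0) φ φt
  dx : ∀ i, IsBddWeakDeriv T B (0, Pi.single i 1) φ (φx i)
  dtt : ∃ φtt, IsBddWeakDeriv T B (1, 0) φt φtt

/-- Vector test functions `φ ∈ W^{1,∞} ∩ L^∞(0,T; W^{2,∞})` with `∂_t² φ ∈ L^∞`, all these norms
(componentwise) bounded by `B`; `φx i` is the weak derivative `∂_i φ`. -/
structure IsVecTestFun {d : ℕ} (ℓ T B : ℝ) (φ φt : ℝ → Space d → Fin d → ℝ)
    (φx : Fin d → ℝ → Space d → Fin d → ℝ) : Prop where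
  comp : ∀ j, IsTestFun ℓ T B (fun t x => φ t x j) (fun t x => φt t x j)
    (fun i t x => φx i t x j)
  dxx : ∀ j i k, ∃ g, IsBddWeakDeriv T B (0, Pi.single k 1) (fun t x => φx i t x j) g

/-! ### Consistency errors -/

/-- Consistency error of the continuity equation. -/
def errDensity {d M : ℕ} (ℓ Δt h : ℝ) (ρ : ℕ → Cell d M → ℝ) (u : ℕ → Cell d M → Fin d → ℝ)
    (τ : ℝ) (φ φt : ℝ → Space d → ℝ) (φx : Fin d → ℝ → Space d → ℝ) : ℝ :=
  (∫ x in cube d ℓ, pwc h (ρ (level Δt τ)) x * φ τ x)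
    - (∫ x in cube d ℓ, pwc h (ρ (level Δt 0)) x * φ 0 x)
    - ∫ t in (0 : ℝ)..τ, ∫ x in cube d ℓ,
        (pwc h (ρ (level Δt t)) x * φt t x
          + ∑ i, pwc h (ρ (level Δt t)) x * pwc h (comp (u (level Δt t)) i) x * φx i t x)

/-- Consistency error of the momentum equation. -/
def errMomentum {d M : ℕ} (ℓ : ℝ) (Ω : Set (Space d)) (a γ μ lam Δt h ε : ℝ)
    (ρ : ℕ → Cell d M → ℝ) (u : ℕ → Cell d M → Fin d → ℝ)
    (τ : ℝ) (φ φt : ℝ → Space d → Fin d → ℝ) (φx : Fin d → ℝ → Space d → Fin d → ℝ) : ℝ :=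
  let R : ℝ → Space d → ℝ := fun t => pwc h (ρ (level Δt t))
  let U : ℝ → Fin d → Space d → ℝ := fun t j => pwc h (comp (u (level Δt t)) j)
  (∫ x in cube d ℓ, ∑ j, R τ x * U τ j x * φ τ x j)
    - (∫ x in cube d ℓ, ∑ j, R 0 x * U 0 j x * φ 0 x j)
    - (∫ t in (0 : ℝ)..τ, ∫ x in cube d ℓ,
        ((∑ j, R t x * U t j x * φt t x j)
          + (∑ j, ∑ i, R t x * U t j x * U t i x * φx i t x j)
          + pressure a γ (R t x) * ∑ i, φx i t x i))
    + (∫ t in (0 : ℝ)..τ, ∫ x in cube d ℓ,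
        (μ * (∑ j, ∑ i, gradE h (comp (u (level Δt t)) j) i x * φx i t x j)
          + nu d μ lam * (pwc h (divh h (u (level Δt t))) x * ∑ i, φx i t x i)))
    + 1 / ε * ∫ t in (0 : ℝ)..τ, ∫ x in cube d ℓ \ Ω, ∑ j, U t j x * φ t x j

/-! ### Exponents (`d = 2` or `d = 3`) -/

/-- The exponent `β_D`. -/
def betaD (d : ℕ) (γ α : ℝ) : ℝ :=
  if 2 ≤ γ then 0
  else if d = 2 then
    (⨅ p : Ici (1 : ℝ), min (((p : ℝ) * (α + 1) + 4) / (2 * (p : ℝ))) 1) * ((γ - 2) / γ)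
  else min ((α + 2) / 3) 1 * (3 * (γ - 2) / (2 * γ))

/-- The exponent `β_R`. -/
def betaR (d : ℕ) (γ α : ℝ) : ℝ :=
  if d = 2 then 0
  else if γ < 6 / 5 then min ((1 + α) / 2) 1 * ((5 * γ - 6) / (2 * γ))
  else 0

/-- The exponent `β_M`; for `d = 2` and `γ ≤ 2` it depends on a Lebesgue exponent `p`. -/
def betaM (d : ℕ) (γ α p : ℝ) : ℝ :=
  if d = 2 then
    if γ ≤ 2 then
      max (-((p * (α + 1) + 4) / (2 * p * γ))) ((p * (γ - 2) - 2 * γ) / (p * γ))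
    else 0
  else if γ ≤ 2 then
    max (max (-((α + 2) / (2 * γ))) ((γ - 3) / γ)) (-(3 / (2 * γ)))
  else if γ < 3 then (γ - 3) / γ
  else 0

end FV

end

namespace FV

/-! ### Discrete calculus -/

section Discrete

variable {d M : ℕ}

/-! The scheme inherits the energy balance of the compressible Navier–Stokes system, and every
constant comes from it. Testing the momentum equation with the velocity and the continuity equation
with `|u|²/2` and with the derivative of the pressure potential cancels convection and pressure up
to signed terms (`ContStep.kinetic`, `ContStep.renormalized`, `IsFVSolution.energy_step`). Summation
in time gives the a priori bounds collected in `EnergyBounds`: kinetic and internal energy uniformly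
in time, the discrete gradient in `L²`, the velocity on the penalized cells of squared size `ε`, and
density jumps weighted by `h^α + |{u}·n|`. Since the fluid stays away from the sides of the cube,
some layer of cells is always penalized. A Poincaré inequality (`exists_poincare`) and discrete
Sobolev inequalities (`sobolev_two`, `sobolev_three`) then control the full `H¹` and `L^p` norms of
the velocity. Interpolation and inverse estimates turn this into space-time `L²` bounds for `ϱ` and
`ϱu`; this is where `β_D` and `β_M` arise (`exists_density_sq_bound`, `exists_momentum_sq_bound`).

The consistency error is split by `abs_time_error_le`. At almost every time `t` the scheme is tested
with the cell averages of the slice `φ(t,·)`, which leaves a purely spatial error. Replacing the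
value of `φ` at the start of a step by its mean over the step costs `O(Δt)`: increments of `ϱ` in
time are not controlled, so Abel summation moves the difference onto `φ`, and the bound on `∂_t²φ`
is used. Finally `τ` need not be a grid point, so the equation is left over on part of one step.
This piece is `O(Δt)` for the density, but only `√Δt + √(Δt/ε)` for the momentum, whose viscous and
penalty terms are bounded only in `L²` in time.

In space, the numerical flux is the centred flux minus products of jumps (`flux_eq`). For the
density, Cauchy–Schwarz against the jump dissipation yields `h^((1+α)/2)` and `h^(1/2)`, and the
jumps of `u` against `ϱ` yield `h^(1+β_D)`; as `β_R ≤ 0`, the rate `h^(1/2)` is at least as good as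
the required `h^((1+β_R)/2)`. For the momentum, jumps of `ϱu` are summed by parts onto `u` and onto
differences of `φ`. That uses second derivatives of `φ` and produces `h`, `h^(1+α)` and `h^(1+β_M)`.
The discrete and the exact penalty terms differ only on cells cut by the boundary. Within the fluid
these lie in a boundary layer of volume `O(h)` (`exists_boundaryLayer_le`), and Cauchy–Schwarz with
the `ε`-weighted velocity bound gives `√(h/ε)`. -/

@[simp] lemma nxt_prv (i : Fin d) (K : Cell d M) : nxt i (prv i K) = K := by
  simp [nxt, prv]

@[simp] lemma prv_nxt (i : Fin d) (K : Cell d M) : prv i (nxt i K) = K := by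
  simp [nxt, prv]

variable [NeZero M]

lemma sum_nxt (i : Fin d) (f : Cell d M → ℝ) : ∑ K, f (nxt i K) = ∑ K, f K :=
  Equiv.sum_comp (Equiv.addRight (Pi.single i 1 : Cell d M)) f

lemma sum_prv (i : Fin d) (f : Cell d M → ℝ) : ∑ K, f (prv i K) = ∑ K, f K :=
  Equiv.sum_comp (Equiv.subRight (Pi.single i 1 : Cell d M)) f

/-- Summation by parts on the periodic mesh. -/
lemma sum_mul_jump (i : Fin d) (f g : Cell d M → ℝ) :
    ∑ K, f K * jump i g K = -∑ K, (f K - f (prv i K)) * g K := by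
  have h1 : ∑ K, f K * g (nxt i K) = ∑ K, f (prv i K) * g K := by
    rw [← sum_nxt i (fun K => f (prv i K) * g K)]
    simp
  simp only [jump, mul_sub, sub_mul, Finset.sum_sub_distrib, h1]
  ring

lemma pow_eq_pow_pred_mul (hd : d ≠ 0) (h : ℝ) : h ^ d = h ^ (d - 1) * h := by
  rw [← pow_succ, Nat.sub_add_cancel (Nat.one_le_iff_ne_zero.mpr hd)]

/-- Discrete integration by parts: the cell divergence is dual to the face averages paired with
jumps. It brings the pressure work and the convective flux to the same form. -/
lemma sum_mul_divh (hd : d ≠ 0) {h : ℝ} (hh : h ≠ 0) (q : Cell d M → ℝ)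
    (v : Cell d M → Fin d → ℝ) :
    ∑ K, h ^ d * (q K * divh h v K)
      = -∑ i, ∑ K, h ^ (d - 1) * (avg i (comp v i) K * jump i q K) := by
  have h1 : ∀ i : Fin d, ∑ K, h ^ (d - 1) * (avg i (comp v i) K * jump i q K)
      = -∑ K, h ^ (d - 1) * (q K * (avg i (comp v i) K - avg i (comp v i) (prv i K))) := by
    intro i
    rw [← Finset.mul_sum, sum_mul_jump, mul_neg, Finset.mul_sum]
    congr 1
    refine Finset.sum_congr rfl fun K _ => by ring
  simp only [h1]
  rw [Finset.sum_neg_distrib, neg_neg, Finset.sum_comm]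
  refine Finset.sum_congr rfl fun K _ => ?_
  rw [← Finset.mul_sum, ← Finset.mul_sum, divh, pow_eq_pow_pred_mul hd]
  field_simp

/-- The discrete continuity equation over one time step. -/
def ContStep (Δt h α : ℝ) (r₀ r₁ : Cell d M → ℝ) (u : Cell d M → Fin d → ℝ) : Prop :=
  ∀ φ : Cell d M → ℝ,
    ∑ K, h ^ d * ((r₁ K - r₀ K) / Δt * φ K)
      - ∑ i, ∑ K, h ^ (d - 1) * (flux h α r₁ u i K * jump i φ K) = 0

/-- The upwind choice makes the flux point out of the set where the new density is positive, into
the set where it is not. So the indicator of `{r₁ ≤ 0}` as test function gives a nonnegative face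
sum, while the time difference would be strictly negative on that set. -/
lemma ContStep.pos {Δt h α : ℝ} {r₀ r₁ : Cell d M → ℝ} {u : Cell d M → Fin d → ℝ}
    (hc : ContStep Δt h α r₀ r₁ u) (ht : 0 < Δt) (hh : 0 < h) (h0 : ∀ K, 0 < r₀ K) :
    ∀ K, 0 < r₁ K := by
  by_contra! hK
  obtain ⟨K₀, hK₀⟩ := hK
  have key := hc (fun K => if r₁ K ≤ 0 then 1 else 0)
  have h1 : ∑ K, h ^ d * ((r₁ K - r₀ K) / Δt * (if r₁ K ≤ 0 then (1 : ℝ) else 0)) < 0 := by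
    have hle : ∀ K, r₁ K ≤ 0 → h ^ d * ((r₁ K - r₀ K) / Δt * 1) < 0 := by
      intro K hK
      have : (r₁ K - r₀ K) / Δt < 0 := div_neg_of_neg_of_pos (by linarith [h0 K]) ht
      rw [mul_one]
      exact mul_neg_of_pos_of_neg (by positivity) this
    refine Finset.sum_neg' (fun K _ => ?_) ⟨K₀, Finset.mem_univ _, ?_⟩
    · by_cases hK : r₁ K ≤ 0
      · simpa [hK] using (hle K hK).le
      · simp [hK]
    · simpa [hK₀] using hle K₀ hK₀
  have h2 : 0 ≤ ∑ i, ∑ K, h ^ (d - 1) *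
      (flux h α r₁ u i K * jump i (fun K => if r₁ K ≤ 0 then (1 : ℝ) else 0) K) := by
    refine Finset.sum_nonneg fun i _ => Finset.sum_nonneg fun K _ =>
      mul_nonneg (by positivity) ?_
    have hα : 0 < h ^ α := Real.rpow_pos_of_pos hh α
    simp only [flux, jump]
    by_cases hw : 0 ≤ avg i (comp u i) K <;> by_cases h3 : r₁ (nxt i K) ≤ 0 <;>
      by_cases h4 : r₁ K ≤ 0 <;> simp only [hw, h3, h4, if_true, if_false, sub_self, mul_zero,
        le_refl]
    · nlinarith [mul_nonneg hα.le (sub_nonneg.mpr (h3.trans (not_le.mp h4).le)),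
        mul_nonneg (not_le.mp h4).le hw]
    · nlinarith [mul_nonneg hα.le (sub_nonneg.mpr (h4.trans (not_le.mp h3).le)),
        mul_nonneg (neg_nonneg.mpr h4) hw]
    · nlinarith [mul_nonneg hα.le (sub_nonneg.mpr (h3.trans (not_le.mp h4).le)),
        mul_nonneg (neg_nonneg.mpr h3) (neg_nonneg.mpr (not_le.mp hw).le)]
    · nlinarith [mul_nonneg hα.le (sub_nonneg.mpr (h4.trans (not_le.mp h3).le)),
        mul_nonneg (not_le.mp h3).le (neg_nonneg.mpr (not_le.mp hw).le)]
  linarith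

/-- Renormalization of the discrete continuity equation. -/
lemma ContStep.renormalized (hd : d ≠ 0) {Δt h α : ℝ} {r₀ r₁ : Cell d M → ℝ}
    {u : Cell d M → Fin d → ℝ}
    (hc : ContStep Δt h α r₀ r₁ u) (ht : 0 < Δt) (hh : 0 < h) (h0 : ∀ K, 0 < r₀ K)
    (h1 : ∀ K, 0 < r₁ K) (b b' : ℝ → ℝ) (e : ℝ → ℝ → ℝ) (he : ∀ x y, 0 < x → 0 < y → 0 ≤ e x y)
    (hsymm : ∀ x y, e x y = e y x)
    -- Here `e` is a symmetric lower bound for the Bregman distance of `b`. Symmetry is needed since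
    -- either neighbour may be the upwind one.
    (hb : ∀ x y, 0 < x → 0 < y → e x y ≤ b x - b y - b' y * (x - y)) :
    ∑ K, h ^ d * (b (r₁ K) - b (r₀ K))
      + Δt * ∑ i, ∑ K, h ^ (d - 1) * ((h ^ α + |avg i (comp u i) K|) * e (r₁ K) (r₁ (nxt i K)))
      ≤ -(Δt * ∑ K, h ^ d * ((r₁ K * b' (r₁ K) - b (r₁ K)) * divh h u K)) := by
  have key := hc (fun K => b' (r₁ K))
  have hα : 0 < h ^ α := Real.rpow_pos_of_pos hh α
  rw [sum_mul_divh hd hh.ne' (fun K => r₁ K * b' (r₁ K) - b (r₁ K))]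
  have e1 : ∑ K, h ^ d * (b (r₁ K) - b (r₀ K))
      ≤ Δt * ∑ K, h ^ d * ((r₁ K - r₀ K) / Δt * b' (r₁ K)) := by
    rw [Finset.mul_sum]
    refine Finset.sum_le_sum fun K _ => ?_
    have h3 := (he (r₀ K) (r₁ K) (h0 K) (h1 K)).trans (hb _ _ (h0 K) (h1 K))
    have : Δt * (h ^ d * ((r₁ K - r₀ K) / Δt * b' (r₁ K)))
        = h ^ d * ((r₁ K - r₀ K) * b' (r₁ K)) := by field_simp
    rw [this]
    exact mul_le_mul_of_nonneg_left (by linarith) (by positivity)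
  -- On a face with upwind value `x` and downwind value `y`, the term `w·[r b' - b]` exceeds the
  -- upwind flux times `[b']` by `|w|` times the Bregman distance `b x - b y - b' y (x - y)`. The
  -- artificial diffusion adds `h^α (y - x)(b' y - b' x)`, the sum of both Bregman distances.
  have e2 : ∑ i, ∑ K, h ^ (d - 1) *
        ((h ^ α + |avg i (comp u i) K|) * e (r₁ K) (r₁ (nxt i K)))
      ≤ (∑ i, ∑ K, h ^ (d - 1) *
          (avg i (comp u i) K * jump i (fun K => r₁ K * b' (r₁ K) - b (r₁ K)) K))
        - ∑ i, ∑ K, h ^ (d - 1) * (flux h α r₁ u i K * jump i (fun K => b' (r₁ K)) K) := by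
    simp only [← Finset.sum_sub_distrib, ← mul_sub]
    refine Finset.sum_le_sum fun i _ => Finset.sum_le_sum fun K _ =>
      mul_le_mul_of_nonneg_left ?_ (by positivity)
    set w := avg i (comp u i) K with hw
    have a1 := hb (r₁ K) (r₁ (nxt i K)) (h1 _) (h1 _)
    have a2 := hb (r₁ (nxt i K)) (r₁ K) (h1 _) (h1 _)
    rw [hsymm] at a2
    have a0 := he (r₁ K) (r₁ (nxt i K)) (h1 _) (h1 _)
    simp only [flux, jump, ← hw]
    generalize r₁ K = x at *
    generalize r₁ (nxt i K) = y at *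
    have a3 : h ^ α * e x y ≤ h ^ α * ((y - x) * (b' y - b' x)) :=
      mul_le_mul_of_nonneg_left (by nlinarith) hα.le
    split_ifs with hw0
    · rw [abs_of_nonneg hw0]
      have := mul_le_mul_of_nonneg_left a1 hw0
      nlinarith
    · rw [abs_of_neg (not_le.mp hw0)]
      have := mul_le_mul_of_nonneg_left a2 (neg_nonneg.mpr (not_le.mp hw0).le)
      nlinarith
  have e3 := mul_le_mul_of_nonneg_left e2 ht.le
  have e4 : ∑ K, h ^ d * ((r₁ K - r₀ K) / Δt * b' (r₁ K))
      = ∑ i, ∑ K, h ^ (d - 1) * (flux h α r₁ u i K * jump i (fun K => b' (r₁ K)) K) := by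
    linarith
  rw [e4] at e1
  linarith

/-- Kinetic energy balance of one step: the fluxes dissipate. -/
lemma ContStep.kinetic {Δt h α : ℝ} {r₀ r₁ : Cell d M → ℝ}
    {u₀ u : Cell d M → Fin d → ℝ} (hc : ContStep Δt h α r₀ r₁ u) (ht : 0 < Δt) (hh : 0 < h)
    (h0 : ∀ K, 0 < r₀ K) (h1 : ∀ K, 0 < r₁ K) :
    ∑ K, h ^ d * (1 / 2 * r₁ K * ∑ j, u K j ^ 2) - ∑ K, h ^ d * (1 / 2 * r₀ K * ∑ j, u₀ K j ^ 2)
      ≤ Δt * (∑ K, h ^ d * ∑ j, (r₁ K * u K j - r₀ K * u₀ K j) / Δt * u K j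
        - ∑ i, ∑ K, h ^ (d - 1) * ∑ j, flux h α (fun L => r₁ L * u L j) u i K
            * jump i (comp u j) K) := by
  have hα : 0 < h ^ α := Real.rpow_pos_of_pos hh α
  -- Subtracting the continuity equation tested with `|u|²/2` completes squares: what remains is `½
  -- r₀ |u - u₀|²` in time, and on each face the square of the velocity jump times the upwind
  -- density and times the diffusion.
  have key := hc (fun K => 1 / 2 * ∑ j, u K j ^ 2)
  have e1 : ∑ K, h ^ d * (1 / 2 * r₁ K * ∑ j, u K j ^ 2)
        - ∑ K, h ^ d * (1 / 2 * r₀ K * ∑ j, u₀ K j ^ 2)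
      ≤ Δt * (∑ K, h ^ d * ∑ j, (r₁ K * u K j - r₀ K * u₀ K j) / Δt * u K j
        - ∑ K, h ^ d * ((r₁ K - r₀ K) / Δt * (1 / 2 * ∑ j, u K j ^ 2))) := by
    rw [← Finset.sum_sub_distrib, ← Finset.sum_sub_distrib, Finset.mul_sum]
    refine Finset.sum_le_sum fun K _ => ?_
    rw [← mul_sub, ← mul_sub, mul_left_comm Δt]
    refine mul_le_mul_of_nonneg_left ?_ (by positivity)
    simp only [Finset.mul_sum, ← Finset.sum_sub_distrib]
    refine Finset.sum_le_sum fun j _ => ?_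
    have : Δt * ((r₁ K * u K j - r₀ K * u₀ K j) / Δt * u K j
          - (r₁ K - r₀ K) / Δt * (1 / 2 * u K j ^ 2))
        = (r₁ K * u K j - r₀ K * u₀ K j) * u K j - (r₁ K - r₀ K) * (1 / 2 * u K j ^ 2) := by
      field_simp
    rw [this]
    nlinarith [mul_nonneg (h0 K).le (sq_nonneg (u K j - u₀ K j))]
  have e2 : ∑ i, ∑ K, h ^ (d - 1) * ∑ j, flux h α (fun L => r₁ L * u L j) u i K
            * jump i (comp u j) K
      ≤ ∑ i, ∑ K, h ^ (d - 1) *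
        (flux h α r₁ u i K * jump i (fun K => 1 / 2 * ∑ j, u K j ^ 2) K) := by
    refine Finset.sum_le_sum fun i _ => Finset.sum_le_sum fun K _ =>
      mul_le_mul_of_nonneg_left ?_ (by positivity)
    simp only [flux, jump, comp]
    rw [← mul_sub (1 / 2 : ℝ), ← Finset.sum_sub_distrib, Finset.mul_sum, Finset.mul_sum]
    refine Finset.sum_le_sum fun j _ => ?_
    set w := avg i (comp u i) K with hw
    have hx := h1 K
    have hy := h1 (nxt i K)
    generalize r₁ K = x at *
    generalize r₁ (nxt i K) = y at *
    generalize u K j = p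
    generalize u (nxt i K) j = q
    have a0 := mul_nonneg hα.le (mul_nonneg (add_pos hx hy).le (sq_nonneg (q - p)))
    split_ifs with hw0
    · have := mul_nonneg hw0 (mul_nonneg hx.le (sq_nonneg (q - p)))
      nlinarith
    · have := mul_nonneg (neg_nonneg.mpr (not_le.mp hw0).le) (mul_nonneg hy.le (sq_nonneg (q - p)))
      nlinarith
  refine e1.trans (mul_le_mul_of_nonneg_left ?_ ht.le)
  linarith

end Discrete

end FV

namespace FV

/-! ### Integrals over the mesh -/

section Geometry

set_option linter.unusedSectionVars false

variable {d M : ℕ}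

/-- The half-open cell with index `K`. -/
def cellBox (h : ℝ) (K : Cell d M) : Set (Space d) :=
  Set.univ.pi fun i => Ico (((K i).val : ℝ) * h) ((((K i).val : ℝ) + 1) * h)

lemma cellSet_eq_pi (h : ℝ) (K : Cell d M) :
    cellSet h K = Set.univ.pi fun i => Icc (((K i).val : ℝ) * h) ((((K i).val : ℝ) + 1) * h) := by
  ext x
  exact (mem_univ_pi (t := fun i => Icc (((K i).val : ℝ) * h) ((((K i).val : ℝ) + 1) * h))).symm

/-- The scheme averages over closed cells, which overlap along faces, whereas the half-open boxes
partition the cube. For integrals the two are interchangeable. -/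
lemma cellBox_ae_eq (h : ℝ) (K : Cell d M) : cellBox h K =ᵐ[volume] cellSet h K := by
  rw [cellSet_eq_pi, cellBox, volume_pi, pi_univ_Icc]
  exact Measure.univ_pi_Ico_ae_eq_Icc (μ := fun _ : Fin d => (volume : Measure ℝ))
    (f := fun i => ((K i).val : ℝ) * h) (g := fun i => (((K i).val : ℝ) + 1) * h)

lemma isCompact_cellSet (h : ℝ) (K : Cell d M) : IsCompact (cellSet h K) := by
  rw [cellSet_eq_pi]
  exact isCompact_univ_pi fun _ => isCompact_Icc

lemma measurableSet_cellBox (h : ℝ) (K : Cell d M) : MeasurableSet (cellBox h K) :=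
  MeasurableSet.univ_pi fun _ => measurableSet_Ico

lemma measurableSet_cube (ℓ : ℝ) : MeasurableSet (cube d ℓ) :=
  MeasurableSet.univ_pi fun _ => measurableSet_Ico

lemma volume_cellSet {h : ℝ} (hh : 0 < h) (K : Cell d M) :
    volume (cellSet h K) = ENNReal.ofReal (h ^ d) := by
  rw [cellSet_eq_pi, volume_pi_pi]
  have : ∀ i, volume (Icc (((K i).val : ℝ) * h) ((((K i).val : ℝ) + 1) * h))
      = ENNReal.ofReal h := by
    intro i
    rw [Real.volume_Icc]
    congr 1
    ring
  simp [this, ENNReal.ofReal_pow hh.le]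

lemma measureReal_cellSet {h : ℝ} (hh : 0 < h) (K : Cell d M) :
    volume.real (cellSet h K) = h ^ d := by
  rw [Measure.real, volume_cellSet hh, ENNReal.toReal_ofReal (by positivity)]

lemma volume_cube_lt_top (ℓ : ℝ) : volume (cube d ℓ) < ⊤ := by
  rw [cube, volume_pi_pi]
  exact ENNReal.prod_lt_top fun _ _ => by simp

instance isFiniteMeasure_cube (ℓ : ℝ) : IsFiniteMeasure (volume.restrict (cube d ℓ)) :=
  isFiniteMeasure_restrict.mpr (volume_cube_lt_top ℓ).ne

variable [NeZero M]

lemma cellAt_of_mem {h : ℝ} (hh : 0 < h) {K : Cell d M} {x : Space d} (hx : x ∈ cellBox h K) :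
    cellAt h x = K := by
  funext i
  have hi := hx i (mem_univ i)
  have : ⌊x i / h⌋ = ((K i).val : ℤ) := by
    rw [Int.floor_eq_iff]
    push_cast
    exact ⟨(le_div_iff₀ hh).mpr hi.1, (div_lt_iff₀ hh).mpr hi.2⟩
  simp only [cellAt, this]
  simp

lemma mem_cellBox_cellAt {h ℓ : ℝ} (hh : 0 < h) (hM : (M : ℝ) * h = ℓ) {x : Space d}
    (hx : x ∈ cube d ℓ) : x ∈ cellBox h (cellAt h x : Cell d M) := by
  intro i _
  have hi := hx i (mem_univ i)
  have h0 : 0 ≤ ⌊x i / h⌋ := Int.floor_nonneg.mpr (div_nonneg hi.1 hh.le)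
  have h1 : ⌊x i / h⌋ < M := by
    rw [Int.floor_lt]
    push_cast
    rw [div_lt_iff₀ hh, hM]
    exact hi.2
  obtain ⟨n, hn⟩ := Int.eq_ofNat_of_zero_le h0
  have hnM : n < M := by omega
  have h2 : (((cellAt h x : Cell d M) i).val : ℝ) = (⌊x i / h⌋ : ℝ) := by
    simp only [cellAt, hn]
    rw [Int.cast_natCast, ZMod.val_natCast_of_lt hnM]
    simp
  change _ ∈ Ico _ _
  rw [h2]
  exact ⟨(le_div_iff₀ hh).mp (Int.floor_le _), (div_lt_iff₀ hh).mp (Int.lt_floor_add_one _)⟩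

lemma cellBox_subset_cube {h ℓ : ℝ} (hh : 0 < h) (hM : (M : ℝ) * h = ℓ) (K : Cell d M) :
    cellBox h K ⊆ cube d ℓ := by
  intro x hx i _
  have hi := hx i (mem_univ i)
  refine ⟨le_trans (by positivity) hi.1, hi.2.trans_le ?_⟩
  rw [← hM]
  gcongr
  exact_mod_cast ZMod.val_lt (K i)

lemma iUnion_cellBox {h ℓ : ℝ} (hh : 0 < h) (hM : (M : ℝ) * h = ℓ) :
    ⋃ K : Cell d M, cellBox h K = cube d ℓ := by
  refine Subset.antisymm (iUnion_subset fun K => cellBox_subset_cube hh hM K) fun x hx => ?_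
  exact mem_iUnion.mpr ⟨_, mem_cellBox_cellAt hh hM hx⟩

lemma integrableOn_cellSet {h ℓ : ℝ} (hh : 0 < h) (hM : (M : ℝ) * h = ℓ) {f : Space d → ℝ}
    (hf : IntegrableOn f (cube d ℓ)) (K : Cell d M) : IntegrableOn f (cellSet h K) :=
  (hf.mono_set (cellBox_subset_cube hh hM K)).congr_set_ae (cellBox_ae_eq h K).symm

lemma integral_cube_eq_sum {h ℓ : ℝ} (hh : 0 < h) (hM : (M : ℝ) * h = ℓ) {f : Space d → ℝ}
    (hf : IntegrableOn f (cube d ℓ)) :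
    ∫ x in cube d ℓ, f x = ∑ K : Cell d M, ∫ x in cellSet h K, f x := by
  rw [← iUnion_cellBox (M := M) hh hM, integral_iUnion_fintype (measurableSet_cellBox h)]
  · exact Finset.sum_congr rfl fun K _ => setIntegral_congr_set (cellBox_ae_eq h K)
  · intro K L hKL
    refine Set.disjoint_left.mpr fun x hK hL => hKL ?_
    rw [← cellAt_of_mem hh hK, ← cellAt_of_mem hh hL]
  · exact fun K => hf.mono_set (cellBox_subset_cube hh hM K)

lemma measurable_pwc (h : ℝ) (r : Cell d M → ℝ) : Measurable (pwc h r) := by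
  have h1 : Measurable fun x : Space d => fun i => ⌊x i / h⌋ :=
    measurable_pi_lambda _ fun i =>
      Measurable.floor ((measurable_pi_apply (X := fun _ : Fin d => ℝ) i).div_const h)
  exact (measurable_of_countable fun z : Fin d → ℤ => r fun i => ((z i : ℤ) : ZMod M)).comp h1

lemma exists_bound_pwc (h : ℝ) (r : Cell d M → ℝ) : ∃ C, ∀ x, |pwc h r x| ≤ C :=
  ⟨∑ K, |r K|, fun x => Finset.single_le_sum (f := fun K => |r K|) (fun _ _ => abs_nonneg _)
    (Finset.mem_univ (cellAt h x))⟩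

lemma integrableOn_pwc_mul {s : Set (Space d)} (h : ℝ) (r : Cell d M → ℝ) {f : Space d → ℝ}
    (hf : IntegrableOn f s) : IntegrableOn (fun x => pwc h r x * f x) s := by
  obtain ⟨C, hC⟩ := exists_bound_pwc h r
  exact Integrable.bdd_mul hf (measurable_pwc h r).aestronglyMeasurable
    (Filter.Eventually.of_forall hC)

lemma pwc_ae_eq {h : ℝ} (hh : 0 < h) (r : Cell d M → ℝ) (K : Cell d M) :
    ∀ᵐ x ∂volume.restrict (cellSet h K), pwc h r x = r K := by
  rw [← Measure.restrict_congr_set (cellBox_ae_eq h K)]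
  filter_upwards [ae_restrict_mem (measurableSet_cellBox h K)] with x hx
  rw [pwc, cellAt_of_mem hh hx]

lemma integral_pwc_mul {h ℓ : ℝ} (hh : 0 < h) (hM : (M : ℝ) * h = ℓ) (r : Cell d M → ℝ)
    {f : Space d → ℝ} (hf : IntegrableOn f (cube d ℓ)) :
    ∫ x in cube d ℓ, pwc h r x * f x = ∑ K, r K * ∫ x in cellSet h K, f x := by
  rw [integral_cube_eq_sum (M := M) hh hM (integrableOn_pwc_mul h r hf)]
  refine Finset.sum_congr rfl fun K _ => ?_
  rw [← integral_const_mul]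
  refine integral_congr_ae ?_
  filter_upwards [pwc_ae_eq hh r K] with x hx
  rw [hx]

lemma integral_pwc {h ℓ : ℝ} (hh : 0 < h) (hM : (M : ℝ) * h = ℓ) (r : Cell d M → ℝ) :
    ∫ x in cube d ℓ, pwc h r x = ∑ K, h ^ d * r K := by
  have := integral_pwc_mul hh hM r (f := fun _ => 1) (integrable_const _)
  simp only [mul_one] at this
  rw [this]
  refine Finset.sum_congr rfl fun K _ => ?_
  rw [setIntegral_const, measureReal_cellSet hh]
  simp [mul_comm]

lemma sum_cells_const {h ℓ : ℝ} (hM : (M : ℝ) * h = ℓ) :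
    ∑ _K : Cell d M, h ^ d = ℓ ^ d := by
  simp [← hM, mul_pow, ZMod.card]

/-! ### Translations -/

lemma cellAt_sub {h : ℝ} (hh : 0 < h) (i : Fin d) (x : Space d) :
    (cellAt h (x - Pi.single i h) : Cell d M) = prv i (cellAt h x) := by
  funext k
  by_cases hk : k = i
  · subst hk
    simp [cellAt, prv, sub_div, hh.ne']
  · simp [cellAt, prv, hk]

/-- The dual cells, and the fundamental theorem of calculus across a face, involve shifts by less
than a full width; only two values of a piecewise constant function can then occur. -/
lemma cellAt_sub_le {h s : ℝ} (hh : 0 < h) (h0 : 0 ≤ s) (h1 : s ≤ h) (i : Fin d) (x : Space d) :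
    (cellAt h (x - Pi.single i s) : Cell d M) = cellAt h x ∨
      (cellAt h (x - Pi.single i s) : Cell d M) = prv i (cellAt h x) := by
  have hs0 : 0 ≤ s / h := by positivity
  have hs1 : s / h ≤ 1 := (div_le_one hh).mpr h1
  have h2 : ⌊x i / h - s / h⌋ ≤ ⌊x i / h⌋ := Int.floor_le_floor (by linarith)
  have h3 : ⌊x i / h⌋ - 1 ≤ ⌊x i / h - s / h⌋ := by
    rw [← Int.floor_sub_one]
    exact Int.floor_le_floor (by linarith)
  have h4 : ⌊x i / h - s / h⌋ = ⌊x i / h⌋ ∨ ⌊x i / h - s / h⌋ = ⌊x i / h⌋ - 1 := by omega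
  refine h4.imp (fun h4 => ?_) fun h4 => ?_
  all_goals
    funext k
    by_cases hk : k = i
    · subst hk
      simp [cellAt, prv, sub_div, h4]
    · simp [cellAt, prv, hk]

lemma cellAt_add_period {h ℓ : ℝ} (hh : 0 < h) (hM : (M : ℝ) * h = ℓ) (i : Fin d) (x : Space d) :
    (cellAt h (x + Pi.single i ℓ) : Cell d M) = cellAt h x := by
  funext k
  by_cases hk : k = i
  · subst hk
    have : (x k + ℓ) / h = x k / h + (M : ℤ) := by
      rw [← hM]
      push_cast
      field_simp
    simp only [cellAt, Pi.add_apply, Pi.single_eq_same]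
    rw [this, Int.floor_add_intCast]
    simp
  · simp [cellAt, hk]

end Geometry

section Periodic

variable {d : ℕ}

/-- The part of the cube where the `i`-th coordinate is taken from `[a, b)` instead. -/
def slab (ℓ : ℝ) (i : Fin d) (a b : ℝ) : Set (Space d) :=
  {x | (∀ k, k ≠ i → x k ∈ Ico 0 ℓ) ∧ x i ∈ Ico a b}

lemma slab_eq_pi (ℓ : ℝ) (i : Fin d) (a b : ℝ) :
    slab ℓ i a b = Set.univ.pi (Function.update (fun _ => Ico 0 ℓ) i (Ico a b)) := by
  ext x
  simp only [slab, mem_ofPred_eq, mem_univ_pi]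
  constructor
  · rintro ⟨h1, h2⟩ k
    by_cases hk : k = i
    · subst hk; simpa using h2
    · simpa [hk] using h1 k hk
  · intro h
    refine ⟨fun k hk => by simpa [hk] using h k, by simpa using h i⟩

lemma measurableSet_slab (ℓ : ℝ) (i : Fin d) (a b : ℝ) : MeasurableSet (slab ℓ i a b) := by
  rw [slab_eq_pi]
  refine MeasurableSet.univ_pi fun k => ?_
  by_cases hk : k = i
  · subst hk; simp
  · simp [hk]

lemma slab_cube (ℓ : ℝ) (i : Fin d) : slab ℓ i 0 ℓ = cube d ℓ := by
  rw [slab_eq_pi, cube]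
  congr 1
  simp

lemma isBounded_slab (ℓ : ℝ) (i : Fin d) (a b : ℝ) : Bornology.IsBounded (slab ℓ i a b) := by
  rw [slab_eq_pi]
  refine Bornology.IsBounded.pi fun k => ?_
  by_cases hk : k = i
  · subst hk; simpa using Metric.isBounded_Ico a b
  · simpa [hk] using Metric.isBounded_Ico 0 ℓ

lemma integral_slab_add {f : Space d → ℝ} {ℓ : ℝ} {i : Fin d} {a b c : ℝ}
    (hf : LocallyIntegrable f) (hab : a ≤ b) (hbc : b ≤ c) :
    ∫ x in slab ℓ i a c, f x = (∫ x in slab ℓ i a b, f x) + ∫ x in slab ℓ i b c, f x := by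
  have hint : ∀ a b, IntegrableOn f (slab ℓ i a b) := fun a b =>
    (hf.integrableOn_isCompact (isBounded_slab ℓ i a b).isCompact_closure).mono_set subset_closure
  rw [← setIntegral_union _ (measurableSet_slab ℓ i b c) (hint a b) (hint b c)]
  · congr 2
    ext x
    simp only [slab, mem_union, mem_ofPred_eq, ← and_or_left, mem_Ico]
    refine and_congr_right fun _ => ⟨fun h => ?_, fun h => ?_⟩
    · rcases lt_or_ge (x i) b with hb | hb
      · exact Or.inl ⟨h.1, hb⟩
      · exact Or.inr ⟨hb, h.2⟩
    · rcases h with h | h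
      · exact ⟨h.1, h.2.trans_le hbc⟩
      · exact ⟨hab.trans h.1, h.2⟩
  · exact Set.disjoint_left.mpr fun x hx hy => (hx.2.2.trans_le hy.2.1).false

lemma integral_slab_shift (f : Space d → ℝ) (ℓ : ℝ) (i : Fin d) (a b s : ℝ) :
    ∫ x in slab ℓ i a b, f (x + Pi.single i s) = ∫ x in slab ℓ i (a + s) (b + s), f x := by
  have hmp := measurePreserving_add_right (volume : Measure (Space d)) (Pi.single i s : Space d)
  have := hmp.setIntegral_preimage_emb (measurableEmbedding_addRight (Pi.single i s : Space d)) f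
    (slab ℓ i (a + s) (b + s))
  rw [← this]
  congr 2
  ext x
  simp only [slab, mem_preimage, mem_ofPred_eq, Pi.add_apply, Pi.single_eq_same, mem_Ico]
  refine and_congr (forall_congr' fun k => ?_) (by constructor <;> intro h <;> constructor <;>
    linarith [h.1, h.2])
  refine imp_congr_right fun hk => ?_
  simp [hk]

/-- Integrals of periodic functions over a period are translation invariant. -/
lemma integral_cube_shift {f : Space d → ℝ} {ℓ : ℝ} (hf : LocallyIntegrable f) (i : Fin d)
    (hp : ∀ᵐ x, f (x + Pi.single i ℓ) = f x) {s : ℝ} (h0 : 0 ≤ s) (h1 : s ≤ ℓ) :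
    ∫ x in cube d ℓ, f (x + Pi.single i s) = ∫ x in cube d ℓ, f x := by
  -- The shifted period `[s, ℓ+s)` is cut at `ℓ`, and its overhang `[ℓ, ℓ+s)` is moved back by one
  -- period to `[0, s)`.
  rw [← slab_cube ℓ i, integral_slab_shift, integral_slab_add hf (b := ℓ) (by linarith) (by linarith),
    integral_slab_add hf h0 h1, zero_add, add_comm]
  congr 1
  have := integral_slab_shift f ℓ i 0 s ℓ
  rw [zero_add] at this
  rw [add_comm ℓ s, ← this]
  exact integral_congr_ae (ae_restrict_of_ae hp)

lemma LocallyIntegrable.comp_add {f : Space d → ℝ} (hf : LocallyIntegrable f) (v : Space d) :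
    LocallyIntegrable fun x => f (x + v) := by
  rw [locallyIntegrable_iff] at hf ⊢
  intro k hk
  have hmp := measurePreserving_add_right (volume : Measure (Space d)) v
  have := (hmp.integrableOn_comp_preimage (measurableEmbedding_addRight v) (f := f)
    (s := (fun x => x + v) '' k)).mpr (hf _ (hk.image (continuous_add_const v)))
  rwa [preimage_image_eq _ (add_left_injective v)] at this

lemma integral_cube_shift_neg {f : Space d → ℝ} {ℓ : ℝ} (hf : LocallyIntegrable f) (i : Fin d)
    (hp : ∀ᵐ x, f (x + Pi.single i ℓ) = f x) {s : ℝ} (h0 : 0 ≤ s) (h1 : s ≤ ℓ) :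
    ∫ x in cube d ℓ, f (x - Pi.single i s) = ∫ x in cube d ℓ, f x := by
  have h2 : LocallyIntegrable fun x : Space d => f (x - Pi.single i s) := by
    simpa [sub_eq_add_neg] using LocallyIntegrable.comp_add hf (-Pi.single i s : Space d)
  have h3 : ∀ᵐ x : Space d, f (x + Pi.single i ℓ - Pi.single i s) = f (x - Pi.single i s) := by
    have := (measurePreserving_sub_right (volume : Measure (Space d))
      (Pi.single i s)).quasiMeasurePreserving.ae hp
    simpa only [add_sub_right_comm] using this
  have := integral_cube_shift h2 i h3 h0 h1
  simpa using this.symm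

end Periodic

end FV

namespace FV

/-! ### Convexity estimates -/

/-- Quadratic lower bound for the second order Taylor remainder. -/
lemma bregman_ge {b b' b'' : ℝ → ℝ} {m κ : ℝ} (hb : ∀ x, 0 < x → HasDerivAt b (b' x) x)
    (hb' : ∀ x, 0 < x → HasDerivAt b' (b'' x) x) (hκ : ∀ x, 0 < x → x ≤ m → κ ≤ b'' x)
    {x y : ℝ} (hx : 0 < x) (hxm : x ≤ m) (hy : 0 < y) (hym : y ≤ m) :
    κ / 2 * (x - y) ^ 2 ≤ b x - b y - b' y * (x - y) := by
  have hb1 : ∀ s t, 0 < s → s < t → t ≤ m → κ * (t - s) ≤ b' t - b' s := by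
    intro s t hs hst ht
    obtain ⟨c, hc, hc'⟩ := exists_hasDerivAt_eq_slope b' b'' hst
      (fun z hz => (hb' z (hs.trans_le hz.1)).continuousAt.continuousWithinAt)
      (fun z hz => hb' z (hs.trans hz.1))
    have := hκ c (hs.trans hc.1) (hc.2.le.trans ht)
    rw [hc', le_div_iff₀ (by linarith)] at this
    exact this
  -- After subtracting the tangent line and the parabola `κ/2 (t - y)²`, the derivative has the sign
  -- of `t - y`, so the remaining function is smallest at `y`. The curvature bound is only available
  -- up to `m`, which will be the larger of the two arguments.
  have hf : ∀ z, 0 < z → HasDerivAt (fun t => b t - b' y * t - κ / 2 * (t - y) ^ 2)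
      (b' z - b' y - κ * (z - y)) z := by
    intro z hz
    have h1 := ((hb z hz).sub ((hasDerivAt_id z).const_mul (b' y))).sub
      ((((hasDerivAt_id z).sub_const y).pow 2).const_mul (κ / 2))
    exact h1.congr_deriv (by simp only [id]; push_cast; ring)
  rcases lt_trichotomy x y with hxy | hxy | hxy
  · obtain ⟨c, hc, hc'⟩ := exists_hasDerivAt_eq_slope _ _ hxy
      (fun z hz => (hf z (hx.trans_le hz.1)).continuousAt.continuousWithinAt)
      (fun z hz => hf z (hx.trans hz.1))
    have h2 := hb1 c y (hx.trans hc.1) hc.2 hym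
    rw [eq_div_iff (by linarith)] at hc'
    nlinarith
  · subst hxy; simp
  · obtain ⟨c, hc, hc'⟩ := exists_hasDerivAt_eq_slope _ _ hxy
      (fun z hz => (hf z (hy.trans_le hz.1)).continuousAt.continuousWithinAt)
      (fun z hz => hf z (hy.trans hz.1))
    have h2 := hb1 y c hy hc.1 (hc.2.le.trans hxm)
    rw [eq_div_iff (by linarith)] at hc'
    nlinarith

/-- The pressure potential. -/
noncomputable def potential (a γ r : ℝ) : ℝ := a / (γ - 1) * r ^ γ

/-- The derivative of the pressure potential. -/
noncomputable def potentialDeriv (a γ r : ℝ) : ℝ := a / (γ - 1) * (γ * r ^ (γ - 1))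

lemma potential_nonneg {a γ r : ℝ} (ha : 0 < a) (hγ : 1 < γ) (hr : 0 ≤ r) :
    0 ≤ potential a γ r :=
  mul_nonneg (div_nonneg ha.le (by linarith)) (Real.rpow_nonneg hr γ)

lemma hasDerivAt_potential {a γ r : ℝ} (hr : 0 < r) :
    HasDerivAt (potential a γ) (potentialDeriv a γ r) r :=
  (Real.hasDerivAt_rpow_const (Or.inl hr.ne')).const_mul _

lemma hasDerivAt_potentialDeriv {a γ r : ℝ} (hγ : 1 < γ) (hr : 0 < r) :
    HasDerivAt (potentialDeriv a γ) (a * γ * r ^ (γ - 2)) r := by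
  have h1 := (((Real.hasDerivAt_rpow_const (p := γ - 1) (Or.inl hr.ne')).const_mul γ).const_mul
    (a / (γ - 1)))
  refine h1.congr_deriv ?_
  have : γ - 1 ≠ 0 := by linarith
  rw [show γ - 1 - 1 = γ - 2 by ring]
  field_simp

/-- This identity is why the pressure work in the momentum equation cancels against the renormalized
continuity equation. -/
lemma mul_potentialDeriv_sub {a γ r : ℝ} (hγ : 1 < γ) (hr : 0 < r) :
    r * potentialDeriv a γ r - potential a γ r = pressure a γ r := by
  have h1 : r * r ^ (γ - 1) = r ^ γ := by
    conv_lhs => rw [← Real.rpow_one_add' hr.le (by linarith)]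
    congr 1
    ring
  have : γ - 1 ≠ 0 := by linarith
  calc r * potentialDeriv a γ r - potential a γ r
      = a / (γ - 1) * (γ * (r * r ^ (γ - 1)) - r ^ γ) := by
        rw [potentialDeriv, potential]; ring
    _ = pressure a γ r := by
        rw [h1, pressure]
        field_simp

lemma potential_tangent {a γ x y : ℝ} (ha : 0 < a) (hγ : 1 < γ) (hx : 0 < x) (hy : 0 < y) :
    potential a γ y + potentialDeriv a γ y * (x - y) ≤ potential a γ x := by
  have := bregman_ge (m := max x y) (κ := 0) (fun x hx => hasDerivAt_potential (a := a) (γ := γ) hx)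
    (fun x hx => hasDerivAt_potentialDeriv hγ hx)
    (fun z hz _ => mul_nonneg (mul_nonneg ha.le (by linarith)) (Real.rpow_nonneg hz.le _))
    hx (le_max_left x y) hy (le_max_right x y)
  linarith

/-- Dissipation of the pressure potential (useful if `γ ≤ 2`). -/
noncomputable def potentialDiss (a γ x y : ℝ) : ℝ :=
  if γ ≤ 2 then a * γ / 2 * max x y ^ (γ - 2) * (x - y) ^ 2 else 0

lemma potentialDiss_nonneg {a γ x y : ℝ} (ha : 0 < a) (hγ : 1 < γ) (hx : 0 < x) :
    0 ≤ potentialDiss a γ x y := by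
  rw [potentialDiss]
  split_ifs
  · have : 0 < max x y := lt_max_of_lt_left hx
    positivity
  · exact le_rfl

lemma potentialDiss_comm (a γ x y : ℝ) : potentialDiss a γ x y = potentialDiss a γ y x := by
  rw [potentialDiss, potentialDiss, max_comm, ← neg_sub y x, neg_sq]

/-- For `γ ≤ 2` the second derivative `aγ r^(γ-2)` is decreasing, so on the segment between the two
densities it is smallest at the larger one. For `γ > 2` it degenerates at vacuum and only convexity
is kept. -/
lemma potentialDiss_le {a γ x y : ℝ} (ha : 0 < a) (hγ : 1 < γ) (hx : 0 < x) (hy : 0 < y) :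
    potentialDiss a γ x y ≤ potential a γ x - potential a γ y - potentialDeriv a γ y * (x - y) := by
  rw [potentialDiss]
  split_ifs with h2
  · have := bregman_ge (m := max x y) (κ := a * γ * max x y ^ (γ - 2))
      (fun x hx => hasDerivAt_potential (a := a) (γ := γ) hx)
      (fun x hx => hasDerivAt_potentialDeriv hγ hx)
      (fun z hz hzm => mul_le_mul_of_nonneg_left
        (Real.rpow_le_rpow_of_nonpos hz hzm (by linarith)) (mul_nonneg ha.le (by linarith)))
      hx (le_max_left x y) hy (le_max_right x y)
    linarith
  · linarith [potential_tangent ha hγ hx hy]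

lemma rpow_le_one_add {x s : ℝ} (hx : 0 ≤ x) (h0 : 0 ≤ s) (h1 : s ≤ 1) : x ^ s ≤ 1 + x := by
  rcases le_total x 1 with h | h
  · linarith [Real.rpow_le_one hx h h0]
  · have := Real.rpow_le_rpow_of_exponent_le h h1
    rw [Real.rpow_one] at this
    linarith

/-- The exponent `2 - γ` lies in `[0, 1]`, hence `max x y ^ (2 - γ) ≤ 1 + x + y`. The weight is the
one that the entropy `r log r - r` also provides, so that both ranges of `γ` share one jump
estimate. -/
lemma sq_sub_div_le_potentialDiss {a γ x y : ℝ} (ha : 0 < a) (hγ : 1 < γ) (h2 : γ ≤ 2)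
    (hx : 0 < x) (hy : 0 < y) :
    a * γ / 2 * ((x - y) ^ 2 / (1 + x + y)) ≤ potentialDiss a γ x y := by
  rw [potentialDiss, if_pos h2, mul_assoc]
  refine mul_le_mul_of_nonneg_left ?_ (by positivity)
  have hm : 0 < max x y := lt_max_of_lt_left hx
  rw [div_eq_mul_inv, mul_comm]
  refine mul_le_mul_of_nonneg_right ?_ (sq_nonneg _)
  rw [show γ - 2 = -(2 - γ) by ring, Real.rpow_neg hm.le]
  refine inv_anti₀ (Real.rpow_pos_of_pos hm _) ?_
  refine (rpow_le_one_add hm.le (by linarith) (by linarith)).trans ?_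
  rcases max_cases x y with h | h <;> linarith [h.1]

/-- Concavity of the power `γ/2 ≤ 1`. It puts `ϱ^(γ/2)` into a discrete `H¹` space with a weight in
`h`, to which the Sobolev inequalities apply. -/
lemma sq_sub_rpow_le_potentialDiss {a γ x y : ℝ} (ha : 0 < a) (hγ : 1 < γ) (h2 : γ ≤ 2)
    (hx : 0 < x) (hy : 0 < y) :
    a * γ / 2 * (x ^ (γ / 2) - y ^ (γ / 2)) ^ 2 ≤ potentialDiss a γ x y := by
  wlog hxy : y ≤ x generalizing x y
  · rw [potentialDiss_comm, ← neg_sub, neg_sq]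
    exact this hy hx (le_of_not_ge hxy)
  rw [potentialDiss, if_pos h2, mul_assoc, max_eq_left hxy]
  refine mul_le_mul_of_nonneg_left ?_ (by positivity)
  have h3 : x ^ (γ / 2) - y ^ (γ / 2) ≤ x ^ (γ / 2 - 1) * (x - y) := by
    have h4 : x ^ (γ / 2 - 1) * x = x ^ (γ / 2) := by
      rw [← Real.rpow_add_one hx.ne']; congr 1; ring
    have h5 : y ^ (γ / 2 - 1) * y = y ^ (γ / 2) := by
      rw [← Real.rpow_add_one hy.ne']; congr 1; ring
    have h6 : x ^ (γ / 2 - 1) ≤ y ^ (γ / 2 - 1) :=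
      Real.rpow_le_rpow_of_nonpos hy hxy (by linarith)
    rw [mul_sub, h4, ← h5]
    linarith [mul_le_mul_of_nonneg_right h6 hy.le]
  have h7 : 0 ≤ x ^ (γ / 2) - y ^ (γ / 2) :=
    sub_nonneg.mpr (Real.rpow_le_rpow hy.le hxy (by linarith))
  calc (x ^ (γ / 2) - y ^ (γ / 2)) ^ 2 ≤ (x ^ (γ / 2 - 1) * (x - y)) ^ 2 := by gcongr
    _ = x ^ (γ - 2) * (x - y) ^ 2 := by
        rw [mul_pow, ← Real.rpow_natCast (x ^ (γ / 2 - 1)), ← Real.rpow_mul hx.le]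
        congr 2
        push_cast
        ring

/-- Dissipation of the entropy `r log r - r`. -/
lemma entropy_diss {x y : ℝ} (hx : 0 < x) (hy : 0 < y) :
    1 / 2 * ((x - y) ^ 2 / (1 + x + y))
      ≤ (x * Real.log x - x) - (y * Real.log y - y) - Real.log y * (x - y) := by
  have := bregman_ge (b := fun t => t * Real.log t - t) (b' := Real.log) (b'' := fun t => t⁻¹)
    (m := max x y) (κ := (max x y)⁻¹)
    (fun t ht => by
      exact ((Real.hasDerivAt_mul_log ht.ne').sub (hasDerivAt_id t)).congr_deriv (by ring))
    (fun t ht => Real.hasDerivAt_log ht.ne')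
    (fun z hz hzm => inv_anti₀ hz hzm) hx (le_max_left x y) hy (le_max_right x y)
  refine le_trans ?_ this
  rw [div_eq_mul_inv ((x - y) ^ 2), mul_comm ((x - y) ^ 2), ← mul_assoc, div_mul_eq_mul_div, one_mul]
  refine mul_le_mul_of_nonneg_right (div_le_div_of_nonneg_right ?_ (by norm_num)) (sq_nonneg _)
  refine inv_anti₀ (lt_max_of_lt_left hx) ?_
  rcases max_cases x y with h | h <;> linarith [h.1]

lemma neg_one_le_entropy {x : ℝ} (hx : 0 < x) : -1 ≤ x * Real.log x - x := by
  have := Real.one_sub_inv_le_log_of_pos hx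
  have h2 := mul_le_mul_of_nonneg_left this hx.le
  rw [mul_sub, mul_inv_cancel₀ hx.ne'] at h2
  linarith

lemma entropy_le {x : ℝ} (hx : 0 < x) : x * Real.log x - x ≤ x ^ 2 := by
  have := mul_le_mul_of_nonneg_left (Real.log_le_sub_one_of_pos hx) hx.le
  nlinarith

lemma sq_le_one_add_rpow {γ x : ℝ} (hγ : 2 ≤ γ) (hx : 0 ≤ x) : x ^ 2 ≤ 1 + x ^ γ := by
  rcases le_total x 1 with h | h
  · have := Real.rpow_nonneg hx γ
    nlinarith
  · have := Real.rpow_le_rpow_of_exponent_le h hγ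
    rw [Real.rpow_two] at this
    linarith

lemma le_one_add_rpow {γ x : ℝ} (hγ : 1 ≤ γ) (hx : 0 ≤ x) : x ≤ 1 + x ^ γ := by
  rcases le_total x 1 with h | h
  · linarith [Real.rpow_nonneg hx γ]
  · have := Real.rpow_le_rpow_of_exponent_le h hγ
    rw [Real.rpow_one] at this
    linarith

/-! ### The energy estimate -/

section Energy

variable {d M : ℕ} [NeZero M]

/-- The discrete total energy. -/
noncomputable def discreteEnergy (a γ h : ℝ) (r : Cell d M → ℝ) (u : Cell d M → Fin d → ℝ) : ℝ :=
  ∑ K, h ^ d * (1 / 2 * r K * ∑ j, u K j ^ 2) + ∑ K, h ^ d * potential a γ (r K)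

lemma IsFVSolution.contStep {Ω : Set (Space d)} {a γ μ lam α : ℝ} {ρ₀ : Space d → ℝ}
    {m₀ : Space d → Fin d → ℝ} {N : ℕ} {Δt h ε : ℝ} {ρ : ℕ → Cell d M → ℝ}
    {u : ℕ → Cell d M → Fin d → ℝ} (S : IsFVSolution Ω a γ μ lam α ρ₀ m₀ N Δt h ε ρ u)
    {k : ℕ} (hk : k < N) : ContStep Δt h α (ρ k) (ρ (k + 1)) (u (k + 1)) :=
  S.continuity k hk

/-- The integral of `|u|²` over the penalized cells. -/
noncomputable def solidSum (Ω : Set (Space d)) (h : ℝ) (u : Cell d M → Fin d → ℝ) : ℝ :=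
  open Classical in ∑ K, (if cellSet h K ⊆ Ω then 0 else h ^ d * ∑ j, u K j ^ 2)

/-- The integral of `|∇_E u|²`. -/
noncomputable def gradSum (h : ℝ) (u : Cell d M → Fin d → ℝ) : ℝ :=
  ∑ i, ∑ K, h ^ d * ∑ j, (jump i (comp u j) K / h) ^ 2

lemma nu_nonneg {μ lam : ℝ} (hd : 2 ≤ d) (hμ : 0 < μ) (hlam : 0 ≤ lam) : 0 ≤ nu d μ lam := by
  have : (2 : ℝ) ≤ d := by exact_mod_cast hd
  have h2 : 0 ≤ ((d : ℝ) - 2) / d := div_nonneg (by linarith) (by linarith)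
  rw [nu]
  positivity

/-- The momentum equation is tested with the new velocity. `ContStep.kinetic` replaces time
difference and convection by kinetic energies, the renormalization with the pressure potential
absorbs the pressure work, and the divergence viscosity is dropped because `ν ≥ 0`. -/
lemma IsFVSolution.energy_step (hd : 2 ≤ d) {Ω : Set (Space d)} {a γ μ lam α : ℝ}
    (ha : 0 < a) (hγ : 1 < γ) (hμ : 0 < μ) (hlam : 0 ≤ lam) {ρ₀ : Space d → ℝ}
    {m₀ : Space d → Fin d → ℝ} {N : ℕ} {Δt h ε : ℝ} {ρ : ℕ → Cell d M → ℝ}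
    {u : ℕ → Cell d M → Fin d → ℝ} (S : IsFVSolution Ω a γ μ lam α ρ₀ m₀ N Δt h ε ρ u)
    (ht : 0 < Δt) (hh : 0 < h) {k : ℕ} (hk : k < N) (h0 : ∀ K, 0 < ρ k K)
    (h1 : ∀ K, 0 < ρ (k + 1) K) :
    discreteEnergy a γ h (ρ (k + 1)) (u (k + 1)) + Δt * (1 / ε * solidSum Ω h (u (k + 1))
        + μ * gradSum h (u (k + 1))
        + ∑ i, ∑ K, h ^ (d - 1) * ((h ^ α + |avg i (comp (u (k + 1)) i) K|)
            * potentialDiss a γ (ρ (k + 1) K) (ρ (k + 1) (nxt i K))))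
      ≤ discreteEnergy a γ h (ρ k) (u k) := by
  have hc := S.contStep hk
  have e1 := hc.kinetic (u₀ := u k) ht hh h0 h1
  have e2 := hc.renormalized (by omega) ht hh h0 h1 (potential a γ) (potentialDeriv a γ)
    (potentialDiss a γ) (fun x y hx _ => potentialDiss_nonneg ha hγ hx) (potentialDiss_comm a γ)
    (fun x y hx hy => potentialDiss_le ha hγ hx hy)
  have e3 := S.momentum k hk (u (k + 1))
  have e4 : ∑ K, h ^ d * ((ρ (k + 1) K * potentialDeriv a γ (ρ (k + 1) K)
        - potential a γ (ρ (k + 1) K)) * divh h (u (k + 1)) K)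
      = ∑ K, h ^ d * (pressure a γ (ρ (k + 1) K) * divh h (u (k + 1)) K) :=
    Finset.sum_congr rfl fun K _ => by rw [mul_potentialDeriv_sub hγ (h1 K)]
  have e5 : 0 ≤ nu d μ lam * ∑ K, h ^ d * (divh h (u (k + 1)) K * divh h (u (k + 1)) K) :=
    mul_nonneg (nu_nonneg hd hμ hlam) (Finset.sum_nonneg fun K _ =>
      mul_nonneg (by positivity) (mul_self_nonneg _))
  simp only [← sq] at e3
  rw [e4] at e2
  have e6 : ∑ K, h ^ d * (potential a γ (ρ (k + 1) K) - potential a γ (ρ k K))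
      = ∑ K, h ^ d * potential a γ (ρ (k + 1) K) - ∑ K, h ^ d * potential a γ (ρ k K) := by
    rw [← Finset.sum_sub_distrib]
    exact Finset.sum_congr rfl fun K _ => mul_sub _ _ _
  rw [e6] at e2
  simp only [← sq] at e5
  simp only [discreteEnergy, solidSum, gradSum]
  set A := ∑ K, h ^ d * ∑ j, (ρ (k + 1) K * u (k + 1) K j - ρ k K * u k K j) / Δt * u (k + 1) K j
  set F := ∑ i, ∑ K, h ^ (d - 1) * ∑ j, flux h α (fun L => ρ (k + 1) L * u (k + 1) L j)
    (u (k + 1)) i K * jump i (comp (u (k + 1)) j) K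
  set P := ∑ K, h ^ d * (pressure a γ (ρ (k + 1) K) * divh h (u (k + 1)) K)
  have e7 := mul_nonneg ht.le e5
  have e8 := congrArg (fun z => Δt * z) e3
  simp only [mul_zero] at e8
  nlinarith

lemma IsFVSolution.pos {Ω : Set (Space d)} {a γ μ lam α : ℝ} {ρ₀ : Space d → ℝ}
    {m₀ : Space d → Fin d → ℝ} {N : ℕ} {Δt h ε : ℝ} {ρ : ℕ → Cell d M → ℝ}
    {u : ℕ → Cell d M → Fin d → ℝ} (S : IsFVSolution Ω a γ μ lam α ρ₀ m₀ N Δt h ε ρ u)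
    (ht : 0 < Δt) (hh : 0 < h) (h0 : ∀ K, 0 < ρ 0 K) {k : ℕ} (hk : k ≤ N) : ∀ K, 0 < ρ k K := by
  induction k with
  | zero => exact h0
  | succ k ih => exact (S.contStep (by omega)).pos ht hh (ih (by omega))

/-! ### The initial energy -/

/-- Only where the momentum may be nonzero is a positive lower bound of the density needed; on the
solid part the momentum vanishes, so `m₀/ϱ₀` is harmless there even if `ϱ₀` is small. -/
lemma IsInitialData.ae_cube {ℓ γ : ℝ} {Ω : Set (Space d)} {ρ₀ : Space d → ℝ}
    {m₀ : Space d → Fin d → ℝ} (hΩ : IsFluidDomain ℓ Ω) (D : IsInitialData ℓ γ Ω ρ₀ m₀) :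
    ∃ c C : ℝ, 0 < c ∧ ∀ᵐ x ∂volume.restrict (cube d ℓ), 0 < ρ₀ x ∧
      ((c ≤ ρ₀ x ∧ ∀ i, |m₀ x i| ≤ C) ∨ m₀ x = 0) := by
  obtain ⟨c, C, hc, h1⟩ := D.density_bounds
  obtain ⟨C', h2⟩ := D.momentum_bound
  refine ⟨c, C', hc, ?_⟩
  have hΩm := hΩ.isOpen.measurableSet
  have h3 := D.momentum_solid
  rw [ae_restrict_iff' ((measurableSet_cube ℓ).diff hΩm)] at h3
  rw [ae_restrict_iff' hΩm] at h1 h2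
  filter_upwards [D.pos, ae_restrict_of_ae h1, ae_restrict_of_ae h2, ae_restrict_of_ae h3,
    ae_restrict_mem (measurableSet_cube ℓ)] with x hp h1 h2 h3 hx
  refine ⟨hp, ?_⟩
  by_cases hxΩ : x ∈ Ω
  · exact Or.inl ⟨(h1 hxΩ).1, h2 hxΩ⟩
  · exact Or.inr (h3 ⟨hx, hxΩ⟩)

lemma IsInitialData.integrable_density {ℓ γ : ℝ} {Ω : Set (Space d)} {ρ₀ : Space d → ℝ}
    {m₀ : Space d → Fin d → ℝ} (hγ : 1 < γ) (D : IsInitialData ℓ γ Ω ρ₀ m₀) :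
    IntegrableOn ρ₀ (cube d ℓ) := by
  refine Integrable.mono' ((integrable_const (1 : ℝ)).add D.integrable) D.meas_density ?_
  filter_upwards [D.pos] with x hx
  rw [Real.norm_of_nonneg hx.le]
  exact le_one_add_rpow hγ.le hx.le

lemma IsInitialData.aestronglyMeasurable_momentum {ℓ γ : ℝ} {Ω : Set (Space d)}
    {ρ₀ : Space d → ℝ} {m₀ : Space d → Fin d → ℝ} (D : IsInitialData ℓ γ Ω ρ₀ m₀) (i : Fin d) :
    AEStronglyMeasurable (fun x => m₀ x i) (volume.restrict (cube d ℓ)) :=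
  (continuous_apply i).comp_aestronglyMeasurable D.meas_momentum

lemma IsInitialData.integrable_momentum {ℓ γ : ℝ} {Ω : Set (Space d)} {ρ₀ : Space d → ℝ}
    {m₀ : Space d → Fin d → ℝ} (hΩ : IsFluidDomain ℓ Ω) (D : IsInitialData ℓ γ Ω ρ₀ m₀)
    (i : Fin d) : IntegrableOn (fun x => m₀ x i) (cube d ℓ) := by
  obtain ⟨c, C, _, h⟩ := D.ae_cube hΩ
  refine Integrable.mono' (integrable_const |C|) (D.aestronglyMeasurable_momentum i) ?_
  filter_upwards [h] with x hx
  rcases hx.2 with hx | hx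
  · exact (hx.2 i).trans (le_abs_self C)
  · simp [hx]

lemma IsInitialData.integrable_kinetic {ℓ γ : ℝ} {Ω : Set (Space d)} {ρ₀ : Space d → ℝ}
    {m₀ : Space d → Fin d → ℝ} (hΩ : IsFluidDomain ℓ Ω) (D : IsInitialData ℓ γ Ω ρ₀ m₀) :
    IntegrableOn (fun x => 1 / 2 * ρ₀ x * ∑ i, (m₀ x i / ρ₀ x) ^ 2) (cube d ℓ) := by
  obtain ⟨c, C, hc, h⟩ := D.ae_cube hΩ
  refine Integrable.mono' (integrable_const (∑ _i : Fin d, C ^ 2 / (2 * c))) ?_ ?_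
  · exact (D.meas_density.const_mul (1 / 2)).mul
      (Finset.aestronglyMeasurable_fun_sum _ fun i _ =>
        ((D.aestronglyMeasurable_momentum i).aemeasurable.div
          D.meas_density.aemeasurable).aestronglyMeasurable.pow 2)
  · filter_upwards [h] with x hx
    have hp := hx.1
    rw [Real.norm_of_nonneg (mul_nonneg (by positivity) (Finset.sum_nonneg fun i _ => sq_nonneg _)),
      Finset.mul_sum]
    refine Finset.sum_le_sum fun i _ => ?_
    rcases hx.2 with hx | hx
    · have h1 : (m₀ x i) ^ 2 ≤ C ^ 2 := sq_le_sq' (by linarith [neg_abs_le (m₀ x i), hx.2 i])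
        ((le_abs_self _).trans (hx.2 i))
      calc 1 / 2 * ρ₀ x * (m₀ x i / ρ₀ x) ^ 2 = m₀ x i ^ 2 / (2 * ρ₀ x) := by field_simp
        _ ≤ C ^ 2 / (2 * c) := by gcongr; exact hx.1
    · have : 0 ≤ C ^ 2 / (2 * c) := by positivity
      simpa [hx] using this

lemma IsInitialData.proj_pos {ℓ γ h : ℝ} {Ω : Set (Space d)} {ρ₀ : Space d → ℝ}
    {m₀ : Space d → Fin d → ℝ} (hγ : 1 < γ) (D : IsInitialData ℓ γ Ω ρ₀ m₀) (hh : 0 < h)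
    (hM : (M : ℝ) * h = ℓ) (K : Cell d M) : 0 < proj h ρ₀ K := by
  refine div_pos ?_ (by positivity)
  have hint := integrableOn_cellSet hh hM (D.integrable_density hγ) K
  have hpos : ∀ᵐ x ∂volume.restrict (cellSet h K), 0 < ρ₀ x := by
    rw [← Measure.restrict_congr_set (cellBox_ae_eq h K)]
    exact ae_restrict_of_ae_restrict_of_subset (cellBox_subset_cube hh hM K) D.pos
  rw [integral_pos_iff_support_of_nonneg_ae (hpos.mono fun x hx => hx.le) hint]
  have h1 : (volume.restrict (cellSet h K)) (Function.support ρ₀) = volume (cellSet h K) := by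
    rw [← Measure.restrict_apply_univ (cellSet h K)]
    refine measure_congr ?_
    filter_upwards [hpos] with x hx
    exact eq_true (show x ∈ Function.support ρ₀ from hx.ne') |>.trans (eq_true (mem_univ x)).symm
  rw [h1, volume_cellSet hh]
  simpa using pow_pos hh d

/-- Jensen's inequality: the energy of the projected data is bounded by the initial energy. -/
lemma IsFVSolution.energy_zero_le {Ω : Set (Space d)} {ℓ a γ μ lam α : ℝ}
    (hΩ : IsFluidDomain ℓ Ω) (ha : 0 < a) (hγ : 1 < γ) {ρ₀ : Space d → ℝ}
    {m₀ : Space d → Fin d → ℝ} (D : IsInitialData ℓ γ Ω ρ₀ m₀)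
    {N : ℕ} {Δt h ε : ℝ} {ρ : ℕ → Cell d M → ℝ}
    {u : ℕ → Cell d M → Fin d → ℝ} (S : IsFVSolution Ω a γ μ lam α ρ₀ m₀ N Δt h ε ρ u)
    (hh : 0 < h) (hM : (M : ℝ) * h = ℓ) :
    discreteEnergy a γ h (ρ 0) (u 0) ≤ initialEnergy ℓ a γ ρ₀ m₀ := by
  have hint := (D.integrable_kinetic hΩ).add (D.integrable.const_mul (a / (γ - 1)))
  rw [initialEnergy, discreteEnergy, ← Finset.sum_add_distrib]
  have hI : ∫ x in cube d ℓ, (1 / 2 * ρ₀ x * ∑ i, (m₀ x i / ρ₀ x) ^ 2 + a / (γ - 1) * ρ₀ x ^ γ)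
      = _ := integral_cube_eq_sum (M := M) hh hM hint
  rw [hI]
  refine Finset.sum_le_sum fun K _ => ?_
  have hhd : (0 : ℝ) < h ^ d := by positivity
  have hρ0 : 0 < ρ 0 K := by rw [S.init_density]; exact D.proj_pos hγ hh hM K
  set r := ρ 0 K with hr
  set v := u 0 K with hv
  have hρi := integrableOn_cellSet hh hM (D.integrable_density hγ) K
  have hmi := fun i => integrableOn_cellSet hh hM (D.integrable_momentum hΩ i) K
  have hρI : ∫ x in cellSet h K, ρ₀ x = h ^ d * r := by
    rw [hr, S.init_density, proj]; field_simp
  have hmI : ∀ i, ∫ x in cellSet h K, m₀ x i = h ^ d * (r * v i) := by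
    intro i
    rw [hr, hv, S.init_momentum, proj]; field_simp
  have hpos : ∀ᵐ x ∂volume.restrict (cellSet h K), 0 < ρ₀ x := by
    rw [← Measure.restrict_congr_set (cellBox_ae_eq h K)]
    exact ae_restrict_of_ae_restrict_of_subset (cellBox_subset_cube hh hM K) D.pos
  have hfin : IsFiniteMeasure (volume.restrict (cellSet h K)) :=
    isFiniteMeasure_restrict.mpr (by rw [volume_cellSet hh]; simp)
  have hlin1 : Integrable (fun x => ∑ i, (v i * m₀ x i - 1 / 2 * v i ^ 2 * ρ₀ x))
      (volume.restrict (cellSet h K)) :=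
    integrable_finsetSum _ fun i _ => ((hmi i).const_mul _).sub (hρi.const_mul _)
  have hlin2 : Integrable (fun x => potential a γ r + potentialDeriv a γ r * (ρ₀ x - r))
      (volume.restrict (cellSet h K)) :=
    (integrable_const _).add ((hρi.sub (integrable_const _)).const_mul _)
  -- Jensen by supporting planes: `|m|²/(2ϱ)` lies above the function `v·m - ½|v|²ϱ`, linear in `(ϱ,
  -- m)`, and the potential above its tangent at `r`. Since `r` and `r v` are the cell averages,
  -- integrating these affine functions returns the discrete energy exactly.
  have hle : ∫ x in cellSet h K, (∑ i, (v i * m₀ x i - 1 / 2 * v i ^ 2 * ρ₀ x)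
        + (potential a γ r + potentialDeriv a γ r * (ρ₀ x - r)))
      ≤ ∫ x in cellSet h K, (1 / 2 * ρ₀ x * ∑ i, (m₀ x i / ρ₀ x) ^ 2
        + a / (γ - 1) * ρ₀ x ^ γ) := by
    refine integral_mono_ae (hlin1.add hlin2) (integrableOn_cellSet hh hM hint K) ?_
    filter_upwards [hpos] with x hx
    refine add_le_add ?_ (potential_tangent ha hγ hx hρ0)
    rw [Finset.mul_sum]
    refine Finset.sum_le_sum fun i _ => ?_
    have : 1 / 2 * ρ₀ x * (m₀ x i / ρ₀ x) ^ 2 - (v i * m₀ x i - 1 / 2 * v i ^ 2 * ρ₀ x)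
        = 1 / 2 * ρ₀ x * (m₀ x i / ρ₀ x - v i) ^ 2 := by
      field_simp
      ring
    nlinarith [mul_nonneg hx.le (sq_nonneg (m₀ x i / ρ₀ x - v i))]
  refine le_trans (le_of_eq ?_) hle
  have hlin3 : ∫ x in cellSet h K, ∑ i, (v i * m₀ x i - 1 / 2 * v i ^ 2 * ρ₀ x)
      = ∑ i, ∫ x in cellSet h K, (v i * m₀ x i - 1 / 2 * v i ^ 2 * ρ₀ x) :=
    integral_finsetSum _ fun i _ => ((hmi i).const_mul _).sub (hρi.const_mul _)
  have hlin4 : ∫ x in cellSet h K, (potential a γ r + potentialDeriv a γ r * (ρ₀ x - r))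
      = h ^ d * potential a γ r := by
    have h1 : ∫ x in cellSet h K, potentialDeriv a γ r * (ρ₀ x - r) = 0 := by
      rw [integral_const_mul, integral_sub hρi (integrable_const _), hρI, setIntegral_const,
        measureReal_cellSet hh, smul_eq_mul, sub_self, mul_zero]
    have h2 : IntegrableOn (fun x => potentialDeriv a γ r * (ρ₀ x - r)) (cellSet h K) :=
      (hρi.sub (integrable_const _)).const_mul _
    rw [integral_add (integrable_const _) h2, h1,
      setIntegral_const, measureReal_cellSet hh, smul_eq_mul, add_zero]
  rw [integral_add hlin1 hlin2, hlin3, hlin4]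
  congr 1
  rw [Finset.mul_sum, Finset.mul_sum]
  refine Finset.sum_congr rfl fun i _ => ?_
  rw [integral_sub ((hmi i).const_mul _) (hρi.const_mul _), integral_const_mul, integral_const_mul,
    hρI, hmI]
  ring

end Energy

end FV

namespace FV

/-! ### A priori bounds from the energy balance. -/

section Bounds

variable {d M : ℕ} [NeZero M]

lemma telescope_le {N : ℕ} {f g c : ℕ → ℝ} (hstep : ∀ k < N, f (k + 1) + g k ≤ f k + c k) :
    ∀ n ≤ N, f n + ∑ k ∈ Finset.range n, g k ≤ f 0 + ∑ k ∈ Finset.range n, c k := by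
  intro n hn
  induction n with
  | zero => simp
  | succ n ih =>
    have := ih (by omega)
    have := hstep n (by omega)
    rw [Finset.sum_range_succ, Finset.sum_range_succ]
    linarith

/-- The a priori bounds that follow from the energy balance. -/
structure EnergyBounds (Ω : Set (Space d)) (γ α : ℝ) (N : ℕ) (Δt h ε : ℝ)
    (ρ : ℕ → Cell d M → ℝ) (u : ℕ → Cell d M → Fin d → ℝ) (E : ℝ) : Prop where
  pos : ∀ k ≤ N, ∀ K, 0 < ρ k K
  kinetic : ∀ k ≤ N, ∑ K, h ^ d * (ρ k K * ∑ j, u k K j ^ 2) ≤ E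
  internal : ∀ k ≤ N, ∑ K, h ^ d * ρ k K ^ γ ≤ E
  grad : ∑ k ∈ Finset.range N, Δt * gradSum h (u (k + 1)) ≤ E
  solid : ∑ k ∈ Finset.range N, Δt * solidSum Ω h (u (k + 1)) ≤ E * ε
  density_jump : ∑ k ∈ Finset.range N, Δt * ∑ i, ∑ K, h ^ (d - 1) *
    ((h ^ α + |avg i (comp (u (k + 1)) i) K|) *
      ((ρ (k + 1) K - ρ (k + 1) (nxt i K)) ^ 2 / (1 + ρ (k + 1) K + ρ (k + 1) (nxt i K)))) ≤ E
  root_jump : γ ≤ 2 → ∑ k ∈ Finset.range N, Δt * ∑ i, ∑ K, h ^ (d - 1) *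
    (h ^ α * (ρ (k + 1) K ^ (γ / 2) - ρ (k + 1) (nxt i K) ^ (γ / 2)) ^ 2) ≤ E

lemma gradSum_nonneg {h : ℝ} (hh : 0 ≤ h) (u : Cell d M → Fin d → ℝ) : 0 ≤ gradSum h u :=
  Finset.sum_nonneg fun _ _ => Finset.sum_nonneg fun _ _ =>
    mul_nonneg (by positivity) (Finset.sum_nonneg fun _ _ => sq_nonneg _)

lemma solidSum_nonneg {h : ℝ} (hh : 0 ≤ h) (Ω : Set (Space d)) (u : Cell d M → Fin d → ℝ) :
    0 ≤ solidSum Ω h u := by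
  refine Finset.sum_nonneg fun K _ => ?_
  split_ifs
  · exact le_rfl
  · exact mul_nonneg (by positivity) (Finset.sum_nonneg fun _ _ => sq_nonneg _)

/-- The difference of the two face averages in direction `i` is the mean of the jumps across both
faces of the cell, so the divergence is controlled by diagonal entries of the discrete gradient. -/
lemma sum_divh_sq_le {h : ℝ} (hh : 0 < h) (u : Cell d M → Fin d → ℝ) :
    ∑ K, h ^ d * divh h u K ^ 2 ≤ d * gradSum h u := by
  have h1 : ∀ K, divh h u K ^ 2 ≤ d * ∑ i, (1 / 2 * (jump i (comp u i) K / h) ^ 2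
      + 1 / 2 * (jump i (comp u i) (prv i K) / h) ^ 2) := by
    intro K
    have e1 : divh h u K = ∑ i, (1 / 2 * (jump i (comp u i) K / h)
        + 1 / 2 * (jump i (comp u i) (prv i K) / h)) := by
      rw [divh, Finset.sum_div]
      refine Finset.sum_congr rfl fun i _ => ?_
      simp only [avg, jump, nxt_prv]
      ring
    have h2 := sq_sum_le_card_mul_sum_sq (s := Finset.univ) (f := fun i : Fin d =>
      1 / 2 * (jump i (comp u i) K / h) + 1 / 2 * (jump i (comp u i) (prv i K) / h))
    rw [Finset.card_univ, Fintype.card_fin] at h2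
    rw [e1]
    refine h2.trans (mul_le_mul_of_nonneg_left (Finset.sum_le_sum fun i _ => ?_) (by positivity))
    nlinarith [sq_nonneg (jump i (comp u i) K / h - jump i (comp u i) (prv i K) / h)]
  calc ∑ K, h ^ d * divh h u K ^ 2
      ≤ ∑ K, h ^ d * (d * ∑ i, (1 / 2 * (jump i (comp u i) K / h) ^ 2
      + 1 / 2 * (jump i (comp u i) (prv i K) / h) ^ 2)) :=
        Finset.sum_le_sum fun K _ => mul_le_mul_of_nonneg_left (h1 K) (by positivity)
    _ = d * ∑ i, ∑ K, h ^ d * (jump i (comp u i) K / h) ^ 2 := by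
        simp only [Finset.mul_sum]
        rw [Finset.sum_comm]
        refine Finset.sum_congr rfl fun i _ => ?_
        have h3 := sum_prv i (fun K => h ^ d * (d * (1 / 2 * (jump i (comp u i) K / h) ^ 2)))
        simp only [mul_add, Finset.sum_add_distrib]
        rw [h3, ← Finset.sum_add_distrib]
        refine Finset.sum_congr rfl fun K _ => by ring
    _ ≤ d * gradSum h u := by
        refine mul_le_mul_of_nonneg_left (Finset.sum_le_sum fun i _ => Finset.sum_le_sum
          fun K _ => mul_le_mul_of_nonneg_left ?_ (by positivity)) (by positivity)
        exact Finset.single_le_sum (f := fun j => (jump i (comp u j) K / h) ^ 2)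
          (fun _ _ => sq_nonneg _) (Finset.mem_univ i)

/-- The total dissipation is controlled by the initial energy. -/
lemma IsFVSolution.energy_bound (hd : 2 ≤ d) {Ω : Set (Space d)} {ℓ a γ μ lam α E₀ : ℝ}
    (hΩ : IsFluidDomain ℓ Ω) (ha : 0 < a) (hγ : 1 < γ) (hμ : 0 < μ) (hlam : 0 ≤ lam)
    {ρ₀ : Space d → ℝ} {m₀ : Space d → Fin d → ℝ} (D : IsInitialData ℓ γ Ω ρ₀ m₀)
    (hE : initialEnergy ℓ a γ ρ₀ m₀ ≤ E₀)
    {N : ℕ} {Δt h ε : ℝ} {ρ : ℕ → Cell d M → ℝ}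
    {u : ℕ → Cell d M → Fin d → ℝ} (S : IsFVSolution Ω a γ μ lam α ρ₀ m₀ N Δt h ε ρ u)
    (ht : 0 < Δt) (hh : 0 < h) (hM : (M : ℝ) * h = ℓ) {n : ℕ} (hn : n ≤ N) :
    discreteEnergy a γ h (ρ n) (u n) + ∑ k ∈ Finset.range n, Δt *
      (1 / ε * solidSum Ω h (u (k + 1)) + μ * gradSum h (u (k + 1))
        + ∑ i, ∑ K, h ^ (d - 1) * ((h ^ α + |avg i (comp (u (k + 1)) i) K|)
            * potentialDiss a γ (ρ (k + 1) K) (ρ (k + 1) (nxt i K)))) ≤ E₀ := by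
  have hpos := fun k (hk : k ≤ N) =>
    S.pos ht hh (fun K => by rw [S.init_density]; exact D.proj_pos hγ hh hM K) hk
  have := telescope_le (N := N) (f := fun n => discreteEnergy a γ h (ρ n) (u n)) (c := fun _ => 0)
    (fun k hk => by
      simpa only [add_zero] using S.energy_step hd ha hγ hμ hlam ht hh hk (hpos k hk.le) (hpos (k + 1) hk)) n hn
  have h0 := S.energy_zero_le hΩ ha hγ D hh hM
  simp only [Finset.sum_const_zero, add_zero] at this
  linarith

-- One constant, depending on the energy bound, `T` and the fixed parameters only, serves all the
-- bounds. The energy inequality gives them directly, except for the density jumps when `γ > 2`: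
-- these come from a second renormalization, with the entropy `r log r - r`, whose source `-∫ ϱ div
-- u` is bounded because `ϱ` and `div_h u` are then both square integrable.
set_option maxHeartbeats 1000000 in
lemma IsFVSolution.energyBounds (hd : 2 ≤ d) {Ω : Set (Space d)} {ℓ a γ μ lam α E₀ T : ℝ}
    (hΩ : IsFluidDomain ℓ Ω) (ha : 0 < a) (hγ : 1 < γ) (hμ : 0 < μ) (hlam : 0 ≤ lam)
    (hT : 0 < T) {ρ₀ : Space d → ℝ} {m₀ : Space d → Fin d → ℝ} (D : IsInitialData ℓ γ Ω ρ₀ m₀)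
    (hE : initialEnergy ℓ a γ ρ₀ m₀ ≤ E₀)
    {N : ℕ} {Δt h ε : ℝ} {ρ : ℕ → Cell d M → ℝ}
    {u : ℕ → Cell d M → Fin d → ℝ} (S : IsFVSolution Ω a γ μ lam α ρ₀ m₀ N Δt h ε ρ u)
    (ht : 0 < Δt) (hh : 0 < h) (hε : 0 < ε) (hN : (N : ℝ) * Δt = T) (hM : (M : ℝ) * h = ℓ) :
    EnergyBounds Ω γ α N Δt h ε ρ u (|E₀| * (3 + (γ - 1) / a + 1 / μ + 2 / (a * γ))
      + (4 + T) * (ℓ ^ d + |E₀| * (γ - 1) / a) + d * (|E₀| / μ)) := by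
  have hℓ : 0 < ℓ := by
    rw [← hM]
    exact mul_pos (by exact_mod_cast Nat.pos_of_ne_zero (NeZero.ne M)) hh
  have hpos := fun k (hk : k ≤ N) =>
    S.pos ht hh (fun K => by rw [S.init_density]; exact D.proj_pos hγ hh hM K) hk
  have hα : 0 < h ^ α := Real.rpow_pos_of_pos hh α
  have hγ1 : 0 < γ - 1 := by linarith
  have hkin0 : ∀ k ≤ N, 0 ≤ ∑ K, h ^ d * (1 / 2 * ρ k K * ∑ j, u k K j ^ 2) := fun k hk =>
    Finset.sum_nonneg fun K _ => mul_nonneg (by positivity)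
      (mul_nonneg (mul_nonneg (by norm_num) (hpos k hk K).le)
        (Finset.sum_nonneg fun _ _ => sq_nonneg _))
  have hint0 : ∀ k ≤ N, 0 ≤ ∑ K, h ^ d * potential a γ (ρ k K) := fun k hk =>
    Finset.sum_nonneg fun K _ => mul_nonneg (by positivity) (potential_nonneg ha hγ (hpos k hk K).le)
  have hs0 := fun k => solidSum_nonneg hh.le Ω (u k)
  have hg0 := fun k => gradSum_nonneg hh.le (u k)
  have hdis0 : ∀ k < N, ∀ i K, 0 ≤ h ^ (d - 1) * ((h ^ α + |avg i (comp (u (k + 1)) i) K|)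
            * potentialDiss a γ (ρ (k + 1) K) (ρ (k + 1) (nxt i K))) := fun k hk i K =>
    mul_nonneg (by positivity) (mul_nonneg (by positivity)
      (potentialDiss_nonneg ha hγ (hpos (k + 1) hk K)))
  have hdis0' : ∀ k < N, 0 ≤ ∑ i, ∑ K, h ^ (d - 1) * ((h ^ α + |avg i (comp (u (k + 1)) i) K|)
            * potentialDiss a γ (ρ (k + 1) K) (ρ (k + 1) (nxt i K))) := fun k hk =>
    Finset.sum_nonneg fun i _ => Finset.sum_nonneg fun K _ => hdis0 k hk i K
  have hE' : ∀ n ≤ N, _ := fun n hn => S.energy_bound hd hΩ ha hγ hμ hlam D hE ht hh hM hn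
  have hterm : ∀ k < N, 0 ≤ Δt *
      (1 / ε * solidSum Ω h (u (k + 1)) + μ * gradSum h (u (k + 1))
        + ∑ i, ∑ K, h ^ (d - 1) * ((h ^ α + |avg i (comp (u (k + 1)) i) K|)
            * potentialDiss a γ (ρ (k + 1) K) (ρ (k + 1) (nxt i K)))) := fun k hk =>
    mul_nonneg ht.le (add_nonneg (add_nonneg (mul_nonneg (by positivity) (hs0 _))
      (mul_nonneg hμ.le (hg0 _))) (hdis0' k hk))
  have hEn : ∀ n ≤ N, discreteEnergy a γ h (ρ n) (u n) ≤ E₀ := fun n hn => by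
    have h1 := hE' n hn
    have h2 := Finset.sum_nonneg fun k (hk : k ∈ Finset.range n) =>
      hterm k (lt_of_lt_of_le (Finset.mem_range.mp hk) hn)
    linarith
  have hE0 : 0 ≤ E₀ := (add_nonneg (hkin0 0 (by omega)) (hint0 0 (by omega))).trans (hEn 0 (by omega))
  rw [abs_of_nonneg hE0]
  have hsum : ∑ k ∈ Finset.range N, Δt *
      (1 / ε * solidSum Ω h (u (k + 1)) + μ * gradSum h (u (k + 1))
        + ∑ i, ∑ K, h ^ (d - 1) * ((h ^ α + |avg i (comp (u (k + 1)) i) K|)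
            * potentialDiss a γ (ρ (k + 1) K) (ρ (k + 1) (nxt i K)))) ≤ E₀ := by
    have := hE' N le_rfl
    have := add_nonneg (hkin0 N le_rfl) (hint0 N le_rfl)
    rw [discreteEnergy] at *
    linarith
  have hle : ∀ {f : ℕ → ℝ}, (∀ k < N, f k ≤ (1 / ε * solidSum Ω h (u (k + 1))
      + μ * gradSum h (u (k + 1))
        + ∑ i, ∑ K, h ^ (d - 1) * ((h ^ α + |avg i (comp (u (k + 1)) i) K|)
            * potentialDiss a γ (ρ (k + 1) K) (ρ (k + 1) (nxt i K))))) →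
      ∑ k ∈ Finset.range N, Δt * f k ≤ E₀ := fun {f} hf =>
    (Finset.sum_le_sum fun k hk => mul_le_mul_of_nonneg_left (hf k (Finset.mem_range.mp hk))
      ht.le).trans hsum
  set E := E₀ * (3 + (γ - 1) / a + 1 / μ + 2 / (a * γ))
      + (4 + T) * (ℓ ^ d + E₀ * (γ - 1) / a) + d * (E₀ / μ) with hEdef
  have hrest : 0 ≤ (4 + T) * (ℓ ^ d + E₀ * (γ - 1) / a) + d * (E₀ / μ) := by positivity
  have t1 : 0 ≤ E₀ * ((γ - 1) / a) := by positivity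
  have t2 : 0 ≤ E₀ * (1 / μ) := by positivity
  have t3 : 0 ≤ E₀ * (2 / (a * γ)) := by positivity
  have hintern : ∀ k ≤ N, ∑ K, h ^ d * ρ k K ^ γ ≤ E₀ * (γ - 1) / a := by
    intro k hk
    have h1 : ∑ K, h ^ d * potential a γ (ρ k K) ≤ E₀ := by
      have h1 := hEn k hk
      have h2 := hkin0 k hk
      rw [discreteEnergy] at h1
      linarith
    have h2 : ∑ K, h ^ d * potential a γ (ρ k K) = a / (γ - 1) * ∑ K, h ^ d * ρ k K ^ γ := by
      rw [Finset.mul_sum]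
      exact Finset.sum_congr rfl fun K _ => by rw [potential]; ring
    rw [h2, div_mul_eq_mul_div, div_le_iff₀ hγ1] at h1
    rw [le_div_iff₀ ha]
    linarith
  have hgrad : ∑ k ∈ Finset.range N, Δt * gradSum h (u (k + 1)) ≤ E₀ / μ := by
    have := hle (f := fun k => μ * gradSum h (u (k + 1))) fun k hk => by
      have := mul_nonneg (one_div_nonneg.mpr hε.le) (hs0 (k + 1))
      linarith [hdis0' k hk]
    rw [le_div_iff₀ hμ, Finset.sum_mul]
    refine le_trans (le_of_eq (Finset.sum_congr rfl fun k _ => by ring)) this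
  refine ⟨hpos, fun k hk => ?_, fun k hk => ?_, ?_, ?_, ?_, fun h2 => ?_⟩
  · have h1 := hEn k hk
    have h2 := hint0 k hk
    rw [discreteEnergy] at h1
    have h3 : ∑ K, h ^ d * (ρ k K * ∑ j, u k K j ^ 2)
        = 2 * ∑ K, h ^ d * (1 / 2 * ρ k K * ∑ j, u k K j ^ 2) := by
      rw [Finset.mul_sum]
      exact Finset.sum_congr rfl fun K _ => by ring
    rw [h3, hEdef]
    nlinarith
  · refine (hintern k hk).trans ?_
    rw [hEdef]
    have : E₀ * (γ - 1) / a = E₀ * ((γ - 1) / a) := by ring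
    nlinarith
  · refine hgrad.trans ?_
    have : E₀ / μ = E₀ * (1 / μ) := by ring
    rw [hEdef]
    nlinarith
  · have := hle (f := fun k => 1 / ε * solidSum Ω h (u (k + 1))) fun k hk => by
      have := mul_nonneg hμ.le (hg0 (k + 1))
      linarith [hdis0' k hk]
    have h3 : ∑ k ∈ Finset.range N, Δt * solidSum Ω h (u (k + 1)) ≤ E₀ * ε := by
      rw [← div_le_iff₀ hε, Finset.sum_div]
      refine le_trans (le_of_eq (Finset.sum_congr rfl fun k _ => by ring)) this
    refine h3.trans (mul_le_mul_of_nonneg_right ?_ hε.le)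
    rw [hEdef]
    nlinarith
  -- For `γ ≤ 2` the pressure potential already dissipates the jumps; for `γ > 2` its recorded
  -- dissipation is zero and the entropy takes over.
  · rcases le_or_gt γ 2 with h2 | h2
    · have := hle (f := fun k => ∑ i, ∑ K, h ^ (d - 1) *
        ((h ^ α + |avg i (comp (u (k + 1)) i) K|) * (a * γ / 2 *
        ((ρ (k + 1) K - ρ (k + 1) (nxt i K)) ^ 2 / (1 + ρ (k + 1) K + ρ (k + 1) (nxt i K))))))
        fun k hk => by
          have h3 := mul_nonneg hμ.le (hg0 (k + 1))
          have h4 := mul_nonneg (one_div_nonneg.mpr hε.le) (hs0 (k + 1))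
          refine le_trans (Finset.sum_le_sum fun i _ => Finset.sum_le_sum fun K _ =>
            mul_le_mul_of_nonneg_left (mul_le_mul_of_nonneg_left
              (sq_sub_div_le_potentialDiss ha hγ h2 (hpos (k + 1) hk K) (hpos (k + 1) hk _))
              (by positivity)) (by positivity)) ?_
          linarith
      have h5 : ∀ A : ℝ, A * (a * γ / 2) ≤ E₀ → A ≤ E := by
        intro A hA
        rw [← le_div_iff₀ (by positivity)] at hA
        refine hA.trans ?_
        have : E₀ / (a * γ / 2) = E₀ * (2 / (a * γ)) := by field_simp
        rw [hEdef]
        nlinarith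
      refine h5 _ (le_trans (le_of_eq ?_) this)
      simp only [Finset.sum_mul, Finset.mul_sum]
      exact Finset.sum_congr rfl fun k _ => Finset.sum_congr rfl fun i _ =>
        Finset.sum_congr rfl fun K _ => by ring
    · have hent : ∀ k < N, ∑ K, h ^ d * (ρ (k + 1) K * Real.log (ρ (k + 1) K) - ρ (k + 1) K)
          + Δt * ∑ i, ∑ K, h ^ (d - 1) *
          ((h ^ α + |avg i (comp (u (k + 1)) i) K|) * (1 / 2 *
          ((ρ (k + 1) K - ρ (k + 1) (nxt i K)) ^ 2 / (1 + ρ (k + 1) K + ρ (k + 1) (nxt i K)))))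
          ≤ ∑ K, h ^ d * (ρ k K * Real.log (ρ k K) - ρ k K)
            + (Δt * (1 / 2 * (ℓ ^ d + E₀ * (γ - 1) / a)) + 1 / 2 * d * (Δt * gradSum h (u (k + 1)))) := by
        intro k hk
        have h3 := (S.contStep hk).renormalized (by omega) ht hh (hpos k hk.le) (hpos (k + 1) hk)
          (fun t => t * Real.log t - t) Real.log
          (fun x y => 1 / 2 * ((x - y) ^ 2 / (1 + x + y)))
          (fun x y hx hy => by positivity)
          (fun x y => by rw [← neg_sub y x, neg_sq, add_right_comm])
          (fun x y hx hy => entropy_diss hx hy)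
        simp only [mul_sub (h ^ d), Finset.sum_sub_distrib] at h3 ⊢
        have h4 : -∑ K, h ^ d * ((ρ (k + 1) K * Real.log (ρ (k + 1) K)
              - (ρ (k + 1) K * Real.log (ρ (k + 1) K) - ρ (k + 1) K)) * divh h (u (k + 1)) K)
            ≤ 1 / 2 * (ℓ ^ d + E₀ * (γ - 1) / a) + 1 / 2 * d * gradSum h (u (k + 1)) := by
          -- For the entropy, `r b' - b = r`; Young's inequality and `r² ≤ 1 + r^γ` are applied to
          -- `-r div_h u`.
          have h5 : -∑ K, h ^ d * ((ρ (k + 1) K * Real.log (ρ (k + 1) K)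
              - (ρ (k + 1) K * Real.log (ρ (k + 1) K) - ρ (k + 1) K)) * divh h (u (k + 1)) K)
              ≤ ∑ K, (1 / 2 * h ^ d + 1 / 2 * (h ^ d * ρ (k + 1) K ^ γ)
                + 1 / 2 * (h ^ d * divh h (u (k + 1)) K ^ 2)) := by
            rw [← Finset.sum_neg_distrib]
            refine Finset.sum_le_sum fun K _ => ?_
            have h6 := sq_le_one_add_rpow h2.le (hpos (k + 1) hk K).le
            have h7 : 0 ≤ h ^ d := by positivity
            nlinarith [mul_le_mul_of_nonneg_left h6 h7,
              mul_nonneg h7 (sq_nonneg (ρ (k + 1) K + divh h (u (k + 1)) K))]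
          have h6 : ∑ K, (1 / 2 * h ^ d + 1 / 2 * (h ^ d * ρ (k + 1) K ^ γ)
                + 1 / 2 * (h ^ d * divh h (u (k + 1)) K ^ 2))
              = 1 / 2 * ∑ _K : Cell d M, h ^ d + 1 / 2 * ∑ K, h ^ d * ρ (k + 1) K ^ γ
                + 1 / 2 * ∑ K, h ^ d * divh h (u (k + 1)) K ^ 2 := by
            simp only [Finset.sum_add_distrib, Finset.mul_sum]
          refine h5.trans ?_
          rw [h6, sum_cells_const hM]
          linarith [hintern (k + 1) hk, sum_divh_sq_le hh (u (k + 1))]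
        have h5 := mul_le_mul_of_nonneg_left h4 ht.le
        linarith
      have h3 := telescope_le
        (f := fun k => ∑ K, h ^ d * (ρ k K * Real.log (ρ k K) - ρ k K))
        (g := fun k => Δt * ∑ i, ∑ K, h ^ (d - 1) *
          ((h ^ α + |avg i (comp (u (k + 1)) i) K|) * (1 / 2 *
          ((ρ (k + 1) K - ρ (k + 1) (nxt i K)) ^ 2 / (1 + ρ (k + 1) K + ρ (k + 1) (nxt i K))))))
        (c := fun k => Δt * (1 / 2 * (ℓ ^ d + E₀ * (γ - 1) / a))
          + 1 / 2 * d * (Δt * gradSum h (u (k + 1)))) hent N le_rfl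
      have h4 : ∑ K, h ^ d * (ρ 0 K * Real.log (ρ 0 K) - ρ 0 K) ≤ ℓ ^ d + E₀ * (γ - 1) / a := by
        refine (Finset.sum_le_sum fun K _ => mul_le_mul_of_nonneg_left
          ((entropy_le (hpos 0 (by omega) K)).trans
            (sq_le_one_add_rpow h2.le (hpos 0 (by omega) K).le)) (by positivity)).trans ?_
        simp only [mul_add, mul_one, Finset.sum_add_distrib]
        rw [sum_cells_const hM]
        linarith [hintern 0 (by omega)]
      -- The entropy is not positive, but it is at least `-1` pointwise, so its final value can be
      -- dropped at the cost of the volume of the torus.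
      have h5 : -ℓ ^ d ≤ ∑ K, h ^ d * (ρ N K * Real.log (ρ N K) - ρ N K) := by
        rw [← sum_cells_const (d := d) hM, ← Finset.sum_neg_distrib]
        refine Finset.sum_le_sum fun K _ => ?_
        have := mul_le_mul_of_nonneg_left (neg_one_le_entropy (hpos N le_rfl K))
          (show 0 ≤ h ^ d by positivity)
        linarith
      have h7 : ∑ k ∈ Finset.range N, (Δt * (1 / 2 * (ℓ ^ d + E₀ * (γ - 1) / a))
          + 1 / 2 * d * (Δt * gradSum h (u (k + 1))))
          = T * (1 / 2 * (ℓ ^ d + E₀ * (γ - 1) / a))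
            + 1 / 2 * d * ∑ k ∈ Finset.range N, Δt * gradSum h (u (k + 1)) := by
        rw [Finset.sum_add_distrib, Finset.sum_const, Finset.card_range, nsmul_eq_mul, ← hN,
          Finset.mul_sum, mul_assoc]
      rw [h7] at h3
      have h6 : ∀ A : ℝ, A * (1 / 2) ≤ 2 * ℓ ^ d + E₀ * (γ - 1) / a
          + T * (1 / 2 * (ℓ ^ d + E₀ * (γ - 1) / a)) + 1 / 2 * d * (E₀ / μ) → A ≤ E := by
        intro A hA
        have t5 : 0 ≤ E₀ * (γ - 1) / a := by positivity
        rw [hEdef]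
        nlinarith
      refine h6 _ (le_trans (le_of_eq ?_) (le_trans (sub_le_sub_right h3
        (∑ K, h ^ d * (ρ N K * Real.log (ρ N K) - ρ N K))) ?_))
      · rw [add_sub_cancel_left]
        simp only [Finset.sum_mul, Finset.mul_sum]
        exact Finset.sum_congr rfl fun k _ => Finset.sum_congr rfl fun i _ =>
          Finset.sum_congr rfl fun K _ => by ring
      · have := mul_le_mul_of_nonneg_left hgrad (show (0 : ℝ) ≤ 1 / 2 * d by positivity)
        linarith
  · have := hle (f := fun k => ∑ i, ∑ K, h ^ (d - 1) *
        (h ^ α * (a * γ / 2 *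
        (ρ (k + 1) K ^ (γ / 2) - ρ (k + 1) (nxt i K) ^ (γ / 2)) ^ 2)))
        fun k hk => by
          have h3 := mul_nonneg hμ.le (hg0 (k + 1))
          have h4 := mul_nonneg (one_div_nonneg.mpr hε.le) (hs0 (k + 1))
          refine le_trans (Finset.sum_le_sum fun i _ => Finset.sum_le_sum fun K _ =>
            mul_le_mul_of_nonneg_left (mul_le_mul (le_add_of_nonneg_right
                (abs_nonneg (avg i (comp (u (k + 1)) i) K)))
              (sq_sub_rpow_le_potentialDiss ha hγ h2 (hpos (k + 1) hk K) (hpos (k + 1) hk _))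
              (by positivity) (by positivity)) (by positivity)) ?_
          linarith
    have h5 : ∀ A : ℝ, A * (a * γ / 2) ≤ E₀ → A ≤ E := by
      intro A hA
      rw [← le_div_iff₀ (by positivity)] at hA
      refine hA.trans ?_
      have : E₀ / (a * γ / 2) = E₀ * (2 / (a * γ)) := by field_simp
      rw [hEdef]
      nlinarith
    refine h5 _ (le_trans (le_of_eq ?_) this)
    simp only [Finset.sum_mul, Finset.mul_sum]
    exact Finset.sum_congr rfl fun k _ => Finset.sum_congr rfl fun i _ =>
      Finset.sum_congr rfl fun K _ => by ring

end Bounds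

end FV

namespace FV

/-! ### Discrete Poincaré and Sobolev inequalities -/

section Lines

set_option linter.unusedSectionVars false

variable {d M : ℕ} [NeZero M]

lemma sum_range_zmod (f : ZMod M → ℝ) : ∑ n ∈ Finset.range M, f (n : ZMod M) = ∑ c, f c := by
  refine Finset.sum_bij (fun n _ => (n : ZMod M)) (fun _ _ => Finset.mem_univ _) ?_ ?_
    (fun _ _ => rfl)
  · intro a ha b hb hab
    have := congrArg ZMod.val hab
    rwa [ZMod.val_natCast_of_lt (Finset.mem_range.mp ha),
      ZMod.val_natCast_of_lt (Finset.mem_range.mp hb)] at this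
  · exact fun c _ => ⟨c.val, Finset.mem_range.mpr (ZMod.val_lt c), by simp⟩

/-- Going from `a` to `b` around the discrete circle takes fewer than `M` steps, so the path uses
each jump at most once. -/
lemma abs_sub_le_sum_circle (f : ZMod M → ℝ) (a b : ZMod M) :
    |f b - f a| ≤ ∑ c, |f (c + 1) - f c| := by
  have h1 : ∀ n : ℕ, |f (a + n) - f a| ≤ ∑ j ∈ Finset.range n, |f (a + j + 1) - f (a + j)| := by
    intro n
    induction n with
    | zero => simp
    | succ n ih =>
      rw [Finset.sum_range_succ]
      have h2 : f (a + (n + 1 : ℕ)) - f a = (f (a + n) - f a) + (f (a + n + 1) - f (a + n)) := by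
        push_cast
        rw [← add_assoc]
        ring
      rw [h2]
      exact (abs_add_le _ _).trans (add_le_add ih le_rfl)
  have h2 := h1 (b - a).val
  have h3 : a + ((b - a).val : ZMod M) = b := by simp
  rw [h3] at h2
  refine h2.trans ?_
  calc ∑ j ∈ Finset.range (b - a).val, |f (a + j + 1) - f (a + j)|
      ≤ ∑ j ∈ Finset.range M, |f (a + j + 1) - f (a + j)| :=
        Finset.sum_le_sum_of_subset_of_nonneg
          (Finset.range_subset_range.mpr (ZMod.val_lt _).le) fun _ _ _ => abs_nonneg _
    _ = ∑ c, |f (a + c + 1) - f (a + c)| :=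
        sum_range_zmod fun c => |f (a + c + 1) - f (a + c)|
    _ = ∑ c, |f (c + 1) - f c| :=
        Equiv.sum_comp (Equiv.addLeft a) fun c => |f (c + 1) - f c|

lemma nxt_update (i : Fin d) (K : Cell d M) (t : ZMod M) :
    nxt i (Function.update K i t) = Function.update K i (t + 1) := by
  funext k
  by_cases hk : k = i
  · subst hk; simp [nxt]
  · simp [nxt, hk]

lemma abs_sub_update_le (i : Fin d) (v : Cell d M → ℝ) (K : Cell d M) (t : ZMod M) :
    |v K - v (Function.update K i t)| ≤ ∑ c, |jump i v (Function.update K i c)| := by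
  have := abs_sub_le_sum_circle (fun c => v (Function.update K i c)) t (K i)
  simpa [jump, nxt_update] using this

/-- Each cell lies on one line in direction `e_i`, and that line is visited once for each of its `M`
cells. -/
lemma sum_sum_update (i : Fin d) (F : Cell d M → ℝ) :
    ∑ K, ∑ t, F (Function.update K i t) = M * ∑ K, F K := by
  have h1 : ∀ K : Cell d M, ∑ t, F (Function.update K i t) = ∑ s, F (K + Pi.single i s) := by
    intro K
    rw [← Equiv.sum_comp (Equiv.addLeft (K i))]
    refine Finset.sum_congr rfl fun s _ => ?_
    congr 1
    funext k
    by_cases hk : k = i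
    · subst hk; simp
    · simp [hk]
  simp only [h1]
  rw [Finset.sum_comm]
  have h2 : ∀ s : ZMod M, ∑ K : Cell d M, F (K + Pi.single i s) = ∑ K, F K := fun s =>
    Equiv.sum_comp (Equiv.addRight (Pi.single i s : Cell d M)) F
  simp [h2, ZMod.card]

/-- The square of the discrete `H¹` norm. -/
noncomputable def sobSum (h : ℝ) (v : Cell d M → ℝ) : ℝ :=
  ∑ K, h ^ d * v K ^ 2 + ∑ i, ∑ K, h ^ d * (jump i v K / h) ^ 2

lemma sobSum_nonneg {h : ℝ} (hh : 0 ≤ h) (v : Cell d M → ℝ) : 0 ≤ sobSum h v :=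
  add_nonneg (Finset.sum_nonneg fun _ _ => by positivity)
    (Finset.sum_nonneg fun _ _ => Finset.sum_nonneg fun _ _ => by positivity)

lemma sum_sq_le_sobSum {h : ℝ} (hh : 0 ≤ h) (v : Cell d M → ℝ) :
    ∑ K, h ^ d * v K ^ 2 ≤ sobSum h v :=
  le_add_of_nonneg_right
    (Finset.sum_nonneg fun _ _ => Finset.sum_nonneg fun _ _ => by positivity)

/-- Poincaré inequality: control of `v` on the cells whose `i`-th index lies in `S`. -/
lemma poincare_layer (i : Fin d) (S : Finset (ZMod M)) (v : Cell d M → ℝ) :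
    S.card * ∑ K, v K ^ 2 ≤ 2 * M * ∑ K, (if K i ∈ S then v K ^ 2 else 0)
      + 2 * S.card * (M ^ 2 * ∑ K, jump i v K ^ 2) := by
  -- The value at `K` is compared with that at position `t` on its line; Cauchy–Schwarz on the total
  -- variation of the line costs a factor `M`. Summation over `t ∈ S` then averages over the layer.
  have h1 : ∀ K t, v K ^ 2 ≤ 2 * v (Function.update K i t) ^ 2
      + 2 * (M * ∑ c, jump i v (Function.update K i c) ^ 2) := by
    intro K t
    have h2 := abs_sub_update_le i v K t
    have h3 := sq_sum_le_card_mul_sum_sq (s := Finset.univ)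
      (f := fun c : ZMod M => |jump i v (Function.update K i c)|)
    simp only [sq_abs, Finset.card_univ, ZMod.card] at h3
    have h4 : (v K - v (Function.update K i t)) ^ 2
        ≤ (∑ c, |jump i v (Function.update K i c)|) ^ 2 := by
      rw [← sq_abs (v K - _)]
      gcongr
    nlinarith [sq_nonneg (v K - 2 * v (Function.update K i t))]
  have h2 : ∀ K, S.card * v K ^ 2 ≤ 2 * ∑ t ∈ S, v (Function.update K i t) ^ 2
      + 2 * S.card * (M * ∑ c, jump i v (Function.update K i c) ^ 2) := by
    intro K
    have := Finset.sum_le_sum fun t (_ : t ∈ S) => h1 K t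
    rw [Finset.sum_const, Finset.sum_add_distrib, Finset.sum_const, ← Finset.mul_sum,
      nsmul_eq_mul, nsmul_eq_mul] at this
    linarith
  have h3 := Finset.sum_le_sum fun K (_ : K ∈ Finset.univ) => h2 K
  rw [← Finset.mul_sum, Finset.sum_add_distrib, ← Finset.mul_sum, ← Finset.mul_sum,
    ← Finset.mul_sum, sum_sum_update i fun K => jump i v K ^ 2] at h3
  have h4 : ∑ K, ∑ t ∈ S, v (Function.update K i t) ^ 2
      = M * ∑ K, (if K i ∈ S then v K ^ 2 else 0) := by
    rw [← sum_sum_update i fun K => if K i ∈ S then v K ^ 2 else 0]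
    refine Finset.sum_congr rfl fun K _ => ?_
    simp [Finset.sum_ite_mem]
  rw [h4] at h3
  linarith

/-- The indices below `⌈δ/h⌉` all qualify, so the layer keeps width at least `δ` uniformly in the
mesh, even for `h > δ`, when index `0` alone is present. -/
lemma card_layer_ge {h ℓ δ : ℝ} (hh : 0 < h) (hM : (M : ℝ) * h = ℓ) (hδ : δ ≤ ℓ) :
    δ ≤ (Finset.univ.filter fun t : ZMod M => (t.val : ℝ) * h < δ).card * h := by
  have hc : ⌈δ / h⌉₊ ≤ M := by
    rw [Nat.ceil_le, div_le_iff₀ hh, hM]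
    exact hδ
  have h1 : ⌈δ / h⌉₊ ≤ (Finset.univ.filter fun t : ZMod M => (t.val : ℝ) * h < δ).card := by
    rw [← Finset.card_range ⌈δ / h⌉₊]
    refine Finset.card_le_card_of_injOn (fun n => (n : ZMod M)) ?_ ?_
    · intro n hn
      have hn' : n < ⌈δ / h⌉₊ := by simpa using hn
      simp only [Finset.coe_filter, Finset.mem_univ, true_and, mem_ofPred_eq]
      rw [ZMod.val_natCast_of_lt (hn'.trans_le hc), ← lt_div_iff₀ hh]
      exact Nat.lt_ceil.mp hn'
    · intro a ha b hb hab
      have ha' : a < ⌈δ / h⌉₊ := by simpa using ha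
      have hb' : b < ⌈δ / h⌉₊ := by simpa using hb
      have := congrArg ZMod.val hab
      simpa only [ZMod.val_natCast_of_lt (ha'.trans_le hc),
        ZMod.val_natCast_of_lt (hb'.trans_le hc)] using this
  have h2 : δ / h ≤ ⌈δ / h⌉₊ := Nat.le_ceil _
  rw [div_le_iff₀ hh] at h2
  refine h2.trans (mul_le_mul_of_nonneg_right ?_ hh.le)
  exact_mod_cast h1

/-- The cells near one side of the cube are penalized. -/
lemma IsFluidDomain.exists_solid_layer {ℓ : ℝ} (hℓ : 0 < ℓ) {Ω : Set (Space d)}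
    (hΩ : IsFluidDomain ℓ Ω) (i : Fin d) : ∃ δ, 0 < δ ∧ δ ≤ ℓ ∧ ∀ x ∈ Ω, δ ≤ x i := by
  have hcomp : IsCompact (closure Ω) := by
    refine Metric.isCompact_of_isClosed_isBounded isClosed_closure ?_
    exact (Bornology.IsBounded.pi fun _ => Metric.isBounded_Ioo 0 ℓ).subset hΩ.closure_subset
  rcases (closure Ω).eq_empty_or_nonempty with he | hne
  · refine ⟨ℓ, hℓ, le_rfl, fun x hx => ?_⟩
    exact absurd (subset_closure hx) (by simp [he])
  · obtain ⟨x₀, hx₀, hmin⟩ := hcomp.exists_isMinOn hne (continuous_apply i).continuousOn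
    have h0 := hΩ.closure_subset hx₀ i (mem_univ i)
    exact ⟨x₀ i, h0.1, h0.2.le, fun x hx => hmin (subset_closure hx)⟩

/-- Poincaré inequality with the penalization as lower order term. -/
lemma exists_poincare (hd : 2 ≤ d) {ℓ : ℝ} (hℓ : 0 < ℓ) {Ω : Set (Space d)}
    (hΩ : IsFluidDomain ℓ Ω) : ∃ C, 0 ≤ C ∧ ∀ (M : ℕ) [NeZero M] (h : ℝ), 0 < h → (M : ℝ) * h = ℓ →
      ∀ u : Cell d M → Fin d → ℝ,
        ∑ K, h ^ d * ∑ j, u K j ^ 2 ≤ C * (solidSum Ω h u + gradSum h u) := by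
  let i₀ : Fin d := ⟨0, by omega⟩
  obtain ⟨δ, hδ, hδℓ, hlay⟩ := hΩ.exists_solid_layer hℓ i₀
  refine ⟨2 * ℓ / δ + 2 * ℓ ^ 2, by positivity, fun M _ h hh hM u => ?_⟩
  set S := Finset.univ.filter fun t : ZMod M => (t.val : ℝ) * h < δ with hS
  have hcard := card_layer_ge hh hM hδℓ
  rw [← hS] at hcard
  have hc0 : 0 < (S.card : ℝ) * h := hδ.trans_le hcard
  have hhd : 0 < h ^ d := by positivity
  -- The lower corner of such a cell has `i₀`-coordinate below `δ`, hence lies outside `Ω`, and the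
  -- cell is penalized.
  have hsol : ∀ K : Cell d M, K i₀ ∈ S → ¬ cellSet h K ⊆ Ω := by
    intro K hK hsub
    have hK' : ((K i₀).val : ℝ) * h < δ := by simpa [hS] using hK
    have hmem : (fun i => ((K i).val : ℝ) * h) ∈ cellSet h K := by
      intro i
      constructor <;> nlinarith
    exact absurd (hlay _ (hsub hmem)) (not_le.mpr hK')
  have hj : ∀ j, ∑ K, h ^ d * u K j ^ 2 ≤ 2 * ℓ / δ *
        ∑ K, h ^ d * (if K i₀ ∈ S then u K j ^ 2 else 0)
        + 2 * ℓ ^ 2 * ∑ K, h ^ d * (jump i₀ (comp u j) K / h) ^ 2 := by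
    intro j
    have h1 := poincare_layer i₀ S (comp u j)
    simp only [comp] at h1
    have h2 : ∑ K, jump i₀ (comp u j) K ^ 2 = h ^ 2 * ∑ K, (jump i₀ (comp u j) K / h) ^ 2 := by
      rw [Finset.mul_sum]
      refine Finset.sum_congr rfl fun K _ => ?_
      field_simp
    have h3 : (M : ℝ) ^ 2 * ∑ K, jump i₀ (comp u j) K ^ 2
        = ℓ ^ 2 * ∑ K, (jump i₀ (comp u j) K / h) ^ 2 := by
      rw [h2, ← hM]; ring
    change S.card * ∑ K, u K j ^ 2 ≤ 2 * M * ∑ K, (if K i₀ ∈ S then u K j ^ 2 else 0)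
      + 2 * S.card * (M ^ 2 * ∑ K, jump i₀ (comp u j) K ^ 2) at h1
    rw [h3] at h1
    have hB : 0 ≤ ∑ K, (if K i₀ ∈ S then u K j ^ 2 else 0) :=
      Finset.sum_nonneg fun K _ => by split_ifs <;> positivity
    have h4 : ∑ K, u K j ^ 2 ≤ 2 * ℓ / δ * ∑ K, (if K i₀ ∈ S then u K j ^ 2 else 0)
        + 2 * ℓ ^ 2 * ∑ K, (jump i₀ (comp u j) K / h) ^ 2 := by
      have h5 : 2 * ℓ * ∑ K, (if K i₀ ∈ S then u K j ^ 2 else 0)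
          ≤ (S.card * h) * (2 * ℓ / δ * ∑ K, (if K i₀ ∈ S then u K j ^ 2 else 0)) := by
        have : 2 * ℓ * ∑ K, (if K i₀ ∈ S then u K j ^ 2 else 0)
            = δ * (2 * ℓ / δ * ∑ K, (if K i₀ ∈ S then u K j ^ 2 else 0)) := by field_simp
        rw [this]
        exact mul_le_mul_of_nonneg_right hcard (by positivity)
      have h6 := mul_le_mul_of_nonneg_right h1 hh.le
      refine le_of_mul_le_mul_left ?_ hc0
      have h7 : 2 * M * (∑ K, (if K i₀ ∈ S then u K j ^ 2 else 0)) * h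
          = 2 * ℓ * ∑ K, (if K i₀ ∈ S then u K j ^ 2 else 0) := by
        rw [← hM]; ring
      linarith
    rw [← Finset.mul_sum, ← Finset.mul_sum, ← Finset.mul_sum]
    nlinarith
  have h1 := Finset.sum_le_sum fun j (_ : j ∈ Finset.univ) => hj j
  rw [Finset.sum_add_distrib, ← Finset.mul_sum, ← Finset.mul_sum] at h1
  have h2 : ∑ K, h ^ d * ∑ j, u K j ^ 2 = ∑ j, ∑ K, h ^ d * u K j ^ 2 := by
    rw [Finset.sum_comm]
    exact Finset.sum_congr rfl fun K _ => Finset.mul_sum _ _ _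
  have h3 : ∑ j, ∑ K, h ^ d * (if K i₀ ∈ S then u K j ^ 2 else 0) ≤ solidSum Ω h u := by
    rw [Finset.sum_comm, solidSum]
    refine Finset.sum_le_sum fun K _ => ?_
    by_cases hK : K i₀ ∈ S
    · simp [hK, hsol K hK, Finset.mul_sum]
    · simp only [hK, if_false, mul_zero, Finset.sum_const_zero]
      split_ifs
      · exact le_rfl
      · exact mul_nonneg hhd.le (Finset.sum_nonneg fun _ _ => sq_nonneg _)
  have h4 : ∑ j, ∑ K, h ^ d * (jump i₀ (comp u j) K / h) ^ 2 ≤ gradSum h u := by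
    rw [Finset.sum_comm, gradSum]
    refine le_trans (le_of_eq ?_) (Finset.single_le_sum
      (f := fun i => ∑ K, h ^ d * ∑ j, (jump i (comp u j) K / h) ^ 2) (fun i _ =>
      Finset.sum_nonneg fun _ _ => mul_nonneg hhd.le (Finset.sum_nonneg fun _ _ => sq_nonneg _))
      (Finset.mem_univ i₀))
    exact Finset.sum_congr rfl fun K _ => (Finset.mul_sum _ _ _).symm
  rw [h2]
  refine h1.trans ?_
  have h5 := solidSum_nonneg hh.le Ω u
  have h6 := gradSum_nonneg hh.le u
  have h7 : 0 ≤ 2 * ℓ / δ := by positivity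
  have h8 : 0 ≤ 2 * ℓ ^ 2 := by positivity
  have h9 := mul_le_mul_of_nonneg_left h3 h7
  have h10 := mul_le_mul_of_nonneg_left h4 h8
  nlinarith [mul_nonneg h7 h6, mul_nonneg h8 h5]

/-- The Gagliardo–Loomis–Whitney inequality for the counting measure. -/
lemma sum_prod_sum_rpow_le (hd : 2 ≤ d) (g : Cell d M → ℝ) (hg : ∀ K, 0 ≤ g K) :
    ∑ K, ∏ i, (∑ t, g (Function.update K i t)) ^ ((1 : ℝ) / (d - 1))
      ≤ (∑ K, g K) ^ ((d : ℝ) / (d - 1)) := by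
  let _ : MeasurableSpace (ZMod M) := ⊤
  have : DiscreteMeasurableSpace (ZMod M) := ⟨fun _ => trivial⟩
  have hd' : (2 : ℝ) ≤ d := by exact_mod_cast hd
  have hconj : Real.HolderConjugate (Fintype.card (Fin d)) ((d : ℝ) / (d - 1)) := by
    rw [Fintype.card_fin, Real.holderConjugate_iff]
    refine ⟨by linarith, ?_⟩
    rw [inv_div]
    field_simp
    ring
  -- The grid-lines inequality behind the Gagliardo–Nirenberg–Sobolev theorem holds for any product
  -- of σ-finite measures; counting measures turn its integrals into sums over the mesh.
  have key := lintegral_prod_lintegral_pow_le (fun _ : Fin d => (Measure.count : Measure (ZMod M)))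
    hconj (f := fun K => ENNReal.ofReal (g K)) (measurable_of_finite _)
  have hsum : ∀ K i, 0 ≤ ∑ t, g (Function.update K i t) := fun K i =>
    Finset.sum_nonneg fun _ _ => hg _
  have hd1 : (0 : ℝ) ≤ 1 / (d - 1) := by
    have : (0 : ℝ) < d - 1 := by linarith
    positivity
  simp only [lintegral_fintype, Measure.pi_singleton, Measure.count_singleton,
    Finset.prod_const_one, mul_one, Fintype.card_fin] at key
  have e1 : ∀ K : Cell d M, ∏ i, (∑ t, ENNReal.ofReal (g (Function.update K i t))) ^ ((1 : ℝ) / (d - 1))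
      = ENNReal.ofReal (∏ i, (∑ t, g (Function.update K i t)) ^ ((1 : ℝ) / (d - 1))) := by
    intro K
    rw [ENNReal.ofReal_prod_of_nonneg fun i _ => Real.rpow_nonneg (hsum K i) _]
    refine Finset.prod_congr rfl fun i _ => ?_
    rw [← ENNReal.ofReal_sum_of_nonneg fun _ _ => hg _,
      ENNReal.ofReal_rpow_of_nonneg (hsum K i) hd1]
  simp only [e1] at key
  rw [← ENNReal.ofReal_sum_of_nonneg fun _ _ => hg _, ENNReal.ofReal_rpow_of_nonneg
    (Finset.sum_nonneg fun _ _ => hg _) (div_nonneg (by linarith) (by linarith)),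
    ← ENNReal.ofReal_sum_of_nonneg fun K _ => Finset.prod_nonneg fun i _ =>
      Real.rpow_nonneg (hsum K i) _] at key
  exact (ENNReal.ofReal_le_ofReal_iff (Real.rpow_nonneg (Finset.sum_nonneg fun _ _ => hg _) _)).mp key

/-- The discrete Sobolev inequality for `W^{1,1}`. -/
lemma sum_rpow_le_of_jump (hd : 2 ≤ d) (v : Cell d M → ℝ) (hv : ∀ K, 0 ≤ v K) :
    ∑ K, v K ^ ((d : ℝ) / (d - 1)) ≤ (∑ K, (v K / M + ∑ i, |jump i v K|)) ^ ((d : ℝ) / (d - 1)) := by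
  have hd' : (2 : ℝ) ≤ d := by exact_mod_cast hd
  have hM : (0 : ℝ) < M := by exact_mod_cast Nat.pos_of_ne_zero (NeZero.ne M)
  have hd1 : (0 : ℝ) ≤ 1 / (d - 1) := by
    have : (0 : ℝ) < d - 1 := by linarith
    positivity
  have hg : ∀ K, 0 ≤ v K / M + ∑ i, |jump i v K| := fun K =>
    add_nonneg (div_nonneg (hv K) hM.le) (Finset.sum_nonneg fun _ _ => abs_nonneg _)
  refine le_trans (Finset.sum_le_sum fun K _ => ?_) (sum_prod_sum_rpow_le hd _ hg)
  -- Averaging `v K ≤ v(t) + (total variation of the line)` over the `M` positions `t` bounds `v K`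
  -- by a sum over its line, in each of the `d` directions; the product of the `d` bounds to the
  -- power `1/(d-1)` is the left side of the grid-lines inequality.
  have h1 : ∀ i, v K ≤ ∑ t, (v (Function.update K i t) / M
      + ∑ k, |jump k v (Function.update K i t)|) := by
    intro i
    have h2 : ∀ t, v K ≤ v (Function.update K i t) + ∑ c, |jump i v (Function.update K i c)| := by
      intro t
      linarith [le_abs_self (v K - v (Function.update K i t)), abs_sub_update_le i v K t]
    have h3 := Finset.sum_le_sum fun t (_ : t ∈ (Finset.univ : Finset (ZMod M))) => h2 t
    rw [Finset.sum_const, Finset.sum_add_distrib, Finset.sum_const, Finset.card_univ, ZMod.card,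
      nsmul_eq_mul, nsmul_eq_mul] at h3
    have h4 : ∑ t, |jump i v (Function.update K i t)|
        ≤ ∑ t, ∑ k, |jump k v (Function.update K i t)| :=
      Finset.sum_le_sum fun t _ => Finset.single_le_sum
        (f := fun k => |jump k v (Function.update K i t)|) (fun _ _ => abs_nonneg _)
        (Finset.mem_univ i)
    rw [Finset.sum_add_distrib, ← Finset.sum_div]
    refine le_trans ?_ (add_le_add le_rfl h4)
    rw [div_add' _ _ _ hM.ne', le_div_iff₀ hM]
    linarith
  calc v K ^ ((d : ℝ) / (d - 1)) = ∏ _i : Fin d, v K ^ ((1 : ℝ) / (d - 1)) := by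
        rw [Finset.prod_const, Finset.card_univ, Fintype.card_fin, ← Real.rpow_natCast,
          ← Real.rpow_mul (hv K)]
        congr 1
        ring
    _ ≤ _ := Finset.prod_le_prod (fun i _ => Real.rpow_nonneg (hv K) _) fun i _ =>
        Real.rpow_le_rpow (hv K) (h1 i) hd1

end Lines

end FV

namespace FV

/-! ### Discrete Sobolev embeddings of `H¹`. -/

section Sobolev

set_option linter.unusedSectionVars false

variable {d M : ℕ} [NeZero M]

/-- Cauchy–Schwarz for weighted sums. -/
lemma sum_mul_le_sqrt {ι : Type*} (s : Finset ι) (w : ℝ) (f g : ι → ℝ) :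
    (∑ k ∈ s, w * (f k * g k)) ^ 2 ≤ (∑ k ∈ s, w * f k ^ 2) * ∑ k ∈ s, w * g k ^ 2 := by
  have := Finset.sum_mul_sq_le_sq_mul_sq s f g
  rw [← Finset.mul_sum, ← Finset.mul_sum, ← Finset.mul_sum, mul_pow]
  have := mul_le_mul_of_nonneg_left this (sq_nonneg w)
  linarith

/-- The `W^{1,1}` norm of `|v|^s`: its jumps are at most `s |v|^(s-1)` times the jumps of `v`, and
Cauchy–Schwarz separates `|v|^(s-1)` from the `H¹` norm. -/
lemma pow_step_bound (hd : 2 ≤ d) {ℓ h : ℝ} (hℓ : 0 < ℓ) (hh : 0 < h) (hM : (M : ℝ) * h = ℓ)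
    {s : ℕ} (hs : 1 ≤ s) (v : Cell d M → ℝ) :
    (h ^ (d - 1) * ∑ K, (|v K| ^ s / M + ∑ i, |jump i (fun L => |v L| ^ s) K|)) ^ 2
      ≤ (∑ K, h ^ d * |v K| ^ (2 * (s - 1))) * (2 * d * (1 / ℓ ^ 2 + 4 * s ^ 2) * sobSum h v) := by
  have hM0 : (0 : ℝ) < M := by exact_mod_cast Nat.pos_of_ne_zero (NeZero.ne M)
  have hd1 : (1 : ℝ) ≤ d := by exact_mod_cast (by omega : 1 ≤ d)
  -- `G` gathers at a cell its value and the difference quotients on both of its faces per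
  -- direction; the second one comes from translating the part of a jump estimate that sits at the
  -- next cell.
  set G : Cell d M → ℝ := fun K => |v K| / ℓ
    + ∑ i, s * (|jump i v K / h| + |jump i v (prv i K) / h|) with hG
  have hG0 : ∀ K, 0 ≤ G K := fun K => add_nonneg (by positivity)
    (Finset.sum_nonneg fun _ _ => by positivity)
  have h1 : ∀ i (K : Cell d M), |jump i (fun L => |v L| ^ s) K|
      ≤ s * |jump i v K| * |v K| ^ (s - 1) + s * |jump i v K| * |v (nxt i K)| ^ (s - 1) := by
    intro i K
    have h2 := abs_pow_sub_pow_le |v (nxt i K)| |v K| s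
    have h3 := abs_abs_sub_abs_le_abs_sub (v (nxt i K)) (v K)
    simp only [abs_abs] at h2
    simp only [jump]
    refine h2.trans ?_
    have h4 : max |v (nxt i K)| |v K| ^ (s - 1) ≤ |v K| ^ (s - 1) + |v (nxt i K)| ^ (s - 1) := by
      have := pow_nonneg (abs_nonneg (v K)) (s - 1)
      have := pow_nonneg (abs_nonneg (v (nxt i K))) (s - 1)
      rcases max_cases |v (nxt i K)| |v K| with h | h <;> rw [h.1] <;> linarith
    have h5 : 0 ≤ max |v (nxt i K)| |v K| ^ (s - 1) := pow_nonneg (le_max_of_le_left (abs_nonneg _)) _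
    calc |(|v (nxt i K)| - |v K|)| * s * max |v (nxt i K)| |v K| ^ (s - 1)
        ≤ |v (nxt i K) - v K| * s * (|v K| ^ (s - 1) + |v (nxt i K)| ^ (s - 1)) := by gcongr
      _ = _ := by ring
  have h2 : h ^ (d - 1) * ∑ K, (|v K| ^ s / M + ∑ i, |jump i (fun L => |v L| ^ s) K|)
      ≤ ∑ K, h ^ d * (|v K| ^ (s - 1) * G K) := by
    have h3 : ∑ K, ∑ i, |jump i (fun L => |v L| ^ s) K|
        ≤ ∑ K, ∑ i, (s * |jump i v K| * |v K| ^ (s - 1)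
          + s * |jump i v (prv i K)| * |v K| ^ (s - 1)) := by
      rw [Finset.sum_comm]
      conv_rhs => rw [Finset.sum_comm]
      refine Finset.sum_le_sum fun i _ => ?_
      refine (Finset.sum_le_sum fun K _ => h1 i K).trans (le_of_eq ?_)
      rw [Finset.sum_add_distrib, Finset.sum_add_distrib]
      congr 1
      rw [← sum_nxt i fun K => s * |jump i v (prv i K)| * |v K| ^ (s - 1)]
      simp
    rw [Finset.sum_add_distrib]
    refine (mul_le_mul_of_nonneg_left (add_le_add le_rfl h3) (by positivity)).trans (le_of_eq ?_)
    rw [← Finset.sum_add_distrib, Finset.mul_sum]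
    refine Finset.sum_congr rfl fun K _ => ?_
    have e1 : |v K| ^ s = |v K| ^ (s - 1) * |v K| := by
      rw [← pow_succ, Nat.sub_add_cancel hs]
    rw [hG, e1, ← hM, pow_eq_pow_pred_mul (by omega : d ≠ 0)]
    simp only [abs_div, abs_of_pos hh, ← add_div, mul_add, Finset.mul_sum, Finset.sum_add_distrib]
    congr 1
    · field_simp
    · rw [← Finset.sum_add_distrib]
      refine Finset.sum_congr rfl fun i _ => ?_
      field_simp
  have h0 : 0 ≤ h ^ (d - 1) * ∑ K, (|v K| ^ s / M + ∑ i, |jump i (fun L => |v L| ^ s) K|) :=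
    mul_nonneg (by positivity) (Finset.sum_nonneg fun K _ => add_nonneg (by positivity)
      (Finset.sum_nonneg fun _ _ => abs_nonneg _))
  have h3 := sum_mul_le_sqrt Finset.univ (h ^ d) (fun K => |v K| ^ (s - 1)) G
  have h4 : ∑ K, h ^ d * G K ^ 2 ≤ 2 * d * (1 / ℓ ^ 2 + 4 * s ^ 2) * sobSum h v := by
    have h5 : ∀ K, G K ^ 2 ≤ 2 / ℓ ^ 2 * v K ^ 2
        + 4 * d * s ^ 2 * ∑ i, ((jump i v K / h) ^ 2 + (jump i v (prv i K) / h) ^ 2) := by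
      intro K
      have h6 := sq_sum_le_card_mul_sum_sq (s := Finset.univ)
        (f := fun i : Fin d => s * (|jump i v K / h| + |jump i v (prv i K) / h|))
      rw [Finset.card_univ, Fintype.card_fin] at h6
      have h7 : ∑ i, (s * (|jump i v K / h| + |jump i v (prv i K) / h|)) ^ 2
          ≤ 2 * s ^ 2 * ∑ i, ((jump i v K / h) ^ 2 + (jump i v (prv i K) / h) ^ 2) := by
        rw [Finset.mul_sum]
        refine Finset.sum_le_sum fun i _ => ?_
        have h9 : (|jump i v K / h| + |jump i v (prv i K) / h|) ^ 2
            ≤ 2 * ((jump i v K / h) ^ 2 + (jump i v (prv i K) / h) ^ 2) := by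
          rw [← sq_abs (jump i v K / h), ← sq_abs (jump i v (prv i K) / h)]
          exact add_sq_le
        rw [mul_pow]
        nlinarith [mul_le_mul_of_nonneg_left h9 (sq_nonneg (s : ℝ))]
      have h8 : G K ^ 2 ≤ 2 * (|v K| / ℓ) ^ 2
          + 2 * (∑ i, s * (|jump i v K / h| + |jump i v (prv i K) / h|)) ^ 2 := by
        rw [hG]
        linarith [add_sq_le (a := |v K| / ℓ)
          (b := ∑ i, s * (|jump i v K / h| + |jump i v (prv i K) / h|))]
      have h9 : (|v K| / ℓ) ^ 2 = 1 / ℓ ^ 2 * v K ^ 2 := by rw [div_pow, sq_abs]; ring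
      rw [h9] at h8
      have h10 := mul_le_mul_of_nonneg_left h7 (by positivity : (0 : ℝ) ≤ d)
      have e : 2 / ℓ ^ 2 * v K ^ 2 = 2 * (1 / ℓ ^ 2 * v K ^ 2) := by ring
      rw [e]
      linarith
    have h6 := Finset.sum_le_sum fun K (_ : K ∈ Finset.univ) =>
      mul_le_mul_of_nonneg_left (h5 K) (pow_nonneg hh.le d)
    refine h6.trans ?_
    have h7 : ∑ K, h ^ d * (2 / ℓ ^ 2 * v K ^ 2
        + 4 * d * s ^ 2 * ∑ i, ((jump i v K / h) ^ 2 + (jump i v (prv i K) / h) ^ 2))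
        = 2 / ℓ ^ 2 * ∑ K, h ^ d * v K ^ 2
          + 8 * d * s ^ 2 * ∑ i, ∑ K, h ^ d * (jump i v K / h) ^ 2 := by
      have h8 : ∑ K, h ^ d * ∑ i, ((jump i v K / h) ^ 2 + (jump i v (prv i K) / h) ^ 2)
          = 2 * ∑ i, ∑ K, h ^ d * (jump i v K / h) ^ 2 := by
        simp only [Finset.mul_sum]
        rw [Finset.sum_comm]
        refine Finset.sum_congr rfl fun i _ => ?_
        simp only [mul_add, Finset.sum_add_distrib]
        rw [sum_prv i fun K => h ^ d * (jump i v K / h) ^ 2, ← Finset.sum_add_distrib]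
        exact Finset.sum_congr rfl fun K _ => (two_mul _).symm
      have h9 : ∀ K, h ^ d * (2 / ℓ ^ 2 * v K ^ 2
        + 4 * d * s ^ 2 * ∑ i, ((jump i v K / h) ^ 2 + (jump i v (prv i K) / h) ^ 2))
        = 2 / ℓ ^ 2 * (h ^ d * v K ^ 2) + 4 * d * s ^ 2 *
          (h ^ d * ∑ i, ((jump i v K / h) ^ 2 + (jump i v (prv i K) / h) ^ 2)) := fun K => by ring
      have h10 : ∑ K, (2 / ℓ ^ 2 * (h ^ d * v K ^ 2) + 4 * d * s ^ 2 *
          (h ^ d * ∑ i, ((jump i v K / h) ^ 2 + (jump i v (prv i K) / h) ^ 2)))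
          = 2 / ℓ ^ 2 * ∑ K, h ^ d * v K ^ 2 + 4 * d * s ^ 2 *
          ∑ K, h ^ d * ∑ i, ((jump i v K / h) ^ 2 + (jump i v (prv i K) / h) ^ 2) := by
        rw [Finset.sum_add_distrib, Finset.mul_sum, Finset.mul_sum]
      simp only [h9]
      rw [h10, h8]
      ring
    rw [h7, sobSum]
    have a1 : 0 ≤ ∑ K, h ^ d * v K ^ 2 := Finset.sum_nonneg fun _ _ => by positivity
    have a2 : 0 ≤ ∑ i, ∑ K, h ^ d * (jump i v K / h) ^ 2 :=
      Finset.sum_nonneg fun _ _ => Finset.sum_nonneg fun _ _ => by positivity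
    have b1 : 2 / ℓ ^ 2 ≤ 2 * d * (1 / ℓ ^ 2 + 4 * s ^ 2) := by
      have : (0 : ℝ) ≤ 1 / ℓ ^ 2 := by positivity
      have e : 2 / ℓ ^ 2 = 2 * (1 / ℓ ^ 2) := by ring
      rw [e]
      nlinarith [mul_nonneg (by linarith : (0 : ℝ) ≤ d - 1) this,
        mul_nonneg (by positivity : (0 : ℝ) ≤ d) (sq_nonneg (s : ℝ))]
    have b2 : 8 * d * (s : ℝ) ^ 2 ≤ 2 * d * (1 / ℓ ^ 2 + 4 * s ^ 2) := by
      have : (0 : ℝ) ≤ d * (1 / ℓ ^ 2) := by positivity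
      linarith
    rw [mul_add (2 * (d : ℝ) * (1 / ℓ ^ 2 + 4 * s ^ 2))]
    exact add_le_add (mul_le_mul_of_nonneg_right b1 a1) (mul_le_mul_of_nonneg_right b2 a2)
  have h5 : ∑ K, h ^ d * (|v K| ^ (s - 1)) ^ 2 = ∑ K, h ^ d * |v K| ^ (2 * (s - 1)) :=
    Finset.sum_congr rfl fun K _ => by rw [← pow_mul, mul_comm 2]
  rw [h5] at h3
  calc _ ≤ (∑ K, h ^ d * (|v K| ^ (s - 1) * G K)) ^ 2 := by gcongr
    _ ≤ _ := h3.trans (mul_le_mul_of_nonneg_left h4 (Finset.sum_nonneg fun _ _ => by positivity))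

/-- The `W^{1,1}` inequality is applied to `|v|^s`. The powers of the mesh width fit because `h^d =
(h^(d-1))^(d/(d-1))`. -/
lemma sobolev_step (hd : 2 ≤ d) {ℓ h : ℝ} (hℓ : 0 < ℓ) (hh : 0 < h) (hM : (M : ℝ) * h = ℓ)
    {s : ℕ} (hs : 1 ≤ s) (v : Cell d M → ℝ) :
    ∑ K, h ^ d * (|v K| ^ s) ^ ((d : ℝ) / (d - 1))
      ≤ ((∑ K, h ^ d * |v K| ^ (2 * (s - 1)))
        * (2 * d * (1 / ℓ ^ 2 + 4 * s ^ 2) * sobSum h v)) ^ ((d : ℝ) / (d - 1) / 2) := by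
  have hd' : (2 : ℝ) ≤ d := by exact_mod_cast hd
  have h1 := sum_rpow_le_of_jump hd (fun K => |v K| ^ s) fun K => by positivity
  have h2 := pow_step_bound hd hℓ hh hM hs v
  have he : (0 : ℝ) ≤ (d : ℝ) / (d - 1) := div_nonneg (by linarith) (by linarith)
  have h0 : 0 ≤ ∑ K, (|v K| ^ s / M + ∑ i, |jump i (fun L => |v L| ^ s) K|) :=
    Finset.sum_nonneg fun K _ => add_nonneg (by positivity)
      (Finset.sum_nonneg fun _ _ => abs_nonneg _)
  have h3 : h ^ d = (h ^ (d - 1)) ^ ((d : ℝ) / (d - 1)) := by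
    rw [← Real.rpow_natCast h (d - 1), ← Real.rpow_mul hh.le, Nat.cast_sub (by omega), Nat.cast_one,
      mul_div_cancel₀ _ (by linarith), Real.rpow_natCast]
  calc ∑ K, h ^ d * (|v K| ^ s) ^ ((d : ℝ) / (d - 1))
      ≤ h ^ d * (∑ K, (|v K| ^ s / M + ∑ i, |jump i (fun L => |v L| ^ s) K|))
        ^ ((d : ℝ) / (d - 1)) := by
        rw [← Finset.mul_sum]
        exact mul_le_mul_of_nonneg_left h1 (by positivity)
    _ = (h ^ (d - 1) * ∑ K, (|v K| ^ s / M + ∑ i, |jump i (fun L => |v L| ^ s) K|))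
        ^ ((d : ℝ) / (d - 1)) := by
        rw [Real.mul_rpow (by positivity) h0, ← h3]
    _ = ((h ^ (d - 1) * ∑ K, (|v K| ^ s / M + ∑ i, |jump i (fun L => |v L| ^ s) K|)) ^ 2)
        ^ ((d : ℝ) / (d - 1) / 2) := by
        rw [← Real.rpow_natCast (_ * _) 2, ← Real.rpow_mul (mul_nonneg (by positivity) h0)]
        congr 1
        push_cast
        ring
    _ ≤ _ := Real.rpow_le_rpow (sq_nonneg _) h2 (by positivity)

/-- `C` is a constant for the discrete Sobolev embedding of `H¹` into `L^p`. -/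
def IsSobolevConst (d : ℕ) (ℓ p C : ℝ) : Prop :=
  0 ≤ C ∧ ∀ (M : ℕ) [NeZero M] (h : ℝ), 0 < h → (M : ℝ) * h = ℓ → ∀ v : Cell d M → ℝ,
    ∑ K, h ^ d * |v K| ^ p ≤ C * sobSum h v ^ (p / 2)

/-- For `d = 3` the choice `s = 4` makes both exponents equal, `s·3/2 = 6 = 2(s-1)`. The same sum
`S` appears on both sides, `S⁴ ≤ (S·C‖v‖²)³`, and is divided out. -/
lemma sobolev_three {ℓ : ℝ} (hℓ : 0 < ℓ) : ∃ C, IsSobolevConst 3 ℓ 6 C := by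
  refine ⟨(2 * 3 * (1 / ℓ ^ 2 + 4 * 4 ^ 2)) ^ 3, by positivity, fun M _ h hh hM v => ?_⟩
  have h1 := sobolev_step (d := 3) (by norm_num) hℓ hh hM (s := 4) (by norm_num) v
  have hH := sobSum_nonneg hh.le v
  push_cast at h1
  set C := 2 * 3 * (1 / ℓ ^ 2 + 4 * (4 : ℝ) ^ 2) with hC
  have hC0 : 0 ≤ C := by positivity
  set S := ∑ K, h ^ 3 * |v K| ^ 6 with hS
  have hS0 : 0 ≤ S := Finset.sum_nonneg fun _ _ => by positivity
  have e1 : ∑ K, h ^ 3 * (|v K| ^ 4) ^ ((3 : ℝ) / (3 - 1)) = S := by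
    refine Finset.sum_congr rfl fun K _ => ?_
    rw [← Real.rpow_natCast (|v K|) 4, ← Real.rpow_mul (abs_nonneg _), ← Real.rpow_natCast (|v K|) 6]
    norm_num
  have e2 : ∑ K, h ^ 3 * |v K| ^ (6 : ℝ) = S :=
    Finset.sum_congr rfl fun K _ => by rw [← Real.rpow_natCast (|v K|) 6]; norm_num
  have e3 : sobSum h v ^ ((6 : ℝ) / 2) = sobSum h v ^ 3 := by
    rw [← Real.rpow_natCast (sobSum h v) 3]; norm_num
  rw [e1] at h1
  rw [e2, e3, ← mul_pow]
  have h2 : S ^ 4 ≤ (S * (C * sobSum h v)) ^ 3 := by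
    calc S ^ 4 ≤ ((S * (C * sobSum h v)) ^ ((3 : ℝ) / (3 - 1) / 2)) ^ 4 := by gcongr
      _ = _ := by
        rw [← Real.rpow_natCast (_ ^ _) 4, ← Real.rpow_mul (by positivity),
          ← Real.rpow_natCast _ 3]
        norm_num
  rcases hS0.eq_or_lt with h0 | h0
  · rw [← h0]; positivity
  · rw [mul_pow] at h2
    have h3 : S ^ 3 * S ≤ S ^ 3 * (C * sobSum h v) ^ 3 := by linarith [pow_succ S 3]
    exact le_of_mul_le_mul_left h3 (by positivity)

/-- For `d = 2` the critical power is `2`, so one application raises the integrability exponent by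
two; iterating it reaches every even exponent. -/
lemma sobolev_two_step {ℓ h : ℝ} (hℓ : 0 < ℓ) (hh : 0 < h) (hM : (M : ℝ) * h = ℓ)
    {s : ℕ} (hs : 1 ≤ s) (v : Cell 2 M → ℝ) :
    ∑ K, h ^ 2 * |v K| ^ (2 * s) ≤ (4 * (1 / ℓ ^ 2 + 4 * s ^ 2))
      * (∑ K, h ^ 2 * |v K| ^ (2 * (s - 1))) * sobSum h v := by
  have h1 := sobolev_step (d := 2) le_rfl hℓ hh hM hs v
  have e1 : ∑ K, h ^ 2 * (|v K| ^ s) ^ (((2 : ℕ) : ℝ) / ((2 : ℕ) - 1))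
      = ∑ K, h ^ 2 * |v K| ^ (2 * s) := by
    refine Finset.sum_congr rfl fun K _ => ?_
    have : ((2 : ℕ) : ℝ) / ((2 : ℕ) - 1) = (2 : ℕ) := by norm_num
    rw [this, Real.rpow_natCast, ← pow_mul, mul_comm s]
  have e2 : ((2 : ℕ) : ℝ) / ((2 : ℕ) - 1) / 2 = 1 := by norm_num
  rw [e1, e2, Real.rpow_one] at h1
  refine h1.trans (le_of_eq ?_)
  push_cast
  ring

lemma sobolev_two_even {ℓ : ℝ} (hℓ : 0 < ℓ) (s : ℕ) : ∃ C, 0 ≤ C ∧ ∀ (M : ℕ) [NeZero M] (h : ℝ),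
    0 < h → (M : ℝ) * h = ℓ → ∀ v : Cell 2 M → ℝ,
    ∑ K, h ^ 2 * |v K| ^ (2 * (s + 1)) ≤ C * sobSum h v ^ (s + 1) := by
  induction s with
  | zero =>
    refine ⟨1, zero_le_one, fun M _ h hh hM v => ?_⟩
    simpa using sum_sq_le_sobSum hh.le v
  | succ s ih =>
    obtain ⟨C, hC, ih⟩ := ih
    refine ⟨4 * (1 / ℓ ^ 2 + 4 * (s + 2 : ℕ) ^ 2) * C, by positivity, fun M _ h hh hM v => ?_⟩
    have h1 := sobolev_two_step hℓ hh hM (s := s + 1 + 1) (by omega) v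
    have h2 := ih M h hh hM v
    have hH := sobSum_nonneg hh.le v
    refine h1.trans ?_
    rw [Nat.add_sub_cancel, pow_succ (sobSum h v) (s + 1)]
    calc _ ≤ 4 * (1 / ℓ ^ 2 + 4 * ((s + 1 + 1 : ℕ) : ℝ) ^ 2) * (C * sobSum h v ^ (s + 1))
          * sobSum h v := by gcongr
      _ = _ := by push_cast; ring

/-- Below an even exponent the embedding follows by scaling: with `A` the `H¹` norm, `(|v|/A)^p ≤ 1
+ (|v|/A)^(2(s+1))`. The degenerate case `A = 0` forces `v = 0`. -/
lemma sobolev_two {ℓ : ℝ} (hℓ : 0 < ℓ) {p : ℝ} (hp : 0 < p) : ∃ C, IsSobolevConst 2 ℓ p C := by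
  obtain ⟨s, hs⟩ := exists_nat_ge p
  obtain ⟨C, hC, h1⟩ := sobolev_two_even hℓ s
  refine ⟨ℓ ^ 2 + C, by positivity, fun M _ h hh hM v => ?_⟩
  have h2 := h1 M h hh hM v
  have hH := sobSum_nonneg hh.le v
  rcases hH.eq_or_lt with h0 | h0
  · have h3 := sum_sq_le_sobSum hh.le v
    rw [← h0] at h3 ⊢
    rw [Real.zero_rpow (by positivity), mul_zero]
    refine le_of_eq (Finset.sum_eq_zero fun K _ => ?_)
    have h4 := (Finset.sum_eq_zero_iff_of_nonneg (fun K _ => by positivity)).mp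
      (le_antisymm h3 (Finset.sum_nonneg fun _ _ => by positivity)) K (Finset.mem_univ K)
    have h5 : v K = 0 := by
      rcases mul_eq_zero.mp h4 with h | h
      · exact absurd h (by positivity)
      · exact pow_eq_zero_iff (two_ne_zero) |>.mp h
    rw [h5, abs_zero, Real.zero_rpow hp.ne', mul_zero]
  · set A := Real.sqrt (sobSum h v) with hA
    have hA0 : 0 < A := Real.sqrt_pos.mpr h0
    have hA2 : A ^ 2 = sobSum h v := Real.sq_sqrt hH
    have hAp : sobSum h v ^ (p / 2) = A ^ p := by
      rw [← hA2, ← Real.rpow_natCast A 2, ← Real.rpow_mul hA0.le]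
      congr 1
      push_cast
      ring
    have h3 : ∀ K, |v K| ^ p ≤ A ^ p * (1 + (|v K| / A) ^ (2 * (s + 1))) := by
      intro K
      have e1 : |v K| ^ p = A ^ p * (|v K| / A) ^ p := by
        rw [← Real.mul_rpow hA0.le (by positivity), mul_div_cancel₀ _ hA0.ne']
      rw [e1]
      refine mul_le_mul_of_nonneg_left ?_ (by positivity)
      rcases le_total (|v K| / A) 1 with h | h
      · have := Real.rpow_le_one (by positivity) h hp.le
        have : 0 ≤ (|v K| / A) ^ (2 * (s + 1)) := by positivity
        linarith
      · have := Real.rpow_le_rpow_of_exponent_le h (show p ≤ ((2 * (s + 1) : ℕ) : ℝ) by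
          push_cast; linarith [hp])
        rw [Real.rpow_natCast] at this
        linarith
    have h4 := Finset.sum_le_sum fun K (_ : K ∈ Finset.univ) =>
      mul_le_mul_of_nonneg_left (h3 K) (pow_nonneg hh.le 2)
    refine h4.trans ?_
    have e2 : ∑ K, h ^ 2 * (A ^ p * (1 + (|v K| / A) ^ (2 * (s + 1))))
        = A ^ p * (∑ _K : Cell 2 M, h ^ 2
          + (∑ K, h ^ 2 * |v K| ^ (2 * (s + 1))) / A ^ (2 * (s + 1))) := by
      rw [Finset.sum_div, ← Finset.sum_add_distrib, Finset.mul_sum]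
      refine Finset.sum_congr rfl fun K _ => ?_
      rw [div_pow]
      ring
    rw [e2, sum_cells_const hM, hAp, mul_comm]
    refine mul_le_mul_of_nonneg_right (add_le_add le_rfl ?_) (by positivity)
    rw [div_le_iff₀ (by positivity), pow_mul, hA2]
    exact h2

/-- Inverse estimate: the maximum norm is controlled by the `H¹` norm. -/
lemma IsSobolevConst.sq_le {ℓ p C : ℝ} (hC : IsSobolevConst d ℓ p C) (hp : 0 < p) {h : ℝ}
    (hh : 0 < h) (hM : (M : ℝ) * h = ℓ) (v : Cell d M → ℝ) (K : Cell d M) :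
    v K ^ 2 ≤ C ^ (2 / p) * h ^ (-(2 * d / p)) * sobSum h v := by
  have hH := sobSum_nonneg hh.le v
  have h1 : h ^ d * |v K| ^ p ≤ C * sobSum h v ^ (p / 2) :=
    (Finset.single_le_sum (f := fun K => h ^ d * |v K| ^ p) (fun _ _ => by positivity)
      (Finset.mem_univ K)).trans (hC.2 M h hh hM v)
  have h2 : |v K| ^ p ≤ C * sobSum h v ^ (p / 2) * h ^ (-(d : ℝ)) := by
    rw [Real.rpow_neg hh.le, Real.rpow_natCast, ← div_eq_mul_inv, le_div_iff₀ (by positivity)]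
    linarith
  have h3 := Real.rpow_le_rpow (by positivity) h2 (show 0 ≤ 2 / p by positivity)
  rw [← Real.rpow_mul (abs_nonneg _), mul_div_cancel₀ _ hp.ne', Real.rpow_two, sq_abs,
    Real.mul_rpow (mul_nonneg hC.1 (by positivity)) (by positivity), Real.mul_rpow hC.1 (by positivity),
    ← Real.rpow_mul hH, ← Real.rpow_mul hh.le] at h3
  have e1 : p / 2 * (2 / p) = 1 := by field_simp
  have e2 : -(d : ℝ) * (2 / p) = -(2 * d / p) := by ring
  rw [e1, e2, Real.rpow_one] at h3
  linarith

end Sobolev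

end FV

namespace FV

/-! ### Space-time bounds of the velocity and the density. -/

section SpaceTimeBounds

set_option linter.unusedSectionVars false

variable {d M : ℕ} [NeZero M]

lemma sum_sobSum_comp (h : ℝ) (u : Cell d M → Fin d → ℝ) :
    ∑ j, sobSum h (comp u j) = ∑ K, h ^ d * ∑ j, u K j ^ 2 + gradSum h u := by
  simp only [sobSum, Finset.sum_add_distrib, gradSum, Finset.mul_sum]
  congr 1
  · rw [Finset.sum_comm]
    rfl
  · rw [Finset.sum_comm]
    refine Finset.sum_congr rfl fun i _ => ?_
    rw [Finset.sum_comm]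

/-- The square root type density variable `ϱ^(γ/2)`. -/
noncomputable def rootDensity (γ : ℝ) (r : Cell d M → ℝ) (K : Cell d M) : ℝ := r K ^ (γ / 2)

lemma rootDensity_sq {γ : ℝ} {r : Cell d M → ℝ} {K : Cell d M} (hr : 0 < r K) :
    rootDensity γ r K ^ 2 = r K ^ γ := by
  rw [rootDensity, ← Real.rpow_natCast, ← Real.rpow_mul hr.le]
  congr 1
  push_cast
  ring

variable {Ω : Set (Space d)} {γ α ℓ T : ℝ} {N : ℕ} {Δt h ε : ℝ} {ρ : ℕ → Cell d M → ℝ}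
  {u : ℕ → Cell d M → Fin d → ℝ} {E : ℝ}

lemma EnergyBounds.nonneg (B : EnergyBounds Ω γ α N Δt h ε ρ u E) (hh : 0 < h) : 0 ≤ E :=
  (Finset.sum_nonneg fun K _ => mul_nonneg (by positivity)
    (Real.rpow_nonneg (B.pos 0 (by omega) K).le _)).trans (B.internal 0 (by omega))

/-- Poincaré at each time level; since `ε ≤ 1`, the penalized part is no larger than `E`. -/
lemma EnergyBounds.sum_sobSum_velocity (B : EnergyBounds Ω γ α N Δt h ε ρ u E) (ht : 0 < Δt)
    (hh : 0 < h) (hε1 : ε ≤ 1) {C : ℝ} (hC0 : 0 ≤ C)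
    (hC : ∀ u : Cell d M → Fin d → ℝ,
        ∑ K, h ^ d * ∑ j, u K j ^ 2 ≤ C * (solidSum Ω h u + gradSum h u)) :
    ∑ k ∈ Finset.range N, Δt * ∑ j, sobSum h (comp (u (k + 1)) j) ≤ (2 * C + 1) * E := by
  have hE := B.nonneg hh
  have h1 : ∀ k ∈ Finset.range N, Δt * ∑ j, sobSum h (comp (u (k + 1)) j)
      ≤ C * (Δt * solidSum Ω h (u (k + 1))) + (C + 1) * (Δt * gradSum h (u (k + 1))) := by
    intro k _
    rw [sum_sobSum_comp]
    nlinarith [mul_le_mul_of_nonneg_left (hC (u (k + 1))) ht.le]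
  refine (Finset.sum_le_sum h1).trans ?_
  have h3 : ∑ k ∈ Finset.range N, (C * (Δt * solidSum Ω h (u (k + 1)))
      + (C + 1) * (Δt * gradSum h (u (k + 1))))
      = C * ∑ k ∈ Finset.range N, Δt * solidSum Ω h (u (k + 1))
        + (C + 1) * ∑ k ∈ Finset.range N, Δt * gradSum h (u (k + 1)) := by
    rw [Finset.sum_add_distrib, Finset.mul_sum, Finset.mul_sum]
  rw [h3]
  have h2 : ∑ k ∈ Finset.range N, Δt * solidSum Ω h (u (k + 1)) ≤ E :=
    B.solid.trans (mul_le_of_le_one_right hE hε1)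
  nlinarith [mul_le_mul_of_nonneg_left h2 hC0,
    mul_le_mul_of_nonneg_left B.grad (by linarith : 0 ≤ C + 1)]

/-- The dissipation weighs squared jumps of `ϱ^(γ/2)` by `h^(d-1+α)`, the `H¹` seminorm by
`h^(d-2)`; the quotient is the loss `h^(-(1+α))`. -/
lemma EnergyBounds.sum_sobSum_root (hd : 2 ≤ d) (B : EnergyBounds Ω γ α N Δt h ε ρ u E)
    (hγ : γ ≤ 2) (hα : -1 < α) (ht : 0 < Δt) (hh : 0 < h) (hh1 : h < 1) (hN : (N : ℝ) * Δt = T) :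
    ∑ k ∈ Finset.range N, Δt * sobSum h (rootDensity γ (ρ (k + 1)))
      ≤ (T + 1) * E * h ^ (-(1 + α)) := by
  have hE := B.nonneg hh
  have hT : 0 ≤ T := by rw [← hN]; positivity
  have hA1 : 1 ≤ h ^ (-(1 + α)) := Real.one_le_rpow_of_pos_of_le_one_of_nonpos hh hh1.le (by linarith)
  have h1 : ∀ k ∈ Finset.range N, Δt * sobSum h (rootDensity γ (ρ (k + 1)))
      ≤ Δt * E + h ^ (-(1 + α)) * (Δt * ∑ i, ∑ K, h ^ (d - 1) *
        (h ^ α * (ρ (k + 1) K ^ (γ / 2) - ρ (k + 1) (nxt i K) ^ (γ / 2)) ^ 2)) := by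
    intro k hk
    have hk' : k + 1 ≤ N := Finset.mem_range.mp hk
    have e1 : ∑ K, h ^ d * rootDensity γ (ρ (k + 1)) K ^ 2 ≤ E := by
      refine le_trans (le_of_eq (Finset.sum_congr rfl fun K _ => ?_)) (B.internal (k + 1) hk')
      rw [rootDensity_sq (B.pos _ hk' K)]
    have e2 : ∑ i, ∑ K, h ^ d * (jump i (rootDensity γ (ρ (k + 1))) K / h) ^ 2
        = h ^ (-(1 + α)) * ∑ i, ∑ K, h ^ (d - 1) *
        (h ^ α * (ρ (k + 1) K ^ (γ / 2) - ρ (k + 1) (nxt i K) ^ (γ / 2)) ^ 2) := by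
      simp only [Finset.mul_sum]
      refine Finset.sum_congr rfl fun i _ => Finset.sum_congr rfl fun K _ => ?_
      have e3 : h ^ (-(1 + α)) * h ^ α = h⁻¹ := by
        rw [← Real.rpow_add hh, ← Real.rpow_neg_one]
        congr 1
        ring
      simp only [jump, rootDensity]
      rw [mul_left_comm, ← mul_assoc (h ^ (-(1 + α))), e3, pow_eq_pow_pred_mul (by omega : d ≠ 0)]
      field_simp
      ring
    rw [sobSum, e2]
    nlinarith [mul_le_mul_of_nonneg_left e1 ht.le]
  refine (Finset.sum_le_sum h1).trans ?_
  rw [Finset.sum_add_distrib, Finset.sum_const, Finset.card_range, nsmul_eq_mul, ← mul_assoc, hN,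
    ← Finset.mul_sum (Finset.range N)]
  have h2 := mul_le_mul_of_nonneg_left (B.root_jump hγ) (by linarith : 0 ≤ h ^ (-(1 + α)))
  nlinarith [mul_le_mul_of_nonneg_left hA1 (mul_nonneg hT hE)]

lemma EnergyBounds.rpow_density_le (B : EnergyBounds Ω γ α N Δt h ε ρ u E) (hh : 0 < h)
    {k : ℕ} (hk : k ≤ N) (K : Cell d M) : ρ k K ^ γ ≤ E * h ^ (-(d : ℝ)) := by
  have h1 := (Finset.single_le_sum (f := fun K => h ^ d * ρ k K ^ γ)
    (fun K _ => mul_nonneg (by positivity) (Real.rpow_nonneg (B.pos k hk K).le _))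
    (Finset.mem_univ K)).trans (B.internal k hk)
  rw [Real.rpow_neg hh.le, Real.rpow_natCast, ← div_eq_mul_inv, le_div_iff₀ (by positivity)]
  linarith

/-- Inverse estimate: one cell, of volume `h^d`, carries at most the whole internal energy. -/
lemma EnergyBounds.density_le (B : EnergyBounds Ω γ α N Δt h ε ρ u E) (hγ : 1 < γ) (hh : 0 < h)
    {k : ℕ} (hk : k ≤ N) (K : Cell d M) : ρ k K ≤ E ^ (1 / γ) * h ^ (-(d : ℝ) / γ) := by
  have h1 := Real.rpow_le_rpow (Real.rpow_nonneg (B.pos k hk K).le _) (B.rpow_density_le hh hk K)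
    (by positivity : 0 ≤ 1 / γ)
  rw [← Real.rpow_mul (B.pos k hk K).le, mul_one_div_cancel (by linarith), Real.rpow_one,
    Real.mul_rpow (B.nonneg hh) (by positivity), ← Real.rpow_mul hh.le] at h1
  rwa [div_eq_mul_one_div (-(d : ℝ))]

lemma EnergyBounds.mass_le (B : EnergyBounds Ω γ α N Δt h ε ρ u E) (hγ : 1 < γ) (hh : 0 < h)
    (hM : (M : ℝ) * h = ℓ) {k : ℕ} (hk : k ≤ N) : ∑ K, h ^ d * ρ k K ≤ ℓ ^ d + E := by
  refine (Finset.sum_le_sum fun K _ => mul_le_mul_of_nonneg_left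
    (le_one_add_rpow hγ.le (B.pos k hk K).le) (by positivity)).trans ?_
  simp only [mul_add, mul_one, Finset.sum_add_distrib]
  rw [sum_cells_const hM]
  linarith [B.internal k hk]

/-- Concave powers are dominated by affine functions of matching scale. -/
lemma rpow_le_scale {y A s : ℝ} (hy : 0 ≤ y) (hA : 0 < A) (h0 : 0 ≤ s) (h1 : s ≤ 1) :
    y ^ s ≤ A ^ s * (1 + y / A) := by
  have : y ^ s = A ^ s * (y / A) ^ s := by
    rw [← Real.mul_rpow hA.le (by positivity), mul_div_cancel₀ _ hA.ne']
  rw [this]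
  exact mul_le_mul_of_nonneg_left (rpow_le_one_add (by positivity) h0 h1) (by positivity)

/-- Interpolation of `L⁴` between `L²` and `H¹` (with an inverse estimate if `d = 3`). -/
lemma exists_four_bound (hd : d = 2 ∨ d = 3) {ℓ : ℝ} (hℓ : 0 < ℓ) : ∃ C, 0 ≤ C ∧
    ∀ (M : ℕ) [NeZero M] (h : ℝ), 0 < h → (M : ℝ) * h = ℓ → ∀ v : Cell d M → ℝ,
    ∑ K, h ^ d * v K ^ 4 ≤ C * h ^ (-((d : ℝ) - 2)) * (∑ K, h ^ d * v K ^ 2) * sobSum h v := by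
  rcases hd with rfl | rfl
  · refine ⟨4 * (1 / ℓ ^ 2 + 4 * (2 : ℕ) ^ 2), by positivity, fun M _ h hh hM v => ?_⟩
    have h1 := sobolev_two_step hℓ hh hM (s := 2) (by norm_num) v
    have e : -(((2 : ℕ) : ℝ) - 2) = 0 := by norm_num
    rw [e, Real.rpow_zero, mul_one]
    have e1 : ∀ K, |v K| ^ (2 * 2) = v K ^ 4 := fun K => (even_two_mul 2).pow_abs (v K)
    have e2 : ∀ K, |v K| ^ (2 * (2 - 1)) = v K ^ 2 := fun K => sq_abs (v K)
    simp only [e1, e2] at h1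
    exact h1
  · obtain ⟨C, hC⟩ := sobolev_three hℓ
    -- In three dimensions `v⁴ ≤ ‖v‖_∞² v²`, and the inverse estimate through `L⁶` loses `h^(-2·3/6)
    -- = h^(-(d-2))`.
    refine ⟨C ^ ((2 : ℝ) / 6), by have := hC.1; positivity, fun M _ h hh hM v => ?_⟩
    have h1 := hC.sq_le (by norm_num) hh hM v
    have e : -(((3 : ℕ) : ℝ) - 2) = -(2 * ((3 : ℕ) : ℝ) / 6) := by norm_num
    rw [e, Finset.mul_sum, Finset.sum_mul]
    refine Finset.sum_le_sum fun K _ => ?_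
    have := mul_le_mul_of_nonneg_left (h1 K) (by positivity : 0 ≤ h ^ 3 * v K ^ 2)
    nlinarith

/-- Space-time square integrability of the density, with the rate `β_D`. -/
lemma exists_density_sq_bound (hd : d = 2 ∨ d = 3) (hℓ : 0 < ℓ) (hγ : 1 < γ) (hα : -1 < α)
    (hE : 0 ≤ E) (hT : 0 < T) : ∃ C, 0 ≤ C ∧ ∀ (M : ℕ) [NeZero M] (N : ℕ) (Δt h ε : ℝ)
      (Ω : Set (Space d)) (ρ : ℕ → Cell d M → ℝ) (u : ℕ → Cell d M → Fin d → ℝ),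
      0 < Δt → 0 < h → h < 1 → (N : ℝ) * Δt = T → (M : ℝ) * h = ℓ →
      EnergyBounds Ω γ α N Δt h ε ρ u E →
      ∑ k ∈ Finset.range N, Δt * ∑ K, h ^ d * ρ (k + 1) K ^ 2 ≤ C * h ^ (2 * betaD d γ α) := by
  have hγ0 : 0 < γ := by linarith
  obtain ⟨C₄, hC₄, h4⟩ := exists_four_bound hd hℓ
  rcases le_or_gt 2 γ with h2 | h2
  · refine ⟨T * (ℓ ^ d + E), by positivity, fun M _ N Δt h ε Ω ρ u ht hh hh1 hN hM B => ?_⟩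
    rw [betaD, if_pos h2, mul_zero, Real.rpow_zero, mul_one, ← hN, mul_assoc, ← nsmul_eq_mul,
      ← Finset.card_range N, ← Finset.sum_const, Finset.card_range]
    refine Finset.sum_le_sum fun k hk => mul_le_mul_of_nonneg_left ?_ ht.le
    have hk' : k + 1 ≤ N := Finset.mem_range.mp hk
    refine (Finset.sum_le_sum fun K _ => mul_le_mul_of_nonneg_left
      (sq_le_one_add_rpow h2 (B.pos _ hk' K).le) (by positivity)).trans ?_
    simp only [mul_add, mul_one, Finset.sum_add_distrib]
    rw [sum_cells_const hM]
    linarith [B.internal _ hk']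
  -- This exponent gives `ϱ² = ϱ^γ · (ϱ^γ)^s` with `0 ≤ s ≤ 1`, which reduces the `L²` norm to the
  -- internal energy density and a concave power of it.
  · set s := (2 - γ) / γ with hs
    have hs0 : 0 ≤ s := div_nonneg (by linarith) hγ0.le
    have hs1 : s ≤ 1 := by rw [hs, div_le_one hγ0]; linarith
    -- Because `h < 1` it suffices to reach an exponent no smaller than `2β_D`. For `d = 2` the
    -- infimum over `p` is bounded below by its limiting value `min ((α+1)/2) 1`, and the factor
    -- `(γ-2)/γ` reverses the inequality.
    have hβ : 2 * betaD d γ α ≤ -(min (α + d - 1) d * s) := by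
      have e : (γ - 2) / γ = -s := by rw [hs]; ring
      rw [betaD, if_neg (not_le.mpr h2)]
      rcases hd with rfl | rfl
      · rw [if_pos rfl, e]
        have h5 : min ((α + 1) / 2) 1 ≤ ⨅ p : Ici (1 : ℝ), min (((p : ℝ) * (α + 1) + 4) / (2 * (p : ℝ))) 1 := by
          have : Nonempty (Ici (1 : ℝ)) := ⟨⟨1, mem_Ici.mpr le_rfl⟩⟩
          refine le_ciInf fun p => min_le_min ?_ le_rfl
          have hp : (0 : ℝ) < p := lt_of_lt_of_le one_pos p.2
          rw [div_le_div_iff₀ (by norm_num) (by positivity)]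
          nlinarith
        have h6 : min (α + (2 : ℕ) - 1) (2 : ℕ) = 2 * min ((α + 1) / 2) 1 := by
          rw [mul_min_of_nonneg _ _ (by norm_num)]
          push_cast
          congr 1 <;> ring
        rw [h6]
        nlinarith [mul_le_mul_of_nonneg_right h5 hs0]
      · rw [if_neg (by norm_num)]
        have h6 : min (α + (3 : ℕ) - 1) (3 : ℕ) = 3 * min ((α + 2) / 3) 1 := by
          rw [mul_min_of_nonneg _ _ (by norm_num)]
          push_cast
          congr 1 <;> ring
        have e2 : 3 * (γ - 2) / (2 * γ) = 3 / 2 * -s := by rw [← e]; field_simp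
        rw [h6, e2]
        apply le_of_eq
        ring
    refine ⟨(T * E + C₄ * E * ((T + 1) * E)) + E ^ s * (T * E), by positivity,
      fun M _ N Δt h ε Ω ρ u ht hh hh1 hN hM B => ?_⟩
    have hsplit : ∀ k, k + 1 ≤ N → ∀ K, ρ (k + 1) K ^ 2
        = ρ (k + 1) K ^ γ * (ρ (k + 1) K ^ γ) ^ s := by
      intro k hk K
      have hp := B.pos _ hk K
      rw [← Real.rpow_mul hp.le, ← Real.rpow_add hp, ← Real.rpow_two]
      congr 1
      rw [hs]
      field_simp
      ring
    have hint : ∑ k ∈ Finset.range N, Δt * ∑ K, h ^ d * ρ (k + 1) K ^ γ ≤ T * E := by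
      rw [← hN, mul_assoc, ← nsmul_eq_mul, ← Finset.card_range N, ← Finset.sum_const,
        Finset.card_range]
      exact Finset.sum_le_sum fun k hk => mul_le_mul_of_nonneg_left
        (B.internal _ (Finset.mem_range.mp hk)) ht.le
    have hint0 : 0 ≤ ∑ k ∈ Finset.range N, Δt * ∑ K, h ^ d * ρ (k + 1) K ^ γ :=
      Finset.sum_nonneg fun k hk => mul_nonneg ht.le (Finset.sum_nonneg fun K _ =>
        mul_nonneg (by positivity) (Real.rpow_nonneg (B.pos _ (Finset.mem_range.mp hk) K).le _))
    -- For `α ≤ 1` the numerical diffusion is strong enough: an `L²` bound of `ϱ^γ`, of size `A`,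
    -- comes from the `L⁴` estimate of `ϱ^(γ/2)`, and `(ϱ^γ)^s` is linearized at scale `A`. For `α ≥
    -- 1` the plain inverse estimate of `ϱ^γ` is at least as good.
    rcases le_total (α + d - 1) d with hα1 | hα1
    · rw [min_eq_left hα1] at hβ
      set A := h ^ (-(α + d - 1)) with hA
      have hA0 : 0 < A := Real.rpow_pos_of_pos hh _
      have h5 : ∑ k ∈ Finset.range N, Δt * ∑ K, h ^ d * (ρ (k + 1) K ^ γ) ^ 2
          ≤ C₄ * E * ((T + 1) * E) * A := by
        have h6 : ∀ k ∈ Finset.range N, Δt * ∑ K, h ^ d * (ρ (k + 1) K ^ γ) ^ 2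
            ≤ C₄ * E * h ^ (-((d : ℝ) - 2)) * (Δt * sobSum h (rootDensity γ (ρ (k + 1)))) := by
          intro k hk
          have hk' : k + 1 ≤ N := Finset.mem_range.mp hk
          have h7 := h4 M h hh hM (rootDensity γ (ρ (k + 1)))
          have e1 : ∀ K, rootDensity γ (ρ (k + 1)) K ^ 4 = (ρ (k + 1) K ^ γ) ^ 2 := fun K => by
            rw [← rootDensity_sq (B.pos _ hk' K)]; ring
          have e2 : ∀ K, rootDensity γ (ρ (k + 1)) K ^ 2 = ρ (k + 1) K ^ γ := fun K =>
            rootDensity_sq (B.pos _ hk' K)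
          simp only [e1, e2] at h7
          have h8 := sobSum_nonneg hh.le (rootDensity γ (ρ (k + 1)))
          have h9 : C₄ * h ^ (-((d : ℝ) - 2)) * (∑ K, h ^ d * ρ (k + 1) K ^ γ)
              ≤ C₄ * h ^ (-((d : ℝ) - 2)) * E :=
            mul_le_mul_of_nonneg_left (B.internal _ hk') (by positivity)
          have h10 := mul_le_mul_of_nonneg_left (h7.trans (mul_le_mul_of_nonneg_right h9 h8)) ht.le
          linarith
        refine (Finset.sum_le_sum h6).trans ?_
        rw [← Finset.mul_sum]
        have h11 := B.sum_sobSum_root (by omega) h2.le hα ht hh hh1 hN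
        have e3 : h ^ (-((d : ℝ) - 2)) * h ^ (-(1 + α)) = A := by
          rw [← Real.rpow_add hh, hA]
          congr 1
          ring
        calc _ ≤ C₄ * E * h ^ (-((d : ℝ) - 2)) * ((T + 1) * E * h ^ (-(1 + α))) :=
              mul_le_mul_of_nonneg_left h11 (by positivity)
          _ = C₄ * E * ((T + 1) * E) * (h ^ (-((d : ℝ) - 2)) * h ^ (-(1 + α))) := by ring
          _ = _ := by rw [e3]
      have h6 : ∀ k ∈ Finset.range N, Δt * ∑ K, h ^ d * ρ (k + 1) K ^ 2
          ≤ A ^ s * (Δt * ∑ K, h ^ d * ρ (k + 1) K ^ γ)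
            + A ^ s * (Δt * ∑ K, h ^ d * (ρ (k + 1) K ^ γ) ^ 2) / A := by
        intro k hk
        have hk' : k + 1 ≤ N := Finset.mem_range.mp hk
        have e : A ^ s * (Δt * ∑ K, h ^ d * ρ (k + 1) K ^ γ)
            + A ^ s * (Δt * ∑ K, h ^ d * (ρ (k + 1) K ^ γ) ^ 2) / A
            = Δt * ∑ K, h ^ d * (ρ (k + 1) K ^ γ * (A ^ s * (1 + ρ (k + 1) K ^ γ / A))) := by
          simp only [Finset.mul_sum, Finset.sum_div]
          rw [← Finset.sum_add_distrib]
          exact Finset.sum_congr rfl fun K _ => by ring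
        rw [e]
        refine mul_le_mul_of_nonneg_left (Finset.sum_le_sum fun K _ =>
          mul_le_mul_of_nonneg_left ?_ (by positivity)) ht.le
        have hp := Real.rpow_nonneg (B.pos _ hk' K).le γ
        rw [hsplit k hk' K]
        exact mul_le_mul_of_nonneg_left (rpow_le_scale hp hA0 hs0 hs1) hp
      have h7 : ∑ k ∈ Finset.range N, Δt * ∑ K, h ^ d * ρ (k + 1) K ^ 2
          ≤ A ^ s * (T * E + C₄ * E * ((T + 1) * E)) := by
        refine (Finset.sum_le_sum h6).trans ?_
        rw [Finset.sum_add_distrib, ← Finset.sum_div]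
        have h12 := Finset.mul_sum (Finset.range N)
          (fun k => Δt * ∑ K, h ^ d * ρ (k + 1) K ^ γ) (A ^ s)
        have h13 := Finset.mul_sum (Finset.range N)
          (fun k => Δt * ∑ K, h ^ d * (ρ (k + 1) K ^ γ) ^ 2) (A ^ s)
        rw [← h12, ← h13]
        have hAs : 0 ≤ A ^ s := by positivity
        have h8 : A ^ s * (∑ k ∈ Finset.range N, Δt * ∑ K, h ^ d * (ρ (k + 1) K ^ γ) ^ 2) / A
            ≤ A ^ s * (C₄ * E * ((T + 1) * E)) := by
          rw [div_le_iff₀ hA0, mul_assoc]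
          exact mul_le_mul_of_nonneg_left h5 hAs
        nlinarith [mul_le_mul_of_nonneg_left hint hAs]
      have h8 : A ^ s ≤ h ^ (2 * betaD d γ α) := by
        rw [hA, ← Real.rpow_mul hh.le]
        exact Real.rpow_le_rpow_of_exponent_ge hh hh1.le (by linarith)
      have h9 : (0 : ℝ) ≤ T * E + C₄ * E * ((T + 1) * E) := by positivity
      have h10 : (0 : ℝ) ≤ E ^ s * (T * E) := by positivity
      have h11 : 0 ≤ h ^ (2 * betaD d γ α) := by positivity
      nlinarith [mul_le_mul_of_nonneg_right h8 h9, mul_nonneg h10 h11]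
    · rw [min_eq_right hα1] at hβ
      have h6 : ∀ k ∈ Finset.range N, Δt * ∑ K, h ^ d * ρ (k + 1) K ^ 2
          ≤ (E * h ^ (-(d : ℝ))) ^ s * (Δt * ∑ K, h ^ d * ρ (k + 1) K ^ γ) := by
        intro k hk
        have hk' : k + 1 ≤ N := Finset.mem_range.mp hk
        have e : (E * h ^ (-(d : ℝ))) ^ s * (Δt * ∑ K, h ^ d * ρ (k + 1) K ^ γ)
            = Δt * ∑ K, h ^ d * (ρ (k + 1) K ^ γ * (E * h ^ (-(d : ℝ))) ^ s) := by
          simp only [Finset.mul_sum]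
          exact Finset.sum_congr rfl fun K _ => by ring
        rw [e]
        refine mul_le_mul_of_nonneg_left (Finset.sum_le_sum fun K _ => ?_) ht.le
        have hp := Real.rpow_nonneg (B.pos _ hk' K).le γ
        rw [hsplit k hk' K]
        exact mul_le_mul_of_nonneg_left (mul_le_mul_of_nonneg_left
          (Real.rpow_le_rpow hp (B.rpow_density_le hh hk' K) hs0) hp) (by positivity)
      refine (Finset.sum_le_sum h6).trans ?_
      rw [← Finset.mul_sum (Finset.range N), Real.mul_rpow hE (by positivity), ← Real.rpow_mul hh.le]
      have h8 : h ^ (-(d : ℝ) * s) ≤ h ^ (2 * betaD d γ α) :=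
        Real.rpow_le_rpow_of_exponent_ge hh hh1.le (by linarith)
      have h9 : (0 : ℝ) ≤ T * E + C₄ * E * ((T + 1) * E) := by positivity
      have h10 : (0 : ℝ) ≤ E ^ s := by positivity
      have h11 : 0 ≤ h ^ (2 * betaD d γ α) := by positivity
      calc _ ≤ E ^ s * h ^ (2 * betaD d γ α) * (T * E) := by gcongr
        _ ≤ _ := by nlinarith [mul_nonneg h9 h11]

end SpaceTimeBounds

end FV

namespace FV

/-! ### Space-time square integrability of the momentum. -/

section MomentumBound

set_option linter.unusedSectionVars false

variable {d M : ℕ} [NeZero M]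

/-- Hölder with exponents `p/(p-2)` and `p/2`, the cell volume being distributed between the
factors, followed by the Sobolev embedding of the velocity component. -/
lemma holder_sobolev {ℓ p C : ℝ} (hC : IsSobolevConst d ℓ p C) (hp : 2 < p) {h : ℝ} (hh : 0 < h)
    (hM : (M : ℝ) * h = ℓ) {r : Cell d M → ℝ} (hr : ∀ K, 0 ≤ r K) (v : Cell d M → ℝ) :
    ∑ K, h ^ d * (r K ^ 2 * v K ^ 2)
      ≤ (∑ K, h ^ d * r K ^ (2 * p / (p - 2))) ^ ((p - 2) / p) * (C ^ (2 / p) * sobSum h v) := by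
  have hp0 : 0 < p := by linarith
  have hp2 : 0 < p - 2 := by linarith
  have hpq : (p / (p - 2)).HolderConjugate (p / 2) := by
    rw [Real.holderConjugate_iff]
    refine ⟨by rw [one_lt_div hp2]; linarith, ?_⟩
    field_simp
    ring
  have h1 := Real.inner_le_Lp_mul_Lq_of_nonneg Finset.univ hpq
    (f := fun K : Cell d M => (h ^ d) ^ ((p - 2) / p) * r K ^ 2)
    (g := fun K : Cell d M => (h ^ d) ^ (2 / p) * v K ^ 2)
    (fun K _ => by positivity) (fun K _ => by positivity)
  have e0 : (h ^ d) ^ ((p - 2) / p) * (h ^ d) ^ (2 / p) = h ^ d := by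
    rw [← Real.rpow_add (by positivity)]
    have : (p - 2) / p + 2 / p = 1 := by field_simp; ring
    rw [this, Real.rpow_one]
  have e1 : ∀ K, (h ^ d) ^ ((p - 2) / p) * r K ^ 2 * ((h ^ d) ^ (2 / p) * v K ^ 2)
      = h ^ d * (r K ^ 2 * v K ^ 2) := fun K => by
    rw [mul_mul_mul_comm, e0]
  have e2 : ∀ K, ((h ^ d) ^ ((p - 2) / p) * r K ^ 2) ^ (p / (p - 2))
      = h ^ d * r K ^ (2 * p / (p - 2)) := fun K => by
    rw [Real.mul_rpow (by positivity) (by positivity), ← Real.rpow_mul (by positivity),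
      ← Real.rpow_natCast (r K) 2, ← Real.rpow_mul (hr K)]
    congr 1
    · have : (p - 2) / p * (p / (p - 2)) = 1 := by field_simp
      rw [this, Real.rpow_one]
    · congr 1
      push_cast
      ring
  have e3 : ∀ K, ((h ^ d) ^ (2 / p) * v K ^ 2) ^ (p / 2) = h ^ d * |v K| ^ p := fun K => by
    rw [Real.mul_rpow (by positivity) (by positivity), ← Real.rpow_mul (by positivity),
      ← sq_abs, ← Real.rpow_natCast |v K| 2, ← Real.rpow_mul (abs_nonneg _)]
    congr 1
    · have : 2 / p * (p / 2) = 1 := by field_simp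
      rw [this, Real.rpow_one]
    · congr 1
      push_cast
      ring
  simp only [e1, e2, e3, one_div_div] at h1
  refine h1.trans (mul_le_mul_of_nonneg_left ?_ (Real.rpow_nonneg
    (Finset.sum_nonneg fun K _ => mul_nonneg (by positivity) (Real.rpow_nonneg (hr K) _)) _))
  have hs := sobSum_nonneg hh.le v
  refine (Real.rpow_le_rpow (Finset.sum_nonneg fun K _ => by positivity) (hC.2 M h hh hM v)
    (by positivity)).trans (le_of_eq ?_)
  rw [Real.mul_rpow hC.1 (by positivity), ← Real.rpow_mul hs]
  have : p / 2 * (2 / p) = 1 := by field_simp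
  rw [this, Real.rpow_one]

variable {Ω : Set (Space d)} {γ α ℓ T : ℝ} {N : ℕ} {Δt h ε : ℝ} {ρ : ℕ → Cell d M → ℝ}
  {u : ℕ → Cell d M → Fin d → ℝ} {E V : ℝ}

/-- Space-time sum of `|ϱu|²`. -/
noncomputable def momentumSum (N : ℕ) (Δt h : ℝ) (ρ : ℕ → Cell d M → ℝ)
    (u : ℕ → Cell d M → Fin d → ℝ) : ℝ :=
  ∑ k ∈ Finset.range N, Δt * ∑ K, h ^ d * (ρ (k + 1) K ^ 2 * ∑ j, u (k + 1) K j ^ 2)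

lemma momentumSum_le_of_density {p C R : ℝ} (hC : IsSobolevConst d ℓ p C) (hp : 2 < p)
    (B : EnergyBounds Ω γ α N Δt h ε ρ u E) (ht : 0 < Δt) (hh : 0 < h) (hM : (M : ℝ) * h = ℓ)
    (hV : ∑ k ∈ Finset.range N, Δt * ∑ j, sobSum h (comp (u (k + 1)) j) ≤ V)
    (hR : ∀ k ≤ N, ∑ K, h ^ d * ρ k K ^ (2 * p / (p - 2)) ≤ R) :
    momentumSum N Δt h ρ u ≤ R ^ ((p - 2) / p) * C ^ (2 / p) * V := by
  have hp2 : 0 ≤ (p - 2) / p := div_nonneg (by linarith) (by linarith)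
  have hnn : ∀ k ≤ N, 0 ≤ ∑ K, h ^ d * ρ k K ^ (2 * p / (p - 2)) := fun k hk =>
    Finset.sum_nonneg fun K _ => mul_nonneg (by positivity) (Real.rpow_nonneg (B.pos k hk K).le _)
  have hR0 : 0 ≤ R := (hnn 0 (by omega)).trans (hR 0 (by omega))
  have hC0 := hC.1
  refine le_trans ?_ (mul_le_mul_of_nonneg_left hV (by positivity))
  rw [momentumSum, Finset.mul_sum]
  refine Finset.sum_le_sum fun k hk => ?_
  have hk' : k + 1 ≤ N := Finset.mem_range.mp hk
  rw [mul_left_comm]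
  refine mul_le_mul_of_nonneg_left ?_ ht.le
  have e : ∑ K, h ^ d * (ρ (k + 1) K ^ 2 * ∑ j, u (k + 1) K j ^ 2)
      = ∑ j, ∑ K, h ^ d * (ρ (k + 1) K ^ 2 * comp (u (k + 1)) j K ^ 2) := by
    rw [Finset.sum_comm]
    simp only [Finset.mul_sum, comp]
  rw [e, Finset.mul_sum]
  refine Finset.sum_le_sum fun j _ => (holder_sobolev hC hp hh hM (fun K => (B.pos _ hk' K).le)
    (comp (u (k + 1)) j)).trans ?_
  rw [mul_assoc]
  have hs := sobSum_nonneg hh.le (comp (u (k + 1)) j)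
  exact mul_le_mul_of_nonneg_right (Real.rpow_le_rpow (hnn _ hk') (hR _ hk') hp2) (by positivity)

lemma EnergyBounds.sum_rpow_le (B : EnergyBounds Ω γ α N Δt h ε ρ u E) (hγ : 1 < γ) (hh : 0 < h)
    {q : ℝ} (hq : γ ≤ q) {k : ℕ} (hk : k ≤ N) :
    ∑ K, h ^ d * ρ k K ^ q ≤ (E ^ (1 / γ) * h ^ (-(d : ℝ) / γ)) ^ (q - γ) * E := by
  have hE := B.nonneg hh
  refine le_trans ?_ (mul_le_mul_of_nonneg_left (B.internal k hk) (by positivity))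
  rw [Finset.mul_sum]
  refine Finset.sum_le_sum fun K _ => ?_
  have hp := B.pos k hk K
  have e : ρ k K ^ q = ρ k K ^ (q - γ) * ρ k K ^ γ := by
    rw [← Real.rpow_add hp]; congr 1; ring
  rw [mul_left_comm, e]
  refine mul_le_mul_of_nonneg_left (mul_le_mul_of_nonneg_right
    (Real.rpow_le_rpow hp.le (B.density_le hγ hh hk K) (by linarith)) (by positivity))
    (by positivity)

/-- When `2p/(p-2)` is at least `γ`, the density norm required by Hölder is lifted from `L^γ` by an
inverse estimate. This gives the alternatives in `β_M` that do not involve `α` and stem from the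
velocity gradient. -/
lemma momentumSum_le_of_inverse {p C : ℝ} (hC : IsSobolevConst d ℓ p C) (hp : 2 < p)
    (hγ : 1 < γ) (hq : γ ≤ 2 * p / (p - 2))
    (B : EnergyBounds Ω γ α N Δt h ε ρ u E) (ht : 0 < Δt) (hh : 0 < h) (hM : (M : ℝ) * h = ℓ)
    (hV : ∑ k ∈ Finset.range N, Δt * ∑ j, sobSum h (comp (u (k + 1)) j) ≤ V) :
    momentumSum N Δt h ρ u ≤ (E ^ (2 / γ) * C ^ (2 / p) * V)
      * h ^ (2 * (d * (1 / 2 - 1 / p - 1 / γ))) := by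
  have hE := B.nonneg hh
  have h1 := momentumSum_le_of_density hC hp B ht hh hM hV
    (fun k hk => B.sum_rpow_le hγ hh hq hk)
  refine h1.trans (le_of_eq ?_)
  have hp0 : 0 < p := by linarith
  have hp2 : 0 < p - 2 := by linarith
  have hγ0 : 0 < γ := by linarith
  have e : ((E ^ (1 / γ) * h ^ (-(d : ℝ) / γ)) ^ (2 * p / (p - 2) - γ) * E) ^ ((p - 2) / p)
      = E ^ (2 / γ) * h ^ (2 * (d * (1 / 2 - 1 / p - 1 / γ))) := by
    rw [Real.mul_rpow (by positivity) hE, ← Real.rpow_mul (by positivity),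
      Real.mul_rpow (by positivity) (by positivity), ← Real.rpow_mul hE, ← Real.rpow_mul hh.le]
    have e1 : E ^ (1 / γ * ((2 * p / (p - 2) - γ) * ((p - 2) / p))) * E ^ ((p - 2) / p)
        = E ^ (2 / γ) := by
      rw [← Real.rpow_add_of_nonneg hE]
      · congr 1
        field_simp
        ring
      · exact mul_nonneg (by positivity) (mul_nonneg (by linarith) (by positivity))
      · positivity
    have e2 : -(d : ℝ) / γ * ((2 * p / (p - 2) - γ) * ((p - 2) / p))
        = 2 * (d * (1 / 2 - 1 / p - 1 / γ)) := by
      field_simp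
      ring
    rw [mul_right_comm, e1, e2]
  rw [e]
  ring

/-- `|ϱu|² ≤ ‖ϱ‖_∞ · ϱ|u|²`, and the last factor is the kinetic energy, bounded uniformly in time.
-/
lemma EnergyBounds.momentum_le_of_density_le (B : EnergyBounds Ω γ α N Δt h ε ρ u E) (hh : 0 < h)
    {k : ℕ} (hk : k ≤ N) {b : ℝ} (hb : 0 ≤ b) (hρ : ∀ K, ρ k K ≤ b) :
    ∑ K, h ^ d * (ρ k K ^ 2 * ∑ j, u k K j ^ 2) ≤ b * E := by
  refine le_trans ?_ (mul_le_mul_of_nonneg_left (B.kinetic k hk) hb)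
  rw [Finset.mul_sum]
  refine Finset.sum_le_sum fun K _ => ?_
  have hp := B.pos k hk K
  have h1 : 0 ≤ ∑ j, u k K j ^ 2 := Finset.sum_nonneg fun _ _ => sq_nonneg _
  have h2 : 0 ≤ h ^ d * (ρ k K * ∑ j, u k K j ^ 2) := by positivity
  nlinarith [mul_le_mul_of_nonneg_right (hρ K) h2]

/-- This is the branch without any dissipation: kinetic energy times the pointwise inverse estimate
of the density. -/
lemma momentumSum_le_of_sup (hγ : 1 < γ) (B : EnergyBounds Ω γ α N Δt h ε ρ u E) (ht : 0 < Δt)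
    (hh : 0 < h) (hN : (N : ℝ) * Δt = T) :
    momentumSum N Δt h ρ u ≤ (T * (E ^ (1 / γ) * E)) * h ^ (2 * (-(d / (2 * γ)))) := by
  have hE := B.nonneg hh
  have h1 : ∀ k ∈ Finset.range N, Δt * ∑ K, h ^ d * (ρ (k + 1) K ^ 2 * ∑ j, u (k + 1) K j ^ 2)
      ≤ Δt * (E ^ (1 / γ) * h ^ (-(d : ℝ) / γ) * E) := fun k hk =>
    mul_le_mul_of_nonneg_left (B.momentum_le_of_density_le hh (Finset.mem_range.mp hk)
      (by positivity) (B.density_le hγ hh (Finset.mem_range.mp hk))) ht.le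
  refine (Finset.sum_le_sum h1).trans (le_of_eq ?_)
  rw [Finset.sum_const, Finset.card_range, nsmul_eq_mul, ← mul_assoc, hN]
  have e : 2 * (-(d / (2 * γ))) = -(d : ℝ) / γ := by
    have : γ ≠ 0 := by linarith
    field_simp
  rw [e]
  ring

/-- The maximum of `ϱ^γ` is controlled by the `H¹` norm of `ϱ^(γ/2)` through the inverse estimate,
which loses `h^(-2d/p)`. That norm is only summable in time and loses `h^(-(1+α))`, so the power
`1/γ` is linearized at the scale `A` of both losses together. -/
lemma momentumSum_le_of_root (hd : 2 ≤ d) {p C : ℝ} (hC : IsSobolevConst d ℓ p C) (hp : 0 < p)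
    (hγ : 1 < γ) (hγ2 : γ ≤ 2) (hα : -1 < α)
    (B : EnergyBounds Ω γ α N Δt h ε ρ u E) (ht : 0 < Δt) (hh : 0 < h) (hh1 : h < 1)
    (hN : (N : ℝ) * Δt = T) (hM : (M : ℝ) * h = ℓ) :
    momentumSum N Δt h ρ u ≤ (E * (T + C ^ (2 / p) * ((T + 1) * E)))
      * h ^ (2 * (-((p * (α + 1) + 2 * d) / (2 * p * γ)))) := by
  have hE := B.nonneg hh
  have hγ0 : 0 < γ := by linarith
  have hC0 := hC.1
  set A := h ^ (-(1 + α) - 2 * d / p) with hA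
  have hA0 : 0 < A := Real.rpow_pos_of_pos hh _
  have h1 : ∀ k ∈ Finset.range N, Δt * ∑ K, h ^ d * (ρ (k + 1) K ^ 2 * ∑ j, u (k + 1) K j ^ 2)
      ≤ E * A ^ (1 / γ) * Δt + E * A ^ (1 / γ) * (C ^ (2 / p) * h ^ (-(2 * (d : ℝ) / p))) / A
          * (Δt * sobSum h (rootDensity γ (ρ (k + 1)))) := by
    intro k hk
    have hk' : k + 1 ≤ N := Finset.mem_range.mp hk
    have hs := sobSum_nonneg hh.le (rootDensity γ (ρ (k + 1)))
    have h2 : ∀ K, ρ (k + 1) K ≤ A ^ (1 / γ) * (1 + C ^ (2 / p) * h ^ (-(2 * (d : ℝ) / p))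
        * sobSum h (rootDensity γ (ρ (k + 1))) / A) := by
      intro K
      have hpos := B.pos _ hk' K
      have h3 := rpow_le_scale (Real.rpow_nonneg hpos.le γ) hA0 (by positivity : 0 ≤ 1 / γ)
        (by rw [div_le_one hγ0]; exact hγ.le)
      rw [← Real.rpow_mul hpos.le, mul_one_div_cancel hγ0.ne', Real.rpow_one] at h3
      refine h3.trans (mul_le_mul_of_nonneg_left ?_ (by positivity))
      have h4 := hC.sq_le hp hh hM (rootDensity γ (ρ (k + 1))) K
      rw [rootDensity_sq hpos] at h4
      gcongr
    have h5 := mul_le_mul_of_nonneg_left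
      (B.momentum_le_of_density_le hh hk' (by positivity) h2) ht.le
    refine h5.trans (le_of_eq ?_)
    ring
  refine (Finset.sum_le_sum h1).trans ?_
  rw [Finset.sum_add_distrib, Finset.sum_const, Finset.card_range, nsmul_eq_mul,
    mul_left_comm (N : ℝ), hN, ← Finset.mul_sum (Finset.range N)]
  have h11 := B.sum_sobSum_root hd hγ2 hα ht hh hh1 hN
  have e3 : h ^ (-(2 * (d : ℝ) / p)) * h ^ (-(1 + α)) = A := by
    rw [← Real.rpow_add hh, hA]
    congr 1
    ring
  have e4 : h ^ (2 * (-((p * (α + 1) + 2 * d) / (2 * p * γ)))) = A ^ (1 / γ) := by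
    rw [hA, ← Real.rpow_mul hh.le]
    congr 1
    field_simp
    ring
  rw [e4]
  calc _ ≤ E * A ^ (1 / γ) * T + E * A ^ (1 / γ) * (C ^ (2 / p) * h ^ (-(2 * (d : ℝ) / p))) / A
          * ((T + 1) * E * h ^ (-(1 + α))) := by gcongr
    _ = E * A ^ (1 / γ) * T + E * A ^ (1 / γ) * C ^ (2 / p) * ((T + 1) * E)
          * ((h ^ (-(2 * (d : ℝ) / p)) * h ^ (-(1 + α))) / A) := by ring
    _ = _ := by rw [e3, div_self hA0.ne']; ring

/-- Any bound that holds may be used, which is why `β_M` is a maximum of exponents. -/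
lemma le_rpow_max {S C₁ C₂ h x y : ℝ} (hh : 0 < h) (h₁ : S ≤ C₁ * h ^ (2 * x))
    (h₂ : S ≤ C₂ * h ^ (2 * y)) (hC₁ : 0 ≤ C₁) (hC₂ : 0 ≤ C₂) :
    S ≤ (C₁ + C₂) * h ^ (2 * max x y) := by
  have := Real.rpow_pos_of_pos hh (2 * x)
  have := Real.rpow_pos_of_pos hh (2 * y)
  rcases le_total x y with hxy | hxy
  · rw [max_eq_right hxy]
    nlinarith
  · rw [max_eq_left hxy]
    nlinarith

/-- Space-time square integrability of the momentum, with the rate `β_M`. -/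
lemma exists_momentum_sq_bound (hd : d = 2 ∨ d = 3) (hℓ : 0 < ℓ) (hγ : 1 < γ) (hα : -1 < α)
    (hE : 0 ≤ E) (hV0 : 0 ≤ V) (hT : 0 < T) {p : ℝ} (hp : 2 < p) : ∃ C, 0 ≤ C ∧
      ∀ (M : ℕ) [NeZero M] (N : ℕ) (Δt h ε : ℝ)
      (Ω : Set (Space d)) (ρ : ℕ → Cell d M → ℝ) (u : ℕ → Cell d M → Fin d → ℝ),
      0 < Δt → 0 < h → h < 1 → (N : ℝ) * Δt = T → (M : ℝ) * h = ℓ →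
      EnergyBounds Ω γ α N Δt h ε ρ u E →
      ∑ k ∈ Finset.range N, Δt * ∑ j, sobSum h (comp (u (k + 1)) j) ≤ V →
      momentumSum N Δt h ρ u ≤ C * h ^ (2 * betaM d γ α p) := by
  have hγ0 : 0 < γ := by linarith
  have hp2 : 0 < p - 2 := by linarith
  rcases hd with rfl | rfl
  · rcases le_or_gt γ 2 with h2 | h2
    · obtain ⟨C, hC⟩ := sobolev_two hℓ (p := p) (by linarith)
      have hC0 := hC.1
      refine ⟨(E * (T + C ^ (2 / p) * ((T + 1) * E))) + (E ^ (2 / γ) * C ^ (2 / p) * V),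
        by positivity, fun M _ N Δt h ε Ω ρ u ht hh hh1 hN hM B hV => ?_⟩
      rw [betaM, if_pos rfl, if_pos h2]
      refine le_rpow_max hh ?_ ?_ (by positivity) (by positivity)
      · have h3 := momentumSum_le_of_root le_rfl hC (by linarith) hγ h2 hα B ht hh hh1 hN hM
        have e : (p * (α + 1) + 2 * ((2 : ℕ) : ℝ)) = p * (α + 1) + 4 := by norm_num
        rwa [e] at h3
      · have h3 := momentumSum_le_of_inverse hC hp hγ
          (by rw [le_div_iff₀ hp2]; nlinarith) B ht hh hM hV
        have e : (((2 : ℕ) : ℝ) * (1 / 2 - 1 / p - 1 / γ)) = (p * (γ - 2) - 2 * γ) / (p * γ) := by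
          push_cast; field_simp; ring
        rwa [e] at h3
    · have hγ2 : 0 < γ - 2 := by linarith
      -- This Sobolev exponent is chosen so that the density is needed exactly in `L^γ`, where it is
      -- bounded without loss.
      obtain ⟨C, hC⟩ := sobolev_two hℓ (p := 2 * γ / (γ - 2)) (by positivity)
      have hC0 := hC.1
      have hp' : 2 < 2 * γ / (γ - 2) := by rw [lt_div_iff₀ hγ2]; linarith
      have eq : 2 * (2 * γ / (γ - 2)) / (2 * γ / (γ - 2) - 2) = γ := by
        have : 2 * γ / (γ - 2) - 2 = 4 / (γ - 2) := by field_simp; ring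
        rw [this]
        field_simp
        ring
      refine ⟨E ^ ((2 * γ / (γ - 2) - 2) / (2 * γ / (γ - 2))) * C ^ (2 / (2 * γ / (γ - 2))) * V,
        by positivity, fun M _ N Δt h ε Ω ρ u ht hh hh1 hN hM B hV => ?_⟩
      rw [betaM, if_pos rfl, if_neg (not_le.mpr h2), mul_zero, Real.rpow_zero, mul_one]
      refine momentumSum_le_of_density hC hp' B ht hh hM hV fun k hk => ?_
      rw [eq]
      exact B.internal k hk
  · obtain ⟨C, hC⟩ := sobolev_three hℓ
    have hC0 := hC.1
    have eq : (2 : ℝ) * 6 / (6 - 2) = 3 := by norm_num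
    have e : (((3 : ℕ) : ℝ) * (1 / 2 - 1 / 6 - 1 / γ)) = (γ - 3) / γ := by
      push_cast; field_simp; ring
    rcases le_or_gt γ 2 with h2 | h2
    · refine ⟨(E * (T + C ^ (2 / 6 : ℝ) * ((T + 1) * E))) + (E ^ (2 / γ) * C ^ (2 / 6 : ℝ) * V)
        + T * (E ^ (1 / γ) * E), by positivity, fun M _ N Δt h ε Ω ρ u ht hh hh1 hN hM B hV => ?_⟩
      rw [betaM, if_neg (by norm_num), if_pos h2]
      refine le_rpow_max hh (le_rpow_max hh ?_ ?_ (by positivity) (by positivity)) ?_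
        (by positivity) (by positivity)
      · have h3 := momentumSum_le_of_root (by norm_num) hC (by norm_num) hγ h2 hα B ht hh hh1 hN hM
        have e : (6 * (α + 1) + 2 * ((3 : ℕ) : ℝ)) / (2 * 6 * γ) = (α + 2) / (2 * γ) := by
          push_cast; field_simp; ring
        rwa [e] at h3
      · have h3 := momentumSum_le_of_inverse hC (by norm_num) hγ
          (by rw [eq]; linarith) B ht hh hM hV
        rwa [e] at h3
      · exact momentumSum_le_of_sup hγ B ht hh hN
    · rcases lt_or_ge γ 3 with h3 | h3
      · refine ⟨E ^ (2 / γ) * C ^ (2 / 6 : ℝ) * V, by positivity,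
          fun M _ N Δt h ε Ω ρ u ht hh hh1 hN hM B hV => ?_⟩
        rw [betaM, if_neg (by norm_num), if_neg (not_le.mpr h2), if_pos h3]
        have h3 := momentumSum_le_of_inverse hC (by norm_num) hγ
          (by rw [eq]; linarith) B ht hh hM hV
        rwa [e] at h3
      -- With the velocity in `L⁶` the density is needed in `L³`, which the internal energy controls
      -- when `γ ≥ 3`.
      · refine ⟨(ℓ ^ 3 + E) ^ ((6 - 2) / 6 : ℝ) * C ^ (2 / 6 : ℝ) * V, by positivity,
          fun M _ N Δt h ε Ω ρ u ht hh hh1 hN hM B hV => ?_⟩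
        rw [betaM, if_neg (by norm_num), if_neg (not_le.mpr h2), if_neg (not_lt.mpr h3), mul_zero,
          Real.rpow_zero, mul_one]
        refine momentumSum_le_of_density hC (by norm_num) B ht hh hM hV fun k hk => ?_
        rw [eq]
        have h4 : ∀ K, h ^ 3 * ρ k K ^ (3 : ℝ) ≤ h ^ 3 * (1 + ρ k K ^ γ) := fun K => by
          have hpos := B.pos k hk K
          refine mul_le_mul_of_nonneg_left ?_ (by positivity)
          have h5 := rpow_le_one_add (Real.rpow_nonneg hpos.le γ) (by positivity : 0 ≤ 3 / γ)
            (by rw [div_le_one hγ0]; exact h3)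
          rwa [← Real.rpow_mul hpos.le, mul_div_cancel₀ _ hγ0.ne'] at h5
        refine (Finset.sum_le_sum fun K _ => h4 K).trans ?_
        simp only [mul_add, mul_one, Finset.sum_add_distrib]
        rw [sum_cells_const hM]
        linarith [B.internal k hk]

end MomentumBound

end FV

namespace FV

/-! ### Estimates of the spatial residual of the continuity equation. -/

section Residuals

set_option linter.unusedSectionVars false

variable {d M : ℕ} [NeZero M]

/-- Integral over all dual cells. -/
noncomputable def faceSum (h : ℝ) (F : Fin d → Cell d M → ℝ) : ℝ := ∑ i, ∑ K, h ^ d * F i K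

lemma faceSum_mono {h : ℝ} (hh : 0 ≤ h) {F G : Fin d → Cell d M → ℝ} (H : ∀ i K, F i K ≤ G i K) :
    faceSum h F ≤ faceSum h G :=
  Finset.sum_le_sum fun i _ => Finset.sum_le_sum fun K _ =>
    mul_le_mul_of_nonneg_left (H i K) (by positivity)

lemma faceSum_nonneg {h : ℝ} (hh : 0 ≤ h) {F : Fin d → Cell d M → ℝ} (H : ∀ i K, 0 ≤ F i K) :
    0 ≤ faceSum h F :=
  Finset.sum_nonneg fun i _ => Finset.sum_nonneg fun K _ => mul_nonneg (by positivity) (H i K)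

lemma faceSum_add (h : ℝ) (F G : Fin d → Cell d M → ℝ) :
    faceSum h (fun i K => F i K + G i K) = faceSum h F + faceSum h G := by
  simp only [faceSum, mul_add, Finset.sum_add_distrib]

lemma faceSum_mul (h c : ℝ) (F : Fin d → Cell d M → ℝ) :
    faceSum h (fun i K => c * F i K) = c * faceSum h F := by
  simp only [faceSum, Finset.mul_sum]
  exact Finset.sum_congr rfl fun i _ => Finset.sum_congr rfl fun K _ => by ring

lemma faceSum_nxt (h : ℝ) (F : Fin d → Cell d M → ℝ) :
    faceSum h (fun i K => F i (nxt i K)) = faceSum h F :=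
  Finset.sum_congr rfl fun i _ => sum_nxt i fun K => h ^ d * F i K

lemma faceSum_prv (h : ℝ) (F : Fin d → Cell d M → ℝ) :
    faceSum h (fun i K => F i (prv i K)) = faceSum h F :=
  Finset.sum_congr rfl fun i _ => sum_prv i fun K => h ^ d * F i K

lemma faceSum_cell (h : ℝ) (f : Cell d M → ℝ) :
    faceSum h (fun _ K => f K) = d * ∑ K, h ^ d * f K := by
  simp [faceSum]

lemma faceSum_component (h : ℝ) (r : Cell d M → ℝ) (u : Cell d M → Fin d → ℝ) :
    faceSum h (fun i K => r K * u K i ^ 2) = ∑ K, h ^ d * (r K * ∑ j, u K j ^ 2) := by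
  rw [faceSum, Finset.sum_comm]
  simp only [Finset.mul_sum]

lemma faceSum_jump_sq_le {h : ℝ} (hh : 0 < h) (u : Cell d M → Fin d → ℝ) :
    faceSum h (fun i K => jump i (comp u i) K ^ 2) ≤ h ^ 2 * gradSum h u := by
  rw [gradSum, faceSum, Finset.mul_sum]
  refine Finset.sum_le_sum fun i _ => ?_
  rw [Finset.mul_sum]
  refine Finset.sum_le_sum fun K _ => ?_
  rw [mul_left_comm]
  refine mul_le_mul_of_nonneg_left ?_ (by positivity)
  have h1 := Finset.single_le_sum (f := fun j => (jump i (comp u j) K / h) ^ 2)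
    (fun _ _ => sq_nonneg _) (Finset.mem_univ i)
  have h2 := mul_le_mul_of_nonneg_left h1 (sq_nonneg h)
  refine le_trans (le_of_eq ?_) h2
  field_simp

lemma two_mul_le_scale {θ : ℝ} (hθ : 0 < θ) (x y : ℝ) : x * y ≤ θ / 2 * x ^ 2 + y ^ 2 / (2 * θ) := by
  have : θ / 2 * x ^ 2 + y ^ 2 / (2 * θ) - x * y = (θ * x - y) ^ 2 / (2 * θ) := by
    field_simp
    ring
  have h2 : 0 ≤ (θ * x - y) ^ 2 / (2 * θ) := by positivity
  linarith

/-- The quantity that controls the spatial consistency error of the continuity equation. -/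
noncomputable def densityRes (h α : ℝ) (r : Cell d M → ℝ) (u : Cell d M → Fin d → ℝ) : ℝ :=
  faceSum h fun i K => |avg i (comp u i) K| * |jump i r K|
    + (r K + r (nxt i K)) * |jump i (comp u i) K| + h ^ α * |jump i r K|

/-- The dissipation due to jumps of the density. -/
noncomputable def jumpDiss (h α : ℝ) (r : Cell d M → ℝ) (u : Cell d M → Fin d → ℝ) : ℝ :=
  ∑ i, ∑ K, h ^ (d - 1) * ((h ^ α + |avg i (comp u i) K|) *
    ((r K - r (nxt i K)) ^ 2 / (1 + r K + r (nxt i K))))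

/-- Young's inequality with weight `θ = h^(1-β)`: the squared jumps yield `h²/θ = h^(1+β)`, and `θ =
h^(1+β) h^(-2β)` compensates a density whose squared `L²` norm is of order `h^(2β)`. -/
lemma faceSum_density_mul_jump_le {h β : ℝ} (hh : 0 < h) {r : Cell d M → ℝ}
    (u : Cell d M → Fin d → ℝ) :
    faceSum h (fun i K => (r K + r (nxt i K)) * |jump i (comp u i) K|)
      ≤ h ^ (1 + β) * (2 * d * (h ^ (-(2 * β)) * ∑ K, h ^ d * r K ^ 2) + gradSum h u) := by
  set θ := h ^ (1 - β) with hθ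
  have hθ0 : 0 < θ := Real.rpow_pos_of_pos hh _
  have h1 : faceSum h (fun i K => (r K + r (nxt i K)) * |jump i (comp u i) K|)
      ≤ θ * faceSum h (fun _ K => r K ^ 2) + θ * faceSum h (fun i K => r (nxt i K) ^ 2)
        + 1 / (2 * θ) * faceSum h (fun i K => jump i (comp u i) K ^ 2) := by
    rw [← faceSum_mul, ← faceSum_mul, ← faceSum_mul, ← faceSum_add, ← faceSum_add]
    refine faceSum_mono hh.le fun i K => ?_
    have h2 := two_mul_le_scale hθ0 (r K + r (nxt i K)) |jump i (comp u i) K|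
    rw [sq_abs] at h2
    have h4 : 1 / (2 * θ) * jump i (comp u i) K ^ 2 = jump i (comp u i) K ^ 2 / (2 * θ) := by ring
    rw [h4]
    nlinarith [mul_nonneg hθ0.le (sq_nonneg (r K - r (nxt i K)))]
  rw [faceSum_nxt h (fun _ K => r K ^ 2), faceSum_cell] at h1
  have h3 := faceSum_jump_sq_le hh u
  have e1 : θ = h ^ (1 + β) * h ^ (-(2 * β)) := by
    rw [hθ, ← Real.rpow_add hh]; congr 1; ring
  have e2 : 1 / θ * h ^ 2 = h ^ (1 + β) := by
    rw [hθ, one_div, ← Real.rpow_neg hh.le, ← Real.rpow_two, ← Real.rpow_add hh]; congr 1; ring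
  have hG := gradSum_nonneg hh.le u
  have h4 : 1 / (2 * θ) * faceSum h (fun i K => jump i (comp u i) K ^ 2)
      ≤ h ^ (1 + β) * gradSum h u := by
    calc _ ≤ 1 / (2 * θ) * (h ^ 2 * gradSum h u) := by gcongr
      _ = (1 / θ * h ^ 2) * gradSum h u / 2 := by field_simp
      _ ≤ _ := by
        rw [e2]
        have : 0 ≤ h ^ (1 + β) * gradSum h u := by positivity
        linarith
  calc _ ≤ _ := h1
    _ ≤ θ * (d * ∑ K, h ^ d * r K ^ 2) + θ * (d * ∑ K, h ^ d * r K ^ 2)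
        + h ^ (1 + β) * gradSum h u := by linarith
    _ = _ := by rw [e1]; ring

/-- Cauchy–Schwarz between the part `h^(d-1) h^α J²/(1+r+r')` of the dissipation and the mass. The
factor `θ = h^((1+α)/2)` balances the two sides since `θ² = h^α h`. -/
lemma faceSum_diffusion_le {ℓ h α : ℝ} (hh : 0 < h) (hd : d ≠ 0) (hM : (M : ℝ) * h = ℓ)
    {r : Cell d M → ℝ} (hr : ∀ K, 0 < r K) (u : Cell d M → Fin d → ℝ) :
    faceSum h (fun i K => h ^ α * |jump i r K|)
      ≤ h ^ ((1 + α) / 2) * (jumpDiss h α r u + d * ℓ ^ d + 2 * d * ∑ K, h ^ d * r K) := by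
  set θ := h ^ ((α + 1) / 2) with hθ
  have hθ0 : 0 < θ := Real.rpow_pos_of_pos hh _
  have e1 : h ^ α * h = θ ^ 2 := by
    rw [hθ, ← Real.rpow_natCast, ← Real.rpow_mul hh.le, ← Real.rpow_add_one hh.ne']
    congr 1
    push_cast
    ring
  have h1 : faceSum h (fun i K => h ^ α * |jump i r K|)
      ≤ θ * jumpDiss h α r u + θ * faceSum h (fun i K => 1 + r K + r (nxt i K)) := by
    rw [← faceSum_mul, jumpDiss, faceSum, faceSum, Finset.mul_sum, ← Finset.sum_add_distrib]
    refine Finset.sum_le_sum fun i _ => ?_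
    rw [Finset.mul_sum, ← Finset.sum_add_distrib]
    refine Finset.sum_le_sum fun K _ => ?_
    have := hr K
    have := hr (nxt i K)
    set S := 1 + r K + r (nxt i K)
    have hS : 0 < S := by positivity
    set J := r K - r (nxt i K)
    have hJ : |jump i r K| = |J| := by rw [jump, abs_sub_comm]
    have h2 : |J| * S ≤ J ^ 2 + S ^ 2 / 2 := by
      rw [← sq_abs J]; nlinarith [sq_nonneg (|J| - S)]
    have hw := abs_nonneg (avg i (comp u i) K)
    have h3 : h ^ α * h * |J| ≤ θ * (h ^ α * (J ^ 2 / S)) + θ * h * S := by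
      have h4 : |J| * (h ^ α * h) ≤ h ^ α * θ * (J ^ 2 / S) + h * θ * S := by
        have h5 := two_mul_le_scale (θ := h ^ α * θ / S) (by positivity) |J| (h ^ α * h)
        rw [sq_abs] at h5
        have e2 : (h ^ α * h) ^ 2 / (2 * (h ^ α * θ / S)) = (h * θ * S) / 2 := by
          rw [div_eq_div_iff (by positivity) (by norm_num)]
          have : (h ^ α * h) ^ 2 = h ^ α * h * θ ^ 2 := by rw [← e1]; ring
          rw [this]
          field_simp
        rw [e2] at h5
        have e3 : h ^ α * θ / S / 2 * J ^ 2 = h ^ α * θ * (J ^ 2 / S) / 2 := by field_simp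
        rw [e3] at h5
        have : 0 ≤ h ^ α * θ * (J ^ 2 / S) := by positivity
        have : 0 ≤ h * θ * S := by positivity
        linarith
      linarith
    have h6 : h ^ α * (J ^ 2 / S) ≤ (h ^ α + |avg i (comp u i) K|) * (J ^ 2 / S) := by
      have : 0 ≤ J ^ 2 / S := by positivity
      nlinarith
    rw [hJ, pow_eq_pow_pred_mul hd]
    have h7 := mul_le_mul_of_nonneg_left (h3.trans (add_le_add_left
      (mul_le_mul_of_nonneg_left h6 hθ0.le) _)) (by positivity : 0 ≤ h ^ (d - 1))
    linarith
  rw [faceSum_add, faceSum_nxt h (fun _ K => r K), faceSum_cell h (fun K => 1 + r K), faceSum_cell]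
    at h1
  simp only [mul_add, mul_one, Finset.sum_add_distrib] at h1
  rw [sum_cells_const hM] at h1
  have e2 : h ^ ((1 + α) / 2) = θ := by rw [hθ, add_comm]
  rw [e2]
  linarith

/-- As for the artificial diffusion, but with the part of the dissipation weighted by `|{u}·n|`; the
balance is now `θ² = h`. The companion factor `|{u}·n| (1+r+r')` is integrable by the mass, the
kinetic energy and the velocity norm. -/
lemma faceSum_upwind_le {ℓ h α : ℝ} (hh : 0 < h) (hh1 : h < 1) (hd : d ≠ 0) (hM : (M : ℝ) * h = ℓ)
    {r : Cell d M → ℝ} (hr : ∀ K, 0 < r K) (u : Cell d M → Fin d → ℝ) :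
    faceSum h (fun i K => |avg i (comp u i) K| * |jump i r K|)
      ≤ h ^ (1 / 2 : ℝ) * (jumpDiss h α r u + 3 * (d * ℓ ^ d) + 2 * (d * ∑ K, h ^ d * r K)
        + 2 * ∑ K, h ^ d * (r K * ∑ j, u K j ^ 2) + 2 * ∑ K, h ^ d * ∑ j, u K j ^ 2 + gradSum h u
        + faceSum h (fun i K => (r K + r (nxt i K)) * |jump i (comp u i) K|)) := by
  set θ := h ^ (1 / 2 : ℝ) with hθ
  have hθ0 : 0 < θ := Real.rpow_pos_of_pos hh _
  have e1 : θ ^ 2 = h := by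
    rw [hθ, ← Real.rpow_natCast, ← Real.rpow_mul hh.le]
    norm_num
  have h1 : faceSum h (fun i K => |avg i (comp u i) K| * |jump i r K|)
      ≤ θ * jumpDiss h α r u
        + θ * (faceSum h (fun i K => (1 + r K) * |u K i|)
          + faceSum h (fun i K => (1 + r (nxt i K)) * |u (nxt i K) i|)
          + faceSum h (fun i K => 1 / 4 + jump i (comp u i) K ^ 2)
          + faceSum h (fun i K => (r K + r (nxt i K)) * |jump i (comp u i) K|)) := by
    rw [← faceSum_add, ← faceSum_add, ← faceSum_add, ← faceSum_mul, jumpDiss, faceSum, faceSum,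
      Finset.mul_sum, ← Finset.sum_add_distrib]
    refine Finset.sum_le_sum fun i _ => ?_
    rw [Finset.mul_sum, ← Finset.sum_add_distrib]
    refine Finset.sum_le_sum fun K _ => ?_
    have hK := hr K
    have hn := hr (nxt i K)
    have ea : avg i (comp u i) K = (u K i + u (nxt i K) i) / 2 := rfl
    have ej : jump i (comp u i) K = u (nxt i K) i - u K i := rfl
    have eJ : |jump i r K| = |r K - r (nxt i K)| := by rw [jump, abs_sub_comm]
    rw [eJ, ea, ej]
    set x := u K i
    set y := u (nxt i K) i
    set S := 1 + r K + r (nxt i K) with hSdef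
    have hS : 0 < S := by positivity
    set J := r K - r (nxt i K)
    set w := |(x + y) / 2| with hw
    have hw0 : 0 ≤ w := abs_nonneg _
    -- The face average is compared with the velocity of that cell whose density it multiplies, so
    -- that density and velocity refer to the same cell; the mismatch is a velocity jump.
    have hS1 : w * S ≤ 2 * ((1 + r K) * |x| + (1 + r (nxt i K)) * |y| + (1 / 4 + (y - x) ^ 2)
        + (r K + r (nxt i K)) * |y - x|) := by
      have h5 : |y - x| ≤ 1 / 4 + (y - x) ^ 2 := by
        rw [← sq_abs (y - x)]; nlinarith [sq_nonneg (|y - x| - 1 / 2)]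
      have hx : w ≤ |x| + |y - x| / 2 := by
        rw [hw]
        have : (x + y) / 2 = x + (y - x) / 2 := by ring
        rw [this]
        refine (abs_add_le _ _).trans ?_
        rw [abs_div, abs_two]
      have hy : w ≤ |y| + |y - x| / 2 := by
        rw [hw]
        have : (x + y) / 2 = y + -((y - x) / 2) := by ring
        rw [this]
        refine (abs_add_le _ _).trans ?_
        rw [abs_neg, abs_div, abs_two]
      have := abs_nonneg (y - x)
      have := abs_nonneg x
      have := abs_nonneg y
      have h6 := mul_le_mul_of_nonneg_right hx (by linarith : 0 ≤ 1 + r K)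
      have h7 := mul_le_mul_of_nonneg_right hy (by linarith : 0 ≤ 1 + r (nxt i K))
      have hz : 0 ≤ (r K + r (nxt i K)) * |y - x| := by positivity
      have : w * S ≤ w * (1 + r K) + w * (1 + r (nxt i K)) := by rw [hSdef]; nlinarith
      nlinarith
    have h4 : w * h * |J| ≤ θ * (w * (J ^ 2 / S)) + θ * h * (w * S / 2) := by
      have h5 := two_mul_le_scale (θ := θ / S) (by positivity) |J| h
      rw [sq_abs] at h5
      have e2 : h ^ 2 / (2 * (θ / S)) = θ * h * S / 2 := by
        rw [div_eq_div_iff (by positivity) (by norm_num)]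
        have : h ^ 2 = h * θ ^ 2 := by rw [e1]; ring
        rw [this]
        field_simp
      have e3 : θ / S / 2 * J ^ 2 = θ * (J ^ 2 / S) / 2 := by field_simp
      rw [e2, e3] at h5
      have h6 := mul_le_mul_of_nonneg_left h5 hw0
      have : 0 ≤ w * (θ * (J ^ 2 / S)) := by positivity
      linarith
    have h6 : w * (J ^ 2 / S) ≤ (h ^ α + w) * (J ^ 2 / S) := by
      have : 0 ≤ J ^ 2 / S := by positivity
      have := Real.rpow_pos_of_pos hh α
      nlinarith
    rw [pow_eq_pow_pred_mul hd]
    have h7 := mul_le_mul_of_nonneg_left (h4.trans (add_le_add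
      (mul_le_mul_of_nonneg_left h6 hθ0.le) (mul_le_mul_of_nonneg_left
        (div_le_div_of_nonneg_right hS1 zero_le_two) (by positivity : 0 ≤ θ * h))))
      (by positivity : 0 ≤ h ^ (d - 1))
    linarith
  rw [faceSum_nxt h (fun i K => (1 + r K) * |u K i|), faceSum_add h (fun _ _ => 1 / 4),
    faceSum_cell h (fun _ => 1 / 4), ← Finset.sum_mul, sum_cells_const hM] at h1
  have h2 : faceSum h (fun i K => (1 + r K) * |u K i|) ≤ d * ℓ ^ d + d * ∑ K, h ^ d * r K
      + ∑ K, h ^ d * (r K * ∑ j, u K j ^ 2) + ∑ K, h ^ d * ∑ j, u K j ^ 2 := by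
    have e2 : ∑ K, h ^ d * ∑ j, u K j ^ 2 = ∑ K, h ^ d * (1 * ∑ j, u K j ^ 2) := by simp
    rw [e2, ← faceSum_component h r u, ← faceSum_component h (fun _ => 1) u, ← faceSum_cell,
      ← sum_cells_const hM]
    have e3 : (d : ℝ) * ∑ _K : Cell d M, h ^ d = faceSum (M := M) (d := d) h (fun _ _ => 1) := by
      rw [faceSum_cell]; simp
    rw [e3, ← faceSum_add, ← faceSum_add, ← faceSum_add]
    refine faceSum_mono hh.le fun i K => ?_
    have hK := hr K
    have : |u K i| ≤ 1 + u K i ^ 2 := by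
      rw [← sq_abs]; nlinarith [sq_nonneg (|u K i| - 1 / 2)]
    nlinarith
  have h3 := faceSum_jump_sq_le hh u
  have h4 : h ^ 2 * gradSum h u ≤ gradSum h u :=
    mul_le_of_le_one_left (gradSum_nonneg hh.le u) (pow_le_one₀ hh.le hh1.le)
  refine h1.trans ?_
  rw [← mul_add]
  refine mul_le_mul_of_nonneg_left ?_ hθ0.le
  have : 0 ≤ (d : ℝ) * ℓ ^ d := by rw [← hM]; positivity
  linarith

lemma densityRes_le {ℓ h α β : ℝ} (hh : 0 < h) (hh1 : h < 1) (hd : d ≠ 0) (hM : (M : ℝ) * h = ℓ)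
    {r : Cell d M → ℝ} (hr : ∀ K, 0 < r K) (u : Cell d M → Fin d → ℝ) :
    densityRes h α r u ≤ (h ^ (1 / 2 : ℝ) + h ^ ((1 + α) / 2) + h ^ (1 + β)) *
      (2 * jumpDiss h α r u + 4 * (d * ℓ ^ d) + 4 * (d * ∑ K, h ^ d * r K)
        + 2 * ∑ K, h ^ d * (r K * ∑ j, u K j ^ 2) + 2 * ∑ K, h ^ d * ∑ j, u K j ^ 2
        + 3 * gradSum h u + 4 * d * (h ^ (-(2 * β)) * ∑ K, h ^ d * r K ^ 2)) := by
  have h1 := faceSum_density_mul_jump_le (β := β) hh (r := r) u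
  have h2 := faceSum_diffusion_le (α := α) hh hd hM hr u
  have h3 := faceSum_upwind_le (α := α) hh hh1 hd hM hr u
  have e : densityRes h α r u = faceSum h (fun i K => |avg i (comp u i) K| * |jump i r K|)
      + faceSum h (fun i K => (r K + r (nxt i K)) * |jump i (comp u i) K|)
      + faceSum h (fun i K => h ^ α * |jump i r K|) := by
    rw [densityRes, faceSum_add, faceSum_add]
  rw [e]
  have hJ : 0 ≤ jumpDiss h α r u := Finset.sum_nonneg fun i _ => Finset.sum_nonneg fun K _ => by
    have := hr K
    have := hr (nxt i K)
    positivity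
  have hG := gradSum_nonneg hh.le u
  have hm : 0 ≤ (d : ℝ) * ∑ K, h ^ d * r K := mul_nonneg (by positivity)
    (Finset.sum_nonneg fun K _ => by have := hr K; positivity)
  have hk : 0 ≤ ∑ K, h ^ d * (r K * ∑ j, u K j ^ 2) :=
    Finset.sum_nonneg fun K _ => by have := hr K; positivity
  have hv : 0 ≤ ∑ K, h ^ d * ∑ j, u K j ^ 2 := Finset.sum_nonneg fun K _ => by positivity
  have hl : 0 ≤ (d : ℝ) * ℓ ^ d := by rw [← hM]; positivity
  have hL : 0 ≤ d * (h ^ (-(2 * β)) * ∑ K, h ^ d * r K ^ 2) := by positivity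
  set F := faceSum h (fun i K => (r K + r (nxt i K)) * |jump i (comp u i) K|)
  set x := h ^ (1 / 2 : ℝ) with hx
  set y := h ^ ((1 + α) / 2)
  set z := h ^ (1 + β)
  have hx0 : 0 ≤ x := by positivity
  have hy0 : 0 ≤ y := by positivity
  have hz0 : 0 ≤ z := by positivity
  have hx1 : x ≤ 1 := Real.rpow_le_one hh.le hh1.le (by norm_num)
  have hF0 : 0 ≤ F := faceSum_nonneg hh.le fun i K => by
    have := hr K
    have := hr (nxt i K)
    positivity
  -- The density–velocity-jump term enters twice, once inside the upwind estimate with a factor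
  -- `h^(1/2) ≤ 1`; this is the factor `2` in `a3`.
  have hxF : x * F ≤ F := mul_le_of_le_one_left hF0 hx1
  generalize jumpDiss h α r u = D at *
  generalize gradSum h u = G at *
  generalize ∑ K, h ^ d * r K = m at *
  generalize ∑ K, h ^ d * (r K * ∑ j, u K j ^ 2) = k at *
  generalize ∑ K, h ^ d * ∑ j, u K j ^ 2 = v at *
  generalize h ^ (-(2 * β)) * ∑ K, h ^ d * r K ^ 2 = L at *
  generalize ℓ ^ d = l at *
  have a1 : x * (D + 3 * (d * l) + 2 * (d * m) + 2 * k + 2 * v + G + F)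
      ≤ x * (2 * D + 4 * (d * l) + 4 * (d * m) + 2 * k + 2 * v + 3 * G + 4 * d * L) + F := by
    nlinarith [mul_nonneg hx0 (by linarith : 0 ≤ D + d * l + 2 * (d * m) + 2 * G + 4 * (d * L))]
  have a2 : y * (D + d * l + 2 * d * m)
      ≤ y * (2 * D + 4 * (d * l) + 4 * (d * m) + 2 * k + 2 * v + 3 * G + 4 * d * L) :=
    mul_le_mul_of_nonneg_left (by linarith) hy0
  have a3 : 2 * (z * (2 * d * L + G))
      ≤ z * (2 * D + 4 * (d * l) + 4 * (d * m) + 2 * k + 2 * v + 3 * G + 4 * d * L) := by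
    rw [mul_left_comm]
    exact mul_le_mul_of_nonneg_left (by linarith) hz0
  linarith

end Residuals

end FV

namespace FV

/-! ### The numerical flux against differences of the test function. -/

section FluxResidual

set_option linter.unusedSectionVars false

variable {d M : ℕ} [NeZero M]

/-- Upwinding is centring minus `½|{u}·n|` times the jump, and the product of averages misses the
average of the product by a quarter of the product of jumps. All deviations from the centred flux of
`r u` thus carry a jump of `r`. -/
lemma flux_eq (h α : ℝ) (r : Cell d M → ℝ) (u : Cell d M → Fin d → ℝ) (i : Fin d) (K : Cell d M) :
    flux h α r u i K = avg i (fun L => r L * u L i) K - jump i r K * jump i (comp u i) K / 4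
      - |avg i (comp u i) K| / 2 * jump i r K - h ^ α * jump i r K := by
  rw [flux]
  split_ifs with h0
  · rw [abs_of_nonneg h0]
    simp only [avg, jump, comp]
    ring
  · rw [abs_of_neg (not_le.mp h0)]
    simp only [avg, jump, comp]
    ring

/-- Only size bounds of the test differences `D` are used; in the mixed term the jump of the
positive density is bounded by the sum of both values, so that the velocity jump remains. -/
lemma abs_sum_flux_mul_sub_le {h α b : ℝ} (hh : 0 < h) {r : Cell d M → ℝ}
    (hr : ∀ K, 0 < r K) (u : Cell d M → Fin d → ℝ) (i : Fin d) {D : Cell d M → ℝ}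
    (hD : ∀ K, |D K| ≤ b * h ^ d) :
    |∑ K, flux h α r u i K * D K - ∑ K, avg i (fun L => r L * u L i) K * D K|
      ≤ b * ∑ K, h ^ d * (|avg i (comp u i) K| * |jump i r K|
        + (r K + r (nxt i K)) * |jump i (comp u i) K| + h ^ α * |jump i r K|) := by
  rw [← Finset.sum_sub_distrib, Finset.mul_sum]
  refine (Finset.abs_sum_le_sum_abs _ _).trans (Finset.sum_le_sum fun K _ => ?_)
  have hK := hr K
  have hn := hr (nxt i K)
  rw [← sub_mul, abs_mul, flux_eq]
  have hJ : |jump i r K| ≤ r K + r (nxt i K) := by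
    rw [jump, abs_le]; constructor <;> linarith
  have h1 : |avg i (fun L => r L * u L i) K - jump i r K * jump i (comp u i) K / 4
      - |avg i (comp u i) K| / 2 * jump i r K - h ^ α * jump i r K
      - avg i (fun L => r L * u L i) K|
      ≤ |avg i (comp u i) K| * |jump i r K|
        + (r K + r (nxt i K)) * |jump i (comp u i) K| + h ^ α * |jump i r K| := by
    have e : avg i (fun L => r L * u L i) K - jump i r K * jump i (comp u i) K / 4
      - |avg i (comp u i) K| / 2 * jump i r K - h ^ α * jump i r K
      - avg i (fun L => r L * u L i) K = -(|avg i (comp u i) K| / 2 * jump i r K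
        + jump i r K * jump i (comp u i) K / 4 + h ^ α * jump i r K) := by ring
    rw [e, abs_neg]
    refine (abs_add_le _ _).trans (add_le_add ((abs_add_le _ _).trans (add_le_add ?_ ?_)) ?_)
    · rw [abs_mul, abs_div, abs_abs, abs_two]
      have := mul_nonneg (abs_nonneg (avg i (comp u i) K)) (abs_nonneg (jump i r K))
      linarith
    · rw [abs_div, abs_mul, abs_of_pos (by norm_num : (0 : ℝ) < 4)]
      have := mul_le_mul_of_nonneg_right hJ (abs_nonneg (jump i (comp u i) K))
      have := mul_nonneg (abs_nonneg (jump i r K)) (abs_nonneg (jump i (comp u i) K))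
      linarith
    · rw [abs_mul, abs_of_pos (Real.rpow_pos_of_pos hh α)]
  calc _ ≤ _ := mul_le_mul h1 (hD K) (abs_nonneg _) (by positivity)
    _ = _ := by ring

/-- Jumps of the momentum are not used directly. Summation by parts removes them: the difference
falls either on `|{u}·n|`, giving velocity jumps, or on `D`, giving second differences of the test
function. This is where `W^{2,∞}` is needed. -/
lemma abs_sum_flux_mul_sub_prv_le {h α b : ℝ} (hh : 0 < h) (hh1 : h ≤ 1) (m : Cell d M → ℝ)
    (u : Cell d M → Fin d → ℝ) (i : Fin d) {D : Cell d M → ℝ}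
    (hD : ∀ K, |D K| ≤ b * h ^ d) (hD2 : ∀ K, |D K - D (prv i K)| ≤ b * h * h ^ d) :
    |∑ K, flux h α m u i K * D K - ∑ K, m K * u K i * ((D K + D (prv i K)) / 2)|
      ≤ b * ∑ K, h ^ d * (|m K| * (h * |u K i| + |jump i (comp u i) K|
        + |jump i (comp u i) (prv i K)| + h ^ (1 + α))) := by
  have hα : h ^ (1 + α) = h ^ α * h := by rw [add_comm, Real.rpow_add_one hh.ne']
  -- A cell exists, so the bound on `D` at index `0` already forces `b` to be nonnegative.
  have hb : 0 ≤ b := by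
    have := (abs_nonneg _).trans (hD 0)
    by_contra hneg
    nlinarith [pow_pos hh d]
  set w := fun K => |avg i (comp u i) K| with hw
  set U := fun K => |jump i (comp u i) K| with hU
  have e1 : ∑ K, flux h α m u i K * D K - ∑ K, m K * u K i * ((D K + D (prv i K)) / 2)
      = -∑ K, jump i m K * (jump i (comp u i) K / 4 * D K)
        + (∑ K, m K * ((w K * D K - w (prv i K) * D (prv i K)) / 2)
        + ∑ K, m K * (h ^ α * (D K - D (prv i K)))) := by
    have s1 : ∑ K, avg i (fun L => m L * u L i) K * D K
        = ∑ K, m K * u K i * ((D K + D (prv i K)) / 2) := by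
      have s0 : ∑ K, m (nxt i K) * u (nxt i K) i * D K
          = ∑ K, m K * u K i * D (prv i K) := by
        rw [← sum_nxt i (fun K => m K * u K i * D (prv i K))]
        simp
      have : ∀ K, avg i (fun L => m L * u L i) K * D K
          = m K * u K i * D K / 2 + m (nxt i K) * u (nxt i K) i * D K / 2 := fun K => by
        rw [avg]; ring
      simp only [this, Finset.sum_add_distrib, ← Finset.sum_div, s0]
      rw [← add_div, ← Finset.sum_add_distrib, Finset.sum_div]
      exact Finset.sum_congr rfl fun K _ => by ring
    have s2 : ∑ K, jump i m K * (w K / 2 * D K)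
        = -∑ K, m K * ((w K * D K - w (prv i K) * D (prv i K)) / 2) := by
      have := sum_mul_jump i (fun K => w K / 2 * D K) m
      simp only [mul_comm (jump i m _)]
      rw [this]
      congr 1
      exact Finset.sum_congr rfl fun K _ => by ring
    have s3 : ∑ K, jump i m K * (h ^ α * D K) = -∑ K, m K * (h ^ α * (D K - D (prv i K))) := by
      have := sum_mul_jump i (fun K => h ^ α * D K) m
      simp only [mul_comm (jump i m _)]
      rw [this]
      congr 1
      exact Finset.sum_congr rfl fun K _ => by ring
    rw [← s1]
    have s4 : ∑ K, flux h α m u i K * D K = ∑ K, avg i (fun L => m L * u L i) K * D K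
        - ∑ K, jump i m K * (jump i (comp u i) K / 4 * D K) - ∑ K, jump i m K * (w K / 2 * D K)
        - ∑ K, jump i m K * (h ^ α * D K) := by
      rw [← Finset.sum_sub_distrib, ← Finset.sum_sub_distrib, ← Finset.sum_sub_distrib]
      refine Finset.sum_congr rfl fun K _ => ?_
      rw [flux_eq]
      ring
    rw [s4, s2, s3]
    ring
  rw [e1]
  have t1 : |-∑ K, jump i m K * (jump i (comp u i) K / 4 * D K)|
      ≤ ∑ K, b * h ^ d * (|m K| * ((U K + U (prv i K)) / 4)) := by
    rw [abs_neg]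
    refine (Finset.abs_sum_le_sum_abs _ _).trans ?_
    have h2 : ∀ K, |jump i m K * (jump i (comp u i) K / 4 * D K)|
        ≤ b * h ^ d * (|m K| * U K / 4) + b * h ^ d * (|m (nxt i K)| * U K / 4) := fun K => by
      rw [abs_mul, abs_mul, abs_div, abs_of_pos (by norm_num : (0 : ℝ) < 4)]
      have h3 : |jump i m K| ≤ |m (nxt i K)| + |m K| := abs_sub _ _
      calc _ ≤ (|m (nxt i K)| + |m K|) * (U K / 4 * (b * h ^ d)) := by
            gcongr
            exact hD K
        _ = _ := by ring
    refine (Finset.sum_le_sum fun K _ => h2 K).trans (le_of_eq ?_)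
    have h4 : ∑ K, b * h ^ d * (|m (nxt i K)| * U K / 4)
        = ∑ K, b * h ^ d * (|m K| * U (prv i K) / 4) := by
      rw [← sum_nxt i (fun K => b * h ^ d * (|m K| * U (prv i K) / 4))]
      simp
    rw [Finset.sum_add_distrib, h4, ← Finset.sum_add_distrib]
    exact Finset.sum_congr rfl fun K _ => by ring
  have t2 : |∑ K, m K * ((w K * D K - w (prv i K) * D (prv i K)) / 2)|
      ≤ ∑ K, b * h ^ d * (|m K| * ((h * |u K i| + U K + U (prv i K)) / 2)) := by
    refine (Finset.abs_sum_le_sum_abs _ _).trans (Finset.sum_le_sum fun K _ => ?_)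
    rw [abs_mul, abs_div, abs_two]
    have ej : comp u i (nxt i K) = comp u i K + jump i (comp u i) K := by rw [jump]; ring
    have ep : jump i (comp u i) (prv i K) = comp u i K - comp u i (prv i K) := by
      rw [jump, nxt_prv]
    have h1 : w K ≤ |u K i| + U K / 2 := by
      have : avg i (comp u i) K = u K i + jump i (comp u i) K / 2 := by
        rw [avg, ej, comp]; ring
      rw [hw]
      simp only [this]
      refine (abs_add_le _ _).trans ?_
      rw [abs_div, abs_two]
    have h2 : |w K - w (prv i K)| ≤ (U K + U (prv i K)) / 2 := by
      refine (abs_abs_sub_abs_le_abs_sub _ _).trans ?_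
      have : avg i (comp u i) K - avg i (comp u i) (prv i K)
          = (jump i (comp u i) K + jump i (comp u i) (prv i K)) / 2 := by
        rw [avg, avg, nxt_prv, ej, ep]; ring
      rw [this, abs_div, abs_two]
      exact div_le_div_of_nonneg_right (abs_add_le _ _) zero_le_two
    have hU0 : 0 ≤ U K := abs_nonneg _
    have hw0 : 0 ≤ w K := abs_nonneg _
    have h3 : |w K * D K - w (prv i K) * D (prv i K)|
        ≤ b * h ^ d * (h * |u K i| + U K + U (prv i K)) := by
      have : w K * D K - w (prv i K) * D (prv i K)
          = w K * (D K - D (prv i K)) + (w K - w (prv i K)) * D (prv i K) := by ring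
      rw [this]
      refine (abs_add_le _ _).trans ?_
      rw [abs_mul, abs_mul, abs_of_nonneg hw0]
      have hc : 0 ≤ b * h ^ d := by positivity
      have h4 : w K * |D K - D (prv i K)| ≤ (|u K i| + U K / 2) * (b * h * h ^ d) :=
        mul_le_mul h1 (hD2 K) (abs_nonneg _) (by positivity)
      have h5 : |w K - w (prv i K)| * |D (prv i K)| ≤ (U K + U (prv i K)) / 2 * (b * h ^ d) :=
        mul_le_mul h2 (hD _) (abs_nonneg _) (by positivity)
      have h6 : U K / 2 * (b * h ^ d) * h ≤ U K / 2 * (b * h ^ d) :=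
        mul_le_of_le_one_right (by positivity) hh1
      have h7 : 0 ≤ U (prv i K) / 2 * (b * h ^ d) := by positivity
      nlinarith
    have := mul_le_mul_of_nonneg_left h3 (abs_nonneg (m K))
    linarith
  have t3 : |∑ K, m K * (h ^ α * (D K - D (prv i K)))|
      ≤ ∑ K, b * h ^ d * (|m K| * h ^ (1 + α)) := by
    refine (Finset.abs_sum_le_sum_abs _ _).trans (Finset.sum_le_sum fun K _ => ?_)
    rw [abs_mul, abs_mul, abs_of_pos (Real.rpow_pos_of_pos hh α), hα]
    have := mul_le_mul_of_nonneg_left (hD2 K) (by positivity : 0 ≤ |m K| * h ^ α)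
    linarith
  refine (abs_add_le _ _).trans ((add_le_add t1 ((abs_add_le _ _).trans (add_le_add t2 t3))).trans ?_)
  rw [← Finset.sum_add_distrib, ← Finset.sum_add_distrib, Finset.mul_sum]
  refine Finset.sum_le_sum fun K _ => ?_
  have hc : 0 ≤ b * h ^ d := by positivity
  have h1 : 0 ≤ |m K| * (h * |u K i|) := by positivity
  have h2 : 0 ≤ |m K| * U K := by positivity
  have h3 : 0 ≤ |m K| * U (prv i K) := by positivity
  have : |m K| * ((U K + U (prv i K)) / 4) + (|m K| * ((h * |u K i| + U K + U (prv i K)) / 2)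
      + |m K| * h ^ (1 + α)) ≤ |m K| * (h * |u K i| + U K + U (prv i K) + h ^ (1 + α)) := by
    linarith
  have := mul_le_mul_of_nonneg_left this hc
  linarith

/-- The quantity that controls the convective part of the momentum consistency error. -/
noncomputable def momentumRes (h α : ℝ) (r : Cell d M → ℝ) (u : Cell d M → Fin d → ℝ) : ℝ :=
  ∑ j, faceSum h fun i K => |r K * u K j| * (h * |u K i| + |jump i (comp u i) K|
        + |jump i (comp u i) (prv i K)| + h ^ (1 + α))

/-- Young's inequality with `θ = h^(1-β)`, as for the density, now pairing the space-time `L²` norm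
of the momentum with the velocity jumps. -/
lemma momentumRes_le {h α β : ℝ} (hh : 0 < h) {r : Cell d M → ℝ}
    (hr : ∀ K, 0 < r K) (u : Cell d M → Fin d → ℝ) :
    momentumRes h α r u ≤ d * (h * ∑ K, h ^ d * (r K * ∑ j, u K j ^ 2)
      + h ^ (1 + β) * (h ^ (-(2 * β)) * ∑ K, h ^ d * (r K ^ 2 * ∑ j, u K j ^ 2) + gradSum h u)
      + h ^ (1 + α) * (d * ∑ K, h ^ d * r K + ∑ K, h ^ d * (r K * ∑ j, u K j ^ 2))) := by
  set θ := h ^ (1 - β) with hθ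
  have hθ0 : 0 < θ := Real.rpow_pos_of_pos hh _
  have e1 : θ = h ^ (1 + β) * h ^ (-(2 * β)) := by
    rw [hθ, ← Real.rpow_add hh]; congr 1; ring
  have e2 : 1 / θ * h ^ 2 = h ^ (1 + β) := by
    rw [hθ, one_div, ← Real.rpow_neg hh.le, ← Real.rpow_two, ← Real.rpow_add hh]; congr 1; ring
  have hα0 : 0 < h ^ (1 + α) := Real.rpow_pos_of_pos hh _
  set A := faceSum h (fun i K => r K * u K i ^ 2)
  set S := faceSum h (fun i K => jump i (comp u i) K ^ 2) with hS
  have h1 : ∀ j, faceSum h (fun i K => |r K * u K j| * (h * |u K i| + |jump i (comp u i) K|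
        + |jump i (comp u i) (prv i K)| + h ^ (1 + α)))
      ≤ h / 2 * faceSum h (fun _ K => r K * u K j ^ 2) + h / 2 * A
        + θ * faceSum h (fun _ K => r K ^ 2 * u K j ^ 2) + 1 / (2 * θ) * S + 1 / (2 * θ) * S
        + h ^ (1 + α) * (faceSum h (fun _ K => r K) + faceSum h (fun _ K => r K * u K j ^ 2)) := by
    intro j
    have e3 : S = faceSum h (fun i K => jump i (comp u i) (prv i K) ^ 2) := by
      rw [hS, faceSum_prv h (fun i K => jump i (comp u i) K ^ 2)]
    nth_rewrite 2 [e3]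
    rw [← faceSum_add, ← faceSum_mul, ← faceSum_mul, ← faceSum_mul, ← faceSum_mul, ← faceSum_mul,
      ← faceSum_mul, ← faceSum_add, ← faceSum_add, ← faceSum_add, ← faceSum_add, ← faceSum_add]
    refine faceSum_mono hh.le fun i K => ?_
    have hK := hr K
    have a1 : |r K * u K j| * (h * |u K i|) ≤ h / 2 * (r K * u K j ^ 2) + h / 2 * (r K * u K i ^ 2) := by
      rw [abs_mul, abs_of_pos hK]
      have : |u K j| * |u K i| ≤ (u K j ^ 2 + u K i ^ 2) / 2 := by
        rw [← sq_abs (u K j), ← sq_abs (u K i)]; nlinarith [sq_nonneg (|u K j| - |u K i|)]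
      have := mul_le_mul_of_nonneg_left this (by positivity : 0 ≤ h * r K)
      linarith
    have a2 : ∀ z : ℝ, |r K * u K j| * |z|
        ≤ θ / 2 * (r K ^ 2 * u K j ^ 2) + 1 / (2 * θ) * z ^ 2 := fun z => by
      have := two_mul_le_scale hθ0 |r K * u K j| |z|
      rw [sq_abs, sq_abs, mul_pow] at this
      refine this.trans (le_of_eq ?_)
      ring
    have a3 : |r K * u K j| * h ^ (1 + α) ≤ h ^ (1 + α) * (r K + r K * u K j ^ 2) := by
      rw [abs_mul, abs_of_pos hK, mul_comm]
      refine mul_le_mul_of_nonneg_left ?_ hα0.le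
      have : |u K j| ≤ 1 + u K j ^ 2 := by
        rw [← sq_abs]; nlinarith [sq_nonneg (|u K j| - 1 / 2)]
      have := mul_le_mul_of_nonneg_left this hK.le
      linarith
    have a4 := a2 (jump i (comp u i) K)
    have a5 := a2 (jump i (comp u i) (prv i K))
    linarith
  have hkin : ∑ j, faceSum h (fun _ K => r K * u K j ^ 2)
      = d * ∑ K, h ^ d * (r K * ∑ j, u K j ^ 2) := by
    simp only [faceSum_cell]
    rw [← Finset.mul_sum, Finset.sum_comm]
    simp only [Finset.mul_sum]
  have hmom : ∑ j, faceSum h (fun _ K => r K ^ 2 * u K j ^ 2)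
      = d * ∑ K, h ^ d * (r K ^ 2 * ∑ j, u K j ^ 2) := by
    simp only [faceSum_cell]
    rw [← Finset.mul_sum, Finset.sum_comm]
    simp only [Finset.mul_sum]
  have hA : A = ∑ K, h ^ d * (r K * ∑ j, u K j ^ 2) := faceSum_component h r u
  have h3 := faceSum_jump_sq_le hh u
  have h4 : 1 / (2 * θ) * S ≤ h ^ (1 + β) * gradSum h u / 2 := by
    calc _ ≤ 1 / (2 * θ) * (h ^ 2 * gradSum h u) := by gcongr
      _ = (1 / θ * h ^ 2) * gradSum h u / 2 := by field_simp
      _ = _ := by rw [e2]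
  refine (Finset.sum_le_sum fun j _ => h1 j).trans ?_
  have hsum : ∀ (a b : Fin d → ℝ) (c₁ c₂ c₃ c₄ c₅ c₆ : ℝ),
      ∑ j, (c₁ * a j + c₂ + c₃ * b j + c₄ + c₄ + c₅ * (c₆ + a j))
        = c₁ * ∑ j, a j + d * c₂ + c₃ * ∑ j, b j + d * c₄ + d * c₄ + c₅ * (d * c₆ + ∑ j, a j) := by
    intro a b c₁ c₂ c₃ c₄ c₅ c₆
    simp [Finset.sum_add_distrib, ← Finset.mul_sum]
  rw [hsum, hkin, hmom, hA, faceSum_cell h r, e1]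
  rw [e1] at h4
  have h5 := mul_le_mul_of_nonneg_left h4 (Nat.cast_nonneg (α := ℝ) d)
  linarith

end FluxResidual

end FV

namespace FV

/-! ### Weak directional derivatives along segments. -/

section WeakDerivative

set_option linter.unusedSectionVars false

variable {E : Type*} [NormedAddCommGroup E] [NormedSpace ℝ E] [FiniteDimensional ℝ E]
  [MeasureSpace E] [BorelSpace E] [(volume : Measure E).IsAddHaarMeasure]

/-- `g` is the weak derivative of `f` on `S` in direction `v`. -/
def HasWeakDeriv (S : Set E) (v : E) (f g : E → ℝ) : Prop :=
  ∀ ψ : E → ℝ, ContDiff ℝ ∞ ψ → HasCompactSupport ψ → tsupport ψ ⊆ S →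
    ∫ z, f z * fderiv ℝ ψ z v = -∫ z, g z * ψ z

-- Integrating `χ` over a segment is convolution with the image of Lebesgue measure on that segment,
-- hence smooth. Moving `z` along `v` shifts the interval of integration, so the derivative is the
-- difference of the end values.
open scoped Convolution in
lemma contDiff_integral_translate {χ : E → ℝ} (hχ : ContDiff ℝ ∞ χ) (hc : HasCompactSupport χ)
    (v : E) {s : ℝ} (hs : 0 ≤ s) :
    ContDiff ℝ ∞ (fun z => ∫ r in Icc 0 s, χ (z - r • v)) ∧
      ∀ z, fderiv ℝ (fun z => ∫ r in Icc 0 s, χ (z - r • v)) z v = χ z - χ (z - s • v) := by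
  set μ : Measure E := Measure.map (fun r : ℝ => r • v) (volume.restrict (Icc 0 s)) with hμ
  have hcont : Continuous fun r : ℝ => r • v := by fun_prop
  have hmap : ∀ F : E → ℝ, Continuous F → ∫ t, F t ∂μ = ∫ r in Icc 0 s, F (r • v) := fun F hF =>
    integral_map hcont.measurable.aemeasurable hF.aestronglyMeasurable
  have hfin : IsFiniteMeasure μ := Measure.isFiniteMeasure_map _ _
  have h1 : LocallyIntegrable (fun _ : E => (1 : ℝ)) μ := (integrable_const 1).locallyIntegrable
  have e : (fun z => ∫ r in Icc 0 s, χ (z - r • v))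
      = ((fun _ : E => (1 : ℝ)) ⋆[ContinuousLinearMap.lsmul ℝ ℝ, μ] χ) := by
    funext z
    have := hmap (fun t => χ (z - t)) (hχ.continuous.comp (by fun_prop))
    simp [MeasureTheory.convolution, this]
  rw [e]
  refine ⟨hc.contDiff_convolution_right _ h1 hχ, fun z => ?_⟩
  rw [← e]
  have hdiff : ContDiff ℝ ∞ (fun z => ∫ r in Icc 0 s, χ (z - r • v)) :=
    e ▸ hc.contDiff_convolution_right _ h1 hχ
  have hk : Continuous fun r : ℝ => χ (z - r • v) := hχ.continuous.comp (by fun_prop)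
  have hline : (fun τ : ℝ => ∫ r in Icc 0 s, χ (z + τ • v - r • v))
      = fun τ => (∫ r in (0 : ℝ)..s - τ, χ (z - r • v)) - ∫ r in (0 : ℝ)..-τ, χ (z - r • v) := by
    funext τ
    rw [integral_Icc_eq_integral_Ioc, ← intervalIntegral.integral_of_le hs,
      intervalIntegral.integral_interval_sub_left (hk.intervalIntegrable _ _)
        (hk.intervalIntegrable _ _), ← zero_sub,
      ← intervalIntegral.integral_comp_sub_right (fun r => χ (z - r • v)) τ]
    refine intervalIntegral.integral_congr fun r _ => ?_
    simp only [sub_smul]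
    congr 1
    abel
  have hP : ∀ x, HasDerivAt (fun x => ∫ r in (0 : ℝ)..x, χ (z - r • v)) (χ (z - x • v)) x := fun x =>
    intervalIntegral.integral_hasDerivAt_right (hk.intervalIntegrable _ _)
      (hk.stronglyMeasurableAtFilter _ _) hk.continuousAt
  have hd1 : HasDerivAt (fun τ : ℝ => ∫ r in Icc 0 s, χ (z + τ • v - r • v))
      (χ z - χ (z - s • v)) 0 := by
    rw [hline]
    have h2 : HasDerivAt (fun τ : ℝ => s - τ) (-1) 0 := (hasDerivAt_id (0 : ℝ)).const_sub s
    have h3 : HasDerivAt (fun τ : ℝ => -τ) (-1) 0 := (hasDerivAt_id (0 : ℝ)).neg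
    have h4 := (HasDerivAt.comp (0 : ℝ) (hP (s - 0)) h2).sub (HasDerivAt.comp (0 : ℝ) (hP (-0)) h3)
    refine h4.congr_deriv ?_
    simp
    ring
  have hd2 : HasDerivAt (fun τ : ℝ => ∫ r in Icc 0 s, χ (z + τ • v - r • v))
      (fderiv ℝ (fun z => ∫ r in Icc 0 s, χ (z - r • v)) z v) 0 := by
    have ha : HasDerivAt (fun τ : ℝ => z + τ • v) v 0 := by
      simpa using ((hasDerivAt_id (0 : ℝ)).smul_const v).const_add z
    have hb : HasFDerivAt (fun z => ∫ r in Icc 0 s, χ (z - r • v))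
        (fderiv ℝ (fun z => ∫ r in Icc 0 s, χ (z - r • v)) z) (z + (0 : ℝ) • v) := by
      rw [zero_smul, add_zero]
      exact (hdiff.differentiable (by simp) z).hasFDerivAt
    exact hb.comp_hasDerivAt (0 : ℝ) ha
  exact hd2.unique hd1

lemma integrable_of_bounded_of_zero_off {X : Type*} [MeasurableSpace X] {μ : Measure X}
    {F : X → ℝ} {K : Set X} {C : ℝ} (hF : AEStronglyMeasurable F μ) (hK : μ K ≠ ⊤)
    (hb : ∀ x, |F x| ≤ C) (h0 : ∀ x, x ∉ K → F x = 0) : Integrable F μ :=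
  IntegrableOn.integrable_of_forall_notMem_eq_zero
    (Measure.integrableOn_of_bounded hK hF (Filter.Eventually.of_forall hb)) h0

lemma locallyIntegrable_of_bounded {X : Type*} [MeasurableSpace X] [TopologicalSpace X]
    {μ : Measure X} [IsLocallyFiniteMeasure μ]
    {F : X → ℝ} {C : ℝ} (hF : AEStronglyMeasurable F μ) (hb : ∀ x, |F x| ≤ C) :
    LocallyIntegrable F μ := fun x => by
  obtain ⟨u, hu, h⟩ := μ.finiteAt_nhds x
  exact ⟨u, hu, Measure.integrableOn_of_bounded h.ne hF (Filter.Eventually.of_forall hb)⟩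

/-- A function with a weak derivative is, along almost every segment in the direction of
derivation, the integral of the derivative. -/
lemma HasWeakDeriv.sub_eq_integral {S : Set E} (hS : IsOpen S) (hconv : Convex ℝ S) {v : E}
    {f g : E → ℝ} {Cf Cg : ℝ} (hf : Measurable f) (hfb : ∀ z, |f z| ≤ Cf) (hg : Measurable g)
    (hgb : ∀ z, |g z| ≤ Cg) (w : HasWeakDeriv S v f g) {s : ℝ} (hs : 0 ≤ s) :
    ∀ᵐ z, z ∈ S → z + s • v ∈ S → f (z + s • v) - f z = ∫ r in Icc 0 s, g (z + r • v) := by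
  set U := S ∩ (fun z => z + s • v) ⁻¹' S with hU
  have hUo : IsOpen U := hS.inter (hS.preimage (by fun_prop))
  have hmeas : Measurable fun p : E × ℝ => g (p.1 + p.2 • v) := by
    refine hg.comp (Continuous.measurable ?_)
    fun_prop
  have hJm : Measurable fun z => ∫ r in Icc 0 s, g (z + r • v) :=
    (hmeas.stronglyMeasurable.integral_prod_right (ν := volume.restrict (Icc 0 s))).measurable
  have hJb : ∀ z, |∫ r in Icc 0 s, g (z + r • v)| ≤ Cg * s := fun z => by
    have := norm_setIntegral_le_of_norm_le_const (μ := volume) (s := Icc 0 s) (C := Cg)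
      (f := fun r => g (z + r • v)) (by simp) (fun r _ => hgb _)
    simpa [Real.norm_eq_abs, measureReal_def, hs] using this
  have hfs : Measurable fun z => f (z + s • v) := hf.comp (measurable_add_const _)
  -- By the fundamental lemma of the calculus of variations it suffices to test with `χ` supported
  -- in `U`. The weak formulation is applied to the segment integral of `χ`, whose derivative in
  -- direction `v` is `χ(z) - χ(z - s v)`; translation and Fubini then move the shifts onto `f` and
  -- `g`.
  have key : ∀ᵐ z, z ∈ U → f (z + s • v) - f z - ∫ r in Icc 0 s, g (z + r • v) = 0 := by
    refine hUo.ae_eq_zero_of_integral_contDiff_smul_eq_zero ?_ ?_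
    · refine (locallyIntegrable_of_bounded (C := Cf + Cf + Cg * s)
        ((hfs.sub hf).sub hJm).aestronglyMeasurable fun z => ?_).locallyIntegrableOn _
      exact (abs_sub _ _).trans (add_le_add ((abs_sub _ _).trans (add_le_add (hfb _) (hfb _))) (hJb z))
    · intro χ hχ hc hsupp
      obtain ⟨Cχ, hCχ⟩ := hc.exists_bound_of_continuous hχ.continuous
      obtain ⟨hψ1, hψ2⟩ := contDiff_integral_translate hχ hc v hs
      set K := (fun p : E × ℝ => p.1 + p.2 • v) '' (tsupport χ ×ˢ Icc 0 s) with hK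
      have hKc : IsCompact K := (hc.isCompact.prod isCompact_Icc).image (by fun_prop)
      -- `K` is swept out by segments with both ends in `S`, hence convexity keeps the new test
      -- function supported in `S`.
      have hKS : K ⊆ S := by
        rintro _ ⟨⟨z, r⟩, ⟨hz, hr⟩, rfl⟩
        have hz' := hsupp hz
        rcases hs.eq_or_lt with h0 | h0
        · have : r = 0 := le_antisymm (h0 ▸ hr.2) hr.1
          simpa [this] using hz'.1
        · have := hconv hz'.1 hz'.2 (a := 1 - r / s) (b := r / s)
            (by rw [sub_nonneg, div_le_one h0]; exact hr.2) (div_nonneg hr.1 hs) (by ring)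
          convert! this using 1
          simp only [smul_add, smul_smul, div_mul_cancel₀ _ h0.ne', sub_smul, one_smul]
          abel
      have hzero : ∀ z, z ∉ K → ∀ r ∈ Icc 0 s, χ (z - r • v) = 0 := fun z hz r hr => by
        by_contra hne
        exact hz ⟨(z - r • v, r), ⟨subset_tsupport _ hne, hr⟩, by simp⟩
      have hψ0 : ∀ z, z ∉ K → ∫ r in Icc 0 s, χ (z - r • v) = 0 := fun z hz => by
        rw [setIntegral_congr_fun measurableSet_Icc (hzero z hz)]
        simp
      have hψc := HasCompactSupport.intro hKc hψ0
      have hψs : tsupport (fun z => ∫ r in Icc 0 s, χ (z - r • v)) ⊆ S := by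
        refine (closure_minimal (fun z hz => ?_) hKc.isClosed).trans hKS
        by_contra hne
        exact hz (hψ0 z hne)
      have h1 := w _ hψ1 hψc hψs
      simp only [hψ2] at h1
      have hχc := hχ.continuous
      have hχm := hχc.measurable
      have hft : ∀ t : E, Integrable fun z => f z * χ (z - t) := fun t => by
        have hi : Integrable fun z => χ (z - t) :=
          (hχc.integrable_of_hasCompactSupport hc).comp_sub_right t
        exact hi.bdd_mul hf.aestronglyMeasurable (Filter.Eventually.of_forall hfb)
      have hf0 : Integrable fun z => f z * χ z := by simpa using hft 0
      have e1 : ∫ z, f z * (χ z - χ (z - s • v)) = (∫ z, f z * χ z) - ∫ z, f (z + s • v) * χ z := by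
        simp only [mul_sub]
        rw [integral_sub hf0 (hft _)]
        congr 1
        rw [← integral_add_right_eq_self (fun z => f z * χ (z - s • v)) (s • v)]
        simp
      have hprod1 : Integrable (Function.uncurry fun (z : E) (r : ℝ) => g z * χ (z - r • v))
          (volume.prod (volume.restrict (Icc 0 s))) := by
        have hm : Measurable (Function.uncurry fun (z : E) (r : ℝ) => g z * χ (z - r • v)) := by
          refine (hg.comp measurable_fst).mul (hχm.comp (Continuous.measurable ?_))
          fun_prop
        rw [← Measure.restrict_univ (μ := (volume : Measure E)), Measure.prod_restrict]
        change IntegrableOn _ (univ ×ˢ Icc (0 : ℝ) s) (volume.prod volume)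
        have h2 : IntegrableOn (Function.uncurry fun (z : E) (r : ℝ) => g z * χ (z - r • v))
            (K ×ˢ Icc (0 : ℝ) s) (volume.prod volume) := by
          refine Measure.integrableOn_of_bounded (M := Cg * Cχ) ?_ hm.aestronglyMeasurable
            (Filter.Eventually.of_forall fun p => ?_)
          · exact ((hKc.prod isCompact_Icc).measure_lt_top).ne
          · rw [Function.uncurry, norm_mul]
            exact mul_le_mul (hgb _) (hCχ _) (norm_nonneg _) ((abs_nonneg _).trans (hgb p.1))
        refine h2.of_forall_sdiff_eq_zero (MeasurableSet.univ.prod measurableSet_Icc) ?_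
        rintro ⟨z, r⟩ ⟨⟨_, hr⟩, hn⟩
        have : z ∉ K := fun hz => hn ⟨hz, hr⟩
        simp [Function.uncurry, hzero z this r hr]
      have hprod2 : Integrable (Function.uncurry fun (r : ℝ) (z : E) => g (z + r • v) * χ z)
          ((volume.restrict (Icc 0 s)).prod volume) := by
        have hm : Measurable (Function.uncurry fun (r : ℝ) (z : E) => g (z + r • v) * χ z) := by
          refine (hg.comp (Continuous.measurable ?_)).mul (hχm.comp measurable_snd)
          fun_prop
        refine integrable_of_bounded_of_zero_off (K := univ ×ˢ tsupport χ) (C := Cg * Cχ)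
          hm.aestronglyMeasurable ?_ ?_ ?_
        · rw [Measure.prod_prod]
          exact ENNReal.mul_ne_top (by simp) hc.isCompact.measure_lt_top.ne
        · rintro ⟨r, z⟩
          rw [Function.uncurry, abs_mul]
          exact mul_le_mul (hgb _) (hCχ _) (abs_nonneg _) ((abs_nonneg _).trans (hgb z))
        · rintro ⟨r, z⟩ hn
          have : z ∉ tsupport χ := fun hz => hn ⟨mem_univ _, hz⟩
          simp [Function.uncurry, image_eq_zero_of_notMem_tsupport this]
      have e2 : ∫ z, g z * ∫ r in Icc 0 s, χ (z - r • v)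
          = ∫ z, (∫ r in Icc 0 s, g (z + r • v)) * χ z := by
        calc _ = ∫ z, ∫ r in Icc 0 s, g z * χ (z - r • v) := by simp only [integral_const_mul]
          _ = ∫ r in Icc 0 s, ∫ z, g z * χ (z - r • v) := integral_integral_swap hprod1
          _ = ∫ r in Icc 0 s, ∫ z, g (z + r • v) * χ z := by
              congr 1
              funext r
              rw [← integral_add_right_eq_self (fun z => g z * χ (z - r • v)) (r • v)]
              simp
          _ = ∫ z, ∫ r in Icc 0 s, g (z + r • v) * χ z := integral_integral_swap hprod2
          _ = _ := by simp only [integral_mul_const]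
      rw [e1, e2] at h1
      have i1 : Integrable fun z => f (z + s • v) * χ z :=
        (hχc.integrable_of_hasCompactSupport hc).bdd_mul hfs.aestronglyMeasurable
          (Filter.Eventually.of_forall fun z => hfb _)
      have i2 : Integrable fun z => (∫ r in Icc 0 s, g (z + r • v)) * χ z :=
        (hχc.integrable_of_hasCompactSupport hc).bdd_mul hJm.aestronglyMeasurable
          (Filter.Eventually.of_forall hJb)
      have e3 : ∀ z, χ z • (f (z + s • v) - f z - ∫ r in Icc 0 s, g (z + r • v))
          = f (z + s • v) * χ z - f z * χ z - (∫ r in Icc 0 s, g (z + r • v)) * χ z := fun z => by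
        rw [smul_eq_mul]; ring
      simp only [e3]
      have i3 : Integrable fun z => f (z + s • v) * χ z - f z * χ z := i1.sub hf0
      rw [integral_sub i3 i2, integral_sub i1 hf0]
      linarith
  filter_upwards [key] with z hz h1 h2
  exact sub_eq_zero.mp (hz ⟨h1, h2⟩)

/-- Weak derivatives inherit translation invariance. -/
lemma HasWeakDeriv.translate_ae_eq {S : Set E} (hS : IsOpen S) {v w : E}
    (hw : ∀ z, z ∈ S ↔ z + w ∈ S) {f g : E → ℝ} {Cg : ℝ} (hg : Measurable g)
    (hgb : ∀ z, |g z| ≤ Cg) (hfw : ∀ z ∈ S, f (z + w) = f z) (H : HasWeakDeriv S v f g) :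
    ∀ᵐ z, z ∈ S → g (z + w) = g z := by
  have hgw : Measurable fun z => g (z + w) := hg.comp (measurable_add_const _)
  have key : ∀ᵐ z, z ∈ S → g (z + w) - g z = 0 := by
    refine hS.ae_eq_zero_of_integral_contDiff_smul_eq_zero ?_ ?_
    · exact (locallyIntegrable_of_bounded (C := Cg + Cg) (hgw.sub hg).aestronglyMeasurable
        fun z => (abs_sub _ _).trans (add_le_add (hgb _) (hgb _))).locallyIntegrableOn _
    · intro χ hχ hc hsupp
      have hχw : ContDiff ℝ ∞ fun z => χ (z - w) := hχ.comp (by fun_prop)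
      have hcw : HasCompactSupport fun z => χ (z - w) := by
        simpa [sub_eq_add_neg, Function.comp_def] using hc.comp_homeomorph (Homeomorph.addRight (-w))
      have hts : tsupport (fun z => χ (z - w)) ⊆ S := by
        have e : tsupport (fun z => χ (z - w)) = (fun z => z - w) ⁻¹' tsupport χ := by
          simpa [sub_eq_add_neg, Function.comp_def] using
            tsupport_comp_eq_preimage χ (Homeomorph.addRight (-w))
        intro z hz
        rw [e] at hz
        have := (hw (z - w)).mp (hsupp hz)
        simpa using this
      have h1 := H χ hχ hc hsupp
      have h2 := H _ hχw hcw hts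
      have e1 : ∫ z, f z * fderiv ℝ (fun z => χ (z - w)) z v = ∫ z, f z * fderiv ℝ χ z v := by
        simp only [fderiv_comp_sub]
        rw [← integral_add_right_eq_self (fun z => f z * fderiv ℝ χ (z - w) v) w]
        congr 1
        funext z
        rw [add_sub_cancel_right]
        -- Invariance of `f` is only known on `S`; elsewhere the derivative of `χ` vanishes.
        by_cases hz : z ∈ S
        · rw [hfw z hz]
        · have h0 : fderiv ℝ χ z = 0 := by
            have : z ∉ tsupport (fderiv ℝ χ) := fun h => hz (hsupp (tsupport_fderiv_subset ℝ h))
            exact image_eq_zero_of_notMem_tsupport this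
          simp [h0]
      have e2 : ∫ z, g z * χ (z - w) = ∫ z, g (z + w) * χ z := by
        rw [← integral_add_right_eq_self (fun z => g z * χ (z - w)) w]
        simp
      have hi := hχ.continuous.integrable_of_hasCompactSupport hc (μ := (volume : Measure E))
      have i1 : Integrable fun z => g (z + w) * χ z :=
        hi.bdd_mul hgw.aestronglyMeasurable (Filter.Eventually.of_forall fun z => hgb _)
      have i2 : Integrable fun z => g z * χ z :=
        hi.bdd_mul hg.aestronglyMeasurable (Filter.Eventually.of_forall fun z => hgb _)
      have e3 : ∀ z, χ z • (g (z + w) - g z) = g (z + w) * χ z - g z * χ z := fun z => by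
        rw [smul_eq_mul]; ring
      simp only [e3]
      rw [integral_sub i1 i2]
      rw [e1, e2] at h2
      linarith
  filter_upwards [key] with z hz h1
  exact sub_eq_zero.mp (hz h1)

/-- A function with a bounded weak derivative is Lipschitz in the direction of derivation. -/
lemma HasWeakDeriv.abs_sub_le {S : Set E} (hS : IsOpen S) (hconv : Convex ℝ S) {v : E}
    {f g : E → ℝ} {Cf Cg : ℝ} (hf : Measurable f) (hfb : ∀ z, |f z| ≤ Cf) (hg : Measurable g)
    (hgb : ∀ z, |g z| ≤ Cg) (w : HasWeakDeriv S v f g) {s : ℝ} (hs : 0 ≤ s) :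
    ∀ᵐ z, z ∈ S → z + s • v ∈ S → |f (z + s • v) - f z| ≤ Cg * s := by
  filter_upwards [w.sub_eq_integral hS hconv hf hfb hg hgb hs] with z hz h1 h2
  rw [hz h1 h2]
  have := norm_setIntegral_le_of_norm_le_const (μ := volume) (s := Icc 0 s) (C := Cg)
    (f := fun r => g (z + r • v)) (by simp) (fun r _ => hgb _)
  simpa [Real.norm_eq_abs, measureReal_def, hs] using this

end WeakDerivative

end FV

/-! ### Representatives of the test functions and their regularity in time. -/

namespace FV

instance (d : ℕ) : (volume : Measure (ℝ × Space d)).IsAddHaarMeasure :=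
  inferInstanceAs ((volume : Measure ℝ).prod (volume : Measure (Space d))).IsAddHaarMeasure

/-- The space-time strip `(0, T) × ℝ^d`. -/
def strip (d : ℕ) (T : ℝ) : Set (ℝ × Space d) := Ioo 0 T ×ˢ univ

lemma mem_strip {d : ℕ} {T : ℝ} {z : ℝ × Space d} : z ∈ strip d T ↔ z.1 ∈ Ioo 0 T := by
  simp [strip]

lemma isOpen_strip (d : ℕ) (T : ℝ) : IsOpen (strip d T) := isOpen_Ioo.prod isOpen_univ

lemma convex_strip (d : ℕ) (T : ℝ) : Convex ℝ (strip d T) := (convex_Ioo 0 T).prod convex_univ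

variable {d : ℕ}

/-- A measurable representative is clipped to `[-B, B]`, so that the bound holds everywhere. The
weak derivative relation also survives changing the function on a null set, which allows second
derivatives to refer to the normalized first ones. -/
lemma IsBddWeakDeriv.exists_normalized {T B : ℝ} {v : ℝ × Space d} {f g : ℝ → Space d → ℝ}
    (hB : 0 ≤ B) (H : IsBddWeakDeriv T B v f g) : ∃ G : ℝ × Space d → ℝ, Measurable G ∧
      (∀ z, |G z| ≤ B) ∧ (∀ᵐ z : ℝ × Space d, z ∈ strip d T → G z = g z.1 z.2) ∧
      ∀ F : ℝ × Space d → ℝ, (∀ᵐ z : ℝ × Space d, z ∈ strip d T → F z = f z.1 z.2) →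
        HasWeakDeriv (strip d T) v F G := by
  have hS : MeasurableSet (strip d T) := (isOpen_strip d T).measurableSet
  set m := H.meas.mk with hm
  have hmm : Measurable m := H.meas.stronglyMeasurable_mk.measurable
  set G : ℝ × Space d → ℝ := fun z => max (-B) (min B (m z)) with hG
  have hGg : ∀ᵐ z : ℝ × Space d, z ∈ strip d T → G z = g z.1 z.2 := by
    rw [← ae_restrict_iff' hS]
    filter_upwards [H.meas.ae_eq_mk, H.bound] with z h1 h2
    have h3 : m z = g z.1 z.2 := h1.symm
    rw [abs_le] at h2
    rw [hG]
    simp only [h3, min_eq_right h2.2, max_eq_right h2.1]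
  refine ⟨G, measurable_const.max (measurable_const.min hmm), fun z => ?_, hGg, fun F hF ψ h1 h2 h3 => ?_⟩
  · rw [abs_le]
    exact ⟨le_max_left _ _, max_le (by linarith) (min_le_left _ _)⟩
  · have h4 := H.weak ψ h1 h2 h3
    have hψ : ∀ z, z ∉ strip d T → ψ z = 0 := fun z hz =>
      image_eq_zero_of_notMem_tsupport fun h => hz (h3 h)
    have hψ' : ∀ z, z ∉ strip d T → fderiv ℝ ψ z = 0 := fun z hz =>
      image_eq_zero_of_notMem_tsupport fun h => hz (h3 (tsupport_fderiv_subset ℝ h))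
    rw [← setIntegral_eq_integral_of_forall_compl_eq_zero (s := strip d T)
        (fun z hz => by simp [hψ' z hz]),
      ← setIntegral_eq_integral_of_forall_compl_eq_zero (s := strip d T) (f := fun z => G z * ψ z)
        (fun z hz => by simp [hψ z hz])]
    have e1 : ∫ z in strip d T, F z * fderiv ℝ ψ z v
        = ∫ z in strip d T, f z.1 z.2 * fderiv ℝ ψ z v := by
      refine integral_congr_ae ?_
      filter_upwards [(ae_restrict_iff' hS).mpr hF] with z hz
      rw [hz]
    have e2 : ∫ z in strip d T, G z * ψ z = ∫ z in strip d T, g z.1 z.2 * ψ z := by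
      refine integral_congr_ae ?_
      filter_upwards [(ae_restrict_iff' hS).mpr hGg] with z hz
      rw [hz]
    rw [e1, e2]
    exact h4

/-- A test function extended to all times together with measurable, everywhere bounded
representatives of its weak derivatives. -/
structure NormalTest (ℓ T B : ℝ) (F Gt : ℝ × Space d → ℝ) (Gx : Fin d → ℝ × Space d → ℝ) :
    Prop where
  cont : Continuous F
  bound : ∀ z, |F z| ≤ B
  periodic : ∀ z i, F (z + (0, Pi.single i ℓ)) = F z
  meas_t : Measurable Gt
  bound_t : ∀ z, |Gt z| ≤ B
  meas_x : ∀ i, Measurable (Gx i)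
  bound_x : ∀ i z, |Gx i z| ≤ B
  dt : HasWeakDeriv (strip d T) (1, 0) F Gt
  dx : ∀ i, HasWeakDeriv (strip d T) (0, Pi.single i 1) F (Gx i)
  lip_t : ∀ δ, 0 ≤ δ → ∀ᵐ z : ℝ × Space d, z ∈ strip d T → z + δ • (1, 0) ∈ strip d T →
    |Gt (z + δ • (1, 0)) - Gt z| ≤ B * δ

lemma IsTestFun.nonneg {ℓ T B : ℝ} {φ φt : ℝ → Space d → ℝ} {φx : Fin d → ℝ → Space d → ℝ}
    (hT : 0 < T) (H : IsTestFun ℓ T B φ φt φx) : 0 ≤ B :=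
  (abs_nonneg _).trans (H.bound 0 ⟨le_rfl, hT.le⟩ 0)

/-- Clamping the time variable extends the function continuously to all times without affecting it
on `[0,T]`. The bound of `∂_t²φ` becomes a Lipschitz bound of `∂_t φ`. -/
lemma IsTestFun.exists_normalTest {ℓ T B : ℝ} {φ φt : ℝ → Space d → ℝ}
    {φx : Fin d → ℝ → Space d → ℝ} (hT : 0 < T) (H : IsTestFun ℓ T B φ φt φx) :
    ∃ F Gt Gx, NormalTest ℓ T B F Gt Gx ∧ (∀ t ∈ Icc 0 T, ∀ x, F (t, x) = φ t x) ∧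
      (∀ᵐ z : ℝ × Space d, z ∈ strip d T → Gt z = φt z.1 z.2) ∧
      ∀ i, ∀ᵐ z : ℝ × Space d, z ∈ strip d T → Gx i z = φx i z.1 z.2 := by
  have hB := H.nonneg hT
  set F : ℝ × Space d → ℝ := fun z => φ (max 0 (min T z.1)) z.2 with hF
  have hclamp : ∀ t : ℝ, max 0 (min T t) ∈ Icc 0 T := fun t =>
    ⟨le_max_left _ _, max_le hT.le (min_le_left _ _)⟩
  have hFφ : ∀ t ∈ Icc 0 T, ∀ x, F (t, x) = φ t x := fun t ht x => by
    simp only [hF, min_eq_right ht.2, max_eq_right ht.1]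
  have hFae : ∀ᵐ z : ℝ × Space d, z ∈ strip d T → F z = φ z.1 z.2 :=
    Filter.Eventually.of_forall fun z hz => hFφ z.1 (Ioo_subset_Icc_self (mem_strip.mp hz)) z.2
  have hFc : Continuous F :=
    H.cont.comp_continuous (f := fun z : ℝ × Space d => (max 0 (min T z.1), z.2)) (by fun_prop)
      fun z => ⟨hclamp z.1, mem_univ _⟩
  obtain ⟨Gt, m1, b1, e1, w1⟩ := H.dt.exists_normalized hB
  obtain ⟨φtt, Htt⟩ := H.dtt
  obtain ⟨Gtt, m2, b2, e2, w2⟩ := Htt.exists_normalized hB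
  choose Gx m3 b3 e3 w3 using fun i => (H.dx i).exists_normalized hB
  refine ⟨F, Gt, Gx, ⟨hFc, fun z => H.bound _ (hclamp z.1) z.2, fun z i => ?_, m1, b1, m3, b3,
    w1 F hFae, fun i => w3 i F hFae, fun δ hδ => ?_⟩, hFφ, e1, e3⟩
  · simpa [hF] using H.periodic _ (hclamp z.1) z.2 i
  · exact (w2 Gt e1).abs_sub_le (isOpen_strip d T) (convex_strip d T) m1 b1 m2 b2 hδ

/-- Regularity in time of integrals of a test function. -/
structure TimeReg (T b : ℝ) (c γ : ℝ → ℝ) : Prop where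
  meas : Measurable γ
  bound_deriv : ∀ t, |γ t| ≤ b
  ftc : ∀ t ∈ Icc 0 T, c t = c 0 + ∫ r in (0 : ℝ)..t, γ r
  lip : ∀ δ, 0 ≤ δ → ∀ᵐ t, t ∈ Ioo 0 T → t + δ ∈ Ioo 0 T → |γ (t + δ) - γ t| ≤ b * δ

lemma TimeReg.intervalIntegrable {T b : ℝ} {c γ : ℝ → ℝ} (R : TimeReg T b c γ) (s t : ℝ) :
    IntervalIntegrable γ volume s t :=
  (intervalIntegrable_const (c := b)).mono_fun' R.meas.aestronglyMeasurable
    (Filter.Eventually.of_forall R.bound_deriv)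

lemma TimeReg.sub_eq {T b : ℝ} {c γ : ℝ → ℝ} (R : TimeReg T b c γ) {s t : ℝ} (hs : s ∈ Icc 0 T)
    (ht : t ∈ Icc 0 T) : c t - c s = ∫ r in s..t, γ r := by
  rw [R.ftc t ht, R.ftc s hs, ← intervalIntegral.integral_interval_sub_left
    (R.intervalIntegrable 0 t) (R.intervalIntegrable 0 s)]
  ring

lemma TimeReg.abs_sub_le {T b : ℝ} {c γ : ℝ → ℝ} (R : TimeReg T b c γ) {s t : ℝ}
    (hs : s ∈ Icc 0 T) (ht : t ∈ Icc 0 T) : |c t - c s| ≤ b * |t - s| := by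
  rw [R.sub_eq hs ht]
  have := intervalIntegral.norm_integral_le_of_norm_le_const (a := s) (b := t) (f := γ) (C := b)
    fun r _ => R.bound_deriv r
  exact this

/-- The mixed second difference is the integral of `γ(r+δ) - γ(r)`, which is of size `δ` almost
everywhere. -/
lemma TimeReg.abs_mixed_le {T b : ℝ} {c γ : ℝ → ℝ} (R : TimeReg T b c γ) {t s δ : ℝ}
    (ht : 0 ≤ t) (hs : 0 ≤ s) (hδ : 0 ≤ δ) (hT : t + s + δ ≤ T) :
    |(c (t + δ + s) - c (t + δ)) - (c (t + s) - c t)| ≤ b * δ * s := by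
  rw [R.sub_eq (s := t + δ) ⟨by linarith, by linarith⟩ ⟨by linarith, by linarith⟩,
    R.sub_eq (s := t) ⟨by linarith, by linarith⟩ ⟨by linarith, by linarith⟩,
    show t + δ + s = t + s + δ by ring, ← intervalIntegral.integral_comp_add_right γ δ,
    ← intervalIntegral.integral_sub]
  · have h1 := intervalIntegral.norm_integral_le_of_norm_le_const_ae (a := t) (b := t + s)
      (C := b * δ) (f := fun r => γ (r + δ) - γ r) ?_
    · simpa [abs_of_nonneg hs] using h1
    -- The Lipschitz bound is available on the open time interval only, and `t + s + δ` may equal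
    -- `T`.
    · have hne : ∀ᵐ r : ℝ, r ≠ t + s := by simp [ae_iff]
      filter_upwards [R.lip δ hδ, hne] with r hr hr1 hr2
      rw [uIoc_of_le (by linarith)] at hr2
      have h2 : r < t + s := lt_of_le_of_ne hr2.2 hr1
      exact hr ⟨by linarith [hr2.1], by linarith⟩ ⟨by linarith [hr2.1], by linarith⟩
  · exact ((intervalIntegrable_const (c := b)).mono_fun'
      (R.meas.comp (measurable_add_const δ)).aestronglyMeasurable
      (Filter.Eventually.of_forall fun r => R.bound_deriv _))
  · exact R.intervalIntegrable _ _

lemma measurable_integral_slice {G : ℝ × Space d → ℝ} (hG : Measurable G) (K : Set (Space d)) :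
    Measurable fun t => ∫ x in K, G (t, x) :=
  (StronglyMeasurable.integral_prod_right (f := fun t x => G (t, x)) hG.stronglyMeasurable (ν := volume.restrict K)).measurable

lemma abs_setIntegral_le {X : Type*} [MeasurableSpace X] {μ : Measure X} {K : Set X} {C : ℝ}
    (hK : μ K ≠ ⊤) {f : X → ℝ} (hf : ∀ x, |f x| ≤ C) : |∫ x in K, f x ∂μ| ≤ C * μ.real K :=
  norm_setIntegral_le_of_norm_le_const (f := f) (C := C) hK.lt_top fun x _ => hf x

lemma ae_ae_of_ae_prod_volume {p : ℝ × Space d → Prop} (h : ∀ᵐ z, p z) :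
    ∀ᵐ t : ℝ, ∀ᵐ x : Space d, p (t, x) := by
  rw [Measure.volume_eq_prod] at h
  exact Measure.ae_ae_of_ae_prod h

lemma NormalTest.timeReg {ℓ T B : ℝ} {F Gt : ℝ × Space d → ℝ} {Gx : Fin d → ℝ × Space d → ℝ}
    (hT : 0 < T) (H : NormalTest ℓ T B F Gt Gx) {K : Set (Space d)} (hK : volume K ≠ ⊤) :
    TimeReg T (B * volume.real K) (fun t => ∫ x in K, F (t, x)) fun t => ∫ x in K, Gt (t, x) := by
  have hfin : IsFiniteMeasure (volume.restrict K) := ⟨by simpa using hK.lt_top⟩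
  set c : ℝ → ℝ := fun t => ∫ x in K, F (t, x) with hc
  set γ : ℝ → ℝ := fun t => ∫ x in K, Gt (t, x) with hγ
  have hγm : Measurable γ := measurable_integral_slice H.meas_t K
  have hγb : ∀ t, |γ t| ≤ B * volume.real K := fun t => abs_setIntegral_le hK fun x => H.bound_t _
  have hγi : ∀ s t, IntervalIntegrable γ volume s t := fun s t =>
    (intervalIntegrable_const (c := B * volume.real K)).mono_fun' hγm.aestronglyMeasurable
      (Filter.Eventually.of_forall hγb)
  have hFi : ∀ t, Integrable (fun x => F (t, x)) (volume.restrict K) := fun t =>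
    (integrable_const B).mono' (H.cont.comp (by fun_prop)).aestronglyMeasurable
      (Filter.Eventually.of_forall fun x => H.bound _)
  have hGi : ∀ t, Integrable (fun x => Gt (t, x)) (volume.restrict K) := fun t =>
    (integrable_const B).mono' (H.meas_t.comp (by fun_prop)).aestronglyMeasurable
      (Filter.Eventually.of_forall fun x => H.bound_t _)
  have hcc : Continuous c := continuous_of_dominated (bound := fun _ => B)
    (fun t => (hFi t).aestronglyMeasurable) (fun t => Filter.Eventually.of_forall fun x => H.bound _)
    (integrable_const B) (Filter.Eventually.of_forall fun x => H.cont.comp (by fun_prop))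
  set P : ℝ → ℝ := fun t => ∫ r in (0 : ℝ)..t, γ r with hP
  have hPc : Continuous P := intervalIntegral.continuous_primitive hγi 0
  -- For fixed `s` the weak derivative gives the increment of `c` over `s` for almost every starting
  -- time. Both sides are continuous in the starting time, hence it holds on the closure, in
  -- particular from time `0`; a second closure argument adds `s = T`.
  have hstep : ∀ s ∈ Ico 0 T, c s - P s = c 0 := by
    intro s hs
    have h1 : ∀ᵐ t : ℝ, t ∈ Ioo 0 (T - s) → c (t + s) - P (t + s) = c t - P t := by
      filter_upwards [ae_ae_of_ae_prod_volume (H.dt.sub_eq_integral (isOpen_strip d T)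
        (convex_strip d T) H.cont.measurable H.bound H.meas_t H.bound_t hs.1)] with t h2 ht
      have h3 : ∀ᵐ x : Space d, F (t + s, x) - F (t, x) = ∫ r in Icc 0 s, Gt (t + r, x) := by
        filter_upwards [h2] with x hx
        have := hx (mem_strip.mpr ⟨ht.1, by have := ht.2; have := hs.1; simp only; linarith⟩)
          (mem_strip.mpr (by simp; exact ⟨by linarith [ht.1, hs.1], by linarith [ht.2]⟩))
        simpa using this
      have h4 : c (t + s) - c t = ∫ r in Icc 0 s, γ (t + r) := by
        rw [hc]
        simp only
        rw [← integral_sub (hFi _) (hFi _), integral_congr_ae (ae_restrict_of_ae h3)]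
        refine integral_integral_swap (f := fun x r => Gt (t + r, x)) ?_
        refine (integrable_const B).mono' (H.meas_t.comp (f := fun p : Space d × ℝ =>
          (t + p.2, p.1)) (by fun_prop)).aestronglyMeasurable
          (Filter.Eventually.of_forall fun p => H.bound_t _)
      rw [integral_Icc_eq_integral_Ioc, ← intervalIntegral.integral_of_le hs.1,
        intervalIntegral.integral_comp_add_left γ t, add_zero,
        ← intervalIntegral.integral_interval_sub_left (hγi 0 (t + s)) (hγi 0 t)] at h4
      simp only [hP]
      linarith
    have h2 : EqOn (fun t => c (t + s) - P (t + s)) (fun t => c t - P t) (Ioo 0 (T - s)) := by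
      refine Measure.eqOn_open_of_ae_eq (μ := volume) ?_ isOpen_Ioo ?_ ?_
      · exact (ae_restrict_iff' measurableSet_Ioo).mpr h1
      · exact ((hcc.comp (continuous_add_const s)).sub
          (hPc.comp (continuous_add_const s))).continuousOn
      · exact (hcc.sub hPc).continuousOn
    have h3 := h2.closure ((hcc.comp (continuous_add_const s)).sub
          (hPc.comp (continuous_add_const s))) (hcc.sub hPc)
    rw [closure_Ioo (by linarith [hs.2])] at h3
    have := h3 ⟨le_rfl, by linarith [hs.2]⟩
    simpa [hP] using this
  have hstep' : ∀ s ∈ Icc 0 T, c s - P s = c 0 := by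
    have h3 := EqOn.closure (show EqOn (fun s => c s - P s) (fun _ => c 0) (Ico 0 T) from hstep)
      (hcc.sub hPc) continuous_const
    rw [closure_Ico hT.ne] at h3
    exact h3
  refine ⟨hγm, hγb, fun t ht => ?_,
    fun δ hδ => ?_⟩
  · have := hstep' t ht
    linarith
  · filter_upwards [ae_ae_of_ae_prod_volume (H.lip_t δ hδ)] with t h1 ht1 ht2
    have h2 : ∀ᵐ x : Space d, |Gt (t + δ, x) - Gt (t, x)| ≤ B * δ := by
      filter_upwards [h1] with x hx
      have := hx (mem_strip.mpr ht1) (mem_strip.mpr (by simpa using ht2))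
      simpa using this
    rw [hγ]
    simp only
    rw [← integral_sub (hGi _) (hGi _)]
    have := norm_setIntegral_le_of_norm_le_const_ae (μ := volume) (s := K) (C := B * δ)
      (f := fun x => Gt (t + δ, x) - Gt (t, x)) hK.lt_top (ae_restrict_of_ae h2)
    rw [Real.norm_eq_abs] at this
    linarith

end FV

/-! ### Projected differences of the test function in space. -/

namespace FV

lemma abs_setIntegral_le_of_ae {X : Type*} [MeasurableSpace X] {μ : Measure X} {K : Set X} {C : ℝ}
    (hK : μ K ≠ ⊤) {f : X → ℝ} (hf : ∀ᵐ x ∂μ.restrict K, |f x| ≤ C) :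
    |∫ x in K, f x ∂μ| ≤ C * μ.real K :=
  norm_setIntegral_le_of_norm_le_const_ae (f := f) (C := C) hK.lt_top hf

/-- Regularity in direction `e_i` of a spatial test function `Φ` with `∂_i Φ = G`. -/
structure SpaceReg {d : ℕ} (ℓ h B : ℝ) (i : Fin d) (Φ G : Space d → ℝ) : Prop where
  cont : Continuous Φ
  bound : ∀ x, |Φ x| ≤ B
  periodic : ∀ x, Φ (x + (Pi.single i ℓ : Space d)) = Φ x
  meas : Measurable G
  bound_deriv : ∀ x, |G x| ≤ B
  periodic_deriv : ∀ᵐ x, G (x + (Pi.single i ℓ : Space d)) = G x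
  ftc : ∀ᵐ x, Φ (x + (Pi.single i h : Space d)) - Φ x = ∫ r in Icc 0 h, G (x + (Pi.single i r : Space d))

/-- Lipschitz regularity in direction `e_i` at the shifts relevant for the mesh width `h`. -/
structure LipReg {d : ℕ} (h B : ℝ) (i : Fin d) (G : Space d → ℝ) : Prop where
  lip : ∀ᵐ r ∂volume.restrict (Icc 0 h), ∀ᵐ x, |G (x + (Pi.single i r : Space d)) - G x| ≤ B * r
  lip_width : ∀ᵐ x, |G (x + (Pi.single i h : Space d)) - G x| ≤ B * h
  lip_half : ∀ᵐ x, |G (x + (Pi.single i (h / 2) : Space d)) - G x| ≤ B * (h / 2)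

section Slices

variable {d : ℕ} {ℓ T B : ℝ} {F Gt : ℝ × Space d → ℝ} {Gx : Fin d → ℝ × Space d → ℝ}

lemma NormalTest.spaceReg (H : NormalTest ℓ T B F Gt Gx) {h : ℝ} (hh : 0 ≤ h) (i : Fin d) :
    ∀ᵐ t : ℝ, t ∈ Ioo 0 T →
      SpaceReg ℓ h B i (fun x => F (t, x)) fun x => Gx i (t, x) := by
  have h1 := ae_ae_of_ae_prod_volume ((H.dx i).sub_eq_integral (isOpen_strip d T)
    (convex_strip d T) H.cont.measurable H.bound (H.meas_x i) (H.bound_x i) hh)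
  have h2 := ae_ae_of_ae_prod_volume ((H.dx i).translate_ae_eq (isOpen_strip d T)
    (w := (0, (Pi.single i ℓ : Space d))) (fun z => by simp [mem_strip]) (H.meas_x i) (H.bound_x i)
    fun z _ => H.periodic z i)
  filter_upwards [h1, h2] with t a1 a2 ht
  have hsm : ∀ r : ℝ, r • (Pi.single i 1 : Space d) = Pi.single i r := fun r => by
    rw [← Pi.single_smul]; simp
  refine ⟨H.cont.comp (by fun_prop), fun x => H.bound _, fun x => ?_,
    (H.meas_x i).comp (by fun_prop), fun x => H.bound_x i _, ?_, ?_⟩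
  · simpa using H.periodic (t, x) i
  · filter_upwards [a2] with x hx
    simpa using hx (mem_strip.mpr ht)
  · filter_upwards [a1] with x hx
    simpa [hsm] using hx (mem_strip.mpr ht) (mem_strip.mpr (by simpa using ht))

/-- For each shift `r` there is a null set of bad times; Fubini on the pairs `(r, t)` gives almost
every time for which almost every shift is good. The shifts `h` and `h/2` are used exactly and are
treated separately. -/
lemma NormalTest.lipReg (H : NormalTest ℓ T B F Gt Gx) {h : ℝ} (hh : 0 ≤ h) (i : Fin d)
    (L : ∀ r, 0 ≤ r → ∀ᵐ z : ℝ × Space d, z ∈ strip d T →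
      |Gx i (z + (0, (Pi.single i r : Space d))) - Gx i z| ≤ B * r) :
    ∀ᵐ t : ℝ, t ∈ Ioo 0 T → LipReg h B i fun x => Gx i (t, x) := by
  have hslice : ∀ r, 0 ≤ r → ∀ᵐ t : ℝ, t ∈ Ioo 0 T → ∀ᵐ x : Space d,
      |Gx i (t, x + (Pi.single i r : Space d)) - Gx i (t, x)| ≤ B * r := fun r hr => by
    filter_upwards [ae_ae_of_ae_prod_volume (L r hr)] with t h1 ht
    filter_upwards [h1] with x hx
    simpa using hx (mem_strip.mpr ht)
  have hm : MeasurableSet {p : (ℝ × ℝ) × Space d |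
      ¬ |Gx i (p.1.2, p.2 + (Pi.single i p.1.1 : Space d)) - Gx i (p.1.2, p.2)| ≤ B * p.1.1} := by
    refine MeasurableSet.compl (s := {p : (ℝ × ℝ) × Space d | |Gx i (p.1.2, p.2 + (Pi.single i p.1.1 : Space d)) - Gx i (p.1.2, p.2)| ≤ B * p.1.1}) (measurableSet_le (f := fun p : (ℝ × ℝ) × Space d =>
      |Gx i (p.1.2, p.2 + (Pi.single i p.1.1 : Space d)) - Gx i (p.1.2, p.2)|) (g := fun p => B * p.1.1) ?_ ?_)
    · have e1 : Measurable fun p : (ℝ × ℝ) × Space d => (p.1.2, p.2 + (Pi.single i p.1.1 : Space d)) := by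
        have : Continuous fun p : (ℝ × ℝ) × Space d => (p.1.2, p.2 + (Pi.single i p.1.1 : Space d)) := by
          refine continuous_fst.snd.prodMk (continuous_snd.add ?_)
          exact (continuous_single i).comp continuous_fst.fst
        exact this.measurable
      exact (((H.meas_x i).comp e1).sub ((H.meas_x i).comp (by fun_prop))).abs
    · fun_prop
  -- The swap of the quantifiers needs measurability of the set of good pairs, expressed through the
  -- measure of the sections of the bad set.
  have hQ : MeasurableSet {p : ℝ × ℝ | p.2 ∈ Ioo 0 T → ∀ᵐ x : Space d,
      |Gx i (p.2, x + Pi.single i p.1) - Gx i (p.2, x)| ≤ B * p.1} := by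
    have e : {p : ℝ × ℝ | p.2 ∈ Ioo 0 T → ∀ᵐ x : Space d,
        |Gx i (p.2, x + Pi.single i p.1) - Gx i (p.2, x)| ≤ B * p.1}
        = {p : ℝ × ℝ | p.2 ∈ Ioo 0 T}ᶜ ∪ (fun p : ℝ × ℝ => (volume : Measure (Space d))
          (Prod.mk p ⁻¹' {p : (ℝ × ℝ) × Space d |
            ¬ |Gx i (p.1.2, p.2 + (Pi.single i p.1.1 : Space d)) - Gx i (p.1.2, p.2)| ≤ B * p.1.1})) ⁻¹' {0} := by
      ext p
      simp only [mem_ofPred_eq, mem_union, mem_compl_iff, mem_preimage, mem_singleton_iff,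
        imp_iff_not_or]
      rfl
    rw [e]
    exact (measurable_snd measurableSet_Ioo).compl.union
      (measurable_measure_prodMk_left hm (measurableSet_singleton 0))
  have hlip : ∀ᵐ t : ℝ, ∀ᵐ r ∂volume.restrict (Icc 0 h), t ∈ Ioo 0 T → ∀ᵐ x : Space d,
      |Gx i (t, x + (Pi.single i r : Space d)) - Gx i (t, x)| ≤ B * r := by
    rw [← Measure.ae_ae_comm (p := fun r t => t ∈ Ioo 0 T → ∀ᵐ x : Space d,
      |Gx i (t, x + (Pi.single i r : Space d)) - Gx i (t, x)| ≤ B * r) hQ]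
    exact (ae_restrict_iff' measurableSet_Icc).mpr
      (Filter.Eventually.of_forall fun r hr => hslice r hr.1)
  filter_upwards [hlip, hslice h hh, hslice (h / 2) (by linarith)] with t a1 a2 a3 ht
  exact ⟨a1.mono fun r hr => hr ht, a2 ht, a3 ht⟩

end Slices

section Cells

set_option linter.unusedSectionVars false

variable {d M : ℕ} [NeZero M] {ℓ h B : ℝ} {i : Fin d} {Φ G : Space d → ℝ}

lemma locallyIntegrable_pwc_mul (h : ℝ) (r : Cell d M → ℝ) (hG : LocallyIntegrable G) :
    LocallyIntegrable fun x => pwc h r x * G x := by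
  rw [locallyIntegrable_iff] at hG ⊢
  exact fun k hk => integrableOn_pwc_mul h r (hG k hk)

lemma integrableOn_cube_of_locallyIntegrable (hG : LocallyIntegrable G) (ℓ : ℝ) :
    IntegrableOn G (cube d ℓ) :=
  (hG.integrableOn_isCompact (k := Set.univ.pi fun _ : Fin d => Icc (0 : ℝ) ℓ)
    (isCompact_univ_pi fun _ => isCompact_Icc)).mono_set (pi_mono fun _ _ => Ico_subset_Icc_self)

lemma pwc_add_period (hh : 0 < h) (hM : (M : ℝ) * h = ℓ) (i : Fin d) (r : Cell d M → ℝ)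
    (x : Space d) : pwc h r (x + (Pi.single i ℓ : Space d)) = pwc h r x := by
  rw [pwc, cellAt_add_period hh hM, pwc]

lemma width_le (hh : 0 < h) (hM : (M : ℝ) * h = ℓ) : h ≤ ℓ := by
  have : (1 : ℝ) ≤ M := by exact_mod_cast NeZero.one_le
  nlinarith

/-- Translation of a piecewise constant weight. -/
lemma integral_pwc_sub_mul (hh : 0 < h) (hM : (M : ℝ) * h = ℓ) (hG : LocallyIntegrable G)
    (hp : ∀ᵐ x, G (x + (Pi.single i ℓ : Space d)) = G x) (r : Cell d M → ℝ) {s : ℝ} (h0 : 0 ≤ s) (h1 : s ≤ h) :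
    ∫ x in cube d ℓ, pwc h r (x - (Pi.single i s : Space d)) * G x
      = ∑ K, r K * ∫ x in cellSet h K, G (x + (Pi.single i s : Space d)) := by
  have hGs : LocallyIntegrable fun x => G (x + (Pi.single i s : Space d)) := LocallyIntegrable.comp_add hG _
  have hps : ∀ᵐ x : Space d, G (x + (Pi.single i ℓ : Space d) + (Pi.single i s : Space d)) = G (x + (Pi.single i s : Space d)) := by
    have := (measurePreserving_add_right (volume : Measure (Space d))
      (Pi.single i s : Space d)).quasiMeasurePreserving.ae hp
    simpa only [add_right_comm] using this
  have h2 := integral_cube_shift_neg (f := fun x => pwc h r x * G (x + (Pi.single i s : Space d))) (ℓ := ℓ)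
    (locallyIntegrable_pwc_mul h r hGs) i (by
      filter_upwards [hps] with x hx
      rw [hx, pwc_add_period hh hM]) h0 (h1.trans (width_le hh hM))
  simp only [sub_add_cancel] at h2
  rw [h2, integral_pwc_mul hh hM r (integrableOn_cube_of_locallyIntegrable hGs ℓ)]

/-- The neighbour may lie on the opposite side of the cube, so periodicity is needed. The
translation formula is applied with the indicator of a single cell as weight. -/
lemma integral_cellSet_nxt (hh : 0 < h) (hM : (M : ℝ) * h = ℓ) (hG : LocallyIntegrable G)
    (hp : ∀ᵐ x, G (x + (Pi.single i ℓ : Space d)) = G x) (K : Cell d M) :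
    ∫ x in cellSet h (nxt i K), G x = ∫ x in cellSet h K, G (x + (Pi.single i h : Space d)) := by
  have h1 := integral_pwc_sub_mul hh hM hG hp (Pi.single K 1) hh.le le_rfl
  have e : ∀ x : Space d, pwc h (Pi.single K 1 : Cell d M → ℝ) (x - (Pi.single i h : Space d))
      = pwc h (Pi.single (nxt i K) 1 : Cell d M → ℝ) x := fun x => by
    simp only [pwc, cellAt_sub hh, Pi.single_apply]
    congr 1
    rw [eq_iff_iff]
    constructor
    · intro h; rw [← h, nxt_prv]
    · intro h; rw [h, prv_nxt]
  simp only [e] at h1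
  rw [integral_pwc_mul hh hM _ (integrableOn_cube_of_locallyIntegrable hG ℓ)] at h1
  simpa [Pi.single_apply] using h1

lemma pow_mul_proj (hh : 0 < h) (f : Space d → ℝ) (K : Cell d M) :
    h ^ d * proj h f K = ∫ x in cellSet h K, f x := by
  rw [proj, mul_div_cancel₀ _ (by positivity)]

/-- The jump of the projected test function across a face, weighted by the measure of the face. -/
noncomputable def faceDiff {d M : ℕ} (h : ℝ) (i : Fin d) (Φ : Space d → ℝ) (K : Cell d M) : ℝ :=
  h ^ d * (jump i (proj h Φ) K / h)

namespace SpaceReg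

lemma locallyIntegrable (R : SpaceReg ℓ h B i Φ G) : LocallyIntegrable G :=
  locallyIntegrable_of_bounded R.meas.aestronglyMeasurable R.bound_deriv

lemma mul_faceDiff (R : SpaceReg ℓ h B i Φ G) (hh : 0 < h) (hM : (M : ℝ) * h = ℓ) (K : Cell d M) :
    h * faceDiff h i Φ K = ∫ x in cellSet h K, (Φ (x + (Pi.single i h : Space d)) - Φ x) := by
  have hΦ : LocallyIntegrable Φ := R.cont.locallyIntegrable
  have hi : ∀ {f : Space d → ℝ}, Continuous f → IntegrableOn f (cellSet h K) := fun hf =>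
    hf.continuousOn.integrableOn_compact (isCompact_cellSet h K)
  have hs : Continuous fun x : Space d => Φ (x + (Pi.single i h : Space d)) :=
    R.cont.comp (by fun_prop)
  rw [integral_sub (hi hs) (hi R.cont),
    ← integral_cellSet_nxt hh hM hΦ (Filter.Eventually.of_forall R.periodic), ← pow_mul_proj hh,
    ← pow_mul_proj hh, faceDiff, jump]
  field_simp

/-- The bound holds almost everywhere by integration; its set is closed and dense, hence everything.
-/
lemma abs_sub_le (R : SpaceReg ℓ h B i Φ G) (hh : 0 ≤ h) (x : Space d) :
    |Φ (x + (Pi.single i h : Space d)) - Φ x| ≤ B * h := by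
  have hc : Continuous fun x => |Φ (x + (Pi.single i h : Space d)) - Φ x| :=
    ((R.cont.comp (by fun_prop)).sub R.cont).abs
  have hae : ∀ᵐ x, |Φ (x + (Pi.single i h : Space d)) - Φ x| ≤ B * h := by
    filter_upwards [R.ftc] with x hx
    rw [hx]
    have := abs_setIntegral_le (μ := volume) (K := Icc 0 h) (by simp)
      fun r => R.bound_deriv (x + (Pi.single i r : Space d))
    simpa [measureReal_def, hh] using this
  have hcl : IsClosed {x | |Φ (x + (Pi.single i h : Space d)) - Φ x| ≤ B * h} :=
    isClosed_le hc continuous_const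
  have hd : Dense {x | |Φ (x + (Pi.single i h : Space d)) - Φ x| ≤ B * h} := Measure.dense_of_ae hae
  have h1 : x ∈ closure {x | |Φ (x + (Pi.single i h : Space d)) - Φ x| ≤ B * h} := hd x
  rwa [hcl.closure_eq] at h1

lemma abs_faceDiff_le (R : SpaceReg ℓ h B i Φ G) (hh : 0 < h) (hM : (M : ℝ) * h = ℓ)
    (K : Cell d M) : |faceDiff h i Φ K| ≤ B * h ^ d := by
  have h1 := abs_setIntegral_le (μ := volume) (K := cellSet h K) (isCompact_cellSet h K).measure_ne_top
    fun x => R.abs_sub_le hh.le x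
  rw [← R.mul_faceDiff hh hM, abs_mul, abs_of_pos hh, measureReal_cellSet hh] at h1
  have : h * |faceDiff h i Φ K| ≤ h * (B * h ^ d) := by linarith
  exact le_of_mul_le_mul_left this hh

lemma integrable_shift (R : SpaceReg ℓ h B i Φ G) (μ : Measure (Space d)) [IsFiniteMeasure μ]
    (s : ℝ) : Integrable (fun x => G (x + (Pi.single i s : Space d))) μ :=
  (integrable_const B).mono' (R.meas.comp (by fun_prop)).aestronglyMeasurable
    (Filter.Eventually.of_forall fun x => R.bound_deriv _)

lemma measurable_uncurry (R : SpaceReg ℓ h B i Φ G) :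
    Measurable fun p : Space d × ℝ => G (p.1 + (Pi.single i p.2 : Space d)) := by
  have : Continuous fun p : Space d × ℝ => p.1 + Pi.single i p.2 :=
    continuous_fst.add ((continuous_single i).comp continuous_snd)
  exact R.meas.comp this.measurable

/-- The projected difference quotient is the mean, over shifts `r ∈ [0, h]`, of cell integrals of
the shifted derivative. The comparison estimates below rest on this formula. -/
lemma mul_faceDiff_eq_integral (R : SpaceReg ℓ h B i Φ G) (hh : 0 < h) (hM : (M : ℝ) * h = ℓ)
    (K : Cell d M) :
    h * faceDiff h i Φ K = ∫ r in Icc 0 h, ∫ x in cellSet h K, G (x + (Pi.single i r : Space d)) := by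
  have hfin : IsFiniteMeasure ((volume : Measure (Space d)).restrict (cellSet h K)) :=
    ⟨by simpa using (isCompact_cellSet h K).measure_lt_top⟩
  rw [R.mul_faceDiff hh hM, integral_congr_ae (ae_restrict_of_ae R.ftc)]
  refine integral_integral_swap (μ := volume.restrict (cellSet h K)) (ν := volume.restrict (Icc 0 h))
    (f := fun (x : Space d) (r : ℝ) => G (x + (Pi.single i r : Space d))) ?_
  exact (integrable_const B).mono' R.measurable_uncurry.aestronglyMeasurable
    (Filter.Eventually.of_forall fun p => R.bound_deriv _)

lemma integrable_cell_shift (R : SpaceReg ℓ h B i Φ G) (K : Cell d M) :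
    IntegrableOn (fun r => ∫ x in cellSet h K, G (x + (Pi.single i r : Space d))) (Icc 0 h) := by
  have hm : Measurable fun r : ℝ => ∫ x in cellSet h K, G (x + (Pi.single i r : Space d)) :=
    (StronglyMeasurable.integral_prod_right (f := fun (r : ℝ) (x : Space d) => G (x + (Pi.single i r : Space d)))
      (R.measurable_uncurry.comp measurable_swap).stronglyMeasurable
      (ν := volume.restrict (cellSet h K))).measurable
  refine Measure.integrableOn_of_bounded (M := B * volume.real (cellSet h K)) (by simp)
    hm.aestronglyMeasurable (Filter.Eventually.of_forall fun r => ?_)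
  exact abs_setIntegral_le (isCompact_cellSet h K).measure_ne_top fun x => R.bound_deriv _

lemma abs_integral_sub_le (R : SpaceReg ℓ h B i Φ G) {s t c : ℝ} (hh : 0 < h) (K : Cell d M)
    (H : ∀ᵐ x, |G (x + (Pi.single i s : Space d)) - G (x + (Pi.single i t : Space d))| ≤ c) :
    |(∫ x in cellSet h K, G (x + (Pi.single i s : Space d))) - ∫ x in cellSet h K, G (x + (Pi.single i t : Space d))|
      ≤ c * h ^ d := by
  have hfin : IsFiniteMeasure ((volume : Measure (Space d)).restrict (cellSet h K)) :=
    ⟨by simpa using (isCompact_cellSet h K).measure_lt_top⟩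
  rw [← integral_sub (R.integrable_shift _ s) (R.integrable_shift _ t), ← measureReal_cellSet hh K]
  exact abs_setIntegral_le_of_ae (isCompact_cellSet h K).measure_ne_top
    (ae_restrict_of_ae H)

lemma abs_faceDiff_sub_le (R : SpaceReg ℓ h B i Φ G) (L : LipReg h B i G) (hh : 0 < h)
    (hB : 0 ≤ B) (hM : (M : ℝ) * h = ℓ) (K : Cell d M) :
    |faceDiff h i Φ K - ∫ x in cellSet h K, G x| ≤ B * h * h ^ d := by
  set A : ℝ → ℝ := fun r => ∫ x in cellSet h K, G (x + (Pi.single i r : Space d)) with hA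
  have hA0 : ∫ x in cellSet h K, G x = A 0 := by simp [hA]
  have hconst : h * A 0 = ∫ _r in Icc 0 h, A 0 := by simp [hh.le]
  have h1 : |∫ r in Icc 0 h, (A r - A 0)| ≤ B * h * h ^ d * volume.real (Icc 0 h) := by
    refine abs_setIntegral_le_of_ae measure_Icc_lt_top.ne ?_
    filter_upwards [L.lip, ae_restrict_mem measurableSet_Icc] with r hr hrm
    refine (R.abs_integral_sub_le hh K (s := r) (t := 0) (c := B * h) ?_)
    filter_upwards [hr] with x hx
    simp only [Pi.single_zero, add_zero]
    exact hx.trans (mul_le_mul_of_nonneg_left hrm.2 hB)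
  rw [integral_sub (R.integrable_cell_shift K) (by simp), ← R.mul_faceDiff_eq_integral hh hM,
    ← hconst, ← mul_sub, abs_mul, abs_of_pos hh, measureReal_def, Real.volume_Icc, sub_zero,
    ENNReal.toReal_ofReal hh.le] at h1
  rw [hA0]
  have : h * |faceDiff h i Φ K - A 0| ≤ h * (B * h * h ^ d) := by linarith
  exact le_of_mul_le_mul_left this hh

lemma abs_faceDiff_sub_half_le (R : SpaceReg ℓ h B i Φ G) (L : LipReg h B i G) (hh : 0 < h)
    (hB : 0 ≤ B) (hM : (M : ℝ) * h = ℓ) (K : Cell d M) :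
    |faceDiff h i Φ K - ∫ x in cellSet h K, G (x + (Pi.single i (h / 2) : Space d))| ≤ 2 * B * h * h ^ d := by
  have h1 := R.abs_faceDiff_sub_le L hh hB hM K
  have h2 := R.abs_integral_sub_le (s := h / 2) (t := 0) hh K (by simpa using L.lip_half)
  simp only [Pi.single_zero, add_zero] at h2
  have h3 : 0 ≤ B * h * h ^ d := by positivity
  rw [abs_le] at *
  constructor <;> linarith [h1.1, h1.2, h2.1, h2.2]

/-- The two differences are averages of the derivative over positions exactly one width apart, so
the Lipschitz bound at the shift `h` suffices. -/
lemma abs_faceDiff_sub_prv_le (R : SpaceReg ℓ h B i Φ G) (L : LipReg h B i G) (hh : 0 < h)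
    (hM : (M : ℝ) * h = ℓ) (K : Cell d M) :
    |faceDiff h i Φ K - faceDiff h i Φ (prv i K)| ≤ B * h * h ^ d := by
  have e1 : h * faceDiff h i Φ (prv i K)
      = ∫ r in Icc 0 h, ∫ x in cellSet h K, G (x + (Pi.single i (r - h) : Space d)) := by
    rw [R.mul_faceDiff_eq_integral hh hM]
    refine setIntegral_congr_fun measurableSet_Icc fun r _ => ?_
    have hGr : LocallyIntegrable fun x : Space d => G (x + (Pi.single i (r - h) : Space d)) :=
      LocallyIntegrable.comp_add R.locallyIntegrable _
    have hp : ∀ᵐ x : Space d, G (x + (Pi.single i ℓ : Space d) + (Pi.single i (r - h) : Space d))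
        = G (x + (Pi.single i (r - h) : Space d)) := by
      have := (measurePreserving_add_right (volume : Measure (Space d))
        (Pi.single i (r - h) : Space d)).quasiMeasurePreserving.ae R.periodic_deriv
      simpa only [add_right_comm] using this
    have := integral_cellSet_nxt hh hM hGr hp (prv i K)
    rw [nxt_prv] at this
    rw [this]
    congr 1
    funext x
    rw [add_assoc, ← Pi.single_add, add_sub_cancel]
  have hint : IntegrableOn (fun r => ∫ x in cellSet h K, G (x + (Pi.single i (r - h) : Space d))) (Icc 0 h) := by
    have hm : Measurable fun r : ℝ => ∫ x in cellSet h K, G (x + (Pi.single i (r - h) : Space d)) :=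
      (StronglyMeasurable.integral_prod_right
        (f := fun (r : ℝ) (x : Space d) => G (x + (Pi.single i (r - h) : Space d)))
        (R.measurable_uncurry.comp (f := fun p : ℝ × Space d => (p.2, p.1 - h))
          (by fun_prop)).stronglyMeasurable (ν := volume.restrict (cellSet h K))).measurable
    refine Measure.integrableOn_of_bounded (M := B * volume.real (cellSet h K)) (by simp)
      hm.aestronglyMeasurable (Filter.Eventually.of_forall fun r => ?_)
    exact abs_setIntegral_le (isCompact_cellSet h K).measure_ne_top fun x => R.bound_deriv _
  have h1 : |∫ r in Icc 0 h, ((∫ x in cellSet h K, G (x + (Pi.single i r : Space d)))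
      - ∫ x in cellSet h K, G (x + (Pi.single i (r - h) : Space d)))|
      ≤ B * h * h ^ d * volume.real (Icc 0 h) := by
    refine abs_setIntegral_le_of_ae measure_Icc_lt_top.ne ?_
    filter_upwards with r
    refine R.abs_integral_sub_le hh K ?_
    have := (measurePreserving_add_right (volume : Measure (Space d))
      (Pi.single i (r - h) : Space d)).quasiMeasurePreserving.ae L.lip_width
    filter_upwards [this] with x hx
    rwa [add_assoc, ← Pi.single_add, sub_add_cancel] at hx
  rw [integral_sub (R.integrable_cell_shift K) hint, ← e1, ← R.mul_faceDiff_eq_integral hh hM,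
    ← mul_sub, abs_mul, abs_of_pos hh, measureReal_def, Real.volume_Icc, sub_zero,
    ENNReal.toReal_ofReal hh.le] at h1
  have : h * |faceDiff h i Φ K - faceDiff h i Φ (prv i K)| ≤ h * (B * h * h ^ d) := by linarith
  exact le_of_mul_le_mul_left this hh

/-- Consistency of the averaged flux with first-order accuracy in the jumps. -/
lemma abs_sum_avg_sub_le (R : SpaceReg ℓ h B i Φ G) (hh : 0 < h) (hM : (M : ℝ) * h = ℓ)
    (q : Cell d M → ℝ) :
    |∑ K, avg i q K * faceDiff h i Φ K - ∫ x in cube d ℓ, pwc h q x * G x|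
      ≤ B * ∑ K, h ^ d * |jump i q K| := by
  set I := ∫ x in cube d ℓ, pwc h q x * G x with hI
  have hGi := integrableOn_cube_of_locallyIntegrable R.locallyIntegrable ℓ
  have e1 : h * ∑ K, avg i q K * faceDiff h i Φ K
      = ∫ r in Icc 0 h, ∑ K, avg i q K * ∫ x in cellSet h K, G (x + (Pi.single i r : Space d)) := by
    rw [integral_finsetSum _ fun K _ => (R.integrable_cell_shift K).const_mul _, Finset.mul_sum]
    refine Finset.sum_congr rfl fun K _ => ?_
    rw [integral_const_mul, ← R.mul_faceDiff_eq_integral hh hM]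
    ring
  have hconst : h * I = ∫ _r in Icc 0 h, I := by simp [hh.le]
  set J : Cell d M → ℝ := fun K => (|jump i q K| + |jump i q (prv i K)|) / 2 with hJ
  have hJsum : ∑ K, J K * h ^ d = ∑ K, h ^ d * |jump i q K| := by
    have h1 : ∑ K, h ^ d * |jump i q (prv i K)| = ∑ K, h ^ d * |jump i q K| :=
      sum_prv i fun K => h ^ d * |jump i q K|
    have h2 : ∀ K, J K * h ^ d = (h ^ d * |jump i q K| + h ^ d * |jump i q (prv i K)|) / 2 :=
      fun K => by rw [hJ]; ring
    simp only [h2, ← Finset.sum_div, Finset.sum_add_distrib, h1]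
    ring
  -- At each shift the face averages, viewed as a shifted piecewise constant weight, differ from `q`
  -- by at most half the adjacent jumps. Only boundedness of the derivative enters, so the test
  -- function needs no second derivatives in space here.
  have hbound : ∀ r ∈ Icc 0 h, |(∑ K, avg i q K * ∫ x in cellSet h K, G (x + (Pi.single i r : Space d))) - I|
      ≤ B * ∑ K, h ^ d * |jump i q K| := by
    intro r hr
    have hi1 : IntegrableOn (fun x => pwc h (avg i q) (x - (Pi.single i r : Space d)) * G x) (cube d ℓ) := by
      obtain ⟨C, hC⟩ := exists_bound_pwc h (avg i q)
      exact Integrable.bdd_mul hGi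
        ((measurable_pwc h (avg i q)).comp (measurable_sub_const _)).aestronglyMeasurable
        (Filter.Eventually.of_forall fun x => hC _)
    have hi2 : IntegrableOn (fun x => pwc h q x * G x) (cube d ℓ) := integrableOn_pwc_mul h q hGi
    rw [← integral_pwc_sub_mul hh hM R.locallyIntegrable R.periodic_deriv (avg i q) hr.1 hr.2, hI,
      ← integral_sub hi1 hi2]
    have hpt : ∀ x, ‖pwc h (avg i q) (x - (Pi.single i r : Space d)) * G x - pwc h q x * G x‖
        ≤ pwc h J x * B := by
      intro x
      rw [← sub_mul, norm_mul]
      refine mul_le_mul ?_ (R.bound_deriv x) (norm_nonneg _) ?_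
      · have h1 : ∀ K : Cell d M, q (nxt i K) = q K + jump i q K := fun K => by rw [jump]; ring
        rw [Real.norm_eq_abs]
        simp only [pwc, hJ]
        rcases cellAt_sub_le (M := M) hh hr.1 hr.2 i x with h2 | h2
        · rw [h2, avg, h1]
          have : (q (cellAt h x) + (q (cellAt h x) + jump i q (cellAt h x))) / 2 - q (cellAt h x)
            = jump i q (cellAt h x) / 2 := by ring
          rw [this, abs_div, abs_two]
          have := abs_nonneg (jump i q (prv i (cellAt h x)))
          linarith
        · rw [h2, avg, nxt_prv]
          have : (q (prv i (cellAt h x)) + q (cellAt h x)) / 2 - q (cellAt h x)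
            = -(jump i q (prv i (cellAt h x)) / 2) := by rw [jump, nxt_prv]; ring
          rw [this, abs_neg, abs_div, abs_two]
          have := abs_nonneg (jump i q (cellAt h x))
          linarith
      · simp only [pwc, hJ]
        positivity
    have hi3 : IntegrableOn (fun x => pwc h J x * B) (cube d ℓ) :=
      integrableOn_pwc_mul h J (integrable_const B)
    refine (norm_integral_le_of_norm_le hi3 (Filter.Eventually.of_forall hpt)).trans (le_of_eq ?_)
    rw [integral_mul_const, integral_pwc hh hM, ← hJsum, mul_comm]
    simp only [mul_comm]
  have h1 : |∫ r in Icc 0 h, ((∑ K, avg i q K * ∫ x in cellSet h K, G (x + (Pi.single i r : Space d))) - I)|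
      ≤ (B * ∑ K, h ^ d * |jump i q K|) * volume.real (Icc 0 h) :=
    abs_setIntegral_le_of_ae measure_Icc_lt_top.ne
      ((ae_restrict_iff' measurableSet_Icc).mpr (Filter.Eventually.of_forall hbound))
  rw [integral_sub (integrable_finsetSum _ fun K _ => (R.integrable_cell_shift K).const_mul _)
      (by simp), ← e1, ← hconst, ← mul_sub, abs_mul, abs_of_pos hh, measureReal_def,
    Real.volume_Icc, sub_zero, ENNReal.toReal_ofReal hh.le] at h1
  have : h * |∑ K, avg i q K * faceDiff h i Φ K - I| ≤ h * (B * ∑ K, h ^ d * |jump i q K|) := by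
    linarith
  exact le_of_mul_le_mul_left this hh

end SpaceReg

end Cells

end FV

namespace FV

/-! ### Consistency in time. -/

section Time

lemma TimeReg.nonneg {T b : ℝ} {c γ : ℝ → ℝ} (R : TimeReg T b c γ) : 0 ≤ b :=
  (abs_nonneg _).trans (R.bound_deriv 0)

lemma TimeReg.continuousOn {T b : ℝ} {c γ : ℝ → ℝ} (R : TimeReg T b c γ) :
    ContinuousOn c (Icc 0 T) :=
  (LipschitzOnWith.of_dist_le_mul (K := ⟨b, R.nonneg⟩) fun s hs t ht => by
    rw [Real.dist_eq, Real.dist_eq]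
    exact R.abs_sub_le ht hs).continuousOn

lemma TimeReg.intervalIntegrable_self {T b : ℝ} {c γ : ℝ → ℝ} (R : TimeReg T b c γ) {s t : ℝ}
    (hs : 0 ≤ s) (hst : s ≤ t) (ht : t ≤ T) : IntervalIntegrable c volume s t :=
  (R.continuousOn.mono (by rw [uIcc_of_le hst]; exact Icc_subset_Icc hs ht)).intervalIntegrable

/-- Deviation of `c` at the left endpoint from its mean over a time step. -/
noncomputable def meanDev (Δt : ℝ) (c : ℝ → ℝ) (k : ℕ) : ℝ :=
  c (k * Δt) - (∫ t in (k * Δt)..((k + 1 : ℕ) * Δt), c t) / Δt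

lemma meanDev_eq (Δt : ℝ) (c : ℝ → ℝ) (k : ℕ) :
    meanDev Δt c k = c (k * Δt) - (∫ s in (0 : ℝ)..Δt, c (k * Δt + s)) / Δt := by
  rw [meanDev, intervalIntegral.integral_comp_add_left c (k * Δt)]
  push_cast
  rw [add_zero, add_mul, one_mul]

lemma TimeReg.abs_meanDev_le {T b Δt : ℝ} {c γ : ℝ → ℝ} (R : TimeReg T b c γ) (ht : 0 < Δt) {k : ℕ}
    (hk : ((k + 1 : ℕ) : ℝ) * Δt ≤ T) : |meanDev Δt c k| ≤ b * Δt := by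
  have hk0 : (0 : ℝ) ≤ k * Δt := by positivity
  push_cast at hk
  have hi : IntervalIntegrable (fun s => c (k * Δt + s)) volume 0 Δt := by
    have h1 := (R.intervalIntegrable_self (s := k * Δt) (t := k * Δt + Δt) hk0 (by linarith)
      (by linarith)).comp_add_left (k * Δt)
    simpa using h1
  have e : meanDev Δt c k = -((∫ s in (0 : ℝ)..Δt, (c (k * Δt + s) - c (k * Δt))) / Δt) := by
    rw [meanDev_eq, intervalIntegral.integral_sub hi (by simp), intervalIntegral.integral_const]
    field_simp
    simp
  rw [e, abs_neg, abs_div, abs_of_pos ht, div_le_iff₀ ht]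
  have h2 := intervalIntegral.norm_integral_le_of_norm_le_const (a := 0) (b := Δt) (C := b * Δt)
    (f := fun s => c (k * Δt + s) - c (k * Δt)) (fun s hs => by
      rw [uIoc_of_le ht.le] at hs
      refine (R.abs_sub_le ⟨hk0, by linarith⟩ ⟨by linarith [hs.1], by linarith [hs.2]⟩).trans ?_
      refine mul_le_mul_of_nonneg_left ?_ R.nonneg
      rw [add_sub_cancel_left, abs_of_pos hs.1]
      exact hs.2)
  simpa [abs_of_pos ht] using h2

/-- Consecutive deviations differ by the mean of a mixed second difference, which gains another
factor `Δt`. -/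
lemma TimeReg.abs_meanDev_sub_le {T b Δt : ℝ} {c γ : ℝ → ℝ} (R : TimeReg T b c γ) (ht : 0 < Δt)
    {k : ℕ} (hk : ((k + 2 : ℕ) : ℝ) * Δt ≤ T) :
    |meanDev Δt c (k + 1) - meanDev Δt c k| ≤ b * Δt * Δt := by
  have hk0 : (0 : ℝ) ≤ k * Δt := by positivity
  push_cast at hk
  have hi : ∀ m : ℕ, m ≤ k + 1 → IntervalIntegrable (fun s => c (m * Δt + s)) volume 0 Δt := by
    intro m hm
    have hm' : (m : ℝ) * Δt ≤ (k + 1) * Δt :=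
      mul_le_mul_of_nonneg_right (by exact_mod_cast hm) ht.le
    have h1 := (R.intervalIntegrable_self (s := m * Δt) (t := m * Δt + Δt) (by positivity)
      (by linarith) (by linarith)).comp_add_left (m * Δt)
    simpa using h1
  have hconst : ∀ x : ℝ, IntervalIntegrable (fun _ : ℝ => x) volume 0 Δt := fun x => by simp
  have e : meanDev Δt c (k + 1) - meanDev Δt c k = -((∫ s in (0 : ℝ)..Δt,
      ((c (k * Δt + Δt + s) - c (k * Δt + Δt)) - (c (k * Δt + s) - c (k * Δt)))) / Δt) := by
    have e1 : ((k + 1 : ℕ) : ℝ) * Δt = k * Δt + Δt := by push_cast; ring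
    have h1 := hi (k + 1) le_rfl
    rw [e1] at h1
    rw [meanDev_eq, meanDev_eq, e1, intervalIntegral.integral_sub (h1.sub (hconst _))
      ((hi k (by omega)).sub (hconst _)), intervalIntegral.integral_sub h1 (hconst _),
      intervalIntegral.integral_sub (hi k (by omega)) (hconst _), intervalIntegral.integral_const,
      intervalIntegral.integral_const]
    field_simp
    simp
    ring
  rw [e, abs_neg, abs_div, abs_of_pos ht, div_le_iff₀ ht]
  have h2 := intervalIntegral.norm_integral_le_of_norm_le_const (a := 0) (b := Δt) (C := b * Δt * Δt)
    (f := fun s => (c (k * Δt + Δt + s) - c (k * Δt + Δt)) - (c (k * Δt + s) - c (k * Δt)))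
    (fun s hs => by
      rw [uIoc_of_le ht.le] at hs
      refine (R.abs_mixed_le hk0 hs.1.le ht.le (by linarith [hs.2])).trans ?_
      exact mul_le_mul_of_nonneg_left hs.2 (mul_nonneg R.nonneg ht.le))
  simpa [abs_of_pos ht] using h2

lemma sum_sub_mul_eq (r β : ℕ → ℝ) (n : ℕ) :
    ∑ k ∈ Finset.range (n + 1), (r (k + 1) - r k) * β k
      = r (n + 1) * β n - r 0 * β 0 - ∑ k ∈ Finset.range n, r (k + 1) * (β (k + 1) - β k) := by
  induction n with
  | zero => simp; ring
  | succ n ih => rw [Finset.sum_range_succ, ih, Finset.sum_range_succ]; ring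

variable {ι : Type*} [Fintype ι]

lemma intervalIntegrable_fintype_sum {f : ι → ℝ → ℝ} {s t : ℝ}
    (H : ∀ i, IntervalIntegrable (f i) volume s t) :
    IntervalIntegrable (fun x => ∑ i, f i x) volume s t := by
  simpa only [Finset.sum_fn] using IntervalIntegrable.sum Finset.univ fun i _ => H i

/-- Time increments of `r` are not small. After Abel summation the differences fall on the
deviations: two boundary terms of order `Δt`, and at most `T/Δt` terms of order `Δt²`. -/
lemma abs_sum_meanDev_le {T b S Δt : ℝ} {N n : ℕ} {c γ : ι → ℝ → ℝ} {r : ℕ → ι → ℝ}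
    (R : ∀ i, TimeReg T b (c i) (γ i)) (ht : 0 < Δt) (hN : (N : ℝ) * Δt = T) (hn : n ≤ N)
    (hS : ∀ k ≤ N, ∑ i, |r k i| * b ≤ S) :
    |∑ k ∈ Finset.range n, ∑ i, (r (k + 1) i - r k i) * meanDev Δt (c i) k|
      ≤ (2 + T) * S * Δt := by
  have hT : 0 ≤ T := by rw [← hN]; positivity
  have hle : ∀ m : ℕ, m ≤ N → (m : ℝ) * Δt ≤ T := fun m hm => by
    rw [← hN]; exact mul_le_mul_of_nonneg_right (by exact_mod_cast hm) ht.le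
  have hone : ∀ k ≤ N, ∀ β : ι → ℝ, ∀ x, 0 ≤ x → (∀ i, |β i| ≤ b * x) → |∑ i, r k i * β i| ≤ S * x := by
    intro k hk β x hx hβ
    refine (Finset.abs_sum_le_sum_abs _ _).trans ?_
    refine le_trans ?_ (mul_le_mul_of_nonneg_right (hS k hk) hx)
    rw [Finset.sum_mul]
    refine Finset.sum_le_sum fun i _ => ?_
    rw [abs_mul, mul_assoc]
    exact mul_le_mul_of_nonneg_left (hβ i) (abs_nonneg _)
  rcases n with _ | n
  · have hS0 : 0 ≤ S := by
      have := hone 0 (by omega) 0 1 zero_le_one (fun i => by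
        simpa using (R i).nonneg)
      simp at this
      exact this
    simp only [Finset.range_zero, Finset.sum_empty, abs_zero]
    positivity
  · rw [Finset.sum_comm, Finset.sum_congr rfl fun i _ => sum_sub_mul_eq (fun k => r k i)
      (fun k => meanDev Δt (c i) k) n]
    rw [Finset.sum_sub_distrib, Finset.sum_sub_distrib, Finset.sum_comm]
    have h1 := hone (n + 1) hn (fun i => meanDev Δt (c i) n) Δt ht.le
      fun i => (R i).abs_meanDev_le ht (hle _ hn)
    have h0 := hone 0 (by omega) (fun i => meanDev Δt (c i) 0) Δt ht.le
      fun i => (R i).abs_meanDev_le ht (hle _ (by omega))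
    have h2 : |∑ k ∈ Finset.range n, ∑ i, r (k + 1) i * (meanDev Δt (c i) (k + 1) - meanDev Δt (c i) k)|
        ≤ T * S * Δt := by
      refine (Finset.abs_sum_le_sum_abs _ _).trans ?_
      have h3 : ∀ k ∈ Finset.range n,
          |∑ i, r (k + 1) i * (meanDev Δt (c i) (k + 1) - meanDev Δt (c i) k)| ≤ S * (Δt * Δt) := by
        intro k hk
        have hk' := Finset.mem_range.mp hk
        refine hone (k + 1) (by omega) _ (Δt * Δt) (by positivity) fun i => ?_
        have := (R i).abs_meanDev_sub_le ht (hle (k + 2) (by omega))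
        linarith
      refine (Finset.sum_le_sum h3).trans ?_
      rw [Finset.sum_const, Finset.card_range, nsmul_eq_mul]
      have hS0 : 0 ≤ S * Δt := (abs_nonneg _).trans h0
      have := mul_le_mul_of_nonneg_right (hle n (by omega)) hS0
      linarith
    rw [abs_le] at *
    constructor <;> linarith [h0.1, h0.2, h1.1, h1.2, h2.1, h2.2]

lemma level_le {Δt τ T : ℝ} {N : ℕ} (ht : 0 < Δt) (hN : (N : ℝ) * Δt = T) (hτ : τ ≤ T) :
    level Δt τ ≤ N := by
  rw [level, Nat.ceil_le, div_le_iff₀ ht, hN]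
  exact hτ

lemma level_eq {Δt t : ℝ} {k : ℕ} (ht : 0 < Δt) (h1 : k * Δt < t) (h2 : t ≤ (k + 1 : ℕ) * Δt) :
    level Δt t = k + 1 := by
  rw [level, Nat.ceil_eq_iff (by omega)]
  refine ⟨?_, by rwa [div_le_iff₀ ht]⟩
  rw [lt_div_iff₀ ht]
  simpa using h1

lemma le_level_mul {Δt t : ℝ} (ht : 0 < Δt) : t ≤ level Δt t * Δt := by
  rw [← div_le_iff₀ ht]
  exact Nat.le_ceil _

lemma level_pred_mul_lt {Δt t : ℝ} (ht : 0 < Δt) {n : ℕ} (h : level Δt t = n + 1) : n * Δt < t := by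
  rw [← lt_div_iff₀ ht]
  have : n < ⌈t / Δt⌉₊ := by rw [← level, h]; omega
  exact Nat.lt_ceil.mp this

/-- The interpolants jump at the grid points, so a representation valid almost everywhere inside the
open steps is all that can be asked for; it determines integrability and the integrals. -/
lemma intervalIntegrable_of_steps {Δt : ℝ} (ht : 0 < Δt) {N : ℕ} {g : ℝ → ℝ} {W : ℕ → ℝ → ℝ}
    (hW : ∀ k < N, IntervalIntegrable (W k) volume (k * Δt) ((k + 1 : ℕ) * Δt))
    (hg : ∀ k < N, ∀ᵐ t : ℝ, t ∈ Ioo (k * Δt) ((k + 1 : ℕ) * Δt) → g t = W k t) :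
    ∀ k < N, IntervalIntegrable g volume (k * Δt) ((k + 1 : ℕ) * Δt) ∧
      ∀ s ∈ Icc (k * Δt) ((k + 1 : ℕ) * Δt), ∫ t in s..((k + 1 : ℕ) * Δt), g t
        = ∫ t in s..((k + 1 : ℕ) * Δt), W k t := by
  intro k hk
  have hkk : (k : ℝ) * Δt ≤ (k + 1 : ℕ) * Δt := by push_cast; linarith
  have hae : ∀ᵐ t : ℝ, t ∈ Ioc (k * Δt) ((k + 1 : ℕ) * Δt) → W k t = g t := by
    have hne : ∀ᵐ t : ℝ, t ≠ (k + 1 : ℕ) * Δt := by simp [ae_iff]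
    filter_upwards [hg k hk, hne] with t h1 h2 h3
    exact (h1 ⟨h3.1, lt_of_le_of_ne h3.2 h2⟩).symm
  constructor
  · refine (hW k hk).congr_ae ?_
    rw [uIoc_of_le hkk]
    exact (ae_restrict_iff' measurableSet_Ioc).mpr hae
  · intro s hs
    refine intervalIntegral.integral_congr_ae ?_
    filter_upwards [hae] with t h1 h2
    rw [uIoc_of_le hs.2] at h2
    exact (h1 ⟨hs.1.trans_lt h2.1, h2.2⟩).symm

/-- Consistency in time: the time derivative of the test function, integrated against the piecewise
constant interpolant, is compared with the difference quotient tested with the means of the test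
function over the time steps. -/
lemma abs_time_error_le {T b S Δt a τ : ℝ} {N : ℕ} {c γ : ι → ℝ → ℝ} {r : ℕ → ι → ℝ}
    {A : ℕ → ℝ → ℝ} {g : ℝ → ℝ} {e : ℕ → ℝ}
    (R : ∀ i, TimeReg T b (c i) (γ i)) (ht : 0 < Δt) (hN : (N : ℝ) * Δt = T)
    (hS : ∀ k ≤ N, ∑ i, |r k i| * b ≤ S)
    (hA : ∀ k < N, ∀ s t, IntervalIntegrable (A k) volume s t)
    (ha : ∀ k < N, ∀ᵐ t : ℝ, t ∈ Ioo 0 T → |A k t| * Δt ≤ a)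
    (hg : ∀ k < N, ∀ᵐ t : ℝ, t ∈ Ioo (k * Δt) ((k + 1 : ℕ) * Δt) →
      g t = (∑ i, r (k + 1) i * γ i t) + A k t)
    (he : ∀ k < N, ∀ᵐ t : ℝ, t ∈ Ioo 0 T →
      |(∑ i, (r (k + 1) i - r k i) * c i t) / Δt - A k t| ≤ e k)
    (he0 : ∀ k < N, 0 ≤ e k) (ha0 : 0 ≤ a) (hτ : τ ∈ Icc 0 T) :
    |(∑ i, r (level Δt τ) i * c i τ) - (∑ i, r 0 i * c i 0) - ∫ t in (0 : ℝ)..τ, g t|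
      ≤ (2 + T) * S * Δt + ∑ k ∈ Finset.range N, Δt * e k + a := by
  set n := level Δt τ with hn
  have hnN : n ≤ N := level_le ht hN hτ.2
  have hle : ∀ m : ℕ, m ≤ N → (m : ℝ) * Δt ≤ T := fun m hm => by
    rw [← hN]; exact mul_le_mul_of_nonneg_right (by exact_mod_cast hm) ht.le
  have hmem : ∀ m : ℕ, m ≤ N → (m : ℝ) * Δt ∈ Icc 0 T := fun m hm => ⟨by positivity, hle m hm⟩
  have hstep : ∀ k : ℕ, (k : ℝ) * Δt ≤ (k + 1 : ℕ) * Δt := fun k => by push_cast; linarith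
  set W : ℕ → ℝ → ℝ := fun k t => (∑ i, r (k + 1) i * γ i t) + A k t with hW
  have hWi : ∀ k < N, ∀ s t, IntervalIntegrable (W k) volume s t := fun k hk s t => by
    refine IntervalIntegrable.add ?_ (hA k hk s t)
    exact intervalIntegrable_fintype_sum fun i => ((R i).intervalIntegrable s t).const_mul _
  have hgs := intervalIntegrable_of_steps ht (fun k hk => hWi k hk _ _) hg
  have hWint : ∀ k < N, ∀ s ∈ Icc 0 T, ∀ t ∈ Icc 0 T, ∫ x in s..t, W k x
      = (∑ i, r (k + 1) i * (c i t - c i s)) + ∫ x in s..t, A k x := by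
    intro k hk s hs t ht'
    simp only [hW]
    rw [intervalIntegral.integral_add (intervalIntegrable_fintype_sum fun i =>
      ((R i).intervalIntegrable s t).const_mul _) (hA k hk s t),
      intervalIntegral.integral_finsetSum fun i _ => ((R i).intervalIntegrable s t).const_mul _]
    congr 1
    refine Finset.sum_congr rfl fun i _ => ?_
    rw [intervalIntegral.integral_const_mul, (R i).sub_eq hs ht']
  have hfull : ∫ t in (0 : ℝ)..n * Δt, g t = ∑ k ∈ Finset.range n,
      ((∑ i, r (k + 1) i * (c i ((k + 1 : ℕ) * Δt) - c i (k * Δt)))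
        + ∫ x in (k * Δt)..((k + 1 : ℕ) * Δt), A k x) := by
    have h1 := intervalIntegral.sum_integral_adjacent_intervals (f := g) (μ := volume)
      (a := fun k : ℕ => (k : ℝ) * Δt) (n := n) fun k hk => (hgs k (by omega)).1
    simp only [Nat.cast_zero, zero_mul] at h1
    rw [← h1]
    refine Finset.sum_congr rfl fun k hk => ?_
    have hk' : k < N := (Finset.mem_range.mp hk).trans_le hnN
    rw [(hgs k hk').2 _ ⟨le_rfl, hstep k⟩, hWint k hk' _ (hmem k hk'.le) _ (hmem (k + 1) hk')]
  -- the part of the last time step after `τ`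
  have hlast : (∑ i, r n i * c i τ) - (∑ i, r 0 i * c i 0) - ∫ t in (0 : ℝ)..τ, g t
      = (∑ i, r n i * c i (n * Δt)) - (∑ i, r 0 i * c i 0) - (∫ t in (0 : ℝ)..n * Δt, g t)
        + ∫ t in τ..n * Δt, A (n - 1) t := by
    rcases hn0 : n with _ | m
    · have hτ0 : τ = 0 := le_antisymm (by
        have := le_level_mul (t := τ) ht
        rw [← hn, hn0] at this
        simpa using this) hτ.1
      simp [hτ0]
    · have hm : m < N := by omega
      have h1 : m * Δt < τ := level_pred_mul_lt ht (hn ▸ hn0)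
      have h2 : τ ≤ (m + 1 : ℕ) * Δt := by
        have := le_level_mul (t := τ) ht
        rwa [← hn, hn0] at this
      have hm0 : (0 : ℝ) ≤ m * Δt := by positivity
      have h3 := (hgs m hm).2 τ ⟨h1.le, h2⟩
      rw [hWint m hm τ hτ _ (hmem (m + 1) hm)] at h3
      have hig : IntervalIntegrable g volume 0 (m * Δt) := by
        have := IntervalIntegrable.trans_iterate (f := g) (μ := volume)
          (a := fun k : ℕ => (k : ℝ) * Δt) (n := m) fun k hk => (hgs k (by omega)).1
        simpa using this
      have hig1 : IntervalIntegrable g volume (m * Δt) τ :=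
        (hgs m hm).1.mono_set (by
          rw [uIcc_of_le h1.le, uIcc_of_le (hstep m)]; exact Icc_subset_Icc_right h2)
      have hig2 : IntervalIntegrable g volume τ ((m + 1 : ℕ) * Δt) :=
        (hgs m hm).1.mono_set (by
          rw [uIcc_of_le h2, uIcc_of_le (hstep m)]; exact Icc_subset_Icc_left h1.le)
      have h4 := intervalIntegral.integral_add_adjacent_intervals (hig.trans hig1) hig2
      have h5 : ∑ i, r (m + 1) i * (c i ((m + 1 : ℕ) * Δt) - c i τ)
          = (∑ i, r (m + 1) i * c i ((m + 1 : ℕ) * Δt)) - ∑ i, r (m + 1) i * c i τ := by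
        simp only [mul_sub, Finset.sum_sub_distrib]
      rw [h5] at h3
      simp only [Nat.add_sub_cancel]
      linarith
  have htel : (∑ i, r n i * c i (n * Δt)) - (∑ i, r 0 i * c i 0) - (∫ t in (0 : ℝ)..n * Δt, g t)
      = ∑ k ∈ Finset.range n, ((∑ i, (r (k + 1) i - r k i) * c i (k * Δt))
        - ∫ x in (k * Δt)..((k + 1 : ℕ) * Δt), A k x) := by
    rw [hfull]
    have h1 := Finset.sum_range_sub (fun k => ∑ i, r k i * c i (k * Δt)) n
    simp only [Nat.cast_zero, zero_mul] at h1
    rw [← h1, ← Finset.sum_sub_distrib]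
    refine Finset.sum_congr rfl fun k _ => ?_
    rw [← Finset.sum_sub_distrib, ← sub_sub, ← Finset.sum_sub_distrib]
    congr 1
    exact Finset.sum_congr rfl fun i _ => by ring
  -- The value of `c` at the start of the step is its mean over the step plus the deviation. Under
  -- the mean, the difference quotient can be compared with `A k t` at every `t`, which is the
  -- scheme tested with the slice at that time.
  have hmean : ∀ k < N, (∑ i, (r (k + 1) i - r k i) * c i (k * Δt))
        - ∫ x in (k * Δt)..((k + 1 : ℕ) * Δt), A k x
      = (∑ i, (r (k + 1) i - r k i) * meanDev Δt (c i) k)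
        + ∫ t in (k * Δt)..((k + 1 : ℕ) * Δt),
          ((∑ i, (r (k + 1) i - r k i) * c i t) / Δt - A k t) := by
    intro k hk
    have hci : ∀ i, IntervalIntegrable (c i) volume (k * Δt) ((k + 1 : ℕ) * Δt) := fun i =>
      (R i).intervalIntegrable_self (by positivity) (hstep k) (hle _ hk)
    rw [intervalIntegral.integral_sub ((intervalIntegrable_fintype_sum fun i =>
        (hci i).const_mul _).div_const _) (hA k hk _ _), intervalIntegral.integral_div,
      intervalIntegral.integral_finsetSum fun i _ => (hci i).const_mul _]
    simp only [intervalIntegral.integral_const_mul, meanDev, mul_sub, Finset.sum_sub_distrib,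
      Finset.sum_div, mul_div_assoc]
    ring
  have h1 : |∑ k ∈ Finset.range n, ∫ t in (k * Δt)..((k + 1 : ℕ) * Δt),
      ((∑ i, (r (k + 1) i - r k i) * c i t) / Δt - A k t)| ≤ ∑ k ∈ Finset.range N, Δt * e k := by
    refine (Finset.abs_sum_le_sum_abs _ _).trans ?_
    refine le_trans ?_ (Finset.sum_le_sum_of_subset_of_nonneg (Finset.range_mono hnN)
      fun k hk _ => mul_nonneg ht.le (he0 k (Finset.mem_range.mp hk)))
    refine Finset.sum_le_sum fun k hk => ?_
    have hk' : k < N := (Finset.mem_range.mp hk).trans_le hnN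
    have h2 := intervalIntegral.norm_integral_le_of_norm_le_const_ae (a := k * Δt)
      (b := (k + 1 : ℕ) * Δt) (C := e k)
      (f := fun t => (∑ i, (r (k + 1) i - r k i) * c i t) / Δt - A k t) (by
        have hne : ∀ᵐ t : ℝ, t ≠ T := by simp [ae_iff]
        filter_upwards [he k hk', hne] with t h3 h4 h5
        rw [uIoc_of_le (hstep k)] at h5
        have h6 : (0 : ℝ) ≤ k * Δt := by positivity
        exact h3 ⟨h6.trans_lt h5.1, lt_of_le_of_ne (h5.2.trans (hle _ hk')) h4⟩)
    have h7 : |((k + 1 : ℕ) : ℝ) * Δt - k * Δt| = Δt := by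
      push_cast
      rw [add_mul, one_mul, add_sub_cancel_left, abs_of_pos ht]
    rw [h7, mul_comm (e k)] at h2
    exact h2
  have h2 : |∫ t in τ..n * Δt, A (n - 1) t| ≤ a := by
    rcases hn0 : n with _ | m
    · have hτ0 : τ = 0 := le_antisymm (by
        have := le_level_mul (t := τ) ht
        rw [← hn, hn0] at this
        simpa using this) hτ.1
      simpa [hτ0] using ha0
    · have hm : m < N := by omega
      have h3 : m * Δt < τ := level_pred_mul_lt ht (hn ▸ hn0)
      have h4 : τ ≤ (m + 1 : ℕ) * Δt := by
        have := le_level_mul (t := τ) ht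
        rwa [← hn, hn0] at this
      -- The remaining piece is shorter than one step, so the bound on `|A| Δt` is enough.
      have h5 := intervalIntegral.norm_integral_le_of_norm_le_const_ae (a := τ)
        (b := (m + 1 : ℕ) * Δt) (C := a / Δt) (f := A m) (by
          have hne : ∀ᵐ t : ℝ, t ≠ T := by simp [ae_iff]
          filter_upwards [ha m hm, hne] with t h6 h7 h8
          rw [uIoc_of_le h4] at h8
          rw [le_div_iff₀ ht]
          exact h6 ⟨hτ.1.trans_lt h8.1, lt_of_le_of_ne (h8.2.trans (hle _ hm)) h7⟩)
      rw [Nat.add_sub_cancel]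
      refine h5.trans ?_
      rw [abs_of_nonneg (by linarith)]
      push_cast
      rw [div_mul_eq_mul_div, div_le_iff₀ ht]
      exact mul_le_mul_of_nonneg_left (by linarith) ha0
  have h3 := abs_sum_meanDev_le (r := r) R ht hN hnN hS
  rw [hlast, htel, Finset.sum_congr rfl fun k hk =>
    hmean k ((Finset.mem_range.mp hk).trans_le hnN), Finset.sum_add_distrib]
  refine (abs_add_le _ _).trans (add_le_add ((abs_add_le _ _).trans (add_le_add h3 h1)) h2)

end Time

end FV

namespace FV

/-! ### Consistency of the continuity equation. -/

section Density

set_option linter.unusedSectionVars false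

variable {d M : ℕ} [NeZero M] {ℓ T B γ α Δt h ε E V : ℝ} {N : ℕ}

/-- Integral over the cube of a piecewise constant function times a time slice. -/
noncomputable def cubePair (ℓ h : ℝ) (q : Cell d M → ℝ) (G : ℝ × Space d → ℝ) (t : ℝ) : ℝ :=
  ∫ x in cube d ℓ, pwc h q x * G (t, x)

lemma integrableOn_slice {G : ℝ × Space d → ℝ} (hG : Measurable G) (hb : ∀ z, |G z| ≤ B)
    (t : ℝ) {s : Set (Space d)} (hs : volume s ≠ ⊤) : IntegrableOn (fun x => G (t, x)) s :=
  Measure.integrableOn_of_bounded hs (hG.comp (by fun_prop)).aestronglyMeasurable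
    (Filter.Eventually.of_forall fun x => hb _)

lemma measurable_cubePair (q : Cell d M → ℝ) {G : ℝ × Space d → ℝ} (hG : Measurable G) :
    Measurable (cubePair ℓ h q G) :=
  measurable_integral_slice (G := fun z => pwc h q z.2 * G z)
    (((measurable_pwc h q).comp measurable_snd).mul hG) (cube d ℓ)

lemma abs_integral_pwc_mul_le (hh : 0 < h) (hM : (M : ℝ) * h = ℓ) (q : Cell d M → ℝ)
    {f : Space d → ℝ} (hb : ∀ x, |f x| ≤ B) :
    |∫ x in cube d ℓ, pwc h q x * f x| ≤ B * ∑ K, h ^ d * |q K| := by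
  have hi : IntegrableOn (fun x => pwc h (fun K => |q K|) x * B) (cube d ℓ) :=
    integrableOn_pwc_mul h _ (integrable_const B)
  have hpt : ∀ x, ‖pwc h q x * f x‖ ≤ pwc h (fun K => |q K|) x * B := fun x => by
    rw [norm_mul]
    exact mul_le_mul_of_nonneg_left (hb x) (abs_nonneg _)
  refine (norm_integral_le_of_norm_le hi (Filter.Eventually.of_forall hpt)).trans (le_of_eq ?_)
  rw [integral_mul_const, integral_pwc hh hM, mul_comm]

lemma abs_cubePair_le (hh : 0 < h) (hM : (M : ℝ) * h = ℓ) (q : Cell d M → ℝ)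
    {G : ℝ × Space d → ℝ} (hb : ∀ z, |G z| ≤ B) (t : ℝ) :
    |cubePair ℓ h q G t| ≤ B * ∑ K, h ^ d * |q K| :=
  abs_integral_pwc_mul_le hh hM q fun x => hb (t, x)

lemma intervalIntegrable_cubePair (hh : 0 < h) (hM : (M : ℝ) * h = ℓ) (q : Cell d M → ℝ)
    {G : ℝ × Space d → ℝ} (hG : Measurable G) (hb : ∀ z, |G z| ≤ B) (s t : ℝ) :
    IntervalIntegrable (cubePair ℓ h q G) volume s t :=
  (intervalIntegrable_const (c := B * ∑ K, h ^ d * |q K|)).mono_fun'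
    (measurable_cubePair q hG).aestronglyMeasurable
    (Filter.Eventually.of_forall fun t => abs_cubePair_le hh hM q hb t)

lemma cubePair_eq_sum (hh : 0 < h) (hM : (M : ℝ) * h = ℓ) (q : Cell d M → ℝ)
    {G : ℝ × Space d → ℝ} (hG : Measurable G) (hb : ∀ z, |G z| ≤ B) (t : ℝ) :
    cubePair ℓ h q G t = ∑ K, q K * ∫ x in cellSet h K, G (t, x) :=
  integral_pwc_mul hh hM q (integrableOn_slice hG hb t (volume_cube_lt_top ℓ).ne)

lemma pow_pred_mul_jump (hh : 0 < h) (hd : d ≠ 0) (i : Fin d) (Φ : Space d → ℝ) (x : ℝ)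
    (K : Cell d M) : h ^ (d - 1) * (x * jump i (proj h Φ) K) = x * faceDiff h i Φ K := by
  rw [faceDiff, pow_eq_pow_pred_mul hd]
  field_simp

/-- Discrete product rule; both terms are already part of the density residual, so passing from the
centred flux to the exact one costs nothing new. -/
lemma abs_jump_mul_le (i : Fin d) {r : Cell d M → ℝ} (hr : ∀ K, 0 < r K)
    (u : Cell d M → Fin d → ℝ) (K : Cell d M) :
    |jump i (fun L => r L * u L i) K| ≤ |avg i (comp u i) K| * |jump i r K|
      + (r K + r (nxt i K)) * |jump i (comp u i) K| := by
  have e : jump i (fun L => r L * u L i) K = avg i (comp u i) K * jump i r K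
      + (r K + r (nxt i K)) / 2 * jump i (comp u i) K := by
    simp only [jump, avg, comp]
    ring
  have h1 := hr K
  have h2 := hr (nxt i K)
  rw [e]
  refine (abs_add_le _ _).trans ?_
  rw [abs_mul, abs_mul, abs_of_pos (by linarith : 0 < (r K + r (nxt i K)) / 2)]
  have := mul_nonneg (by linarith : 0 ≤ (r K + r (nxt i K)) / 2) (abs_nonneg (jump i (comp u i) K))
  linarith

/-- Spatial consistency error of the continuity equation at a fixed time. -/
lemma abs_sum_flux_faceDiff_sub_le (hh : 0 < h) (hM : (M : ℝ) * h = ℓ) {Φ : Space d → ℝ}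
    {G : Fin d → Space d → ℝ} (R : ∀ i, SpaceReg ℓ h B i Φ (G i)) (hB : 0 ≤ B)
    {r : Cell d M → ℝ} (hr : ∀ K, 0 < r K) (u : Cell d M → Fin d → ℝ) :
    |(∑ i, ∑ K, flux h α r u i K * faceDiff h i Φ K)
        - ∑ i, ∫ x in cube d ℓ, pwc h (fun L => r L * u L i) x * G i x|
      ≤ 2 * B * densityRes h α r u := by
  rw [← Finset.sum_sub_distrib]
  refine (Finset.abs_sum_le_sum_abs _ _).trans ?_
  rw [densityRes, faceSum, Finset.mul_sum]
  refine Finset.sum_le_sum fun i _ => ?_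
  have h1 := abs_sum_flux_mul_sub_le (α := α) hh hr u i (b := B) fun K => (R i).abs_faceDiff_le hh hM K
  have h2 := (R i).abs_sum_avg_sub_le hh hM fun L => r L * u L i
  have h3 : ∑ K, h ^ d * |jump i (fun L => r L * u L i) K|
      ≤ ∑ K, h ^ d * (|avg i (comp u i) K| * |jump i r K|
        + (r K + r (nxt i K)) * |jump i (comp u i) K| + h ^ α * |jump i r K|) := by
    refine Finset.sum_le_sum fun K _ => mul_le_mul_of_nonneg_left ?_ (by positivity)
    have := abs_jump_mul_le i hr u K
    have : 0 ≤ h ^ α * |jump i r K| := by positivity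
    linarith
  have h4 := mul_le_mul_of_nonneg_left h3 hB
  refine (abs_sub_le _ (∑ K, avg i (fun L => r L * u L i) K * faceDiff h i Φ K) _).trans ?_
  linarith

lemma sum_abs_density_velocity_le (hh : 0 < h) {r : Cell d M → ℝ} (hr : ∀ K, 0 < r K)
    (u : Cell d M → Fin d → ℝ) :
    ∑ i, ∑ K, h ^ d * |r K * u K i|
      ≤ d * ∑ K, h ^ d * r K + ∑ K, h ^ d * (r K * ∑ j, u K j ^ 2) := by
  rw [← faceSum_cell, ← faceSum_component h r u, ← faceSum_add]
  refine faceSum_mono hh.le fun i K => ?_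
  rw [abs_mul, abs_of_pos (hr K)]
  have : |u K i| ≤ 1 + u K i ^ 2 := by
    rw [← sq_abs]; nlinarith [sq_nonneg (|u K i| - 1 / 2)]
  have := mul_le_mul_of_nonneg_left this (hr K).le
  linarith

/-- Space-time bound of the spatial consistency error of the continuity equation. -/
lemma exists_sum_densityRes_le (hd : d = 2 ∨ d = 3) (hℓ : 0 < ℓ) (hγ : 1 < γ) (hα : -1 < α)
    (hE : 0 ≤ E) (hT : 0 < T) (V : ℝ) : ∃ C, ∀ (M : ℕ) [NeZero M] (N : ℕ) (Δt h ε : ℝ)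
      (Ω : Set (Space d)) (ρ : ℕ → Cell d M → ℝ) (u : ℕ → Cell d M → Fin d → ℝ),
      0 < Δt → 0 < h → h < 1 → (N : ℝ) * Δt = T → (M : ℝ) * h = ℓ →
      EnergyBounds Ω γ α N Δt h ε ρ u E →
      ∑ k ∈ Finset.range N, Δt * ∑ j, sobSum h (comp (u (k + 1)) j) ≤ V →
      ∑ k ∈ Finset.range N, Δt * densityRes h α (ρ (k + 1)) (u (k + 1))
        ≤ C * (h ^ (1 / 2 : ℝ) + h ^ ((1 + α) / 2) + h ^ (1 + betaD d γ α)) := by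
  obtain ⟨C₂, hC₂, H₂⟩ := exists_density_sq_bound hd hℓ hγ hα hE hT
  refine ⟨2 * E + T * (4 * (d * ℓ ^ d) + 4 * (d * (ℓ ^ d + E)) + 2 * E) + 2 * V + 3 * E
    + 4 * d * C₂, fun M _ N Δt h ε Ω ρ u ht hh hh1 hN hM Bd hV => ?_⟩
  set X := h ^ (1 / 2 : ℝ) + h ^ ((1 + α) / 2) + h ^ (1 + betaD d γ α) with hX
  have hX0 : 0 ≤ X := by positivity
  set β := betaD d γ α with hβ
  have hd0 : d ≠ 0 := by omega
  set w : ℝ := 4 * (d * ℓ ^ d) + 4 * (d * (ℓ ^ d + E)) + 2 * E with hw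
  have h1 : ∀ k ∈ Finset.range N, Δt * densityRes h α (ρ (k + 1)) (u (k + 1))
      ≤ X * (2 * (Δt * jumpDiss h α (ρ (k + 1)) (u (k + 1))) + Δt * w
        + 2 * (Δt * ∑ j, sobSum h (comp (u (k + 1)) j)) + 3 * (Δt * gradSum h (u (k + 1)))
        + 4 * d * h ^ (-(2 * β)) * (Δt * ∑ K, h ^ d * ρ (k + 1) K ^ 2)) := by
    intro k hk
    have hk' : k + 1 ≤ N := Finset.mem_range.mp hk
    have h2 := densityRes_le (α := α) (β := β) hh hh1 hd0 hM (Bd.pos _ hk') (u (k + 1))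
    have h3 := Bd.mass_le hγ hh hM hk'
    have h4 := Bd.kinetic _ hk'
    have h5 : ∑ K, h ^ d * ∑ j, u (k + 1) K j ^ 2 ≤ ∑ j, sobSum h (comp (u (k + 1)) j) := by
      rw [sum_sobSum_comp]
      have := gradSum_nonneg hh.le (u (k + 1))
      linarith
    have h6 := mul_le_mul_of_nonneg_left h3 (Nat.cast_nonneg (α := ℝ) d)
    have h7 : 2 * jumpDiss h α (ρ (k + 1)) (u (k + 1)) + 4 * (d * ℓ ^ d)
        + 4 * (d * ∑ K, h ^ d * ρ (k + 1) K)
        + 2 * ∑ K, h ^ d * (ρ (k + 1) K * ∑ j, u (k + 1) K j ^ 2)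
        + 2 * ∑ K, h ^ d * ∑ j, u (k + 1) K j ^ 2
        + 3 * gradSum h (u (k + 1)) + 4 * d * (h ^ (-(2 * β)) * ∑ K, h ^ d * ρ (k + 1) K ^ 2)
        ≤ 2 * jumpDiss h α (ρ (k + 1)) (u (k + 1)) + w + 2 * ∑ j, sobSum h (comp (u (k + 1)) j)
        + 3 * gradSum h (u (k + 1)) + 4 * d * (h ^ (-(2 * β)) * ∑ K, h ^ d * ρ (k + 1) K ^ 2) := by
      rw [hw]
      linarith
    have h8 := mul_le_mul_of_nonneg_left (h2.trans (mul_le_mul_of_nonneg_left h7 hX0)) ht.le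
    refine h8.trans (le_of_eq ?_)
    ring
  refine (Finset.sum_le_sum h1).trans ?_
  have hsum : ∀ (a b c e : ℕ → ℝ) (x y z w : ℝ),
      ∑ k ∈ Finset.range N, X * (x * a k + w + y * b k + z * c k + 4 * d * h ^ (-(2 * β)) * e k)
        = X * (x * ∑ k ∈ Finset.range N, a k + N * w + y * ∑ k ∈ Finset.range N, b k
          + z * ∑ k ∈ Finset.range N, c k
          + 4 * d * h ^ (-(2 * β)) * ∑ k ∈ Finset.range N, e k) := by
    intro a b c e x y z w
    simp [Finset.sum_add_distrib, ← Finset.mul_sum]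
  rw [hsum, ← mul_assoc (N : ℝ), hN, mul_comm X]
  refine mul_le_mul_of_nonneg_right ?_ hX0
  -- The weight cancels the growth `h^(2β_D)` of the squared `L²` norm of the density.
  have h9 : h ^ (-(2 * β)) * ∑ k ∈ Finset.range N, Δt * ∑ K, h ^ d * ρ (k + 1) K ^ 2 ≤ C₂ := by
    have h10 := mul_le_mul_of_nonneg_left (H₂ M N Δt h ε Ω ρ u ht hh hh1 hN hM Bd)
      (by positivity : 0 ≤ h ^ (-(2 * β)))
    rw [mul_left_comm, ← Real.rpow_add hh] at h10
    simpa using h10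
  have h11 : ∑ k ∈ Finset.range N, Δt * jumpDiss h α (ρ (k + 1)) (u (k + 1)) ≤ E := Bd.density_jump
  have h12 := Bd.grad
  have h13 := mul_le_mul_of_nonneg_left h9 (by positivity : (0 : ℝ) ≤ 4 * d)
  linarith

/-- Consistency of the continuity equation in terms of the energy bounds and the spatial residual. -/
lemma abs_errDensity_le (hd : d ≠ 0) (hγ : 1 < γ) (hT : 0 < T) (ht : 0 < Δt) (hh : 0 < h)
    (hN : (N : ℝ) * Δt = T) (hM : (M : ℝ) * h = ℓ) {Ω : Set (Space d)} {a μ lam : ℝ}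
    {ρ₀ : Space d → ℝ} {m₀ : Space d → Fin d → ℝ} {ρ : ℕ → Cell d M → ℝ}
    {u : ℕ → Cell d M → Fin d → ℝ} (S : IsFVSolution Ω a γ μ lam α ρ₀ m₀ N Δt h ε ρ u)
    (Bd : EnergyBounds Ω γ α N Δt h ε ρ u E)
    {φ φt : ℝ → Space d → ℝ} {φx : Fin d → ℝ → Space d → ℝ} (H : IsTestFun ℓ T B φ φt φx)
    {τ : ℝ} (hτ : τ ∈ Icc 0 T) :
    |errDensity ℓ Δt h ρ u τ φ φt φx|
      ≤ (2 + T) * (B * (ℓ ^ d + E)) * Δt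
        + 2 * B * ∑ k ∈ Finset.range N, Δt * densityRes h α (ρ (k + 1)) (u (k + 1))
        + B * (d * (ℓ ^ d + E) + E) * Δt := by
  have hB := H.nonneg hT
  have hℓ : 0 < ℓ := hh.trans_le (width_le hh hM)
  have hE := Bd.nonneg hh
  obtain ⟨F, Gt, Gx, Hn, hF, hGt, hGx⟩ := H.exists_normalTest hT
  set c : Cell d M → ℝ → ℝ := fun K t => ∫ x in cellSet h K, F (t, x) with hc
  set g' : Cell d M → ℝ → ℝ := fun K t => ∫ x in cellSet h K, Gt (t, x) with hg'
  have R : ∀ K, TimeReg T (B * h ^ d) (c K) (g' K) := fun K => by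
    have := Hn.timeReg hT (isCompact_cellSet h K).measure_ne_top
    rwa [measureReal_cellSet hh] at this
  set q : ℕ → Fin d → Cell d M → ℝ := fun k i K => ρ (k + 1) K * u (k + 1) K i with hq
  set A : ℕ → ℝ → ℝ := fun k t => ∑ i, cubePair ℓ h (q k i) (Gx i) t with hA
  set g : ℝ → ℝ := fun t => ∫ x in cube d ℓ, (pwc h (ρ (level Δt t)) x * φt t x
          + ∑ i, pwc h (ρ (level Δt t)) x * pwc h (comp (u (level Δt t)) i) x * φx i t x) with hg
  have hφ : ∀ t ∈ Icc 0 T, ∀ r : Cell d M → ℝ,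
      ∫ x in cube d ℓ, pwc h r x * φ t x = ∑ K, r K * c K t := by
    intro t ht' r
    rw [← integral_pwc_mul hh hM r (integrableOn_slice Hn.cont.measurable Hn.bound t
      (volume_cube_lt_top ℓ).ne)]
    simp only [hF t ht']
  have hA0 : ∀ k < N, ∀ t, |A k t| ≤ B * (d * (ℓ ^ d + E) + E) := by
    intro k hk t
    have h1 : |A k t| ≤ ∑ i, B * ∑ K, h ^ d * |q k i K| :=
      (Finset.abs_sum_le_sum_abs _ _).trans (Finset.sum_le_sum fun i _ =>
        abs_cubePair_le hh hM _ (Hn.bound_x i) t)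
    rw [← Finset.mul_sum] at h1
    refine h1.trans (mul_le_mul_of_nonneg_left ?_ hB)
    have h2 := sum_abs_density_velocity_le hh (Bd.pos (k + 1) hk) (u (k + 1))
    have h3 := mul_le_mul_of_nonneg_left (Bd.mass_le hγ hh hM (k := k + 1) hk)
      (Nat.cast_nonneg (α := ℝ) d)
    have h4 := Bd.kinetic (k + 1) hk
    linarith
  -- The index set is that of the cells: `c K` is the cell integral of the test function, and `A`
  -- the exact convective term. It is bounded uniformly in time, so the incomplete last step costs
  -- only `Δt`.
  have hmain := abs_time_error_le (r := ρ) (A := A) (g := g) (S := B * (ℓ ^ d + E))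
    (a := B * (d * (ℓ ^ d + E) + E) * Δt)
    (e := fun k => 2 * B * densityRes h α (ρ (k + 1)) (u (k + 1))) R ht hN ?_ ?_ ?_ ?_ ?_ ?_ ?_ hτ
  · rw [errDensity, hφ τ hτ, hφ 0 ⟨le_rfl, hT.le⟩]
    have e0 : level Δt 0 = 0 := by simp [level]
    rw [e0]
    refine hmain.trans (le_of_eq ?_)
    rw [Finset.mul_sum]
    congr 2
    exact Finset.sum_congr rfl fun k _ => by ring
  · intro k hk
    have h1 : ∀ K, |ρ k K| * (B * h ^ d) = B * (h ^ d * ρ k K) := fun K => by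
      rw [abs_of_pos (Bd.pos k hk K)]; ring
    simp only [h1]
    rw [← Finset.mul_sum]
    exact mul_le_mul_of_nonneg_left (Bd.mass_le hγ hh hM hk) hB
  · intro k _ s t
    exact intervalIntegrable_fintype_sum fun i =>
      intervalIntegrable_cubePair hh hM _ (Hn.meas_x i) (Hn.bound_x i) s t
  · intro k hk
    exact Filter.Eventually.of_forall fun t _ => mul_le_mul_of_nonneg_right (hA0 k hk t) ht.le
  · intro k hk
    filter_upwards [ae_ae_of_ae_prod_volume hGt,
      eventually_countable_forall.mpr fun i => ae_ae_of_ae_prod_volume (hGx i)] with t h1 h2 h3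
    have htT : t ∈ Ioo 0 T := by
      have h4 : (0 : ℝ) ≤ k * Δt := by positivity
      refine ⟨h4.trans_lt h3.1, h3.2.trans_le ?_⟩
      rw [← hN]
      exact mul_le_mul_of_nonneg_right (by exact_mod_cast hk) ht.le
    simp only [hg, level_eq ht h3.1 h3.2.le]
    have h5 : ∀ᵐ x : Space d, pwc h (ρ (k + 1)) x * φt t x
          + ∑ i, pwc h (ρ (k + 1)) x * pwc h (comp (u (k + 1)) i) x * φx i t x
        = pwc h (ρ (k + 1)) x * Gt (t, x) + ∑ i, pwc h (q k i) x * Gx i (t, x) := by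
      filter_upwards [h1, eventually_countable_forall.mpr h2] with x a1 a2
      rw [a1 (mem_strip.mpr htT)]
      congr 1
      refine Finset.sum_congr rfl fun i _ => ?_
      rw [a2 i (mem_strip.mpr htT)]
      rfl
    have hi : ∀ (p : Cell d M → ℝ) {G : ℝ × Space d → ℝ}, Measurable G → (∀ z, |G z| ≤ B) →
        IntegrableOn (fun x => pwc h p x * G (t, x)) (cube d ℓ) := fun p G hm hb =>
      integrableOn_pwc_mul h p (integrableOn_slice hm hb t (volume_cube_lt_top ℓ).ne)
    rw [integral_congr_ae (ae_restrict_of_ae h5), integral_add (hi _ Hn.meas_t Hn.bound_t)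
      (integrable_finsetSum _ fun i _ => hi _ (Hn.meas_x i) (Hn.bound_x i)),
      integral_finsetSum _ fun i _ => hi _ (Hn.meas_x i) (Hn.bound_x i)]
    congr 1
    exact cubePair_eq_sum hh hM _ Hn.meas_t Hn.bound_t t
  · intro k hk
    filter_upwards [eventually_countable_forall.mpr fun i => Hn.spaceReg hh.le i] with t h1 h2
    have h3 := S.continuity k hk (proj h fun x => F (t, x))
    have h4 : ∑ K, h ^ d * ((ρ (k + 1) K - ρ k K) / Δt * proj h (fun x => F (t, x)) K)
        = (∑ K, (ρ (k + 1) K - ρ k K) * c K t) / Δt := by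
      rw [Finset.sum_div]
      refine Finset.sum_congr rfl fun K _ => ?_
      simp only [hc]
      rw [← pow_mul_proj hh]
      ring
    have h5 := abs_sum_flux_faceDiff_sub_le (α := α) hh hM (fun i => h1 i h2) hB
      (Bd.pos (k + 1) hk) (u (k + 1))
    simp only [pow_pred_mul_jump hh hd] at h3
    rw [h4, sub_eq_zero] at h3
    rw [h3]
    exact h5
  · intro k hk
    refine mul_nonneg (by positivity) (faceSum_nonneg hh.le fun i K => ?_)
    have := Bd.pos (k + 1) hk K
    have := Bd.pos (k + 1) hk (nxt i K)
    positivity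
  · positivity

end Density

end FV

namespace FV

/-! ### The volume of the boundary layer. -/

section BoundaryLayer

variable {d : ℕ} {ℓ : ℝ} {Ω : Set (Space d)}

lemma norm_single (i : Fin d) (t : ℝ) : ‖(Pi.single i t : Space d)‖ = |t| := by
  rw [Pi.norm_single, Real.norm_eq_abs]

/-- A set of width at most `δ` in direction `e_i` has measure of order `δ`. -/
lemma volume_mul_le_of_width {A : Set (Space d)} (hA : MeasurableSet A) {x : Space d} {r δ : ℝ}
    (hAr : A ⊆ Metric.ball x r) (i : Fin d)
    (hδ : ∀ p t, p ∈ A → p + (Pi.single i t : Space d) ∈ A → |t| ≤ δ) :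
    volume A * ENNReal.ofReal r ≤ ENNReal.ofReal δ * volume (Metric.ball x (2 * r)) := by
  have hm : Measurable fun q : ℝ × Space d => q.2 - (Pi.single i q.1 : Space d) := by
    have : Continuous fun q : ℝ × Space d => q.2 - (Pi.single i q.1 : Space d) :=
      continuous_snd.sub ((continuous_single i).comp continuous_fst)
    exact this.measurable
  -- The volume is averaged over the shifts of `A` by `t ∈ [0, r]`, all inside the larger ball.
  -- After Tonelli, a given point is covered only for `t` in a set of diameter at most `δ`.
  have h1 : ∫⁻ _t in Icc 0 r, volume A = volume A * ENNReal.ofReal r := by simp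
  have h2 : ∀ t ∈ Icc 0 r, volume A
      = ∫⁻ y in Metric.ball x (2 * r), A.indicator 1 (y - (Pi.single i t : Space d)) := by
    intro t ht
    have hs : MeasurableSet ((fun y : Space d => y - (Pi.single i t : Space d)) ⁻¹' A) :=
      (measurable_sub_const _) hA
    have e : ∀ y : Space d, A.indicator (1 : Space d → ENNReal) (y - (Pi.single i t : Space d))
        = ((fun y : Space d => y - (Pi.single i t : Space d)) ⁻¹' A).indicator 1 y := fun y => rfl
    simp only [e]
    rw [lintegral_indicator_one hs, Measure.restrict_apply hs, inter_eq_left.mpr ?_]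
    · exact ((measurePreserving_sub_right volume (Pi.single i t : Space d)).measure_preimage
        hA.nullMeasurableSet).symm
    intro y hy
    have h3 := hAr hy
    simp only [Metric.mem_ball, dist_eq_norm] at h3 ⊢
    have h4 : y - x = (y - (Pi.single i t : Space d) - x) + (Pi.single i t : Space d) := by abel
    rw [h4]
    refine (norm_add_le _ _).trans_lt ?_
    rw [norm_single, abs_of_nonneg ht.1]
    linarith [ht.2]
  rw [← h1, setLIntegral_congr_fun measurableSet_Icc h2, lintegral_lintegral_swap
    (f := fun t y => A.indicator (1 : Space d → ENNReal) (y - (Pi.single i t : Space d)))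
    (((measurable_one.indicator hA).comp hm).aemeasurable)]
  refine (lintegral_mono (g := fun _ => ENNReal.ofReal δ) fun y => ?_).trans
    (le_of_eq (by simp))
  have hs : MeasurableSet ((fun t : ℝ => y - (Pi.single i t : Space d)) ⁻¹' A) :=
    (hm.comp (measurable_id.prodMk measurable_const)) hA
  have e : ∀ t : ℝ, A.indicator (1 : Space d → ENNReal) (y - (Pi.single i t : Space d))
      = ((fun t : ℝ => y - (Pi.single i t : Space d)) ⁻¹' A).indicator 1 t := fun t => rfl
  simp only [e]
  rw [lintegral_indicator_one hs]
  refine (Measure.restrict_apply_le _ _).trans ((Real.volume_le_diam _).trans ?_)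
  refine Metric.ediam_le fun s hs t ht => ?_
  rw [edist_dist, Real.dist_eq]
  refine ENNReal.ofReal_le_ofReal (hδ (y - (Pi.single i s : Space d)) (s - t) hs ?_)
  have : y - (Pi.single i s : Space d) + Pi.single i (s - t) = y - Pi.single i t := by
    rw [Pi.single_sub]; abel
  rw [this]
  exact ht

/-- The segment from `z` to `y` is connected, so it cannot be covered by the disjoint open sets `Ω`
and the exterior while meeting both. -/
lemma exists_mem_frontier {z y : Space d} (hΩ : IsOpen Ω) (hz : z ∈ Ω) (hy : y ∉ Ω) :
    ∃ w ∈ frontier Ω, dist w z ≤ dist y z := by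
  by_contra! H
  have hs : segment ℝ z y ⊆ Ω ∪ (closure Ω)ᶜ := by
    intro w hw
    by_contra hc
    rw [mem_union, not_or, notMem_compl_iff] at hc
    have hw' : w ∈ frontier Ω := by rw [hΩ.frontier_eq]; exact ⟨hc.2, hc.1⟩
    refine absurd (H w hw') (not_lt.mpr ?_)
    obtain ⟨t, ht, rfl⟩ := (segment_eq_image_lineMap ℝ z y) ▸ hw
    rw [dist_lineMap_left, dist_comm z y, Real.norm_of_nonneg ht.1]
    exact mul_le_of_le_one_left dist_nonneg ht.2
  have hyc : y ∈ (closure Ω)ᶜ := (hs (right_mem_segment ℝ z y)).resolve_left hy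
  obtain ⟨w, -, hw1, hw2⟩ := (convex_segment (𝕜 := ℝ) z y).isPreconnected Ω (closure Ω)ᶜ hΩ
    isClosed_closure.isOpen_compl hs ⟨z, left_mem_segment ℝ z y, hz⟩
    ⟨y, right_mem_segment ℝ z y, hyc⟩
  exact hw2 (subset_closure hw1)

/-- The points of `Ω` at distance at most `h` from its complement. -/
def boundaryLayer (Ω : Set (Space d)) (h : ℝ) : Set (Space d) := {z | z ∈ Ω ∧ ∃ y ∉ Ω, dist y z ≤ h}

/-- Some partial derivative of `g` is nonzero at `x`. Strict differentiability makes `g` grow at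
least at half that rate along the coordinate direction near `x`. A point of the layer satisfies `-L
h ≤ g < 0` with `L` a local Lipschitz constant, so the layer has width at most `L h / c` in that
direction, without flattening the boundary. -/
lemma volume_sublevel_layer_le {x : Space d} {g : Space d → ℝ} (hg : ContDiff ℝ ∞ g)
    (hx : fderiv ℝ g x ≠ 0) {U : Set (Space d)} (hU : U ∈ 𝓝 x) (hΩ : ∀ y ∈ U, (y ∈ Ω ↔ g y < 0)) :
    ∃ r C : ℝ, 0 < r ∧ 0 ≤ C ∧ ∀ h, 0 < h → h ≤ r →
      volume (boundaryLayer Ω h ∩ Metric.ball x r) ≤ ENNReal.ofReal (C * h) := by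
  obtain ⟨i, hi⟩ : ∃ i, fderiv ℝ g x (Pi.single i 1) ≠ 0 := by
    by_contra! H
    refine hx (ContinuousLinearMap.coe_injective ?_)
    refine LinearMap.pi_ext' fun i => LinearMap.ext_ring ?_
    simpa using H i
  set φ := fderiv ℝ g x with hφ
  set c : ℝ := |φ (Pi.single i 1)| / 2 with hc
  have hc0 : 0 < c := by positivity
  obtain ⟨s, hs, happ⟩ := (hg.contDiffAt.hasStrictFDerivAt (by simp) :
    HasStrictFDerivAt g φ x).approximates_deriv_on_nhds (c := ⟨c, hc0.le⟩) (Or.inr hc0)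
  have happ' : ∀ p ∈ s, ∀ q ∈ s, |g p - g q - φ (p - q)| ≤ c * ‖p - q‖ :=
    fun p hp q hq => happ p hp q hq
  obtain ⟨R, hR, hRs⟩ := Metric.mem_nhds_iff.mp (Filter.inter_mem hU hs)
  set r := R / 2 with hr
  have hr0 : 0 < r := by positivity
  set L := ‖φ‖ + c with hL
  have hL0 : 0 ≤ L := by positivity
  set V := (volume (Metric.ball x (2 * r))).toReal with hV
  refine ⟨r, L / c * V / r, hr0, by positivity, fun h hh hhr => ?_⟩
  set A : Set (Space d) := Metric.ball x r ∩ (g ⁻¹' Ico (-(L * h)) 0) with hA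
  have hAm : MeasurableSet A :=
    Metric.isOpen_ball.measurableSet.inter (hg.continuous.measurable measurableSet_Ico)
  have hball : ∀ p ∈ Metric.ball x r, p ∈ U ∩ s := fun p hp =>
    hRs (Metric.ball_subset_ball (by linarith) hp)
  have hsub : boundaryLayer Ω h ∩ Metric.ball x r ⊆ A := by
    rintro z ⟨⟨hz, y, hy, hyz⟩, hzr⟩
    have hyR : y ∈ U ∩ s := hRs (by
      rw [Metric.mem_ball] at hzr ⊢
      have := dist_triangle y z x
      linarith)
    have hzU := hball z hzr
    refine ⟨hzr, ?_, (hΩ z hzU.1).mp hz⟩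
    have h1 : 0 ≤ g y := not_lt.mp fun h0 => hy ((hΩ y hyR.1).mpr h0)
    have h2 := happ' y hyR.2 z hzU.2
    have h3 : |φ (y - z)| ≤ ‖φ‖ * ‖y - z‖ := φ.le_opNorm _
    rw [dist_eq_norm] at hyz
    have h4 : L * ‖y - z‖ ≤ L * h := mul_le_mul_of_nonneg_left hyz hL0
    rw [hL, add_mul] at h4
    rw [abs_le] at h2 h3
    change -(L * h) ≤ g z
    linarith [h2.2, h3.2]
  have hwidth : ∀ p t, p ∈ A → p + (Pi.single i t : Space d) ∈ A → |t| ≤ L * h / c := by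
    intro p t hp hpt
    have h1 := happ' _ (hball _ hpt.1).2 _ (hball _ hp.1).2
    have h2 : (Pi.single i t : Space d) = t • Pi.single i 1 := by rw [← Pi.single_smul]; simp
    rw [add_sub_cancel_left, norm_single, h2, map_smul, smul_eq_mul] at h1
    have h3 : |t * φ (Pi.single i 1)| = 2 * c * |t| := by rw [abs_mul, hc]; ring
    have h4 : |g (p + t • (Pi.single i 1 : Space d)) - g p| ≤ L * h := by
      rw [← h2, abs_le]
      have h5 := hp.2
      have h6 := hpt.2
      simp only [mem_preimage, mem_Ico] at h5 h6
      constructor <;> linarith [h5.1, h5.2, h6.1, h6.2]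
    have h5 : |t * φ (Pi.single i 1)| ≤ |g (p + t • (Pi.single i 1 : Space d)) - g p|
        + |g (p + t • (Pi.single i 1 : Space d)) - g p - t * φ (Pi.single i 1)| := by
      have := abs_sub (g (p + t • (Pi.single i 1 : Space d)) - g p)
        (g (p + t • (Pi.single i 1 : Space d)) - g p - t * φ (Pi.single i 1))
      simpa using this
    rw [le_div_iff₀ hc0]
    linarith
  have h1 := volume_mul_le_of_width hAm inter_subset_left i hwidth
  have hfin : volume (Metric.ball x (2 * r)) ≠ ⊤ := Metric.isBounded_ball.measure_lt_top.ne
  rw [← ENNReal.ofReal_toReal hfin, ← ENNReal.ofReal_mul (by positivity), ← hV] at h1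
  refine (measure_mono hsub).trans ?_
  have h2 := (ENNReal.le_div_iff_mul_le (Or.inl (by simpa using hr0))
    (Or.inl ENNReal.ofReal_ne_top)).mpr h1
  refine h2.trans (le_of_eq ?_)
  rw [← ENNReal.ofReal_div_of_pos hr0]
  congr 1
  field_simp

/-- The boundary layer of width `h` of a domain with smooth boundary has measure of order `h`. -/
lemma exists_boundaryLayer_le (hΩ : IsFluidDomain ℓ Ω) : ∃ C : ℝ, 0 ≤ C ∧ ∀ h, 0 < h →
    volume.real (boundaryLayer Ω h) ≤ C * h := by
  have hbd : Bornology.IsBounded (closure Ω) := by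
    refine ((isCompact_univ_pi fun _ : Fin d => isCompact_Icc (a := (0 : ℝ)) (b := ℓ)).isBounded).subset
      (hΩ.closure_subset.trans (pi_mono fun _ _ => Ioo_subset_Icc_self))
  have hfc : IsCompact (frontier Ω) :=
    (hbd.isCompact_closure).of_isClosed_subset isClosed_frontier
      (frontier_subset_closure.trans subset_closure)
  have hfin : volume Ω ≠ ⊤ := (hbd.subset subset_closure).measure_lt_top.ne
  obtain ⟨r, C, hr, hC, H⟩ : ∃ r C : ℝ, 0 < r ∧ 0 ≤ C ∧ ∀ h, 0 < h → h ≤ r →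
      volume {z ∈ boundaryLayer Ω h | ∃ w ∈ frontier Ω, dist w z ≤ h} ≤ ENNReal.ofReal (C * h) := by
    -- Compactness of the boundary glues finitely many local estimates; the threshold `r` shrinks to
    -- the minimum and the constants add.
    refine hfc.induction_on (p := fun s => ∃ r C : ℝ, 0 < r ∧ 0 ≤ C ∧ ∀ h, 0 < h → h ≤ r →
      volume {z ∈ boundaryLayer Ω h | ∃ w ∈ s, dist w z ≤ h} ≤ ENNReal.ofReal (C * h)) ?_ ?_ ?_ ?_
    · exact ⟨1, 0, one_pos, le_rfl, fun h _ _ => by simp⟩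
    · rintro s t hst ⟨r, C, hr, hC, H⟩
      refine ⟨r, C, hr, hC, fun h h0 h1 => (measure_mono ?_).trans (H h h0 h1)⟩
      rintro z ⟨hz, w, hw, hwz⟩
      exact ⟨hz, w, hst hw, hwz⟩
    · rintro s t ⟨r, C, hr, hC, H⟩ ⟨r', C', hr', hC', H'⟩
      refine ⟨min r r', C + C', lt_min hr hr', add_nonneg hC hC', fun h h0 h1 => ?_⟩
      rw [add_mul, ENNReal.ofReal_add (by positivity) (by positivity)]
      refine (measure_mono ?_).trans ((measure_union_le _ _).trans
        (add_le_add (H h h0 (h1.trans (min_le_left _ _))) (H' h h0 (h1.trans (min_le_right _ _)))))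
      rintro z ⟨hz, w, hw | hw, hwz⟩
      · exact Or.inl ⟨hz, w, hw, hwz⟩
      · exact Or.inr ⟨hz, w, hw, hwz⟩
    · intro x hx
      obtain ⟨U, hU, g, hg, hgx, hgU⟩ := hΩ.smooth_boundary x hx
      obtain ⟨r, C, hr, hC, H⟩ := volume_sublevel_layer_le hg hgx hU hgU
      refine ⟨Metric.ball x (r / 2), mem_nhdsWithin_of_mem_nhds (Metric.ball_mem_nhds x (by positivity)),
        r / 2, C, by positivity, hC, fun h h0 h1 => (measure_mono ?_).trans (H h h0 (by linarith))⟩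
      rintro z ⟨hz, w, hw, hwz⟩
      refine ⟨hz, ?_⟩
      rw [Metric.mem_ball] at hw ⊢
      have := dist_triangle_left z x w
      linarith
  refine ⟨C + volume.real Ω / r, by positivity, fun h hh => ?_⟩
  have hq : 0 ≤ volume.real Ω / r := by positivity
  -- For `h > r` the whole volume of `Ω` is at most a constant times `h`.
  rcases le_or_gt h r with h1 | h1
  · have h2 : boundaryLayer Ω h ⊆ {z ∈ boundaryLayer Ω h | ∃ w ∈ frontier Ω, dist w z ≤ h} := by
      intro z hz
      obtain ⟨hz1, y, hy, hyz⟩ := id hz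
      obtain ⟨w, hw, hwz⟩ := exists_mem_frontier hΩ.isOpen hz1 hy
      exact ⟨hz, w, hw, hwz.trans hyz⟩
    have h3 := ENNReal.toReal_mono ENNReal.ofReal_ne_top ((measure_mono h2).trans (H h hh h1))
    rw [ENNReal.toReal_ofReal (by positivity)] at h3
    rw [add_mul]
    exact h3.trans (le_add_of_nonneg_right (by positivity))
  · have h2 : volume.real (boundaryLayer Ω h) ≤ volume.real Ω :=
      measureReal_mono (fun z hz => hz.1) hfin
    have h3 : volume.real Ω ≤ volume.real Ω / r * h := by
      rw [div_mul_eq_mul_div, le_div_iff₀ hr]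
      exact mul_le_mul_of_nonneg_left h1.le measureReal_nonneg
    rw [add_mul]
    have : 0 ≤ C * h := by positivity
    linarith

end BoundaryLayer

end FV

namespace FV

/-! ### Spatial consistency of convection, pressure and viscosity. -/

section MomentumSpace

set_option linter.unusedSectionVars false

variable {d M : ℕ} [NeZero M] {ℓ h B α : ℝ} {Φ : Fin d → Space d → ℝ}
  {G : Fin d → Fin d → Space d → ℝ}

lemma integral_pwc_mul_of_bounded (hh : 0 < h) (hM : (M : ℝ) * h = ℓ) (q : Cell d M → ℝ)
    {f : Space d → ℝ} (hf : Measurable f) (hb : ∀ x, |f x| ≤ B) :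
    ∫ x in cube d ℓ, pwc h q x * f x = ∑ K, q K * ∫ x in cellSet h K, f x :=
  integral_pwc_mul hh hM q
    (Measure.integrableOn_of_bounded (volume_cube_lt_top ℓ).ne hf.aestronglyMeasurable
      (Filter.Eventually.of_forall fun x => hb x))

lemma SpaceReg.abs_faceDiff_avg_sub_le {i : Fin d} {Φ G : Space d → ℝ} (R : SpaceReg ℓ h B i Φ G)
    (L : LipReg h B i G) (hh : 0 < h) (hB : 0 ≤ B) (hM : (M : ℝ) * h = ℓ) (K : Cell d M) :
    |(faceDiff h i Φ K + faceDiff h i Φ (prv i K)) / 2 - ∫ x in cellSet h K, G x|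
      ≤ 2 * B * h * h ^ d := by
  have h1 := R.abs_faceDiff_sub_le L hh hB hM K
  have h2 := R.abs_faceDiff_sub_prv_le L hh hM K
  have h3 : 0 ≤ B * h * h ^ d := by positivity
  rw [abs_le] at *
  constructor <;> linarith [h1.1, h1.2, h2.1, h2.2]

/-- Consistency of the convective flux of the momentum equation at a fixed time. -/
lemma abs_sum_momentum_flux_sub_le (hh : 0 < h) (hh1 : h ≤ 1) (hM : (M : ℝ) * h = ℓ) (hB : 0 ≤ B)
    (R : ∀ j i, SpaceReg ℓ h B i (Φ j) (G j i)) (L : ∀ j i, LipReg h B i (G j i))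
    (r : Cell d M → ℝ) (u : Cell d M → Fin d → ℝ) :
    |(∑ j, ∑ i, ∑ K, flux h α (fun L => r L * u L j) u i K * faceDiff h i (Φ j) K)
        - ∑ j, ∑ i, ∫ x in cube d ℓ, pwc h (fun L => r L * u L j * u L i) x * G j i x|
      ≤ 3 * B * momentumRes h α r u := by
  rw [← Finset.sum_sub_distrib, momentumRes, Finset.mul_sum]
  refine (Finset.abs_sum_le_sum_abs _ _).trans (Finset.sum_le_sum fun j _ => ?_)
  rw [← Finset.sum_sub_distrib, faceSum, Finset.mul_sum]
  refine (Finset.abs_sum_le_sum_abs _ _).trans (Finset.sum_le_sum fun i _ => ?_)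
  set m : Cell d M → ℝ := fun L => r L * u L j with hm
  set D := faceDiff (M := M) h i (Φ j) with hD
  have h1 := abs_sum_flux_mul_sub_prv_le (α := α) hh hh1 m u i
    (fun K => (R j i).abs_faceDiff_le hh hM K)
    (fun K => (R j i).abs_faceDiff_sub_prv_le (L j i) hh hM K)
  rw [integral_pwc_mul_of_bounded hh hM _ (R j i).meas (R j i).bound_deriv]
  have h2 : |∑ K, m K * u K i * ((D K + D (prv i K)) / 2)
      - ∑ K, m K * u K i * ∫ x in cellSet h K, G j i x|
      ≤ 2 * B * ∑ K, h ^ d * (|m K| * (h * |u K i| + |jump i (comp u i) K|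
        + |jump i (comp u i) (prv i K)| + h ^ (1 + α))) := by
    rw [← Finset.sum_sub_distrib, Finset.mul_sum]
    refine (Finset.abs_sum_le_sum_abs _ _).trans (Finset.sum_le_sum fun K _ => ?_)
    rw [← mul_sub, abs_mul, abs_mul]
    have h3 := mul_le_mul_of_nonneg_left
      ((R j i).abs_faceDiff_avg_sub_le (L j i) hh hB hM K)
      (mul_nonneg (abs_nonneg (m K)) (abs_nonneg (u K i)))
    refine h3.trans ?_
    have h4 : 0 ≤ 2 * B * (h ^ d * (|m K| * (|jump i (comp u i) K|
        + |jump i (comp u i) (prv i K)| + h ^ (1 + α)))) := by positivity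
    linarith
  refine (abs_sub_le _ _ _).trans ((add_le_add h1 h2).trans (le_of_eq ?_))
  ring

lemma pow_mul_divh_proj (hh : 0 < h) (K : Cell d M) :
    h ^ d * divh h (fun L j => proj h (Φ j) L) K
      = ∑ i, (faceDiff h i (Φ i) K + faceDiff h i (Φ i) (prv i K)) / 2 := by
  rw [divh, Finset.sum_div, Finset.mul_sum]
  refine Finset.sum_congr rfl fun i _ => ?_
  simp only [faceDiff, avg, jump, comp, nxt_prv]
  field_simp
  ring

/-- Consistency of the discrete divergence of the projected test function. -/
lemma abs_sum_divh_sub_le (hh : 0 < h) (hM : (M : ℝ) * h = ℓ) (hB : 0 ≤ B)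
    (R : ∀ j i, SpaceReg ℓ h B i (Φ j) (G j i)) (L : ∀ j i, LipReg h B i (G j i))
    (q : Cell d M → ℝ) :
    |(∑ K, h ^ d * (q K * divh h (fun L j => proj h (Φ j) L) K))
        - ∑ i, ∫ x in cube d ℓ, pwc h q x * G i i x|
      ≤ 2 * d * B * h * ∑ K, h ^ d * |q K| := by
  have e1 : ∑ i, ∫ x in cube d ℓ, pwc h q x * G i i x
      = ∑ K, ∑ i, q K * ∫ x in cellSet h K, G i i x := by
    rw [Finset.sum_comm]
    exact Finset.sum_congr rfl fun i _ =>
      integral_pwc_mul_of_bounded hh hM _ (R i i).meas (R i i).bound_deriv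
  rw [e1, ← Finset.sum_sub_distrib, Finset.mul_sum]
  refine (Finset.abs_sum_le_sum_abs _ _).trans (Finset.sum_le_sum fun K _ => ?_)
  rw [mul_left_comm, pow_mul_divh_proj hh, Finset.mul_sum, ← Finset.sum_sub_distrib]
  refine (Finset.abs_sum_le_sum_abs _ _).trans ?_
  have h1 : ∀ i ∈ Finset.univ, |q K * ((faceDiff h i (Φ i) K + faceDiff h i (Φ i) (prv i K)) / 2)
      - q K * ∫ x in cellSet h K, G i i x| ≤ |q K| * (2 * B * h * h ^ d) := fun i _ => by
    rw [← mul_sub, abs_mul]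
    exact mul_le_mul_of_nonneg_left ((R i i).abs_faceDiff_avg_sub_le (L i i) hh hB hM K)
      (abs_nonneg _)
  refine (Finset.sum_le_sum h1).trans (le_of_eq ?_)
  simp only [Finset.sum_const, Finset.card_univ, Fintype.card_fin, nsmul_eq_mul]
  ring

/-- The `L¹` norm of the discrete gradient. -/
noncomputable def gradAbs (h : ℝ) (u : Cell d M → Fin d → ℝ) : ℝ :=
  ∑ j, ∑ i, ∑ K, h ^ d * |jump i (comp u j) K / h|

/-- Consistency of the discrete viscous term at a fixed time. -/
lemma abs_sum_grad_sub_le (hh : 0 < h) (hM : (M : ℝ) * h = ℓ) (hB : 0 ≤ B)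
    (R : ∀ j i, SpaceReg ℓ h B i (Φ j) (G j i)) (L : ∀ j i, LipReg h B i (G j i))
    (u : Cell d M → Fin d → ℝ) :
    |(∑ j, ∑ i, ∑ K, jump i (comp u j) K / h * faceDiff h i (Φ j) K)
        - ∑ j, ∑ i, ∫ x in cube d ℓ, pwc h (fun K => jump i (comp u j) K / h) x
            * G j i (x + (Pi.single i (h / 2) : Space d))|
      ≤ 2 * B * h * gradAbs h u := by
  rw [← Finset.sum_sub_distrib, gradAbs, Finset.mul_sum]
  refine (Finset.abs_sum_le_sum_abs _ _).trans (Finset.sum_le_sum fun j _ => ?_)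
  rw [← Finset.sum_sub_distrib, Finset.mul_sum]
  refine (Finset.abs_sum_le_sum_abs _ _).trans (Finset.sum_le_sum fun i _ => ?_)
  rw [integral_pwc_mul_of_bounded hh hM _
    (f := fun x : Space d => G j i (x + (Pi.single i (h / 2) : Space d)))
    ((R j i).meas.comp (by fun_prop)) fun x => (R j i).bound_deriv _, ← Finset.sum_sub_distrib, Finset.mul_sum]
  refine (Finset.abs_sum_le_sum_abs _ _).trans (Finset.sum_le_sum fun K _ => ?_)
  rw [← mul_sub, abs_mul]
  refine (mul_le_mul_of_nonneg_left ((R j i).abs_faceDiff_sub_half_le (L j i) hh hB hM K)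
    (abs_nonneg _)).trans (le_of_eq ?_)
  ring

lemma mul_abs_le_one_add_sq (s x : ℝ) : s * |x| ≤ 1 + s ^ 2 * x ^ 2 := by
  rw [← sq_abs x]
  nlinarith [sq_nonneg (s * |x| - 1 / 2)]

/-- The free weight `s` is later `1` for sums over all steps and `√Δt` for a single step, where only
`Δt` times the squared gradient is bounded. -/
lemma mul_gradAbs_le (hh : 0 ≤ h) (hM : (M : ℝ) * h = ℓ) (s : ℝ) (u : Cell d M → Fin d → ℝ) :
    s * gradAbs h u ≤ d * (d * ℓ ^ d) + s ^ 2 * gradSum h u := by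
  have e1 : gradSum h u = ∑ j, ∑ i, ∑ K, h ^ d * (jump i (comp u j) K / h) ^ 2 := by
    rw [gradSum, eq_comm, Finset.sum_comm]
    refine Finset.sum_congr rfl fun i _ => ?_
    rw [Finset.sum_comm]
    simp only [Finset.mul_sum]
  have e2 : (d : ℝ) * (d * ℓ ^ d) = ∑ _j : Fin d, ∑ _i : Fin d, ∑ _K : Cell d M, h ^ d := by
    simp only [sum_cells_const hM]; simp
  rw [e1, e2, gradAbs]
  simp only [Finset.mul_sum, ← Finset.sum_add_distrib]
  refine Finset.sum_le_sum fun j _ => Finset.sum_le_sum fun i _ => Finset.sum_le_sum fun K _ => ?_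
  have := mul_le_mul_of_nonneg_left (mul_abs_le_one_add_sq s (jump i (comp u j) K / h))
    (by positivity : 0 ≤ h ^ d)
  linarith

lemma mul_sum_abs_divh_le (hh : 0 < h) (hM : (M : ℝ) * h = ℓ) (s : ℝ) (u : Cell d M → Fin d → ℝ) :
    s * ∑ K, h ^ d * |divh h u K| ≤ ℓ ^ d + s ^ 2 * (d * gradSum h u) := by
  have h1 : s * ∑ K, h ^ d * |divh h u K| ≤ ℓ ^ d + s ^ 2 * ∑ K, h ^ d * divh h u K ^ 2 := by
    rw [← sum_cells_const (d := d) hM]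
    simp only [Finset.mul_sum, ← Finset.sum_add_distrib]
    refine Finset.sum_le_sum fun K _ => ?_
    have := mul_le_mul_of_nonneg_left (mul_abs_le_one_add_sq s (divh h u K))
      (by positivity : 0 ≤ h ^ d)
    linarith
  have h2 := mul_le_mul_of_nonneg_left (sum_divh_sq_le hh u) (sq_nonneg s)
  linarith

end MomentumSpace

/-! ### The penalty term and the cut cells. -/

section Penalty

set_option linter.unusedSectionVars false

variable {d M : ℕ} [NeZero M] {ℓ h B : ℝ} {Ω : Set (Space d)} {Φ : Fin d → Space d → ℝ}

open Classical in
/-- The indicator of the cells that are not contained in `Ω`. -/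
noncomputable def solidInd (Ω : Set (Space d)) (h : ℝ) (K : Cell d M) : ℝ :=
  if cellSet h K ⊆ Ω then 0 else 1

lemma solidInd_nonneg (K : Cell d M) : 0 ≤ solidInd Ω h K := by
  rw [solidInd]; split_ifs <;> norm_num

lemma solidInd_le_one (K : Cell d M) : solidInd Ω h K ≤ 1 := by
  rw [solidInd]; split_ifs <;> norm_num

lemma solidSum_eq (u : Cell d M → Fin d → ℝ) :
    solidSum Ω h u = ∑ K, solidInd Ω h K * (h ^ d * ∑ j, u K j ^ 2) := by
  rw [solidSum]
  refine Finset.sum_congr rfl fun K _ => ?_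
  rw [solidInd]
  split_ifs <;> simp

/-- The cut cells fill at most the boundary layer. -/
lemma sum_solidInd_mul_volume_le (hh : 0 < h) (hM : (M : ℝ) * h = ℓ) (hΩ : IsFluidDomain ℓ Ω) :
    ∑ K : Cell d M, solidInd Ω h K * volume.real (cellSet h K ∩ Ω)
      ≤ volume.real (boundaryLayer Ω h) := by
  have hΩc : Ω ⊆ cube d ℓ := subset_closure.trans
    (hΩ.closure_subset.trans (pi_mono fun _ _ => Ioo_subset_Ico_self))
  have hfin : volume Ω ≠ ⊤ := ((measure_mono hΩc).trans_lt (volume_cube_lt_top ℓ)).ne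
  have hm := hΩ.isOpen.measurableSet
  have h1 := integral_pwc_mul_of_bounded (B := 1) hh hM (solidInd (M := M) Ω h)
    (f := Ω.indicator 1) (measurable_one.indicator hm) fun x => by
      simpa using norm_indicator_le_norm_self (s := Ω) (1 : Space d → ℝ) x
  have h2 : ∀ K : Cell d M, ∫ x in cellSet h K, Ω.indicator (1 : Space d → ℝ) x
      = volume.real (cellSet h K ∩ Ω) := fun K => by
    rw [integral_indicator_one hm, measureReal_restrict_apply hm, inter_comm]
  simp only [h2] at h1
  rw [← h1]
  set S : Set (Space d) := Ω ∩ (pwc h (solidInd (M := M) Ω h)) ⁻¹' {1} with hS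
  have hSm : MeasurableSet S := hm.inter (measurable_pwc h _ (measurableSet_singleton 1))
  have h3 : ∀ x, pwc h (solidInd (M := M) Ω h) x * Ω.indicator 1 x = S.indicator 1 x := by
    intro x
    by_cases hx : x ∈ Ω
    · by_cases hc : cellSet h (cellAt h x : Cell d M) ⊆ Ω
      · have : x ∉ S := fun hxs => by
          have := hxs.2
          simp [pwc, solidInd, hc] at this
        simp [pwc, solidInd, hc, this]
      · have : x ∈ S := ⟨hx, by simp [pwc, solidInd, hc]⟩
        simp [pwc, solidInd, hc, this, hx]
    · have : x ∉ S := fun hxs => hx hxs.1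
      simp [hx, this]
  simp only [h3]
  rw [integral_indicator_one hSm, measureReal_restrict_apply hSm]
  refine measureReal_mono ?_ (measure_ne_top_of_subset (fun z hz => hz.1) hfin)
  rintro x ⟨⟨hx, hs⟩, hxc⟩
  have hc : ¬ cellSet h (cellAt h x : Cell d M) ⊆ Ω := fun hc => by
    simp [pwc, solidInd, hc] at hs
  obtain ⟨y, hy, hyΩ⟩ := not_subset.mp hc
  -- A penalized cell contains a point outside `Ω`, and in the maximum norm two points of a cell are
  -- at most `h` apart.
  refine ⟨hx, y, hyΩ, (dist_pi_le_iff hh.le).mpr fun i => ?_⟩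
  have h4 := mem_cellBox_cellAt (M := M) hh hM hxc i (mem_univ i)
  have h5 := hy i
  rw [Real.dist_eq, abs_le]
  constructor <;> linarith [h4.1, h4.2, h5.1, h5.2]

/-- Cells inside `Ω` contribute to neither term, and solid points are treated alike by both. What
differs is the part of each penalized cell that lies in the fluid. -/
lemma abs_sum_penalty_sub_le (hh : 0 < h) (hM : (M : ℝ) * h = ℓ) (hΩ : IsFluidDomain ℓ Ω)
    (hΦ : ∀ j, Continuous (Φ j)) (hb : ∀ j x, |Φ j x| ≤ B) (u : Cell d M → Fin d → ℝ) :
    |(∑ K, solidInd Ω h K * (h ^ d * ∑ j, u K j * proj h (Φ j) K))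
        - ∑ j, ∫ x in cube d ℓ, pwc h (comp u j) x * Ωᶜ.indicator (Φ j) x|
      ≤ B * ∑ K, ∑ j, |u K j| * (solidInd Ω h K * volume.real (cellSet h K ∩ Ω)) := by
  have hm := hΩ.isOpen.measurableSet
  have hB : ∀ j x, |Ωᶜ.indicator (Φ j) x| ≤ B := fun j x =>
    (norm_indicator_le_norm_self (Φ j) x).trans (hb j x)
  have e1 : ∑ j, ∫ x in cube d ℓ, pwc h (comp u j) x * Ωᶜ.indicator (Φ j) x
      = ∑ K, ∑ j, u K j * ∫ x in cellSet h K, Ωᶜ.indicator (Φ j) x := by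
    rw [Finset.sum_comm]
    exact Finset.sum_congr rfl fun j _ => integral_pwc_mul_of_bounded hh hM _
      ((hΦ j).measurable.indicator hm.compl) (hB j)
  rw [e1, ← Finset.sum_sub_distrib, Finset.mul_sum]
  refine (Finset.abs_sum_le_sum_abs _ _).trans (Finset.sum_le_sum fun K _ => ?_)
  have e2 : solidInd Ω h K * (h ^ d * ∑ j, u K j * proj h (Φ j) K)
      = ∑ j, u K j * (solidInd Ω h K * ∫ x in cellSet h K, Φ j x) := by
    simp only [← pow_mul_proj hh, Finset.mul_sum]
    exact Finset.sum_congr rfl fun j _ => by ring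
  rw [e2, ← Finset.sum_sub_distrib, Finset.mul_sum]
  refine (Finset.abs_sum_le_sum_abs _ _).trans (Finset.sum_le_sum fun j _ => ?_)
  rw [← mul_sub, abs_mul, mul_left_comm]
  refine mul_le_mul_of_nonneg_left ?_ (abs_nonneg _)
  have hi : IntegrableOn (Φ j) (cellSet h K) :=
    (hΦ j).continuousOn.integrableOn_compact (isCompact_cellSet h K)
  by_cases hc : cellSet h K ⊆ Ω
  · have h0 : ∫ x in cellSet h K, Ωᶜ.indicator (Φ j) x = 0 := by
      refine setIntegral_eq_zero_of_forall_eq_zero fun x hx => ?_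
      rw [indicator_of_notMem]
      exact fun hx' => hx' (hc hx)
    simp [solidInd, hc, h0]
  · have h0 : (∫ x in cellSet h K, Φ j x) - ∫ x in cellSet h K, Ωᶜ.indicator (Φ j) x
        = ∫ x in cellSet h K ∩ Ω, Φ j x := by
      rw [← integral_sub hi (hi.indicator hm.compl), ← setIntegral_indicator hm]
      congr 1
      funext x
      by_cases hx : x ∈ Ω <;> simp [hx]
    simp only [solidInd, hc, if_false, one_mul]
    rw [h0]
    exact abs_setIntegral_le (measure_ne_top_of_subset inter_subset_left
      (isCompact_cellSet h K).measure_ne_top) fun x => hb j x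

/-- Weighted bound of the velocity in the boundary layer. -/
lemma mul_sum_layer_le (hh : 0 < h) (hM : (M : ℝ) * h = ℓ) (hΩ : IsFluidDomain ℓ Ω) (s : ℝ)
    (u : Cell d M → Fin d → ℝ) :
    s * ∑ K, ∑ j, |u K j| * (solidInd Ω h K * volume.real (cellSet h K ∩ Ω))
      ≤ d * volume.real (boundaryLayer Ω h) + s ^ 2 * solidSum Ω h u := by
  refine le_trans ?_ (add_le_add_left (mul_le_mul_of_nonneg_left
    (sum_solidInd_mul_volume_le (M := M) hh hM hΩ) (Nat.cast_nonneg d)) _)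
  rw [solidSum_eq, Finset.mul_sum, Finset.mul_sum, Finset.mul_sum, ← Finset.sum_add_distrib]
  refine Finset.sum_le_sum fun K _ => ?_
  have e : (d : ℝ) * (solidInd Ω h K * volume.real (cellSet h K ∩ Ω))
      = ∑ _j : Fin d, solidInd Ω h K * volume.real (cellSet h K ∩ Ω) := by simp
  rw [e]
  simp only [Finset.mul_sum]
  rw [← Finset.sum_add_distrib]
  refine Finset.sum_le_sum fun j _ => ?_
  set w := volume.real (cellSet h K ∩ Ω) with hw
  have hw0 : 0 ≤ w := measureReal_nonneg
  have hw1 : w ≤ h ^ d := by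
    rw [← measureReal_cellSet hh K]
    exact measureReal_mono inter_subset_left (isCompact_cellSet h K).measure_ne_top
  have h0 := solidInd_nonneg (Ω := Ω) (h := h) K
  have h1 := mul_le_mul_of_nonneg_right (mul_abs_le_one_add_sq s (u K j)) (mul_nonneg h0 hw0)
  have h2 := mul_le_mul_of_nonneg_left hw1 (by positivity : 0 ≤ s ^ 2 * u K j ^ 2 * solidInd Ω h K)
  linarith

lemma abs_sum_penalty_le (hh : 0 < h) (hM : (M : ℝ) * h = ℓ) (hΩ : IsOpen Ω)
    (hΦ : ∀ j, Measurable (Φ j)) (hb : ∀ j x, |Φ j x| ≤ B) (u : Cell d M → Fin d → ℝ) :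
    |∑ j, ∫ x in cube d ℓ, pwc h (comp u j) x * Ωᶜ.indicator (Φ j) x|
      ≤ B * ∑ K, ∑ j, |u K j| * (solidInd Ω h K * h ^ d) := by
  have hm := hΩ.measurableSet
  have hB : ∀ j x, |Ωᶜ.indicator (Φ j) x| ≤ B := fun j x =>
    (norm_indicator_le_norm_self (Φ j) x).trans (hb j x)
  have e1 : ∑ j, ∫ x in cube d ℓ, pwc h (comp u j) x * Ωᶜ.indicator (Φ j) x
      = ∑ K, ∑ j, u K j * ∫ x in cellSet h K, Ωᶜ.indicator (Φ j) x := by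
    rw [Finset.sum_comm]
    exact Finset.sum_congr rfl fun j _ => integral_pwc_mul_of_bounded hh hM _
      ((hΦ j).indicator hm.compl) (hB j)
  rw [e1, Finset.mul_sum]
  refine (Finset.abs_sum_le_sum_abs _ _).trans (Finset.sum_le_sum fun K _ => ?_)
  rw [Finset.mul_sum]
  refine (Finset.abs_sum_le_sum_abs _ _).trans (Finset.sum_le_sum fun j _ => ?_)
  rw [abs_mul, mul_left_comm]
  refine mul_le_mul_of_nonneg_left ?_ (abs_nonneg _)
  by_cases hc : cellSet h K ⊆ Ω
  · have h0 : ∫ x in cellSet h K, Ωᶜ.indicator (Φ j) x = 0 := by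
      refine setIntegral_eq_zero_of_forall_eq_zero fun x hx => ?_
      rw [indicator_of_notMem]
      exact fun hx' => hx' (hc hx)
    simp [solidInd, hc, h0]
  · simp only [solidInd, hc, if_false, one_mul]
    rw [← measureReal_cellSet hh K]
    exact abs_setIntegral_le (isCompact_cellSet h K).measure_ne_top fun x => hB j x

lemma mul_sum_solid_abs_le (hh : 0 < h) (hM : (M : ℝ) * h = ℓ) (s : ℝ)
    (u : Cell d M → Fin d → ℝ) :
    s * ∑ K, ∑ j, |u K j| * (solidInd Ω h K * h ^ d)
      ≤ d * ℓ ^ d + s ^ 2 * solidSum Ω h u := by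
  have e : (d : ℝ) * ℓ ^ d = ∑ _K : Cell d M, ∑ _j : Fin d, h ^ d := by
    simp only [← sum_cells_const (d := d) hM]
    simp only [Finset.sum_const, Finset.card_univ, Fintype.card_fin, nsmul_eq_mul]
    ring
  rw [e, solidSum_eq]
  simp only [Finset.mul_sum]
  rw [← Finset.sum_add_distrib]
  refine Finset.sum_le_sum fun K _ => ?_
  rw [← Finset.sum_add_distrib]
  refine Finset.sum_le_sum fun j _ => ?_
  have h0 := solidInd_nonneg (Ω := Ω) (h := h) K
  have h1 := mul_le_mul_of_nonneg_right (mul_abs_le_one_add_sq s (u K j))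
    (mul_nonneg h0 (by positivity : 0 ≤ h ^ d))
  have h2 := mul_le_mul_of_nonneg_right (solidInd_le_one (Ω := Ω) (h := h) K)
    (by positivity : 0 ≤ h ^ d)
  linarith

end Penalty

end FV

namespace FV

/-! ### Vector test functions. -/

section VecTest

variable {d : ℕ} {ℓ T B : ℝ}

/-- Componentwise normalized representatives of a vector test function. -/
structure VecNormalTest (ℓ T B : ℝ) (φ φt : ℝ → Space d → Fin d → ℝ)
    (φx : Fin d → ℝ → Space d → Fin d → ℝ) (F Gt : Fin d → ℝ × Space d → ℝ)
    (Gx : Fin d → Fin d → ℝ × Space d → ℝ) : Prop where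
  test : ∀ j, NormalTest ℓ T B (F j) (Gt j) (Gx j)
  eq : ∀ j, ∀ t ∈ Icc 0 T, ∀ x, F j (t, x) = φ t x j
  eq_t : ∀ j, ∀ᵐ z : ℝ × Space d, z ∈ strip d T → Gt j z = φt z.1 z.2 j
  eq_x : ∀ j i, ∀ᵐ z : ℝ × Space d, z ∈ strip d T → Gx j i z = φx i z.1 z.2 j
  lip : ∀ j i r, 0 ≤ r → ∀ᵐ z : ℝ × Space d, z ∈ strip d T →
    |Gx j i (z + (0, (Pi.single i r : Space d))) - Gx j i z| ≤ B * r

/-- Only the pure second derivatives are used: each difference of the test function is taken in the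
direction in which it was differentiated. -/
lemma IsVecTestFun.exists_vecNormalTest (hT : 0 < T) {φ φt : ℝ → Space d → Fin d → ℝ}
    {φx : Fin d → ℝ → Space d → Fin d → ℝ} (H : IsVecTestFun ℓ T B φ φt φx) :
    ∃ F Gt Gx, VecNormalTest ℓ T B φ φt φx F Gt Gx := by
  choose F Gt Gx hn hF hGt hGx using fun j => (H.comp j).exists_normalTest hT
  refine ⟨F, Gt, Gx, hn, hF, hGt, hGx, fun j i r hr => ?_⟩
  obtain ⟨g, hg⟩ := H.dxx j i i
  obtain ⟨G, hGm, hGb, -, hGw⟩ := hg.exists_normalized ((H.comp j).nonneg hT)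
  have h1 := (hGw (Gx j i) (hGx j i)).abs_sub_le (isOpen_strip d T) (convex_strip d T)
    ((hn j).meas_x i) ((hn j).bound_x i) hGm hGb hr
  have hsm : r • ((0 : ℝ), (Pi.single i 1 : Space d)) = (0, Pi.single i r) := by
    rw [Prod.smul_mk, smul_zero, ← Pi.single_smul]; simp
  filter_upwards [h1] with z hz hzs
  rw [hsm] at hz
  exact hz hzs (mem_strip.mpr (by simpa using mem_strip.mp hzs))

end VecTest

lemma intervalIntegrable_of_level {T Δt τ : ℝ} {N : ℕ} (ht : 0 < Δt) (hN : (N : ℝ) * Δt = T)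
    (hτ : τ ∈ Icc 0 T) {g : ℝ → ℝ} {W : ℕ → ℝ → ℝ}
    (hW : ∀ k < N, ∀ s t, IntervalIntegrable (W k) volume s t)
    (hg : ∀ k < N, ∀ᵐ t : ℝ, t ∈ Ioo (k * Δt) ((k + 1 : ℕ) * Δt) → g t = W k t) :
    IntervalIntegrable g volume 0 τ := by
  have h1 := IntervalIntegrable.trans_iterate (f := g) (μ := volume) (a := fun k : ℕ => (k : ℝ) * Δt)
    (n := N) fun k hk => (intervalIntegrable_of_steps ht (fun k hk => hW k hk _ _) hg k hk).1
  simp only [Nat.cast_zero, zero_mul, hN] at h1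
  refine h1.mono_set ?_
  rw [uIcc_of_le hτ.1, uIcc_of_le (hτ.1.trans hτ.2)]
  exact Icc_subset_Icc_right hτ.2

/-! ### The momentum balance at a fixed time. -/

section MomentumTime

set_option linter.unusedSectionVars false

variable {d M : ℕ} [NeZero M] {ℓ T B γ α a μ lam Δt h ε E : ℝ} {N : ℕ} {Ω : Set (Space d)}

/-- The scheme tested with projections, written with cell and face integrals. -/
lemma IsFVSolution.momentum_proj (hh : 0 < h) (hd : d ≠ 0)
    {ρ₀ : Space d → ℝ} {m₀ : Space d → Fin d → ℝ} {ρ : ℕ → Cell d M → ℝ}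
    {u : ℕ → Cell d M → Fin d → ℝ} (S : IsFVSolution Ω a γ μ lam α ρ₀ m₀ N Δt h ε ρ u)
    {k : ℕ} (hk : k < N) (Φ : Fin d → Space d → ℝ) :
    (∑ K, ∑ j, (ρ (k + 1) K * u (k + 1) K j - ρ k K * u k K j) * ∫ x in cellSet h K, Φ j x) / Δt
      = (∑ j, ∑ i, ∑ K, flux h α (fun L => ρ (k + 1) L * u (k + 1) L j) (u (k + 1)) i K
          * faceDiff h i (Φ j) K)
        + (∑ K, h ^ d * (pressure a γ (ρ (k + 1) K) * divh h (fun L j => proj h (Φ j) L) K))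
        - 1 / ε * (∑ K, solidInd Ω h K * (h ^ d * ∑ j, u (k + 1) K j * proj h (Φ j) K))
        - μ * (∑ j, ∑ i, ∑ K, jump i (comp (u (k + 1)) j) K / h * faceDiff h i (Φ j) K)
        - nu d μ lam * ∑ K, h ^ d * (divh h (u (k + 1)) K * divh h (fun L j => proj h (Φ j) L) K) := by
  have h0 := S.momentum k hk fun L j => proj h (Φ j) L
  have e1 : ∑ K, h ^ d * ∑ j, (ρ (k + 1) K * u (k + 1) K j - ρ k K * u k K j) / Δt
      * proj h (Φ j) K
      = (∑ K, ∑ j, (ρ (k + 1) K * u (k + 1) K j - ρ k K * u k K j)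
        * ∫ x in cellSet h K, Φ j x) / Δt := by
    simp only [← pow_mul_proj hh, Finset.sum_div, Finset.mul_sum]
    exact Finset.sum_congr rfl fun K _ => Finset.sum_congr rfl fun j _ => by ring
  have e2 : ∑ i, ∑ K, h ^ (d - 1) * ∑ j, flux h α (fun L => ρ (k + 1) L * u (k + 1) L j)
        (u (k + 1)) i K * jump i (comp (fun L j => proj h (Φ j) L) j) K
      = ∑ j, ∑ i, ∑ K, flux h α (fun L => ρ (k + 1) L * u (k + 1) L j) (u (k + 1)) i K
          * faceDiff h i (Φ j) K := by
    rw [eq_comm, Finset.sum_comm]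
    refine Finset.sum_congr rfl fun i _ => ?_
    rw [Finset.sum_comm]
    simp only [Finset.mul_sum, ← pow_pred_mul_jump hh hd]
    rfl
  have e3 : ∑ i, ∑ K, h ^ d * ∑ j, (jump i (comp (u (k + 1)) j) K / h)
        * (jump i (comp (fun L j => proj h (Φ j) L) j) K / h)
      = ∑ j, ∑ i, ∑ K, jump i (comp (u (k + 1)) j) K / h * faceDiff h i (Φ j) K := by
    rw [eq_comm, Finset.sum_comm]
    refine Finset.sum_congr rfl fun i _ => ?_
    rw [Finset.sum_comm]
    simp only [Finset.mul_sum, faceDiff]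
    refine Finset.sum_congr rfl fun K _ => Finset.sum_congr rfl fun j _ => ?_
    rw [mul_left_comm]
    rfl
  have e4 : (open Classical in ∑ K, (if cellSet h K ⊆ Ω then 0 else h ^ d * ∑ j, u (k + 1) K j * proj h (Φ j) K))
      = ∑ K, solidInd Ω h K * (h ^ d * ∑ j, u (k + 1) K j * proj h (Φ j) K) := by
    refine Finset.sum_congr rfl fun K _ => ?_
    rw [solidInd]
    split_ifs <;> simp
  rw [e1, e2, e3, e4] at h0
  linarith

/-- Convection and pressure at time `t`, tested with the gradient `Gx`. -/
noncomputable def fluxPair (ℓ a γ h : ℝ) (r : Cell d M → ℝ) (u : Cell d M → Fin d → ℝ)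
    (Gx : Fin d → Fin d → ℝ × Space d → ℝ) (t : ℝ) : ℝ :=
  (∑ j, ∑ i, cubePair ℓ h (fun L => r L * u L j * u L i) (Gx j i) t)
    + ∑ i, cubePair ℓ h (fun L => pressure a γ (r L)) (Gx i i) t

/-- The viscous terms at time `t`, tested with the gradient `Gx`. -/
noncomputable def viscPair (ℓ μ lam h : ℝ) (u : Cell d M → Fin d → ℝ)
    (Gx : Fin d → Fin d → ℝ × Space d → ℝ) (t : ℝ) : ℝ :=
  μ * (∑ j, ∑ i, cubePair ℓ h (fun K => jump i (comp u j) K / h)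
      (fun z => Gx j i (z.1, z.2 + (Pi.single i (h / 2) : Space d))) t)
    + nu d μ lam * ∑ i, cubePair ℓ h (divh h u) (Gx i i) t

/-- The velocity in the solid part at time `t`, tested with `F`. -/
noncomputable def penaltyPair (ℓ h : ℝ) (Ω : Set (Space d)) (u : Cell d M → Fin d → ℝ)
    (F : Fin d → ℝ × Space d → ℝ) (t : ℝ) : ℝ :=
  ∑ j, cubePair ℓ h (comp u j) (fun z => Ωᶜ.indicator (fun x => F j (z.1, x)) z.2) t

/-- The terms of the momentum balance at time `t`, other than the time derivative. -/
noncomputable def momentumPair (ℓ a γ μ lam h ε : ℝ) (Ω : Set (Space d)) (r : Cell d M → ℝ)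
    (u : Cell d M → Fin d → ℝ) (F : Fin d → ℝ × Space d → ℝ)
    (Gx : Fin d → Fin d → ℝ × Space d → ℝ) (t : ℝ) : ℝ :=
  fluxPair ℓ a γ h r u Gx t - viscPair ℓ μ lam h u Gx t - 1 / ε * penaltyPair ℓ h Ω u F t

end MomentumTime

end FV

namespace FV

section MomentumTime

set_option linter.unusedSectionVars false

variable {d M : ℕ} [NeZero M] {ℓ T B γ α a μ lam Δt h ε E : ℝ} {N : ℕ} {Ω : Set (Space d)}

/-- Bound of the spatial consistency error of the momentum equation at a fixed time. -/
noncomputable def momentumErr (B a γ μ lam α h ε : ℝ) (Ω : Set (Space d)) (r : Cell d M → ℝ)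
    (u : Cell d M → Fin d → ℝ) : ℝ :=
  3 * B * momentumRes h α r u + 2 * d * B * h * (∑ K, h ^ d * |pressure a γ (r K)|)
    + μ * (2 * B * h * gradAbs h u) + nu d μ lam * (2 * d * B * h * ∑ K, h ^ d * |divh h u K|)
    + 1 / ε * (B * ∑ K, ∑ j, |u K j| * (solidInd Ω h K * volume.real (cellSet h K ∩ Ω)))

lemma momentumRes_nonneg (hh : 0 ≤ h) (r : Cell d M → ℝ) (u : Cell d M → Fin d → ℝ) :
    0 ≤ momentumRes h α r u :=
  Finset.sum_nonneg fun _ _ => faceSum_nonneg hh fun _ _ => by positivity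

lemma gradAbs_nonneg (hh : 0 ≤ h) (u : Cell d M → Fin d → ℝ) : 0 ≤ gradAbs h u :=
  Finset.sum_nonneg fun _ _ => faceSum_nonneg hh fun _ _ => abs_nonneg _

lemma momentumErr_nonneg (hB : 0 ≤ B) (hμ : 0 ≤ μ) (hν : 0 ≤ nu d μ lam) (hh : 0 ≤ h) (hε : 0 ≤ ε)
    (r : Cell d M → ℝ) (u : Cell d M → Fin d → ℝ) :
    0 ≤ momentumErr B a γ μ lam α h ε Ω r u := by
  have h1 := momentumRes_nonneg (α := α) hh r u
  have h2 := gradAbs_nonneg hh u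
  have h3 : 0 ≤ ∑ K, ∑ j, |u K j| * (solidInd Ω h K * volume.real (cellSet h K ∩ Ω)) :=
    Finset.sum_nonneg fun K _ => Finset.sum_nonneg fun j _ =>
      mul_nonneg (abs_nonneg _) (mul_nonneg (solidInd_nonneg K) measureReal_nonneg)
  rw [momentumErr]
  positivity

/-- The scheme tested with the projected slice expresses the time difference through five discrete
terms; each is compared with its exact counterpart separately. -/
lemma abs_sub_momentumPair_le (hB : 0 ≤ B) (hμ : 0 ≤ μ) (hν : 0 ≤ nu d μ lam) (hh : 0 < h)
    (hh1 : h ≤ 1) (hε : 0 < ε) (hM : (M : ℝ) * h = ℓ) (hd : d ≠ 0) (hΩ : IsFluidDomain ℓ Ω)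
    {ρ₀ : Space d → ℝ} {m₀ : Space d → Fin d → ℝ} {ρ : ℕ → Cell d M → ℝ}
    {u : ℕ → Cell d M → Fin d → ℝ} (S : IsFVSolution Ω a γ μ lam α ρ₀ m₀ N Δt h ε ρ u)
    {k : ℕ} (hk : k < N) {F : Fin d → ℝ × Space d → ℝ} {Gx : Fin d → Fin d → ℝ × Space d → ℝ}
    {t : ℝ} (R : ∀ j i, SpaceReg ℓ h B i (fun x => F j (t, x)) fun x => Gx j i (t, x))
    (L : ∀ j i, LipReg h B i fun x => Gx j i (t, x)) :
    |(∑ K, ∑ j, (ρ (k + 1) K * u (k + 1) K j - ρ k K * u k K j)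
        * ∫ x in cellSet h K, F j (t, x)) / Δt
      - momentumPair ℓ a γ μ lam h ε Ω (ρ (k + 1)) (u (k + 1)) F Gx t|
      ≤ momentumErr B a γ μ lam α h ε Ω (ρ (k + 1)) (u (k + 1)) := by
  have h1 := abs_sum_momentum_flux_sub_le (α := α) hh hh1 hM hB R L (ρ (k + 1)) (u (k + 1))
  have h2 := abs_sum_divh_sub_le hh hM hB R L fun K => pressure a γ (ρ (k + 1) K)
  have h3 := mul_le_mul_of_nonneg_left (abs_sum_grad_sub_le hh hM hB R L (u (k + 1))) hμ
  have h4 := mul_le_mul_of_nonneg_left (abs_sum_divh_sub_le hh hM hB R L (divh h (u (k + 1)))) hν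
  have h5 := mul_le_mul_of_nonneg_left (abs_sum_penalty_sub_le hh hM hΩ
    (fun j => (R j j).cont) (fun j => (R j j).bound) (u (k + 1))) (by positivity : 0 ≤ 1 / ε)
  rw [S.momentum_proj hh hd hk fun j x => F j (t, x)]
  simp only [momentumPair, fluxPair, viscPair, penaltyPair, cubePair, momentumErr]
  have key : ∀ x₁ x₂ x₃ x₄ x₅ y₁ y₂ y₃ y₄ y₅ : ℝ,
      |(x₁ + x₂ - 1 / ε * x₅ - μ * x₃ - nu d μ lam * x₄)
        - (y₁ + y₂ - (μ * y₃ + nu d μ lam * y₄) - 1 / ε * y₅)|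
      ≤ |x₁ - y₁| + |x₂ - y₂| + μ * |x₃ - y₃| + nu d μ lam * |x₄ - y₄| + 1 / ε * |x₅ - y₅| := by
    intro x₁ x₂ x₃ x₄ x₅ y₁ y₂ y₃ y₄ y₅
    have e1 : (x₁ + x₂ - 1 / ε * x₅ - μ * x₃ - nu d μ lam * x₄)
        - (y₁ + y₂ - (μ * y₃ + nu d μ lam * y₄) - 1 / ε * y₅)
        = (x₁ - y₁) + (x₂ - y₂) - μ * (x₃ - y₃) - nu d μ lam * (x₄ - y₄)
          - 1 / ε * (x₅ - y₅) := by ring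
    have e2 : |μ * (x₃ - y₃)| = μ * |x₃ - y₃| := by rw [abs_mul, abs_of_nonneg hμ]
    have e3 : |nu d μ lam * (x₄ - y₄)| = nu d μ lam * |x₄ - y₄| := by
      rw [abs_mul, abs_of_nonneg hν]
    have e4 : |1 / ε * (x₅ - y₅)| = 1 / ε * |x₅ - y₅| := by
      rw [abs_mul, abs_of_nonneg (by positivity : 0 ≤ 1 / ε)]
    rw [e1, ← e2, ← e3, ← e4]
    refine (abs_sub _ _).trans (add_le_add_left ((abs_sub _ _).trans (add_le_add_left
      ((abs_sub _ _).trans (add_le_add_left (abs_add_le _ _) _)) _)) _)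
  refine (key _ _ _ _ _ _ _ _ _ _).trans ?_
  exact add_le_add (add_le_add (add_le_add (add_le_add h1 h2) h3) h4) h5

section Pair

variable {F Gt : Fin d → ℝ × Space d → ℝ} {Gx : Fin d → Fin d → ℝ × Space d → ℝ}

lemma measurable_penalty_test (hΩ : MeasurableSet Ω) {f : ℝ × Space d → ℝ} (hf : Measurable f) :
    Measurable fun z : ℝ × Space d => Ωᶜ.indicator (fun x => f (z.1, x)) z.2 := by
  have e : (fun z : ℝ × Space d => Ωᶜ.indicator (fun x => f (z.1, x)) z.2)
      = (Prod.snd ⁻¹' Ωᶜ).indicator f := by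
    funext z
    by_cases hz : z.2 ∈ Ω <;> simp [hz]
  rw [e]
  exact hf.indicator (measurable_snd hΩ.compl)

lemma abs_penalty_test_le {f : ℝ × Space d → ℝ} (hf : ∀ z, |f z| ≤ B) (z : ℝ × Space d) :
    |Ωᶜ.indicator (fun x => f (z.1, x)) z.2| ≤ B :=
  (norm_indicator_le_norm_self (fun x => f (z.1, x)) z.2).trans (hf _)

lemma intervalIntegrable_fluxPair (hn : ∀ j, NormalTest ℓ T B (F j) (Gt j) (Gx j)) (hh : 0 < h)
    (hM : (M : ℝ) * h = ℓ) (r : Cell d M → ℝ) (u : Cell d M → Fin d → ℝ) (s t : ℝ) :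
    IntervalIntegrable (fluxPair ℓ a γ h r u Gx) volume s t :=
  (intervalIntegrable_fintype_sum fun j => intervalIntegrable_fintype_sum fun i =>
      intervalIntegrable_cubePair hh hM _ ((hn j).meas_x i) ((hn j).bound_x i) s t).add
    (intervalIntegrable_fintype_sum fun i =>
      intervalIntegrable_cubePair hh hM _ ((hn i).meas_x i) ((hn i).bound_x i) s t)

lemma intervalIntegrable_viscPair (hn : ∀ j, NormalTest ℓ T B (F j) (Gt j) (Gx j)) (hh : 0 < h)
    (hM : (M : ℝ) * h = ℓ) (u : Cell d M → Fin d → ℝ) (s t : ℝ) :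
    IntervalIntegrable (viscPair ℓ μ lam h u Gx) volume s t :=
  ((intervalIntegrable_fintype_sum fun j => intervalIntegrable_fintype_sum fun i =>
      intervalIntegrable_cubePair hh hM _ (((hn j).meas_x i).comp (by fun_prop))
        (fun _ => (hn j).bound_x i _) s t).const_mul μ).add
    ((intervalIntegrable_fintype_sum fun i =>
      intervalIntegrable_cubePair hh hM _ ((hn i).meas_x i) ((hn i).bound_x i) s t).const_mul _)

lemma intervalIntegrable_penaltyPair (hn : ∀ j, NormalTest ℓ T B (F j) (Gt j) (Gx j)) (hh : 0 < h)
    (hM : (M : ℝ) * h = ℓ) (hΩ : IsOpen Ω) (u : Cell d M → Fin d → ℝ) (s t : ℝ) :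
    IntervalIntegrable (penaltyPair ℓ h Ω u F) volume s t :=
  intervalIntegrable_fintype_sum fun j => intervalIntegrable_cubePair hh hM _
    (measurable_penalty_test hΩ.measurableSet (hn j).cont.measurable)
    (abs_penalty_test_le (hn j).bound) s t

lemma abs_fluxPair_le (hn : ∀ j, NormalTest ℓ T B (F j) (Gt j) (Gx j)) (hB : 0 ≤ B) (hh : 0 < h)
    (hM : (M : ℝ) * h = ℓ) (ha : 0 ≤ a) {r : Cell d M → ℝ} (hr : ∀ K, 0 < r K)
    (u : Cell d M → Fin d → ℝ) (t : ℝ) :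
    |fluxPair ℓ a γ h r u Gx t| ≤ B * (d * ∑ K, h ^ d * (r K * ∑ j, u K j ^ 2)
      + d * (a * ∑ K, h ^ d * r K ^ γ)) := by
  have h1 : |∑ j, ∑ i, cubePair ℓ h (fun L => r L * u L j * u L i) (Gx j i) t|
      ≤ B * (d * ∑ K, h ^ d * (r K * ∑ j, u K j ^ 2)) := by
    have h2 : |∑ j, ∑ i, cubePair ℓ h (fun L => r L * u L j * u L i) (Gx j i) t|
        ≤ ∑ j : Fin d, ∑ i : Fin d, ∑ K, B * (h ^ d * |r K * u K j * u K i|) := by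
      refine (Finset.abs_sum_le_sum_abs _ _).trans (Finset.sum_le_sum fun j _ =>
        (Finset.abs_sum_le_sum_abs _ _).trans (Finset.sum_le_sum fun i _ => ?_))
      rw [← Finset.mul_sum]
      exact abs_cubePair_le hh hM _ ((hn j).bound_x i) t
    have h3 : ∀ (i j : Fin d) (K : Cell d M), B * (h ^ d * |r K * u K j * u K i|)
        ≤ B * (h ^ d * (r K * (1 / 2 * u K j ^ 2))) + B * (h ^ d * (r K * (1 / 2 * u K i ^ 2))) := by
      intro i j K
      rw [← mul_add, ← mul_add, ← mul_add]
      refine mul_le_mul_of_nonneg_left (mul_le_mul_of_nonneg_left ?_ (by positivity)) hB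
      rw [mul_assoc, abs_mul, abs_of_pos (hr K)]
      refine mul_le_mul_of_nonneg_left ?_ (hr K).le
      rw [abs_mul, ← sq_abs (u K j), ← sq_abs (u K i)]
      nlinarith [sq_nonneg (|u K j| - |u K i|)]
    refine h2.trans ((Finset.sum_le_sum fun j _ => Finset.sum_le_sum fun i _ =>
      Finset.sum_le_sum fun K _ => h3 i j K).trans (le_of_eq ?_))
    have h4 : ∑ j : Fin d, ∑ K, B * (h ^ d * (r K * (1 / 2 * u K j ^ 2)))
        = B * (1 / 2 * ∑ K, h ^ d * (r K * ∑ j, u K j ^ 2)) := by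
      rw [Finset.sum_comm]
      simp only [Finset.mul_sum]
      exact Finset.sum_congr rfl fun K _ => Finset.sum_congr rfl fun j _ => by ring
    have h5 : ∀ X : Fin d → ℝ, ∑ j, ∑ i, (X j + X i) = 2 * d * ∑ j, X j := fun X => by
      simp only [Finset.sum_add_distrib, Finset.sum_const, Finset.card_univ, Fintype.card_fin,
        nsmul_eq_mul, ← Finset.mul_sum]
      ring
    have h6 := h5 fun j => ∑ K, B * (h ^ d * (r K * (1 / 2 * u K j ^ 2)))
    rw [h4] at h6
    simp only [← Finset.sum_add_distrib] at h6
    rw [h6]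
    ring
  have h5 : |∑ i, cubePair ℓ h (fun L => pressure a γ (r L)) (Gx i i) t|
      ≤ B * (d * (a * ∑ K, h ^ d * r K ^ γ)) := by
    refine (Finset.abs_sum_le_sum_abs _ _).trans ((Finset.sum_le_sum fun i _ =>
      abs_cubePair_le hh hM _ ((hn i).bound_x i) t).trans (le_of_eq ?_))
    have h6 : ∑ K, h ^ d * |pressure a γ (r K)| = a * ∑ K, h ^ d * r K ^ γ := by
      rw [Finset.mul_sum]
      refine Finset.sum_congr rfl fun K _ => ?_
      have := hr K
      rw [pressure, abs_of_nonneg (by positivity)]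
      ring
    rw [h6]
    simp only [Finset.sum_const, Finset.card_univ, Fintype.card_fin, nsmul_eq_mul]
    ring
  rw [fluxPair]
  refine (abs_add_le _ _).trans ?_
  linarith

lemma abs_viscPair_le (hn : ∀ j, NormalTest ℓ T B (F j) (Gt j) (Gx j)) (hμ : 0 ≤ μ)
    (hν : 0 ≤ nu d μ lam) (hh : 0 < h) (hM : (M : ℝ) * h = ℓ) (u : Cell d M → Fin d → ℝ) (t : ℝ) :
    |viscPair ℓ μ lam h u Gx t|
      ≤ B * (μ * gradAbs h u + nu d μ lam * (d * ∑ K, h ^ d * |divh h u K|)) := by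
  have h1 : |∑ j, ∑ i, cubePair ℓ h (fun K => jump i (comp u j) K / h)
      (fun z => Gx j i (z.1, z.2 + (Pi.single i (h / 2) : Space d))) t| ≤ B * gradAbs h u := by
    rw [gradAbs, Finset.mul_sum]
    refine (Finset.abs_sum_le_sum_abs _ _).trans (Finset.sum_le_sum fun j _ => ?_)
    rw [Finset.mul_sum]
    exact (Finset.abs_sum_le_sum_abs _ _).trans (Finset.sum_le_sum fun i _ =>
      abs_cubePair_le hh hM _ (fun _ => (hn j).bound_x i _) t)
  have h2 : |∑ i, cubePair ℓ h (divh h u) (Gx i i) t|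
      ≤ B * (d * ∑ K, h ^ d * |divh h u K|) := by
    refine (Finset.abs_sum_le_sum_abs _ _).trans ((Finset.sum_le_sum fun i _ =>
      abs_cubePair_le hh hM _ ((hn i).bound_x i) t).trans (le_of_eq ?_))
    simp only [Finset.sum_const, Finset.card_univ, Fintype.card_fin, nsmul_eq_mul]
    ring
  have h3 := mul_le_mul_of_nonneg_left h1 hμ
  have h4 := mul_le_mul_of_nonneg_left h2 hν
  rw [viscPair]
  refine (abs_add_le _ _).trans ?_
  rw [abs_mul, abs_mul, abs_of_nonneg hμ, abs_of_nonneg hν]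
  linarith

lemma abs_penaltyPair_le (hn : ∀ j, NormalTest ℓ T B (F j) (Gt j) (Gx j)) (hh : 0 < h)
    (hM : (M : ℝ) * h = ℓ) (hΩ : IsOpen Ω) (u : Cell d M → Fin d → ℝ) (t : ℝ) :
    |penaltyPair ℓ h Ω u F t| ≤ B * ∑ K, ∑ j, |u K j| * (solidInd Ω h K * h ^ d) :=
  abs_sum_penalty_le hh hM hΩ (Φ := fun j x => F j (t, x))
    (fun j => (hn j).cont.measurable.comp (by fun_prop)) (fun j x => (hn j).bound _) u

end Pair

end MomentumTime

end FV

namespace FV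

/-! ### Consistency of the momentum equation. -/

section MomentumError

set_option linter.unusedSectionVars false

variable {d M : ℕ} [NeZero M] {ℓ T B γ α a μ lam Δt h ε E : ℝ} {N : ℕ} {Ω : Set (Space d)}
  {F Gt : Fin d → ℝ × Space d → ℝ} {Gx : Fin d → Fin d → ℝ × Space d → ℝ}
  {φ φt : ℝ → Space d → Fin d → ℝ} {φx : Fin d → ℝ → Space d → Fin d → ℝ}

lemma integrableOn_pwc_slice (q : Cell d M → ℝ) {G : ℝ × Space d → ℝ} (hG : Measurable G)
    (hb : ∀ z, |G z| ≤ B) (t : ℝ) : IntegrableOn (fun x => pwc h q x * G (t, x)) (cube d ℓ) :=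
  integrableOn_pwc_mul h q (integrableOn_slice hG hb t (volume_cube_lt_top ℓ).ne)

lemma VecNormalTest.integral_flux_eq (V : VecNormalTest ℓ T B φ φt φx F Gt Gx) (hh : 0 < h)
    (hM : (M : ℝ) * h = ℓ) (r : Cell d M → ℝ) (u : Cell d M → Fin d → ℝ) :
    ∀ᵐ t : ℝ, t ∈ Ioo 0 T →
      ∫ x in cube d ℓ, ((∑ j, pwc h r x * pwc h (comp u j) x * φt t x j)
          + (∑ j, ∑ i, pwc h r x * pwc h (comp u j) x * pwc h (comp u i) x * φx i t x j)
          + pressure a γ (pwc h r x) * ∑ i, φx i t x i)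
        = (∑ K, ∑ j, r K * u K j * ∫ x in cellSet h K, Gt j (t, x)) + fluxPair ℓ a γ h r u Gx t := by
  filter_upwards [eventually_countable_forall.mpr fun j => ae_ae_of_ae_prod_volume (V.eq_t j),
    eventually_countable_forall.mpr fun j => eventually_countable_forall.mpr fun i =>
      ae_ae_of_ae_prod_volume (V.eq_x j i)] with t h1 h2 ht
  have h3 : ∀ᵐ x : Space d, (∑ j, pwc h r x * pwc h (comp u j) x * φt t x j)
          + (∑ j, ∑ i, pwc h r x * pwc h (comp u j) x * pwc h (comp u i) x * φx i t x j)
          + pressure a γ (pwc h r x) * ∑ i, φx i t x i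
      = (∑ j, pwc h (fun L => r L * u L j) x * Gt j (t, x))
        + ((∑ j, ∑ i, pwc h (fun L => r L * u L j * u L i) x * Gx j i (t, x))
          + ∑ i, pwc h (fun L => pressure a γ (r L)) x * Gx i i (t, x)) := by
    filter_upwards [eventually_countable_forall.mpr h1, eventually_countable_forall.mpr
      fun j => eventually_countable_forall.mpr fun i => h2 j i] with x a1 a2
    have hs := mem_strip (d := d) (z := (t, x)).mpr ht
    simp only [fun j => a1 j hs, fun j i => a2 j i hs, Finset.mul_sum, add_assoc]
    rfl
  have it : ∀ j, IntegrableOn (fun x => pwc h (fun L => r L * u L j) x * Gt j (t, x)) (cube d ℓ) :=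
    fun j => integrableOn_pwc_slice _ (V.test j).meas_t (V.test j).bound_t t
  have ix : ∀ (q : Cell d M → ℝ) j i, IntegrableOn (fun x => pwc h q x * Gx j i (t, x)) (cube d ℓ) :=
    fun q j i => integrableOn_pwc_slice _ ((V.test j).meas_x i) ((V.test j).bound_x i) t
  have iA : IntegrableOn (fun x => ∑ j, ∑ i, pwc h (fun L => r L * u L j * u L i) x * Gx j i (t, x))
      (cube d ℓ) := integrable_finsetSum _ fun j _ => integrable_finsetSum _ fun i _ => ix _ j i
  have iB : IntegrableOn (fun x => ∑ i, pwc h (fun L => pressure a γ (r L)) x * Gx i i (t, x))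
      (cube d ℓ) := integrable_finsetSum _ fun i _ => ix _ i i
  have iAB : IntegrableOn (fun x =>
      (∑ j, ∑ i, pwc h (fun L => r L * u L j * u L i) x * Gx j i (t, x))
        + ∑ i, pwc h (fun L => pressure a γ (r L)) x * Gx i i (t, x)) (cube d ℓ) := iA.add iB
  rw [integral_congr_ae (ae_restrict_of_ae h3),
    integral_add (integrable_finsetSum _ fun j _ => it j) iAB, integral_add iA iB,
    integral_finsetSum _ fun j _ => it j, integral_finsetSum _ fun i _ => ix _ i i,
    integral_finsetSum _ fun j _ => integrable_finsetSum _ fun i _ => ix _ j i]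
  have e : ∀ j, ∫ x in cube d ℓ, ∑ i, pwc h (fun L => r L * u L j * u L i) x * Gx j i (t, x)
      = ∑ i, ∫ x in cube d ℓ, pwc h (fun L => r L * u L j * u L i) x * Gx j i (t, x) :=
    fun j => integral_finsetSum _ fun i _ => ix _ j i
  simp only [e]
  congr 1
  rw [Finset.sum_comm]
  exact Finset.sum_congr rfl fun j _ => cubePair_eq_sum hh hM _ (V.test j).meas_t (V.test j).bound_t t

/-- The discrete gradient lives on dual cells, shifted by `h/2`. By periodicity the shift is
transferred to the derivative of the test function, so that the gradient becomes piecewise constant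
on the primal mesh. -/
lemma VecNormalTest.integral_visc_eq (V : VecNormalTest ℓ T B φ φt φx F Gt Gx) (hh : 0 < h)
    (hM : (M : ℝ) * h = ℓ) (u : Cell d M → Fin d → ℝ) :
    ∀ᵐ t : ℝ, t ∈ Ioo 0 T →
      ∫ x in cube d ℓ, (μ * (∑ j, ∑ i, gradE h (comp u j) i x * φx i t x j)
          + nu d μ lam * (pwc h (divh h u) x * ∑ i, φx i t x i))
        = viscPair ℓ μ lam h u Gx t := by
  filter_upwards [eventually_countable_forall.mpr fun j => eventually_countable_forall.mpr fun i =>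
      ae_ae_of_ae_prod_volume (V.eq_x j i),
    eventually_countable_forall.mpr fun j => eventually_countable_forall.mpr fun i =>
      (V.test j).spaceReg hh.le i] with t h2 hR ht
  have h3 : ∀ᵐ x : Space d, μ * (∑ j, ∑ i, gradE h (comp u j) i x * φx i t x j)
          + nu d μ lam * (pwc h (divh h u) x * ∑ i, φx i t x i)
      = μ * (∑ j, ∑ i, pwc h (fun K => jump i (comp u j) K / h)
          (x - (Pi.single i (h / 2) : Space d)) * Gx j i (t, x))
        + nu d μ lam * ∑ i, pwc h (divh h u) x * Gx i i (t, x) := by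
    filter_upwards [eventually_countable_forall.mpr
      fun j => eventually_countable_forall.mpr fun i => h2 j i] with x a2
    have hs := mem_strip (d := d) (z := (t, x)).mpr ht
    simp only [fun j i => a2 j i hs, Finset.mul_sum]
    rfl
  have ix : ∀ (q : Cell d M → ℝ) j i, IntegrableOn (fun x => pwc h q x * Gx j i (t, x)) (cube d ℓ) :=
    fun q j i => integrableOn_pwc_slice _ ((V.test j).meas_x i) ((V.test j).bound_x i) t
  have is : ∀ j i, IntegrableOn (fun x => pwc h (fun K => jump i (comp u j) K / h)
      (x - (Pi.single i (h / 2) : Space d)) * Gx j i (t, x)) (cube d ℓ) := fun j i => by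
    obtain ⟨C, hC⟩ := exists_bound_pwc h fun K => jump i (comp u j) K / h
    exact Integrable.bdd_mul
      (integrableOn_slice ((V.test j).meas_x i) ((V.test j).bound_x i) t (volume_cube_lt_top ℓ).ne)
      ((measurable_pwc h _).comp (measurable_sub_const _)).aestronglyMeasurable
      (Filter.Eventually.of_forall fun x => hC _)
  rw [integral_congr_ae (ae_restrict_of_ae h3), integral_add
    ((integrable_finsetSum _ fun j _ => integrable_finsetSum _ fun i _ => is j i).const_mul _)
    ((integrable_finsetSum _ fun i _ => ix _ i i).const_mul _), integral_const_mul,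
    integral_const_mul, integral_finsetSum _ fun i _ => ix _ i i,
    integral_finsetSum _ fun j _ => integrable_finsetSum _ fun i _ => is j i]
  simp only [fun j => integral_finsetSum Finset.univ fun i _ => is j i]
  rw [viscPair]
  congr 2
  refine Finset.sum_congr rfl fun j _ => Finset.sum_congr rfl fun i _ => ?_
  have hr := hR j i ht
  rw [integral_pwc_sub_mul hh hM hr.locallyIntegrable hr.periodic_deriv _ (by positivity)
    (by linarith)]
  exact (cubePair_eq_sum hh hM _
    (G := fun z => Gx j i (z.1, z.2 + (Pi.single i (h / 2) : Space d))) (((V.test j).meas_x i).comp (by fun_prop))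
    (fun _ => (V.test j).bound_x i _) t).symm

lemma VecNormalTest.integral_penalty_eq (V : VecNormalTest ℓ T B φ φt φx F Gt Gx)
    (hΩ : IsOpen Ω) (u : Cell d M → Fin d → ℝ) {t : ℝ} (ht : t ∈ Icc 0 T) :
    ∫ x in cube d ℓ \ Ω, ∑ j, pwc h (comp u j) x * φ t x j = penaltyPair ℓ h Ω u F t := by
  have hm := hΩ.measurableSet
  have hi : ∀ j, IntegrableOn (fun x => pwc h (comp u j) x * F j (t, x)) (cube d ℓ) := fun j =>
    integrableOn_pwc_slice _ (V.test j).cont.measurable (V.test j).bound t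
  simp only [← V.eq _ t ht]
  rw [integral_finsetSum _ fun j _ => (hi j).mono_set sdiff_subset]
  refine Finset.sum_congr rfl fun j _ => ?_
  rw [sdiff_eq, ← setIntegral_indicator hm.compl]
  simp only [cubePair]
  congr 1
  funext x
  by_cases hx : x ∈ Ω <;> simp [hx]

lemma VecNormalTest.integral_momentum_eq (V : VecNormalTest ℓ T B φ φt φx F Gt Gx) (hh : 0 < h)
    (hM : (M : ℝ) * h = ℓ) (r : Cell d M → ℝ) (u : Cell d M → Fin d → ℝ) {t : ℝ}
    (ht : t ∈ Icc 0 T) :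
    ∫ x in cube d ℓ, ∑ j, pwc h r x * pwc h (comp u j) x * φ t x j
      = ∑ K, ∑ j, r K * u K j * ∫ x in cellSet h K, F j (t, x) := by
  have hi : ∀ j, IntegrableOn (fun x => pwc h (fun L => r L * u L j) x * F j (t, x)) (cube d ℓ) :=
    fun j => integrableOn_pwc_slice _ (V.test j).cont.measurable (V.test j).bound t
  simp only [← V.eq _ t ht]
  rw [Finset.sum_comm]
  refine (integral_finsetSum _ fun j _ => hi j).trans (Finset.sum_congr rfl fun j _ => ?_)
  exact cubePair_eq_sum hh hM _ (V.test j).cont.measurable (V.test j).bound t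

end MomentumError

end FV

namespace FV

section MomentumError

set_option linter.unusedSectionVars false

variable {d M : ℕ} [NeZero M] {ℓ T B γ α a μ lam Δt h ε E : ℝ} {N : ℕ} {Ω : Set (Space d)}
  {F Gt : Fin d → ℝ × Space d → ℝ} {Gx : Fin d → Fin d → ℝ × Space d → ℝ}
  {φ φt : ℝ → Space d → Fin d → ℝ} {φx : Fin d → ℝ → Space d → Fin d → ℝ}

lemma term_le_of_sum_le {f : ℕ → ℝ} {C : ℝ} (hf : ∀ k, 0 ≤ f k)
    (H : ∑ k ∈ Finset.range N, f k ≤ C) {k : ℕ} (hk : k < N) : f k ≤ C :=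
  (Finset.single_le_sum (f := f) (fun k _ => hf k) (Finset.mem_range.mpr hk)).trans H

/-- The terms of the momentum balance over a single time step. -/
lemma abs_momentumPair_mul_le (hn : ∀ j, NormalTest ℓ T B (F j) (Gt j) (Gx j)) (hB : 0 ≤ B)
    (ha : 0 ≤ a) (hμ : 0 ≤ μ) (hν : 0 ≤ nu d μ lam) (ht : 0 < Δt) (hh : 0 < h) (hε : 0 < ε)
    (hM : (M : ℝ) * h = ℓ) (hΩ : IsOpen Ω) {ρ : ℕ → Cell d M → ℝ} {u : ℕ → Cell d M → Fin d → ℝ}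
    (Bd : EnergyBounds Ω γ α N Δt h ε ρ u E) {k : ℕ} (hk : k < N) (t : ℝ) :
    |momentumPair ℓ a γ μ lam h ε Ω (ρ (k + 1)) (u (k + 1)) F Gx t| * Δt
      ≤ B * (d * E + d * (a * E)) * Δt
        + √Δt * (B * (μ * (d * (d * ℓ ^ d) + E) + nu d μ lam * (d * (ℓ ^ d + d * E))))
        + √(Δt / ε) * (B * (d * ℓ ^ d + E)) := by
  set v := u (k + 1) with hv
  have h1 : |fluxPair ℓ a γ h (ρ (k + 1)) v Gx t| ≤ B * (d * E + d * (a * E)) := by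
    refine (abs_fluxPair_le hn hB hh hM ha (Bd.pos _ hk) v t).trans
      (mul_le_mul_of_nonneg_left ?_ hB)
    have := Bd.kinetic _ hk
    have := Bd.internal _ hk
    gcongr
  have hg : Δt * gradSum h v ≤ E :=
    term_le_of_sum_le (f := fun k => Δt * gradSum h (u (k + 1)))
      (fun k => mul_nonneg ht.le (gradSum_nonneg hh.le _)) Bd.grad hk
  have hs : Δt * solidSum Ω h v ≤ E * ε :=
    term_le_of_sum_le (f := fun k => Δt * solidSum Ω h (u (k + 1)))
      (fun k => mul_nonneg ht.le (solidSum_nonneg hh.le _ _)) Bd.solid hk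
  have hst : √Δt ^ 2 = Δt := Real.sq_sqrt ht.le
  -- For a single step only `Δt · gradSum ≤ E` is known, so one factor `√Δt` is spent on the
  -- velocity gradient and one remains.
  have h2 : |viscPair ℓ μ lam h v Gx t| * Δt
      ≤ √Δt * (B * (μ * (d * (d * ℓ ^ d) + E) + nu d μ lam * (d * (ℓ ^ d + d * E)))) := by
    have e1 := abs_viscPair_le hn hμ hν hh hM v t
    have e2 := mul_gradAbs_le hh.le hM √Δt v
    have e3 := mul_sum_abs_divh_le hh hM √Δt v
    rw [hst] at e2 e3
    have e4 : √Δt * gradAbs h v ≤ d * (d * ℓ ^ d) + E := by linarith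
    have e5 : √Δt * ∑ K, h ^ d * |divh h v K| ≤ ℓ ^ d + d * E := by
      have := mul_le_mul_of_nonneg_left hg (Nat.cast_nonneg (α := ℝ) d)
      linarith
    calc |viscPair ℓ μ lam h v Gx t| * Δt
        ≤ B * (μ * gradAbs h v + nu d μ lam * (d * ∑ K, h ^ d * |divh h v K|)) * Δt :=
          mul_le_mul_of_nonneg_right e1 ht.le
      _ = √Δt * (B * (μ * (√Δt * gradAbs h v)
          + nu d μ lam * (d * (√Δt * ∑ K, h ^ d * |divh h v K|)))) := by
          conv_lhs => rw [← hst]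
          ring
      _ ≤ _ := by gcongr
  -- Here `Δt/ε` times the penalized velocity square is at most `E`; one root of `Δt/ε` is used up
  -- and the other is the rate.
  have h3 : 1 / ε * |penaltyPair ℓ h Ω v F t| * Δt ≤ √(Δt / ε) * (B * (d * ℓ ^ d + E)) := by
    have e1 := abs_penaltyPair_le hn hh hM hΩ v t
    have e2 := mul_sum_solid_abs_le (Ω := Ω) hh hM √(Δt / ε) v
    have hsq : √(Δt / ε) ^ 2 = Δt / ε := Real.sq_sqrt (by positivity)
    rw [hsq] at e2
    have e3 : Δt / ε * solidSum Ω h v ≤ E := by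
      rw [div_mul_eq_mul_div, div_le_iff₀ hε]
      exact hs
    calc 1 / ε * |penaltyPair ℓ h Ω v F t| * Δt
        = |penaltyPair ℓ h Ω v F t| * √(Δt / ε) ^ 2 := by rw [hsq]; ring
      _ ≤ B * (∑ K, ∑ j, |v K j| * (solidInd Ω h K * h ^ d)) * √(Δt / ε) ^ 2 := by gcongr
      _ = √(Δt / ε) * (B * (√(Δt / ε) * ∑ K, ∑ j, |v K j| * (solidInd Ω h K * h ^ d))) := by ring
      _ ≤ _ := by
        gcongr
        linarith
  have h4 : |momentumPair ℓ a γ μ lam h ε Ω (ρ (k + 1)) v F Gx t|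
      ≤ |fluxPair ℓ a γ h (ρ (k + 1)) v Gx t| + |viscPair ℓ μ lam h v Gx t|
        + 1 / ε * |penaltyPair ℓ h Ω v F t| := by
    have e : |1 / ε * penaltyPair ℓ h Ω v F t| = 1 / ε * |penaltyPair ℓ h Ω v F t| := by
      rw [abs_mul, abs_of_nonneg (by positivity : 0 ≤ 1 / ε)]
    rw [← e, momentumPair]
    exact (abs_sub _ _).trans (add_le_add_left (abs_sub _ _) _)
  have h5 := mul_le_mul_of_nonneg_right h4 ht.le
  have h6 := mul_le_mul_of_nonneg_right h1 ht.le
  rw [add_mul, add_mul] at h5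
  linarith

/-- Consistency of the momentum equation in terms of the energy bounds and the spatial error. -/
lemma abs_errMomentum_le (hd : d ≠ 0) (hγ : 1 < γ) (ha : 0 ≤ a) (hμ : 0 ≤ μ)
    (hν : 0 ≤ nu d μ lam) (hT : 0 < T) (ht : 0 < Δt) (hh : 0 < h) (hh1 : h ≤ 1) (hε : 0 < ε)
    (hN : (N : ℝ) * Δt = T) (hM : (M : ℝ) * h = ℓ) (hΩ : IsFluidDomain ℓ Ω)
    {ρ₀ : Space d → ℝ} {m₀ : Space d → Fin d → ℝ} {ρ : ℕ → Cell d M → ℝ}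
    {u : ℕ → Cell d M → Fin d → ℝ} (S : IsFVSolution Ω a γ μ lam α ρ₀ m₀ N Δt h ε ρ u)
    (Bd : EnergyBounds Ω γ α N Δt h ε ρ u E) (H : IsVecTestFun ℓ T B φ φt φx)
    {τ : ℝ} (hτ : τ ∈ Icc 0 T) :
    |errMomentum ℓ Ω a γ μ lam Δt h ε ρ u τ φ φt φx|
      ≤ (2 + T) * (B * (d * (ℓ ^ d + E) + E)) * Δt
        + ∑ k ∈ Finset.range N, Δt * momentumErr B a γ μ lam α h ε Ω (ρ (k + 1)) (u (k + 1))
        + (B * (d * E + d * (a * E)) * Δt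
          + √Δt * (B * (μ * (d * (d * ℓ ^ d) + E) + nu d μ lam * (d * (ℓ ^ d + d * E))))
          + √(Δt / ε) * (B * (d * ℓ ^ d + E))) := by
  obtain ⟨j₀⟩ : Nonempty (Fin d) := ⟨⟨0, Nat.pos_of_ne_zero hd⟩⟩
  have hB : 0 ≤ B := (H.comp j₀).nonneg hT
  have hℓ : 0 < ℓ := hh.trans_le (width_le hh hM)
  have hE := Bd.nonneg hh
  obtain ⟨F, Gt, Gx, V⟩ := H.exists_vecNormalTest hT
  set c : Cell d M × Fin d → ℝ → ℝ := fun q t => ∫ x in cellSet h q.1, F q.2 (t, x) with hc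
  set g' : Cell d M × Fin d → ℝ → ℝ := fun q t => ∫ x in cellSet h q.1, Gt q.2 (t, x) with hg'
  set r : ℕ → Cell d M × Fin d → ℝ := fun k q => ρ k q.1 * u k q.1 q.2 with hr
  have R : ∀ q, TimeReg T (B * h ^ d) (c q) (g' q) := fun q => by
    have := (V.test q.2).timeReg hT (isCompact_cellSet h q.1).measure_ne_top
    rwa [measureReal_cellSet hh] at this
  set A : ℕ → ℝ → ℝ := fun k t =>
    momentumPair ℓ a γ μ lam h ε Ω (ρ (k + 1)) (u (k + 1)) F Gx t with hA
  set I₁ : ℝ → ℝ := fun t => ∫ x in cube d ℓ,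
        ((∑ j, pwc h (ρ (level Δt t)) x * pwc h (comp (u (level Δt t)) j) x * φt t x j)
          + (∑ j, ∑ i, pwc h (ρ (level Δt t)) x * pwc h (comp (u (level Δt t)) j) x
              * pwc h (comp (u (level Δt t)) i) x * φx i t x j)
          + pressure a γ (pwc h (ρ (level Δt t)) x) * ∑ i, φx i t x i) with hI₁
  set I₂ : ℝ → ℝ := fun t => ∫ x in cube d ℓ,
        (μ * (∑ j, ∑ i, gradE h (comp (u (level Δt t)) j) i x * φx i t x j)
          + nu d μ lam * (pwc h (divh h (u (level Δt t))) x * ∑ i, φx i t x i)) with hI₂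
  set I₃ : ℝ → ℝ := fun t => ∫ x in cube d ℓ \ Ω, ∑ j, pwc h (comp (u (level Δt t)) j) x * φ t x j
    with hI₃
  have hstep : ∀ k < N, ∀ t ∈ Ioo (k * Δt) ((k + 1 : ℕ) * Δt),
      level Δt t = k + 1 ∧ t ∈ Ioo 0 T := by
    intro k hk t h3
    refine ⟨level_eq ht h3.1 h3.2.le, lt_of_le_of_lt (by positivity) h3.1, h3.2.trans_le ?_⟩
    rw [← hN]
    exact mul_le_mul_of_nonneg_right (by exact_mod_cast hk) ht.le
  have h₁ : ∀ k < N, ∀ᵐ t : ℝ, t ∈ Ioo (k * Δt) ((k + 1 : ℕ) * Δt) →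
      I₁ t = (∑ q, r (k + 1) q * g' q t) + fluxPair ℓ a γ h (ρ (k + 1)) (u (k + 1)) Gx t := by
    intro k hk
    filter_upwards [V.integral_flux_eq (a := a) (γ := γ) hh hM (ρ (k + 1)) (u (k + 1))] with t h1 h2
    obtain ⟨h3, h4⟩ := hstep k hk t h2
    simp only [hI₁, h3, Fintype.sum_prod_type]
    exact h1 h4
  have h₂ : ∀ k < N, ∀ᵐ t : ℝ, t ∈ Ioo (k * Δt) ((k + 1 : ℕ) * Δt) →
      I₂ t = viscPair ℓ μ lam h (u (k + 1)) Gx t := by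
    intro k hk
    filter_upwards [V.integral_visc_eq (μ := μ) (lam := lam) hh hM (u (k + 1))] with t h1 h2
    obtain ⟨h3, h4⟩ := hstep k hk t h2
    simp only [hI₂, h3]
    exact h1 h4
  have h₃ : ∀ k < N, ∀ᵐ t : ℝ, t ∈ Ioo (k * Δt) ((k + 1 : ℕ) * Δt) →
      I₃ t = penaltyPair ℓ h Ω (u (k + 1)) F t := by
    intro k hk
    refine Filter.Eventually.of_forall fun t h2 => ?_
    obtain ⟨h3, h4⟩ := hstep k hk t h2
    simp only [hI₃, h3]
    exact V.integral_penalty_eq hΩ.isOpen _ (Ioo_subset_Icc_self h4)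
  have i₁ : IntervalIntegrable I₁ volume 0 τ := by
    refine intervalIntegrable_of_level ht hN hτ (fun k _ s t => ?_) h₁
    exact (intervalIntegrable_fintype_sum fun q =>
      ((R q).intervalIntegrable s t).const_mul _).add (intervalIntegrable_fluxPair V.test hh hM _ _ s t)
  have i₂ : IntervalIntegrable I₂ volume 0 τ :=
    intervalIntegrable_of_level ht hN hτ
      (fun k _ s t => intervalIntegrable_viscPair V.test hh hM _ s t) h₂
  have i₃ : IntervalIntegrable I₃ volume 0 τ :=
    intervalIntegrable_of_level ht hN hτ
      (fun k _ s t => intervalIntegrable_penaltyPair V.test hh hM hΩ.isOpen _ s t) h₃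
  have hmom : ∀ t ∈ Icc 0 T, ∀ k, ∫ x in cube d ℓ, ∑ j, pwc h (ρ k) x * pwc h (comp (u k) j) x
      * φ t x j = ∑ q, r k q * c q t := fun t ht' k => by
    rw [Fintype.sum_prod_type]
    exact V.integral_momentum_eq hh hM _ _ ht'
  -- The unknowns are indexed by pairs of cell and component, and the flux, viscous and penalty
  -- integrals are collected into one function of time.
  have hmain := abs_time_error_le (r := r) (A := A) (g := fun t => I₁ t - I₂ t - 1 / ε * I₃ t)
    (S := B * (d * (ℓ ^ d + E) + E))
    (e := fun k => momentumErr B a γ μ lam α h ε Ω (ρ (k + 1)) (u (k + 1)))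
    (a := B * (d * E + d * (a * E)) * Δt
      + √Δt * (B * (μ * (d * (d * ℓ ^ d) + E) + nu d μ lam * (d * (ℓ ^ d + d * E))))
      + √(Δt / ε) * (B * (d * ℓ ^ d + E))) R ht hN ?_ ?_ ?_ ?_ ?_ ?_ ?_ hτ
  · refine le_trans (le_of_eq ?_) hmain
    congr 1
    rw [intervalIntegral.integral_sub (i₁.sub i₂) (i₃.const_mul _),
      intervalIntegral.integral_sub i₁ i₂, intervalIntegral.integral_const_mul,
      ← hmom τ hτ, ← hmom 0 ⟨le_rfl, hT.le⟩]
    have e0 : level Δt 0 = 0 := by simp [level]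
    simp only [errMomentum, e0, hI₁, hI₂, hI₃]
    ring
  · intro k hk
    have h1 : ∀ q, |r k q| * (B * h ^ d) = B * (h ^ d * |ρ k q.1 * u k q.1 q.2|) := fun q => by
      simp only [hr]; ring
    simp only [h1]
    rw [← Finset.mul_sum, Fintype.sum_prod_type, Finset.sum_comm]
    refine mul_le_mul_of_nonneg_left ?_ hB
    have h2 := sum_abs_density_velocity_le hh (Bd.pos k hk) (u k)
    have h3 := mul_le_mul_of_nonneg_left (Bd.mass_le hγ hh hM hk) (Nat.cast_nonneg (α := ℝ) d)
    have h4 := Bd.kinetic k hk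
    linarith
  · intro k _ s t
    exact ((intervalIntegrable_fluxPair V.test hh hM _ _ s t).sub
      (intervalIntegrable_viscPair V.test hh hM _ s t)).sub
      ((intervalIntegrable_penaltyPair V.test hh hM hΩ.isOpen _ s t).const_mul _)
  · intro k hk
    exact Filter.Eventually.of_forall fun t _ =>
      abs_momentumPair_mul_le V.test hB ha hμ hν ht hh hε hM hΩ.isOpen Bd hk t
  · intro k hk
    filter_upwards [h₁ k hk, h₂ k hk, h₃ k hk] with t a1 a2 a3 h3
    simp only [hA, momentumPair]
    rw [a1 h3, a2 h3, a3 h3]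
    ring
  · intro k hk
    filter_upwards [eventually_countable_forall.mpr fun j => eventually_countable_forall.mpr fun i =>
        (V.test j).spaceReg hh.le i,
      eventually_countable_forall.mpr fun j => eventually_countable_forall.mpr fun i =>
        (V.test j).lipReg hh.le i (V.lip j i)] with t h1 h2 h3
    have h4 := abs_sub_momentumPair_le hB hμ hν hh hh1 hε hM hd hΩ S hk
      (fun j i => h1 j i h3) fun j i => h2 j i h3
    rw [Fintype.sum_prod_type]
    exact h4
  · intro k hk
    exact momentumErr_nonneg hB hμ hν hh.le hε.le _ _
  · positivity

/-- Space-time bound of the spatial consistency error of the momentum equation. -/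
lemma sum_momentumErr_le (hB : 0 ≤ B) (ha : 0 ≤ a) (hμ : 0 ≤ μ)
    (hν : 0 ≤ nu d μ lam) (ht : 0 < Δt) (hh : 0 < h) (hε : 0 < ε)
    (hN : (N : ℝ) * Δt = T) (hM : (M : ℝ) * h = ℓ) (hΩ : IsFluidDomain ℓ Ω) {C : ℝ}
    (hC : ∀ h, 0 < h → volume.real (boundaryLayer Ω h) ≤ C * h)
    {ρ : ℕ → Cell d M → ℝ} {u : ℕ → Cell d M → Fin d → ℝ}
    (Bd : EnergyBounds Ω γ α N Δt h ε ρ u E) :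
    ∑ k ∈ Finset.range N, Δt * momentumErr B a γ μ lam α h ε Ω (ρ (k + 1)) (u (k + 1))
      ≤ 3 * B * ∑ k ∈ Finset.range N, Δt * momentumRes h α (ρ (k + 1)) (u (k + 1))
        + h * (2 * d * B * (a * E) * T + μ * (2 * B) * (d * (d * ℓ ^ d) * T + E)
          + nu d μ lam * (2 * d * B) * (ℓ ^ d * T + d * E))
        + √(h / ε) * (B * (d * C * T + E)) := by
  have hsq : √(h / ε) ^ 2 = h / ε := Real.sq_sqrt (by positivity)
  have h1 : ∀ k ∈ Finset.range N, Δt * momentumErr B a γ μ lam α h ε Ω (ρ (k + 1)) (u (k + 1))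
      ≤ 3 * B * (Δt * momentumRes h α (ρ (k + 1)) (u (k + 1)))
        + (h * (2 * d * B * (a * E) + μ * (2 * B) * (d * (d * ℓ ^ d))
            + nu d μ lam * (2 * d * B) * ℓ ^ d) + √(h / ε) * (B * (d * C))) * Δt
        + h * (μ * (2 * B) + nu d μ lam * (2 * d * B) * d) * (Δt * gradSum h (u (k + 1)))
        + √(h / ε) * (B / ε) * (Δt * solidSum Ω h (u (k + 1))) := by
    intro k hk
    have hk' : k + 1 ≤ N := Finset.mem_range.mp hk
    have e1 : ∑ K, h ^ d * |pressure a γ (ρ (k + 1) K)| ≤ a * E := by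
      have := mul_le_mul_of_nonneg_left (Bd.internal _ hk') ha
      refine le_trans (le_of_eq ?_) this
      rw [Finset.mul_sum]
      refine Finset.sum_congr rfl fun K _ => ?_
      have := Bd.pos _ hk' K
      rw [pressure, abs_of_nonneg (by positivity)]
      ring
    have e2 := mul_gradAbs_le hh.le hM 1 (u (k + 1))
    have e3 := mul_sum_abs_divh_le hh hM 1 (u (k + 1))
    have e4 := mul_sum_layer_le hh hM hΩ √(h / ε) (u (k + 1))
    rw [one_mul, one_pow, one_mul] at e2 e3
    rw [hsq] at e4
    set Y := ∑ K, ∑ j, |u (k + 1) K j| * (solidInd Ω h K * volume.real (cellSet h K ∩ Ω)) with hY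
    -- With the weight `√(h/ε)`, the layer volume contributes `C h` and the velocity `h/ε` times its
    -- penalized square, both proportional to `h`; dividing by `h` leaves the rate `√(h/ε)`.
    have e5 : 1 / ε * (B * Y) ≤ √(h / ε) * (B * (d * C + solidSum Ω h (u (k + 1)) / ε)) := by
      have e6 : √(h / ε) * Y ≤ h * (d * C + solidSum Ω h (u (k + 1)) / ε) := by
        have := mul_le_mul_of_nonneg_left (hC h hh) (Nat.cast_nonneg (α := ℝ) d)
        refine e4.trans ?_
        have e7 : h / ε * solidSum Ω h (u (k + 1)) = h * (solidSum Ω h (u (k + 1)) / ε) := by ring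
        linarith
      calc 1 / ε * (B * Y) = √(h / ε) ^ 2 * (B * Y) / h := by rw [hsq]; field_simp
        _ = √(h / ε) * (B * (√(h / ε) * Y)) / h := by ring
        _ ≤ √(h / ε) * (B * (h * (d * C + solidSum Ω h (u (k + 1)) / ε))) / h := by gcongr
        _ = _ := by field_simp
    have e8 : momentumErr B a γ μ lam α h ε Ω (ρ (k + 1)) (u (k + 1))
        ≤ 3 * B * momentumRes h α (ρ (k + 1)) (u (k + 1)) + 2 * d * B * h * (a * E)
          + μ * (2 * B * h * (d * (d * ℓ ^ d) + gradSum h (u (k + 1))))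
          + nu d μ lam * (2 * d * B * h * (ℓ ^ d + d * gradSum h (u (k + 1))))
          + √(h / ε) * (B * (d * C + solidSum Ω h (u (k + 1)) / ε)) := by
      rw [momentumErr]
      gcongr
    refine (mul_le_mul_of_nonneg_left e8 ht.le).trans (le_of_eq ?_)
    ring
  refine (Finset.sum_le_sum h1).trans ?_
  have hsum : ∀ (a b c : ℕ → ℝ) (x w y z : ℝ),
      ∑ k ∈ Finset.range N, (x * a k + w * Δt + y * b k + z * c k)
        = x * ∑ k ∈ Finset.range N, a k + w * T + y * ∑ k ∈ Finset.range N, b k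
          + z * ∑ k ∈ Finset.range N, c k := by
    intro a b c x w y z
    rw [← hN]
    simp only [Finset.sum_add_distrib, ← Finset.mul_sum, Finset.sum_const, Finset.card_range,
      nsmul_eq_mul]
  rw [hsum]
  have e1 := mul_le_mul_of_nonneg_left Bd.grad
    (by positivity : 0 ≤ h * (μ * (2 * B) + nu d μ lam * (2 * d * B) * d))
  have e2 := mul_le_mul_of_nonneg_left Bd.solid (by positivity : 0 ≤ √(h / ε) * (B / ε))
  have e3 : √(h / ε) * (B / ε) * (E * ε) = √(h / ε) * (B * E) := by field_simp
  rw [e3] at e2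
  linarith

end MomentumError

end FV

namespace FV

/-! ### Uniform constants and the conclusion. -/

/-- A priori bounds for all solutions of the scheme with given energy. -/
lemma exists_apriori_bounds {d : ℕ} (hd : 2 ≤ d) {ℓ : ℝ} (hℓ : 0 < ℓ) {Ω : Set (Space d)}
    (hΩ : IsFluidDomain ℓ Ω) {a γ μ lam α T : ℝ} (ha : 0 < a) (hγ : 1 < γ) (hμ : 0 < μ)
    (hlam : 0 ≤ lam) (hT : 0 < T) (E₀ : ℝ) : ∃ E V : ℝ, 0 ≤ E ∧ 0 ≤ V ∧
      ∀ (ρ₀ : Space d → ℝ) (m₀ : Space d → Fin d → ℝ),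
      IsInitialData ℓ γ Ω ρ₀ m₀ → initialEnergy ℓ a γ ρ₀ m₀ ≤ E₀ →
      ∀ (N M : ℕ) [NeZero M] (Δt h ε : ℝ),
        Δt ∈ Ioo (0 : ℝ) 1 → h ∈ Ioo (0 : ℝ) 1 → ε ∈ Ioo (0 : ℝ) 1 →
        (N : ℝ) * Δt = T → (M : ℝ) * h = ℓ →
      ∀ (ρ : ℕ → Cell d M → ℝ) (u : ℕ → Cell d M → Fin d → ℝ),
        IsFVSolution Ω a γ μ lam α ρ₀ m₀ N Δt h ε ρ u →
        EnergyBounds Ω γ α N Δt h ε ρ u E ∧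
          ∑ k ∈ Finset.range N, Δt * ∑ j, sobSum h (comp (u (k + 1)) j) ≤ V := by
  obtain ⟨C, hC0, hC⟩ := exists_poincare hd hℓ hΩ
  set E : ℝ := |E₀| * (3 + (γ - 1) / a + 1 / μ + 2 / (a * γ))
      + (4 + T) * (ℓ ^ d + |E₀| * (γ - 1) / a) + d * (|E₀| / μ) with hE
  have hγ' : 0 < γ - 1 := by linarith
  have hE0 : 0 ≤ E := by positivity
  refine ⟨E, (2 * C + 1) * E, hE0, by positivity, ?_⟩
  intro ρ₀ m₀ D hD N M _ Δt h ε ht hh hε hN hM ρ u S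
  have Bd := S.energyBounds hd hΩ ha hγ hμ hlam hT D hD ht.1 hh.1 hε.1 hN hM
  exact ⟨Bd, Bd.sum_sobSum_velocity ht.1 hh.1 hε.2.le hC0 (hC M h hh.1 hM)⟩

/-- The upwind residual is of order `h^(1/2)`; the sign of `β_R` shows that this is no worse than
the required rate. -/
lemma betaR_nonpos {d : ℕ} {γ α : ℝ} (hγ : 1 < γ) (hα : -1 < α) : betaR d γ α ≤ 0 := by
  rw [betaR]
  split_ifs with h1 h2
  · exact le_rfl
  · exact mul_nonpos_of_nonneg_of_nonpos (le_min (by linarith) zero_le_one)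
      (div_nonpos_of_nonpos_of_nonneg (by linarith) (by linarith))
  · exact le_rfl

/-- Space-time bound of the convective residual of the momentum equation. -/
lemma exists_sum_momentumRes_le {d : ℕ} (hd : d = 2 ∨ d = 3) {ℓ γ α E V T : ℝ} (hℓ : 0 < ℓ)
    (hγ : 1 < γ) (hα : -1 < α) (hE : 0 ≤ E) (hV : 0 ≤ V) (hT : 0 < T) {p : ℝ} (hp : 2 < p) :
    ∃ C, 0 ≤ C ∧ ∀ (M : ℕ) [NeZero M] (N : ℕ) (Δt h ε : ℝ)
      (Ω : Set (Space d)) (ρ : ℕ → Cell d M → ℝ) (u : ℕ → Cell d M → Fin d → ℝ),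
      0 < Δt → 0 < h → h < 1 → (N : ℝ) * Δt = T → (M : ℝ) * h = ℓ →
      EnergyBounds Ω γ α N Δt h ε ρ u E →
      ∑ k ∈ Finset.range N, Δt * ∑ j, sobSum h (comp (u (k + 1)) j) ≤ V →
      ∑ k ∈ Finset.range N, Δt * momentumRes h α (ρ (k + 1)) (u (k + 1))
        ≤ C * (h + h ^ (1 + α) + h ^ (1 + betaM d γ α p)) := by
  obtain ⟨C, hC, H⟩ := exists_momentum_sq_bound hd hℓ hγ hα hE hV hT hp
  refine ⟨d * (T * E + (C + E) + T * (d * (ℓ ^ d + E) + E)), by positivity,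
    fun M _ N Δt h ε Ω ρ u ht hh hh1 hN hM Bd hS => ?_⟩
  set β := betaM d γ α p with hβ
  have h1 : ∀ k ∈ Finset.range N, Δt * momentumRes h α (ρ (k + 1)) (u (k + 1))
      ≤ d * (h * E + h ^ (1 + α) * (d * (ℓ ^ d + E) + E)) * Δt
        + d * h ^ (1 + β) * h ^ (-(2 * β))
          * (Δt * ∑ K, h ^ d * (ρ (k + 1) K ^ 2 * ∑ j, u (k + 1) K j ^ 2))
        + d * h ^ (1 + β) * (Δt * gradSum h (u (k + 1))) := by
    intro k hk
    have hk' : k + 1 ≤ N := Finset.mem_range.mp hk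
    have e1 := momentumRes_le (α := α) (β := β) hh (Bd.pos _ hk') (u (k + 1))
    have e2 := Bd.kinetic _ hk'
    have e3 := Bd.mass_le hγ hh hM hk'
    have e4 : momentumRes h α (ρ (k + 1)) (u (k + 1)) ≤ d * (h * E
        + h ^ (1 + β) * (h ^ (-(2 * β)) * ∑ K, h ^ d * (ρ (k + 1) K ^ 2 * ∑ j, u (k + 1) K j ^ 2)
          + gradSum h (u (k + 1))) + h ^ (1 + α) * (d * (ℓ ^ d + E) + E)) := by
      refine e1.trans ?_
      gcongr
    refine (mul_le_mul_of_nonneg_left e4 ht.le).trans (le_of_eq ?_)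
    ring
  refine (Finset.sum_le_sum h1).trans ?_
  have hsum : ∀ (a b : ℕ → ℝ) (w x y : ℝ),
      ∑ k ∈ Finset.range N, (w * Δt + x * a k + y * b k)
        = w * T + x * ∑ k ∈ Finset.range N, a k + y * ∑ k ∈ Finset.range N, b k := by
    intro a b w x y
    rw [← hN]
    simp only [Finset.sum_add_distrib, ← Finset.mul_sum, Finset.sum_const, Finset.card_range,
      nsmul_eq_mul]
  rw [hsum]
  have e1 := mul_le_mul_of_nonneg_left (H M N Δt h ε Ω ρ u ht hh hh1 hN hM Bd hS)
    -- The powers `h^(-2β)` and `h^(2β)` cancel, so the `L²` bound of the momentum leaves exactly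
    -- the rate `h^(1+β_M)`.
    (by positivity : 0 ≤ d * h ^ (1 + β) * h ^ (-(2 * β)))
  have e2 : d * h ^ (1 + β) * h ^ (-(2 * β)) * (C * h ^ (2 * β)) = d * h ^ (1 + β) * C := by
    have : h ^ (-(2 * β)) * h ^ (2 * β) = 1 := by
      rw [← Real.rpow_add hh]; simp
    linear_combination (d * h ^ (1 + β) * C) * this
  rw [momentumSum, e2] at e1
  have e3 := mul_le_mul_of_nonneg_left Bd.grad (by positivity : 0 ≤ d * h ^ (1 + β))
  set x := h ^ (1 + α) with hx
  set y := h ^ (1 + β) with hy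
  have hx0 : 0 ≤ x := by positivity
  have hy0 : 0 ≤ y := by positivity
  have e4 : d * (h * E + x * (d * (ℓ ^ d + E) + E)) * T + d * y * C + d * y * E
      ≤ d * (T * E + (C + E) + T * (d * (ℓ ^ d + E) + E)) * (h + x + y) := by
    have f1 : 0 ≤ d * (T * E) * (x + y) := by positivity
    have f2 : 0 ≤ d * (C + E) * (h + x) := by positivity
    have f3 : 0 ≤ d * (T * (d * (ℓ ^ d + E) + E)) * (h + y) := by positivity
    linarith
  linarith

end FV

theorem lemma4p4 {d : ℕ} (hd : d = 2 ∨ d = 3)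
    (ℓ : ℝ) (hℓ : 0 < ℓ) (Ω : Set (FV.Space d)) (hΩ : FV.IsFluidDomain ℓ Ω)
    (a γ μ lam α : ℝ) (ha : 0 < a) (hγ : 1 < γ) (hμ : 0 < μ) (hlam : 0 ≤ lam) (hα : -1 < α)
    (E₀ T B : ℝ) (hT : 0 < T) :
    (∃ C : ℝ, ∀ (ρ₀ : FV.Space d → ℝ) (m₀ : FV.Space d → Fin d → ℝ),
      FV.IsInitialData ℓ γ Ω ρ₀ m₀ → FV.initialEnergy ℓ a γ ρ₀ m₀ ≤ E₀ →
      ∀ (N M : ℕ) [NeZero M] (Δt h ε : ℝ),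
        Δt ∈ Set.Ioo (0 : ℝ) 1 → h ∈ Set.Ioo (0 : ℝ) 1 → ε ∈ Set.Ioo (0 : ℝ) 1 →
        (N : ℝ) * Δt = T → (M : ℝ) * h = ℓ →
      ∀ (ρ : ℕ → FV.Cell d M → ℝ) (u : ℕ → FV.Cell d M → Fin d → ℝ),
        FV.IsFVSolution Ω a γ μ lam α ρ₀ m₀ N Δt h ε ρ u →
      ∀ (φ φt : ℝ → FV.Space d → ℝ) (φx : Fin d → ℝ → FV.Space d → ℝ),
        FV.IsTestFun ℓ T B φ φt φx →
      ∀ τ ∈ Set.Icc (0 : ℝ) T,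
        |FV.errDensity ℓ Δt h ρ u τ φ φt φx| ≤
          C * (Δt + h ^ ((1 + α) / 2) + h ^ ((1 + FV.betaR d γ α) / 2)
            + h ^ (1 + FV.betaD d γ α))) ∧
    (∀ p : ℝ, 2 * γ / (γ - 1) ≤ p →
      ∃ C : ℝ, ∀ (ρ₀ : FV.Space d → ℝ) (m₀ : FV.Space d → Fin d → ℝ),
      FV.IsInitialData ℓ γ Ω ρ₀ m₀ → FV.initialEnergy ℓ a γ ρ₀ m₀ ≤ E₀ →
      ∀ (N M : ℕ) [NeZero M] (Δt h ε : ℝ),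
        Δt ∈ Set.Ioo (0 : ℝ) 1 → h ∈ Set.Ioo (0 : ℝ) 1 → ε ∈ Set.Ioo (0 : ℝ) 1 →
        (N : ℝ) * Δt = T → (M : ℝ) * h = ℓ →
      ∀ (ρ : ℕ → FV.Cell d M → ℝ) (u : ℕ → FV.Cell d M → Fin d → ℝ),
        FV.IsFVSolution Ω a γ μ lam α ρ₀ m₀ N Δt h ε ρ u →
      ∀ (φ φt : ℝ → FV.Space d → Fin d → ℝ) (φx : Fin d → ℝ → FV.Space d → Fin d → ℝ),
        FV.IsVecTestFun ℓ T B φ φt φx →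
      ∀ τ ∈ Set.Icc (0 : ℝ) T,
        |FV.errMomentum ℓ Ω a γ μ lam Δt h ε ρ u τ φ φt φx| ≤
          C * (√Δt + h + h ^ (1 + α) + h ^ (1 + FV.betaM d γ α p)
            + (h / ε) ^ (1 / 2 : ℝ) + (Δt / ε) ^ (1 / 2 : ℝ))) := by
  have hd2 : 2 ≤ d := by omega
  have hd0 : d ≠ 0 := by omega
  have hν : 0 ≤ FV.nu d μ lam := FV.nu_nonneg hd2 hμ hlam
  obtain ⟨E, V, hE, hV, hAP⟩ := FV.exists_apriori_bounds (α := α) hd2 hℓ hΩ ha hγ hμ hlam hT E₀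
  refine ⟨?_, fun p hp => ?_⟩
  · obtain ⟨C, hC⟩ := FV.exists_sum_densityRes_le hd hℓ hγ hα hE hT V
    -- The constant is fixed before the test function is known, and `B` may be negative a priori;
    -- the absolute value disappears once a test function exists.
    refine ⟨(2 + T) * (|B| * (ℓ ^ d + E)) + 2 * |B| * |C| + |B| * (d * (ℓ ^ d + E) + E), ?_⟩
    intro ρ₀ m₀ D hD N M _ Δt h ε ht hh hε hN hM ρ u S φ φt φx H τ hτ
    obtain ⟨Bd, hS⟩ := hAP ρ₀ m₀ D hD N M Δt h ε ht hh hε hN hM ρ u S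
    have hB := H.nonneg hT
    rw [abs_of_nonneg hB]
    have h1 := FV.abs_errDensity_le hd0 hγ hT ht.1 hh.1 hN hM S Bd H hτ
    have h2 := hC M N Δt h ε Ω ρ u ht.1 hh.1 hh.2 hN hM Bd hS
    have h3 : h ^ (1 / 2 : ℝ) ≤ h ^ ((1 + FV.betaR d γ α) / 2) :=
      Real.rpow_le_rpow_of_exponent_ge hh.1 hh.2.le
        (by linarith [FV.betaR_nonpos (d := d) hγ hα])
    have hh0 := hh.1
    have ht0 := ht.1
    set Y := h ^ (1 / 2 : ℝ) + h ^ ((1 + α) / 2) + h ^ (1 + FV.betaD d γ α) with hY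
    have hY0 : 0 ≤ Y := by positivity
    set X := Δt + h ^ ((1 + α) / 2) + h ^ ((1 + FV.betaR d γ α) / 2)
      + h ^ (1 + FV.betaD d γ α) with hX
    have hYX : Y ≤ X := by rw [hY, hX]; linarith
    have htX : Δt ≤ X := by
      have : 0 ≤ h ^ ((1 + α) / 2) + h ^ ((1 + FV.betaR d γ α) / 2)
        + h ^ (1 + FV.betaD d γ α) := by positivity
      linarith
    have h4 : C * Y ≤ |C| * X :=
      (mul_le_mul_of_nonneg_right (le_abs_self C) hY0).trans
        (mul_le_mul_of_nonneg_left hYX (abs_nonneg C))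
    calc _ ≤ _ := h1
      _ ≤ (2 + T) * (B * (ℓ ^ d + E)) * X + 2 * B * (|C| * X)
          + B * (d * (ℓ ^ d + E) + E) * X := by
        gcongr
        exact h2.trans h4
      _ = _ := by ring
  -- The lower bound `2γ/(γ-1)` exceeds `2`; the Hölder and Sobolev argument for the momentum needs
  -- no more than `p > 2`.
  · have hp2 : 2 < p := by
      refine lt_of_lt_of_le ?_ hp
      rw [lt_div_iff₀ (by linarith)]
      linarith
    obtain ⟨C₁, hC₁, H₁⟩ := FV.exists_sum_momentumRes_le hd hℓ hγ hα hE hV hT hp2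
    obtain ⟨C₂, hC₂, H₂⟩ := FV.exists_boundaryLayer_le hΩ
    refine ⟨(2 + T) * (|B| * (d * (ℓ ^ d + E) + E)) + 3 * |B| * C₁
      + (2 * d * |B| * (a * E) * T + μ * (2 * |B|) * (d * (d * ℓ ^ d) * T + E)
          + FV.nu d μ lam * (2 * d * |B|) * (ℓ ^ d * T + d * E)) + |B| * (d * C₂ * T + E)
      + |B| * (d * E + d * (a * E))
      + |B| * (μ * (d * (d * ℓ ^ d) + E) + FV.nu d μ lam * (d * (ℓ ^ d + d * E)))
      + |B| * (d * ℓ ^ d + E), ?_⟩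
    intro ρ₀ m₀ D hD N M _ Δt h ε ht hh hε hN hM ρ u S φ φt φx H τ hτ
    obtain ⟨Bd, hS⟩ := hAP ρ₀ m₀ D hD N M Δt h ε ht hh hε hN hM ρ u S
    have hB : 0 ≤ B := (H.comp ⟨0, by omega⟩).nonneg hT
    rw [abs_of_nonneg hB]
    have h1 := FV.abs_errMomentum_le hd0 hγ ha.le hμ.le hν hT ht.1 hh.1 hh.2.le hε.1 hN hM hΩ
      S Bd H hτ
    have h2 := FV.sum_momentumErr_le hB ha.le hμ.le hν ht.1 hh.1 hε.1 hN hM hΩ H₂ Bd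
    have h3 := H₁ M N Δt h ε Ω ρ u ht.1 hh.1 hh.2 hN hM Bd hS
    have hh0 := hh.1
    have ht0 := ht.1
    have hε0 := hε.1
    -- As `Δt < 1`, the first-order contributions in time are absorbed into `√Δt`.
    have htt : Δt ≤ √Δt := by
      rw [Real.le_sqrt' ht0]
      nlinarith [ht.2]
    rw [← Real.sqrt_eq_rpow, ← Real.sqrt_eq_rpow]
    set x₁ := √Δt with hx₁
    set x₂ := h ^ (1 + α) with hx₂
    set x₃ := h ^ (1 + FV.betaM d γ α p) with hx₃
    set x₄ := √(h / ε) with hx₄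
    set x₅ := √(Δt / ε) with hx₅
    have p₁ : 0 ≤ x₁ := Real.sqrt_nonneg _
    have p₂ : 0 ≤ x₂ := by positivity
    have p₃ : 0 ≤ x₃ := by positivity
    have p₄ : 0 ≤ x₄ := Real.sqrt_nonneg _
    have p₅ : 0 ≤ x₅ := Real.sqrt_nonneg _
    set X := x₁ + h + x₂ + x₃ + x₄ + x₅ with hX
    calc _ ≤ _ := h1
      _ ≤ (2 + T) * (B * (d * (ℓ ^ d + E) + E)) * X
          + (3 * B * (C₁ * X)
            + X * (2 * d * B * (a * E) * T + μ * (2 * B) * (d * (d * ℓ ^ d) * T + E)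
              + FV.nu d μ lam * (2 * d * B) * (ℓ ^ d * T + d * E))
            + X * (B * (d * C₂ * T + E)))
          + (B * (d * E + d * (a * E)) * X
            + X * (B * (μ * (d * (d * ℓ ^ d) + E) + FV.nu d μ lam * (d * (ℓ ^ d + d * E))))
            + X * (B * (d * ℓ ^ d + E))) := by
        refine add_le_add (add_le_add ?_ (h2.trans ?_)) ?_
        · gcongr
          linarith
        · gcongr
          · refine h3.trans ?_
            gcongr
            linarith
          · linarith
          · linarith
        · gcongr
          · linarith
          · linarith
          · linarith
      _ = _ := by ring
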